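/- **Setting.** Let $K$ be a field, let $\ell>1$ be an odd integer and let $q\in K^\times$ be a primitive $\ell$-th root of unity. For $n\ge 1$ let $V_n=K^n$ with basis $e_1,\dots,e_n$. For $r\in K^\times$ let $R_r$ be the operator on $V_n^{\otimes 2}$ with $R_r(e_i\otimes e_j)=e_j\otimes e_i$ if $i<j$, $R_r(e_i\otimes e_i)=r\,e_i\otimes e_i$, and $R_r(e_i\otimes e_j)=(r-r^{-1})\,e_i\otimes e_j+e_j\otimes e_i$ if $i>j$. Let $T_k$ $(1\le k<d)$ act on $V_n^{\otimes d}$ as $R_r$ on the factors $k,k+1$; this is the action of the Hecke algebra $H_d$. A *quantum polynomial functor of degree $d$ (with parameter $r$)* is a $K$-linear functor to finite dimensional vector spaces from the category with objects the integers $n\ge1$ and with morphisms $n\to m$ the $H_d$-linear maps $V_n^{\otimes d}\to V_m^{\otimes d}$. For $r=1$ these are the strict polynomial functors of degree $d$. **The complexes.** Let $S_r^d$ be the quotient of $\bigotimes^d$ by $\sum_k \operatorname{im}(T_k-r)$, let $\Lambda_r^d$ be the quotient of $\bigotimes^d$ by $\sum_k\ker(T_k-r)$ (so that $e_i\wedge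 e_i=0$ and $e_j\wedge e_i=-r^{-1}e_i\wedge e_j$ for $i<j$), and let $\Omega^i_d=S_r^{d-i}\otimes\Lambda_r^i$ for $0\le i\le d$ and $\Omega_d^i=0$ for $i>d$. The de Rham differential $\delta:\Omega_d^i\to\Omega_d^{i+1}$ is induced by the operator $\sum_{s=0}^{m-1} r^{s}\,T_{m-1}\cdots T_{m-s}$ on $V_n^{\otimes d}$, with $m=d-i$; that is, it is the coproduct $S_r^{m}\to S_r^{m-1}\otimes S_r^1$ followed by the product $\Lambda_r^1\otimes\Lambda_r^i\to\Lambda_r^{i+1}$. The Koszul differential $\kappa:\Omega_d^{i}\to\Omega_d^{i-1}$ is induced by $\sum_{s=0}^{i-1}(-r^{-1})^{s}\,T_{p+1}\cdots T_{p+s}$, with $p=d-i$; that is, it is the coproduct $\Lambda_r^i\to\Lambda_r^1\otimes\Lambda_r^{i-1}$ followed by the product $S_r^{p}\otimes S_r^1\to S_r^{p+1}$. On $\Omega=\bigoplus_{d,i}\Omega^i_d$ the product is $(s\otimes\lambda)(s'\otimes\lambda')=s\,\tau(\lambda\otimes s')\,\lambda'$, where $\tau:\Lambda_r^a\otimes S_r^b\to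 S_r^b\otimes\Lambda_r^a$ is the braiding induced by $R_r$. Let $N_d^0=\Omega_d^0$ and $N_d^i=\ker(\kappa:\Omega_d^i\to\Omega_d^{i-1})$ for $i\ge1$. For $r=q$ and $d$ divisible by $\ell$ these form a subcomplex $N_d^\bullet$ of the quantum de Rham complex $(\Omega_d^\bullet,\delta)$. **The Frobenius twist.** If $f:V_n^{\otimes d\ell}\to V_m^{\otimes d\ell}$ is $H_{d\ell}$-linear with $r=q$, let $\mathrm{Fr}(f):V_n^{\otimes d}\to V_m^{\otimes d}$ be the map with matrix coefficients $\mathrm{Fr}(f)_{I,J}=f_{I^\ell,J^\ell}$, where $I^\ell$ is the word obtained from $I$ by repeating each letter $\ell$ times in place. (This is dual to the quantum Frobenius $x_{ij}\mapsto x_{ij}^\ell$ on coordinate rings of matrices.) This is a functor, the identity on objects, and a strict polynomial functor $F$ of degree $d$ gives by composition with it a quantum polynomial functor $F^{(1)_q}$ of degree $d\ell$ with parameter $q$. **Proposition.** Below, $\Omega_d^{i(1)_q}$ and $N_d^{i(1)_q}$ are the twists of the classical functors ($r=1$), while $\Omega_{d\ell}^\bullet$, $N_{d\ell}^\bullet$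 are the quantum complexes ($r=q$). 1. There are isomorphisms of functors $c_d^i:\Omega_d^{i(1)_q}\cong H^i(\Omega_{d\ell}^\bullet)$, for all $d,i\ge0$ (the *Cartier isomorphism*), which for every $n$ form an isomorphism of unital graded algebras with $e_k\otimes1\mapsto[e_k^\ell\otimes1]$ and $1\otimes e_k\mapsto[e_k^{\ell-1}\otimes e_k]$. They restrict to isomorphisms of functors $\varphi^i_d:N_d^{i(1)_q}\cong H^i(N_{d\ell}^\bullet)$ for all $d,i\ge0$; that is, the composite of $\varphi^i_d$ with the map $H^i(N_{d\ell}^\bullet)\to H^i(\Omega_{d\ell}^\bullet)$ induced by the inclusion is the restriction of $c^i_d$ to $N_d^{i(1)_q}$. 2. In particular, with $I=\bigotimes^1$ the identity functor, $H^0(N_\ell^\bullet)\cong I^{(1)_q}$ and $H^i(N_\ell^\bullet)=0$ for all $i>0$. -/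

import Mathlib

open CategoryTheory

universe u

namespace QPF

noncomputable section

variable {K : Type u} [Field K] {n m d : ℕ}

/-- Words of length `d` in the letters `0, …, n - 1`. -/
abbrev Word (n d : ℕ) : Type := Fin d → Fin n

/-- The tensor power `V_n^{⊗ d}` of `V_n = K^n`, in its basis of words: the word `w` stands for
`e_{w 0} ⊗ ⋯ ⊗ e_{w (d - 1)}`. -/
abbrev Tens (K : Type u) [Field K] (n d : ℕ) : Type u := Word n d →₀ K

/-- The word `w` with its letters in the positions `k` and `k + 1` exchanged. -/
def Word.swap (w : Word n d) (k : ℕ) (h : k + 1 < d) : Word n d :=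
  w ∘ Equiv.swap ⟨k, by omega⟩ ⟨k + 1, h⟩

/-- The value on the basis vector `w` of the Yang-Baxter operator `R_n`, placed in the positions
`k` and `k + 1` (counted from `0`). -/
def braidWord (q : Kˣ) (k : ℕ) (w : Word n d) : Tens K n d :=
  if h : k + 1 < d then
    if w ⟨k, by omega⟩ < w ⟨k + 1, h⟩ then Finsupp.single (w.swap k h) 1
    else if w ⟨k, by omega⟩ = w ⟨k + 1, h⟩ then Finsupp.single w (q : K)
    else Finsupp.single w ((q : K) - (q : K)⁻¹) + Finsupp.single (w.swap k h) 1
  else 0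

/-- The action of the generator `T_{k+1}` of the Hecke algebra on `V_n^{⊗ d}`, for `k + 1 < d`. -/
def T (q : Kˣ) (k : ℕ) : Module.End K (Tens K n d) :=
  Finsupp.linearCombination K (braidWord q k)

/-- `T_k` acts on the basis by `w ↦ coef (w k) (w (k+1)) • w + w.swap k`. -/
def coef (q : Kˣ) {n : ℕ} (i j : Fin n) : K :=
  if i < j then 0 else if i = j then (q : K) - 1 else (q : K) - (q : K)⁻¹

lemma coef_lt (q : Kˣ) {i j : Fin n} (h : i < j) : coef q i j = 0 := if_pos h

lemma coef_gt (q : Kˣ) {i j : Fin n} (h : i < j) : coef q j i = (q : K) - (q : K)⁻¹ := by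
  rw [coef, if_neg h.not_gt, if_neg h.ne']

lemma coef_self (q : Kˣ) (i : Fin n) : coef q i i = (q : K) - 1 := by
  rw [coef, if_neg (lt_irrefl i), if_pos rfl]

lemma Word.swap_eq_self (w : Word n d) (k : ℕ) (h : k + 1 < d)
    (e : w ⟨k, by omega⟩ = w ⟨k + 1, h⟩) : w.swap k h = w := by
  funext x
  simp only [Word.swap, Function.comp, Equiv.swap_apply_def]
  split_ifs with h1 h2
  · rw [h1, e]
  · rw [h2, e]
  · rfl

lemma Word.swap_left (w : Word n d) (k : ℕ) (h : k + 1 < d) :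
    w.swap k h ⟨k, by omega⟩ = w ⟨k + 1, h⟩ := by
  simp [Word.swap]

lemma Word.swap_right (w : Word n d) (k : ℕ) (h : k + 1 < d) :
    w.swap k h ⟨k + 1, h⟩ = w ⟨k, by omega⟩ := by
  simp [Word.swap]

lemma Word.swap_of_ne (w : Word n d) (k : ℕ) (h : k + 1 < d) (j : ℕ) (hj : j < d)
    (h1 : j ≠ k) (h2 : j ≠ k + 1) : w.swap k h ⟨j, hj⟩ = w ⟨j, hj⟩ := by
  simp only [Word.swap, Function.comp]
  rw [Equiv.swap_apply_of_ne_of_ne] <;> simpa [Fin.ext_iff]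

lemma Word.swap_swap (w : Word n d) (k : ℕ) (h : k + 1 < d) :
    (w.swap k h).swap k h = w := by
  funext x
  simp [Word.swap]

lemma T_single (q : Kˣ) (k : ℕ) (h : k + 1 < d) (w : Word n d) :
    T q k (Finsupp.single w (1 : K)) =
      coef q (w ⟨k, by omega⟩) (w ⟨k + 1, h⟩) • Finsupp.single w (1 : K)
        + Finsupp.single (w.swap k h) 1 := by
  simp only [T, Finsupp.linearCombination_single, one_smul, braidWord, dif_pos h, coef]
  split_ifs with h1 h2
  · simp
  · rw [Word.swap_eq_self w k h h2, Finsupp.smul_single, ← Finsupp.single_add]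
    simp
  · simp

lemma T_of_not (q : Kˣ) (k : ℕ) (h : ¬ k + 1 < d) : T (n := n) (d := d) q k = 0 := by
  ext w : 1
  ext
  simp [T, braidWord, h]

lemma T_quad (q : Kˣ) (k : ℕ) (h : k + 1 < d) :
    T (n := n) (d := d) q k * T q k = ((q : K) - (q : K)⁻¹) • T q k + 1 := by
  have hq : (q : K) ≠ 0 := q.ne_zero
  refine Finsupp.lhom_ext' fun w => LinearMap.ext_ring ?_
  simp only [LinearMap.comp_apply, Finsupp.lsingle_apply, Module.End.mul_apply,
    LinearMap.add_apply, LinearMap.smul_apply, Module.End.one_apply]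
  rw [T_single q k h, map_add, map_smul, T_single q k h, T_single q k h,
    Word.swap_left, Word.swap_right, Word.swap_swap]
  rcases lt_trichotomy (w ⟨k, by omega⟩) (w ⟨k + 1, h⟩) with h1 | h1 | h1
  · simp [coef, h1, h1.not_gt, h1.ne']
  · rw [Word.swap_eq_self w k h h1]
    simp only [coef, h1, lt_irrefl, if_true, if_false]
    rw [← sub_eq_zero]
    have : ((q:K) - 1) * ((q:K) - 1) + (q - 1) + (q - 1) + 1 - ((q - (q:K)⁻¹) * (q - 1) + (q - (q:K)⁻¹) + 1) = 0 := by
      field_simp; ring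
    rw [← zero_smul K (Finsupp.single w (1 : K)), ← this]
    module
  · simp only [coef, h1, h1.not_gt, h1.ne', if_true, if_false]
    module

lemma T_comm (q : Kˣ) (k j : ℕ) (h : k + 1 < j) :
    T (n := n) (d := d) q k * T q j = T q j * T q k := by
  by_cases hj : j + 1 < d
  swap
  · rw [T_of_not q j hj]; simp
  have hk : k + 1 < d := by omega
  refine Finsupp.lhom_ext' fun w => LinearMap.ext_ring ?_
  simp only [LinearMap.comp_apply, Finsupp.lsingle_apply, Module.End.mul_apply]
  have e : (w.swap j hj).swap k hk = (w.swap k hk).swap j hj := by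
    funext ⟨x, hx⟩
    by_cases h1 : x = k
    · subst h1
      rw [Word.swap_left, Word.swap_of_ne, Word.swap_of_ne, Word.swap_left] <;> omega
    by_cases h2 : x = k + 1
    · subst h2
      rw [Word.swap_right, Word.swap_of_ne, Word.swap_of_ne, Word.swap_right] <;> omega
    by_cases h3 : x = j
    · subst h3
      rw [Word.swap_left, Word.swap_of_ne, Word.swap_left, Word.swap_of_ne] <;> omega
    by_cases h4 : x = j + 1
    · subst h4
      rw [Word.swap_right, Word.swap_of_ne, Word.swap_right, Word.swap_of_ne] <;> omega
    rw [Word.swap_of_ne, Word.swap_of_ne, Word.swap_of_ne, Word.swap_of_ne] <;> omega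
  rw [T_single q k hk, T_single q j hj, map_add, map_add, map_smul, map_smul, T_single q k hk,
    T_single q j hj, T_single q k hk, T_single q j hj, e,
    Word.swap_of_ne w j hj k, Word.swap_of_ne w j hj (k+1), Word.swap_of_ne w k hk j,
    Word.swap_of_ne w k hk (j+1)]
  · module
  all_goals omega

lemma T_braid (q : Kˣ) (k : ℕ) (h : k + 2 < d) :
    T (n := n) (d := d) q k * T q (k + 1) * T q k = T q (k + 1) * T q k * T q (k + 1) := by
  have h0 : k + 1 < d := by omega
  have h1 : k + 1 + 1 < d := h
  refine Finsupp.lhom_ext' fun w => LinearMap.ext_ring ?_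
  simp only [LinearMap.comp_apply, Finsupp.lsingle_apply, Module.End.mul_apply]
  have e : ((w.swap k h0).swap (k+1) h1).swap k h0 = ((w.swap (k+1) h1).swap k h0).swap (k+1) h1 := by
    funext ⟨x, hx⟩
    by_cases c1 : x = k
    · subst c1
      rw [Word.swap_left, Word.swap_left, Word.swap_of_ne, Word.swap_of_ne, Word.swap_left, Word.swap_left] <;> omega
    by_cases c2 : x = k + 1
    · subst c2
      rw [Word.swap_right, Word.swap_of_ne, Word.swap_left, Word.swap_left, Word.swap_of_ne, Word.swap_right] <;> omega
    by_cases c3 : x = k + 1 + 1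
    · subst c3
      rw [Word.swap_of_ne, Word.swap_right, Word.swap_right, Word.swap_right, Word.swap_right, Word.swap_of_ne] <;> omega
    rw [Word.swap_of_ne, Word.swap_of_ne, Word.swap_of_ne, Word.swap_of_ne, Word.swap_of_ne, Word.swap_of_ne] <;> omega
  have s1 := Word.swap_of_ne w k h0 (k+1+1) h1 (by omega) (by omega)
  have s2 := Word.swap_of_ne w (k+1) h1 k (by omega) (by omega) (by omega)
  have s3 := Word.swap_of_ne (w.swap k h0) (k+1) h1 k (by omega) (by omega) (by omega)
  have s4 := Word.swap_of_ne (w.swap (k+1) h1) k h0 (k+1+1) h1 (by omega) (by omega)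
  simp only [T_single q k h0, T_single q (k+1) h1, map_add, map_smul,
    Word.swap_left, Word.swap_right, Word.swap_swap, s1, s2, s3, s4, e]
  have w1 := Word.swap_eq_self w k h0
  have w2 := Word.swap_eq_self w (k+1) h1
  rcases lt_trichotomy (w ⟨k, by omega⟩) (w ⟨k + 1, h0⟩) with c1 | c1 | c1 <;>
  rcases lt_trichotomy (w ⟨k+1, h0⟩) (w ⟨k + 1+1, h1⟩) with c2 | c2 | c2 <;>
  rcases lt_trichotomy (w ⟨k, by omega⟩) (w ⟨k + 1+1, h1⟩) with c3 | c3 | c3 <;>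
  first
  | (exfalso; omega)
  | skip
  all_goals
    try rw [w1 c1] at e
    try simp only [w1 c1, ← e]
    try simp only [w2 c2]
    try (rw [w1 c1, w2 c2] at e)
    try simp only [c1]
    try simp only [c2]
    try simp only [c3]
    try simp only [coef_lt q c1, coef_gt q c1]
    try simp only [coef_lt q c2, coef_gt q c2]
    try simp only [coef_lt q c3, coef_gt q c3]
    try simp only [coef_self]
    match_scalars <;> field_simp <;> ring

/-- The Hecke operator `T_{a+r-1} ⋯ T_{a+1} T_a`; it moves the letter in position `a` to the
position `a + r`. -/
def up (q : Kˣ) (a : ℕ) : ℕ → Module.End K (Tens K n d)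
  | 0 => 1
  | r + 1 => T q (a + r) * up q a r

/-- The Hecke operator `T_a T_{a+1} ⋯ T_{a+r-1}`; it moves the letter in position `a + r` to the
position `a`. -/
def down (q : Kˣ) (a : ℕ) : ℕ → Module.End K (Tens K n d)
  | 0 => 1
  | r + 1 => down q a r * T q (a + r)

/-- The action of `∑_σ q^{l(σ)} T_σ` on the first `m` tensor factors, the sum being over all
`(m-1, 1)`-shuffles. It induces the component `S^m → S^{m-1} ⊗ S^1` of the coproduct. -/
def symShuffle (q : Kˣ) (m : ℕ) : Module.End K (Tens K n d) :=
  ∑ r ∈ Finset.range m, (q : K) ^ r • up q (m - 1 - r) r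

/-- The action of `∑_σ (-q⁻¹)^{l(σ)} T_σ` on the `i` tensor factors from the position `p` on,
the sum being over all `(1, i-1)`-shuffles. It induces the component `Λ^i → Λ^1 ⊗ Λ^{i-1}` of
the coproduct. -/
def extShuffle (q : Kˣ) (p i : ℕ) : Module.End K (Tens K n d) :=
  ∑ r ∈ Finset.range i, (-(q : K)⁻¹) ^ r • down q p r

lemma down_succ' (q : Kˣ) (a r : ℕ) :
    down (n := n) (d := d) q a (r + 1) = T q a * down q (a + 1) r := by
  induction r with
  | zero => simp [down]
  | succ r ih =>
    rw [down, ih, down, mul_assoc, show a + (r + 1) = a + 1 + r by ring]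

lemma symShuffle_zero (q : Kˣ) : symShuffle (n := n) (d := d) q 0 = 0 := by simp [symShuffle]

lemma extShuffle_zero (q : Kˣ) (p : ℕ) : extShuffle (n := n) (d := d) q p 0 = 0 := by
  simp [extShuffle]

lemma symShuffle_succ (q : Kˣ) (m : ℕ) :
    symShuffle (n := n) (d := d) q (m + 1) = 1 + (q : K) • (T q (m - 1) * symShuffle q m) := by
  rw [symShuffle, Finset.sum_range_succ', symShuffle, Finset.mul_sum, Finset.smul_sum, add_comm]
  congr 1
  · simp [up]
  · refine Finset.sum_congr rfl fun r hr => ?_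
    have hr := Finset.mem_range.1 hr
    rw [up, mul_smul_comm, smul_smul, pow_succ', show m + 1 - 1 - (r + 1) + r = m - 1 by omega,
      show m + 1 - 1 - (r + 1) = m - 1 - r by omega]

lemma extShuffle_succ (q : Kˣ) (p i : ℕ) :
    extShuffle (n := n) (d := d) q p (i + 1) =
      1 + (-(q : K)⁻¹) • (T q p * extShuffle q (p + 1) i) := by
  rw [extShuffle, Finset.sum_range_succ', extShuffle, Finset.mul_sum, Finset.smul_sum, add_comm]
  congr 1
  · simp [down]
  · refine Finset.sum_congr rfl fun r hr => ?_
    rw [down_succ', mul_smul_comm, smul_smul, pow_succ']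

lemma symShuffle_comm (q : Kˣ) (m k : ℕ) (h : m ≤ k) :
    Commute (symShuffle (n := n) (d := d) q m) (T q k) := by
  induction m with
  | zero => rw [symShuffle_zero]; exact Commute.zero_left _
  | succ m ih =>
    rw [symShuffle_succ]
    refine (Commute.one_left _).add_left (Commute.smul_left ?_ _)
    rcases Nat.eq_zero_or_pos m with rfl | hm
    · rw [symShuffle_zero, mul_zero]; exact Commute.zero_left _
    · exact Commute.mul_left (T_comm q _ _ (by omega)) (ih (by omega))

lemma extShuffle_comm (q : Kˣ) (p i k : ℕ) (h : k + 1 < p) :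
    Commute (extShuffle (n := n) (d := d) q p i) (T q k) := by
  induction i generalizing p with
  | zero => rw [extShuffle_zero]; exact Commute.zero_left _
  | succ i ih =>
    rw [extShuffle_succ]
    have h1 : Commute (T (n := n) (d := d) q p * extShuffle q (p + 1) i) (T q k) :=
      Commute.mul_left (T_comm q _ _ h).symm (ih _ (by omega))
    exact (Commute.one_left _).add_left (h1.smul_left _)

lemma symShuffle_comm_extShuffle (q : Kˣ) (m p i : ℕ) (h : m ≤ p) :
    Commute (symShuffle (n := n) (d := d) q m) (extShuffle q p i) := by
  induction i generalizing p with
  | zero => rw [extShuffle_zero]; exact Commute.zero_right _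
  | succ i ih =>
    rw [extShuffle_succ]
    have h1 : Commute (symShuffle (n := n) (d := d) q m) (T q p * extShuffle q (p + 1) i) :=
      Commute.mul_right (symShuffle_comm q _ _ (by omega)) (ih _ (by omega))
    exact (Commute.one_right _).add_right (h1.smul_right _)

/-- The kernel of `V_n^{⊗ d} → S^{d-i} ⊗ Λ^i`. The kernel of `V ⊗ V → S^2` is the image of
`R - q`, and the kernel of `V ⊗ V → Λ^2`, which is spanned by all `e_j ⊗ e_i + q⁻¹ e_i ⊗ e_j`
with `i < j` and all `e_i ⊗ e_i`, is the kernel of `R - q`; the former is imposed in all pairs of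
neighbours among the first `d - i` positions and the latter among the last `i`. For `d < i` the
quotient is zero. -/
def rel (q : Kˣ) (n d i : ℕ) : Submodule K (Tens K n d) :=
  if i ≤ d then
    (⨆ (k : ℕ) (_ : k + 1 < d - i), LinearMap.range (T q k - (q : K) • 1)) ⊔
    (⨆ (k : ℕ) (_ : d - i ≤ k ∧ k + 1 < d), LinearMap.ker (T q k - (q : K) • 1))
  else ⊤

lemma rel_le (q : Kˣ) {i : ℕ} (h : i ≤ d) {P : Submodule K (Tens K n d)}
    (h1 : ∀ k, k + 1 < d - i → ∀ y, T q k y - (q : K) • y ∈ P)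
    (h2 : ∀ k, d - i ≤ k → k + 1 < d → ∀ y, T q k y = (q : K) • y → y ∈ P) :
    rel q n d i ≤ P := by
  rw [rel, if_pos h]
  refine sup_le (iSup₂_le fun k hk => ?_) (iSup₂_le fun k hk => ?_)
  · rintro _ ⟨y, rfl⟩
    simpa using h1 k hk y
  · intro y hy
    exact h2 k hk.1 hk.2 y (by simpa [sub_eq_zero] using hy)

lemma sym_mem_rel (q : Kˣ) {i k : ℕ} (hk : k + 1 < d - i) (y : Tens K n d) :
    T q k y - (q : K) • y ∈ rel q n d i := by
  rw [rel, if_pos (by omega)]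
  refine Submodule.mem_sup_left (Submodule.mem_iSup_of_mem k (Submodule.mem_iSup_of_mem hk ?_))
  exact ⟨y, by simp⟩

lemma ext_mem_rel (q : Kˣ) {i k : ℕ} (hk : d - i ≤ k) (hk' : k + 1 < d) {y : Tens K n d}
    (hy : T q k y = (q : K) • y) : y ∈ rel q n d i := by
  rw [rel]
  split_ifs
  · refine Submodule.mem_sup_right
      (Submodule.mem_iSup_of_mem k (Submodule.mem_iSup_of_mem ⟨hk, hk'⟩ ?_))
    simp [hy]
  · trivial

lemma rel_eq_top (q : Kˣ) {i : ℕ} (h : d < i) : rel (K := K) q n d i = ⊤ := if_neg (by omega)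

/-- The operators of the Hecke algebra at the positions `k ≥ p` descend modulo the first sort of
relations of a smaller index. -/
lemma T_preserves_sym (q : Kˣ) {m k : ℕ} (hk : m ≤ k) {y : Tens K n d}
    (hy : y ∈ ⨆ (k : ℕ) (_ : k + 1 < m), LinearMap.range (T q k - (q : K) • 1)) :
    T q k y ∈ ⨆ (k : ℕ) (_ : k + 1 < m), LinearMap.range (T (n := n) (d := d) q k - (q : K) • 1) := by
  suffices h : (⨆ (k : ℕ) (_ : k + 1 < m), LinearMap.range (T (n := n) (d := d) q k - (q : K) • 1)) ≤
      (⨆ (k : ℕ) (_ : k + 1 < m), LinearMap.range (T (n := n) (d := d) q k - (q : K) • 1)).comap (T q k) from h hy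
  refine iSup₂_le fun j hj => ?_
  rintro _ ⟨z, rfl⟩
  refine Submodule.mem_iSup_of_mem j (Submodule.mem_iSup_of_mem hj ⟨T q k z, ?_⟩)
  have := congrArg (fun f => f z) (T_comm (n := n) (d := d) q j k (by omega))
  simp only [Module.End.mul_apply] at this
  simp [this]

lemma symShuffle_mem (q : Kˣ) {m k : ℕ} (hk : k + 1 < m) (hm : m ≤ d) (y : Tens K n d) :
    symShuffle q m (T q k y - (q : K) • y) ∈
      ⨆ (k : ℕ) (_ : k + 1 < m - 1), LinearMap.range (T (n := n) (d := d) q k - (q : K) • 1) := by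
  have hq : (q : K) ≠ 0 := q.ne_zero
  induction m, hk using Nat.le_induction with
  | base =>
    have quad := congrArg (fun f => f y) (T_quad (n := n) q k (by omega : k + 1 < d))
    simp only [Module.End.mul_apply, LinearMap.add_apply, LinearMap.smul_apply,
      Module.End.one_apply] at quad
    have h1 : T q k y - (q : K) • y + (q : K) • T q k (T q k y - (q : K) • y) = 0 := by
      rw [map_sub, map_smul, quad]
      match_scalars <;> field_simp <;> ring
    rw [symShuffle_succ]
    simp only [LinearMap.add_apply, LinearMap.smul_apply, Module.End.one_apply,
      Module.End.mul_apply, Nat.add_sub_cancel]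
    rcases Nat.eq_zero_or_pos k with rfl | hk0
    · rw [symShuffle_succ, symShuffle_zero]
      simp only [mul_zero, smul_zero, add_zero, Module.End.one_apply, h1]
      exact zero_mem _
    · obtain ⟨k, rfl⟩ : ∃ j, k = j + 1 := ⟨k - 1, by omega⟩
      have c := congrArg (fun f => f y) (symShuffle_comm (n := n) (d := d) q (k + 1) (k + 1) le_rfl).eq
      simp only [Module.End.mul_apply] at c
      set z := symShuffle q (k + 1) y with hz
      have e : symShuffle q (k + 1 + 1) (T q (k + 1) y - (q : K) • y) =
          T q (k + 1) y - (q : K) • y + (q : K) • T q k (T q (k + 1) z - (q : K) • z) := by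
        rw [symShuffle_succ]
        simp only [LinearMap.add_apply, LinearMap.smul_apply, Module.End.one_apply,
          Module.End.mul_apply, Nat.add_sub_cancel]
        rw [map_sub (symShuffle q (k + 1)), c, map_smul, ← hz]
      have br := congrArg (fun f => f z) (T_braid (n := n) (d := d) q k (by omega))
      simp only [Module.End.mul_apply] at br
      rw [e, map_add, smul_add, ← add_assoc, h1, zero_add, map_smul, map_sub, map_sub, map_smul,
        map_smul, ← br]
      refine Submodule.smul_mem _ _ (Submodule.smul_mem _ _ ?_)
      refine Submodule.mem_iSup_of_mem k (Submodule.mem_iSup_of_mem (by omega)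
        ⟨T q (k + 1) (T q k z), ?_⟩)
      simp
  | succ m hkm ih =>
    have hkm' : k + 2 ≤ m := hkm
    rw [symShuffle_succ]
    simp only [LinearMap.add_apply, LinearMap.smul_apply, Module.End.one_apply,
      Module.End.mul_apply]
    refine Submodule.add_mem _ ?_ (Submodule.smul_mem _ _ ?_)
    · exact Submodule.mem_iSup_of_mem k (Submodule.mem_iSup_of_mem (by omega) ⟨y, by simp⟩)
    · have := T_preserves_sym q (le_refl (m - 1)) (ih (by omega))
      exact (iSup₂_le fun j hj => le_iSup₂_of_le j (by omega) le_rfl :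
        (⨆ (k : ℕ) (_ : k + 1 < m - 1), LinearMap.range (T (n := n) (d := d) q k - (q : K) • 1)) ≤
          ⨆ (k : ℕ) (_ : k + 1 < m + 1 - 1), LinearMap.range (T (n := n) (d := d) q k - (q : K) • 1))
        this

lemma extShuffle_mem (q : Kˣ) {p i k : ℕ} (hp : p ≤ k) (hk : k + 1 < p + i) (hi : p + i ≤ d)
    {y : Tens K n d} (hy : T q k y = (q : K) • y) :
    extShuffle q p i y ∈ ⨆ (k : ℕ) (_ : p + 1 ≤ k ∧ k + 1 < d),
      LinearMap.ker (T (n := n) (d := d) q k - (q : K) • 1) := by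
  have hq : (q : K) ≠ 0 := q.ne_zero
  induction i generalizing p with
  | zero => omega
  | succ i ih =>
    rw [extShuffle_succ]
    simp only [LinearMap.add_apply, LinearMap.smul_apply, Module.End.one_apply,
      Module.End.mul_apply]
    rcases hp.eq_or_lt with rfl | hp
    · obtain ⟨i, rfl⟩ : ∃ j, i = j + 1 := ⟨i - 1, by omega⟩
      have c := congrArg (fun f => f y) (extShuffle_comm (n := n) (d := d) q (p + 1 + 1) i p (by omega)).eq
      simp only [Module.End.mul_apply, hy, map_smul] at c
      rcases Nat.eq_zero_or_pos i with rfl | hi0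
      · simp [extShuffle_succ, extShuffle_zero, hy, smul_smul]
      set z := extShuffle q (p + 1 + 1) i y with hz
      have br := congrArg (fun f => f z) (T_braid (n := n) (d := d) q p (by omega))
      simp only [Module.End.mul_apply] at br
      rw [extShuffle_succ]
      simp only [LinearMap.add_apply, LinearMap.smul_apply, Module.End.one_apply,
        Module.End.mul_apply, ← hz]
      rw [map_add, hy, map_smul, smul_add, ← add_assoc, smul_smul, neg_mul, inv_mul_cancel₀ hq,
        neg_smul, one_smul, add_neg_cancel, zero_add]
      refine Submodule.smul_mem _ _ (Submodule.smul_mem _ _ ?_)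
      refine Submodule.mem_iSup_of_mem (p + 1) (Submodule.mem_iSup_of_mem (by omega) ?_)
      simp [← br, ← c]
    · refine Submodule.add_mem _ ?_ (Submodule.smul_mem _ _ ?_)
      · exact Submodule.mem_iSup_of_mem k (Submodule.mem_iSup_of_mem (by omega) (by simp [hy]))
      · have h0 := ih (p := p + 1) hp (by omega) (by omega)
        suffices h : (⨆ (k : ℕ) (_ : p + 1 + 1 ≤ k ∧ k + 1 < d),
            LinearMap.ker (T (n := n) (d := d) q k - (q : K) • 1)) ≤
            (⨆ (k : ℕ) (_ : p + 1 ≤ k ∧ k + 1 < d),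
            LinearMap.ker (T (n := n) (d := d) q k - (q : K) • 1)).comap (T q p) from h h0
        refine iSup₂_le fun j hj => ?_
        intro x hx
        refine Submodule.mem_iSup_of_mem j (Submodule.mem_iSup_of_mem (by omega) ?_)
        have := congrArg (fun f => f x) (T_comm (n := n) (d := d) q p j (by omega))
        simp only [Module.End.mul_apply] at this
        have hx : T q j x = (q : K) • x := by simpa [sub_eq_zero] using hx
        simp [← this, hx]

/-- The de Rham differential is well defined. -/
lemma symShuffle_rel (q : Kˣ) (n d i : ℕ) :
    rel (K := K) q n d i ≤ (rel q n d (i + 1)).comap (symShuffle q (d - i)) := by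
  rcases Nat.lt_or_ge d (i + 1) with h | h
  · rw [rel_eq_top q h, Submodule.comap_top]; exact le_top
  refine rel_le q (by omega) (fun k hk y => ?_) (fun k hk hk' y hy => ?_)
  · have := symShuffle_mem q hk (by omega) y
    rw [Submodule.mem_comap, rel, if_pos h]
    exact Submodule.mem_sup_left (by rwa [show d - (i + 1) = d - i - 1 by omega])
  · refine ext_mem_rel q (k := k) (by omega) hk' ?_
    have := congrArg (fun f => f y) (symShuffle_comm (n := n) (d := d) q (d - i) k hk).eq
    simp only [Module.End.mul_apply, hy, map_smul] at this
    exact this.symm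

/-- The Koszul differential is well defined. -/
lemma extShuffle_rel (q : Kˣ) (n d i : ℕ) (h : i + 1 ≤ d) :
    rel (K := K) q n d (i + 1) ≤ (rel q n d i).comap (extShuffle q (d - (i + 1)) (i + 1)) := by
  refine rel_le q h (fun k hk y => ?_) (fun k hk hk' y hy => ?_)
  · have := congrArg (fun f => f y)
      (extShuffle_comm (n := n) (d := d) q (d - (i + 1)) (i + 1) k hk).eq
    simp only [Module.End.mul_apply] at this
    rw [Submodule.mem_comap, map_sub, map_smul, this]
    exact sym_mem_rel q (by omega) _
  · have := extShuffle_mem q hk (i := i + 1) (by omega) (by omega) hy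
    rw [Submodule.mem_comap, rel, if_pos (by omega)]
    refine Submodule.mem_sup_right ?_
    rwa [show d - (i + 1) + 1 = d - i by omega] at this

section DeRhamRelation

variable {q : Kˣ}

lemma shuffle_aux {A : Type*} [Ring A] [Algebra K A] (q : K) (D₁ D₂ D₃ a b X : A)
    (c : D₁ * b = b * D₁) (br : a * b * a = b * a * b) (h₂ : D₂ = 1 + q • (a * D₁))
    (h₃ : D₃ = 1 + q • (b * D₂)) (hX : D₁ * D₂ = X + q • (a * X)) :
    D₂ * D₃ = (D₂ + (q * q) • (a * (b * X))) + q • (b * (D₂ + (q * q) • (a * (b * X)))) := by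
  have e1 : D₂ * D₃ = D₂ + q • (b * D₂) + (q * q) • (a * (b * (D₁ * D₂))) := by
    rw [h₃, mul_add, mul_one, mul_smul_comm]
    conv_lhs => enter [2, 2, 1]; rw [h₂]
    rw [add_mul, one_mul, smul_mul_assoc, smul_add, smul_smul, ← add_assoc]
    congr 2
    rw [← mul_assoc, mul_assoc a, c, mul_assoc, mul_assoc]
  have e2 : a * (b * (X + q • (a * X))) = a * (b * X) + q • (b * (a * (b * X))) := by
    rw [mul_add, mul_add, mul_smul_comm, mul_smul_comm]
    congr 2
    simpa only [mul_assoc] using congrArg (· * X) br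
  rw [e1, hX, e2]
  simp only [mul_add, smul_add, mul_smul_comm, smul_smul]
  have e3 : (q : K) * q * q = q * (q * q) := mul_assoc _ _ _
  rw [e3]
  abel

lemma symShuffle_symShuffle (q : Kˣ) (m : ℕ) (h : m + 1 ≤ d) :
    ∃ X : Module.End K (Tens K n d),
      symShuffle q m * symShuffle q (m + 1) = X + (q : K) • (T q (m - 1) * X) := by
  induction m with
  | zero => exact ⟨0, by simp [symShuffle_zero]⟩
  | succ m ih =>
    obtain ⟨X, hX⟩ := ih (by omega)
    rcases Nat.eq_zero_or_pos m with rfl | hm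
    · refine ⟨1, ?_⟩
      simp [symShuffle_succ, symShuffle_zero]
    obtain ⟨m, rfl⟩ : ∃ j, m = j + 1 := ⟨m - 1, by omega⟩
    refine ⟨symShuffle q (m + 2) + ((q : K) * (q : K)) • (T q m * (T q (m + 1) * X)), ?_⟩
    have c := (symShuffle_comm (n := n) (d := d) q (m + 1) (m + 1) le_rfl).eq
    have br := T_braid (n := n) (d := d) q m (by omega)
    have h2 := symShuffle_succ (K := K) (n := n) (d := d) q (m + 1)
    have h3 := symShuffle_succ (K := K) (n := n) (d := d) q (m + 1 + 1)
    rw [Nat.add_sub_cancel] at h2 h3 hX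
    rw [Nat.add_sub_cancel]
    exact shuffle_aux (A := Module.End K (Tens K n d)) (q : K) _ _ _ _ _ _ c br h2 h3 hX

lemma symShuffle_symShuffle_mem (q : Kˣ) (i : ℕ) (y : Tens K n d) :
    symShuffle q (d - (i + 1)) (symShuffle q (d - i) y) ∈ rel q n d (i + 2) := by
  rcases Nat.lt_or_ge d (i + 2) with h | h
  · rw [rel_eq_top q h]; trivial
  obtain ⟨X, hX⟩ := symShuffle_symShuffle (K := K) (n := n) (d := d) q (d - (i + 1)) (by omega)
  have := congrArg (fun f => f y) hX
  rw [show d - (i + 1) + 1 = d - i by omega] at this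
  simp only [Module.End.mul_apply, LinearMap.add_apply, LinearMap.smul_apply] at this
  rw [this]
  refine ext_mem_rel q (k := d - (i + 1) - 1) (by omega) (by omega) ?_
  have quad := congrArg (fun f => f (X y))
    (T_quad (n := n) q (d - (i + 1) - 1) (by omega : d - (i + 1) - 1 + 1 < d))
  simp only [Module.End.mul_apply, LinearMap.add_apply, LinearMap.smul_apply,
    Module.End.one_apply] at quad
  have hq : (q : K) ≠ 0 := q.ne_zero
  rw [map_add, map_smul, quad]
  match_scalars <;> field_simp <;> ring

lemma up_sub_mem (q : Kˣ) {i a r : ℕ} (h : a + r < d - i) (y : Tens K n d) :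
    up q a r y - (q : K) ^ r • y ∈ rel q n d i := by
  induction r with
  | zero => simp [up]
  | succ r ih =>
    have e : up q a (r + 1) y - (q : K) ^ (r + 1) • y =
        (T q (a + r) (up q a r y) - (q : K) • up q a r y) +
          (q : K) • (up q a r y - (q : K) ^ r • y) := by
      rw [up, Module.End.mul_apply, smul_sub, smul_smul, pow_succ']
      abel
    rw [e]
    exact Submodule.add_mem _ (sym_mem_rel q (by omega) _) (Submodule.smul_mem _ _ (ih (by omega)))

lemma down_sub_mem (q : Kˣ) {i a r : ℕ} (ha : d - i ≤ a) (h : a + r < d) (y : Tens K n d) :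
    down q a r y - (-(q : K)⁻¹) ^ r • y ∈ rel q n d i := by
  have hq : (q : K) ≠ 0 := q.ne_zero
  induction r generalizing a with
  | zero => simp [down]
  | succ r ih =>
    have e : down q a (r + 1) y - (-(q : K)⁻¹) ^ (r + 1) • y =
        (T q a (down q (a + 1) r y) + (q : K)⁻¹ • down q (a + 1) r y) +
          (-(q : K)⁻¹) • (down q (a + 1) r y - (-(q : K)⁻¹) ^ r • y) := by
      rw [down_succ', Module.End.mul_apply, smul_sub, smul_smul, pow_succ', neg_smul]
      abel
    rw [e]
    refine Submodule.add_mem _ (ext_mem_rel q ha (by omega) ?_)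
      (Submodule.smul_mem _ _ (ih (by omega) (by omega)))
    set z := down q (a + 1) r y
    have quad := congrArg (fun f => f z) (T_quad (n := n) q a (by omega : a + 1 < d))
    simp only [Module.End.mul_apply, LinearMap.add_apply, LinearMap.smul_apply,
      Module.End.one_apply] at quad
    rw [map_add, map_smul, quad]
    match_scalars <;> field_simp <;> ring

lemma symShuffle_sub_mem (q : Kˣ) (i : ℕ) (y : Tens K n d) :
    symShuffle q (d - i) y - (∑ r ∈ Finset.range (d - i), (q : K) ^ (2 * r)) • y
      ∈ rel q n d i := by
  rw [symShuffle, LinearMap.sum_apply, Finset.sum_smul, ← Finset.sum_sub_distrib]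
  refine Submodule.sum_mem _ fun r hr => ?_
  have hr := Finset.mem_range.1 hr
  rw [LinearMap.smul_apply, two_mul, pow_add, mul_smul, ← smul_sub]
  exact Submodule.smul_mem _ _ (up_sub_mem q (by omega) y)

lemma extShuffle_sub_mem (q : Kˣ) {i : ℕ} (h : i ≤ d) (y : Tens K n d) :
    extShuffle q (d - i) i y - (∑ r ∈ Finset.range i, (-(q : K)⁻¹) ^ (2 * r)) • y
      ∈ rel q n d i := by
  rw [extShuffle, LinearMap.sum_apply, Finset.sum_smul, ← Finset.sum_sub_distrib]
  refine Submodule.sum_mem _ fun r hr => ?_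
  have hr := Finset.mem_range.1 hr
  rw [LinearMap.smul_apply, two_mul, pow_add, mul_smul, ← smul_sub]
  exact Submodule.smul_mem _ _ (down_sub_mem q le_rfl (by omega) y)

lemma shuffle_comm (q : Kˣ) (m i : ℕ) :
    ((q : K)⁻¹ ^ 2) • (symShuffle (n := n) (d := d) q (m + 1 + 1) * extShuffle q (m + 1) i) +
      extShuffle q m (i + 1) * symShuffle q (m + 1) =
    ((q : K)⁻¹ ^ 2) • extShuffle q (m + 1) i + symShuffle q (m + 1) := by
  have hq : (q : K) ≠ 0 := q.ne_zero
  have c := (symShuffle_comm_extShuffle (n := n) (d := d) q (m + 1) (m + 1) i le_rfl).eq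
  rw [symShuffle_succ q (m + 1), extShuffle_succ q m i, Nat.add_sub_cancel]
  simp only [add_mul, one_mul, smul_mul_assoc, mul_assoc, smul_add, smul_smul, c]
  have e : (q : K)⁻¹ ^ 2 * q = (q : K)⁻¹ := by field_simp
  rw [e]
  module

/-- The relation between the two differentials. -/
lemma koszul_deRham (q : Kˣ) {i : ℕ} (h : i + 1 ≤ d) (y : Tens K n d) :
    ((q : K)⁻¹ ^ 2) • symShuffle q (d - i) (extShuffle q (d - (i + 1)) (i + 1) y) +
      extShuffle q (d - (i + 2)) (i + 2) (symShuffle q (d - (i + 1)) y) -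
      ((q : K)⁻¹ ^ (2 * (i + 1)) * ∑ r ∈ Finset.range d, (q : K) ^ (2 * r)) • y
    ∈ rel q n d (i + 1) := by
  have hq : (q : K) ≠ 0 := q.ne_zero
  have key : ((q : K)⁻¹ ^ 2) • symShuffle q (d - i) (extShuffle q (d - (i + 1)) (i + 1) y) +
      extShuffle q (d - (i + 2)) (i + 2) (symShuffle q (d - (i + 1)) y) =
      ((q : K)⁻¹ ^ 2) • extShuffle q (d - (i + 1)) (i + 1) y + symShuffle q (d - (i + 1)) y := by
    rcases h.eq_or_lt with h | h
    · subst h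
      simp [symShuffle_zero, show i + 1 - i = 1 by omega, symShuffle_succ q 0]
    · have := congrArg (fun f => f y) (shuffle_comm (n := n) (d := d) q (d - (i + 2)) (i + 1))
      rw [show d - (i + 2) + 1 + 1 = d - i by omega, show d - (i + 2) + 1 = d - (i + 1) by omega]
        at this
      simpa only [Module.End.mul_apply, LinearMap.add_apply, LinearMap.smul_apply] using this
  have hs : ((q : K)⁻¹ ^ (2 * (i + 1)) * ∑ r ∈ Finset.range d, (q : K) ^ (2 * r)) =
      (q : K)⁻¹ ^ 2 * (∑ r ∈ Finset.range (i + 1), (-(q : K)⁻¹) ^ (2 * r)) +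
        ∑ r ∈ Finset.range (d - (i + 1)), (q : K) ^ (2 * r) := by
    conv_lhs => rw [show d = (i + 1) + (d - (i + 1)) by omega, Finset.sum_range_add, mul_add]
    congr 1
    · rw [← Finset.sum_range_reflect, Finset.mul_sum, Finset.mul_sum]
      refine Finset.sum_congr rfl fun r hr => ?_
      have hr := Finset.mem_range.1 hr
      obtain ⟨s, hs⟩ : ∃ s, i = r + s := ⟨i - r, by omega⟩
      subst hs
      rw [show r + s + 1 - 1 - r = s by omega, (even_two_mul r).neg_pow]
      rw [show 2 * (r + s + 1) = 2 * s + (2 + 2 * r) by ring, pow_add, pow_add, mul_right_comm,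
        ← mul_pow, inv_mul_cancel₀ hq, one_pow, one_mul]
    · rw [Finset.mul_sum]
      refine Finset.sum_congr rfl fun r hr => ?_
      rw [mul_add 2 (i + 1) r, pow_add, ← mul_assoc, ← mul_pow, inv_mul_cancel₀ hq, one_pow, one_mul]
  rw [key, hs]
  have := Submodule.add_mem _ (Submodule.smul_mem _ ((q : K)⁻¹ ^ 2) (extShuffle_sub_mem q h y))
    (symShuffle_sub_mem q (i + 1) y)
  convert this using 1
  module

end DeRhamRelation

/-- The `q`-Schur bimodule `S_q(n, m; d)`: the linear maps `V_n^{⊗ d} → V_m^{⊗ d}` that are linear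
over the Hecke algebra, that is, that commute with its generators. -/
def schur (q : Kˣ) (n m d : ℕ) : Submodule K (Tens K n d →ₗ[K] Tens K m d) where
  carrier := {f | ∀ k v, f (T q k v) = T q k (f v)}
  add_mem' hf hg k v := by simp [hf k v, hg k v]
  zero_mem' k v := by simp
  smul_mem' c f hf k v := by simp [hf k v]

instance (q : Kˣ) (n m d : ℕ) : Neg (schur q n m d) :=
  ⟨fun f => ⟨-f.1, fun k v => by simp [f.2 k v]⟩⟩

instance (q : Kˣ) (n m d : ℕ) : AddCommGroup (schur q n m d) :=
  { (inferInstance : AddCommMonoid (schur q n m d)) with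
    zsmul := zsmulRec
    neg_add_cancel := fun f => Subtype.ext (neg_add_cancel f.1) }

/-- The category `Γ_q^d V`: its objects are the `V_n^{⊗ d}` for `n ≥ 1`, its morphisms are the maps
that are linear over the Hecke algebra. -/
structure Source (q : Kˣ) (d : ℕ) where
  dim : ℕ
  pos : 0 < dim

instance (q : Kˣ) (d : ℕ) : Category (Source q d) where
  Hom A B := schur q A.dim B.dim d
  id A := ⟨LinearMap.id, fun _ _ => rfl⟩
  comp f g := ⟨g.1 ∘ₗ f.1, fun k v => by simp [f.2 k v, g.2 k (f.1 v)]⟩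

instance (q : Kˣ) (d : ℕ) (A B : Source q d) : AddCommGroup (A ⟶ B) :=
  inferInstanceAs (AddCommGroup (schur q A.dim B.dim d))

instance (q : Kˣ) (d : ℕ) (A B : Source q d) : Module K (A ⟶ B) :=
  inferInstanceAs (Module K (schur q A.dim B.dim d))

instance (q : Kˣ) (d : ℕ) : Preadditive (Source q d) where
  homGroup _ _ := inferInstance
  add_comp _ _ _ f f' g := Subtype.ext (LinearMap.comp_add f.1 f'.1 g.1)
  comp_add _ _ _ f g g' := Subtype.ext (LinearMap.add_comp f.1 g'.1 g.1)

instance (q : Kˣ) (d : ℕ) : Linear K (Source q d) where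
  homModule _ _ := inferInstance
  smul_comp _ _ _ r f g := Subtype.ext (LinearMap.comp_smul g.1 r f.1)
  comp_smul _ _ _ f r g := Subtype.ext (LinearMap.smul_comp r g.1 f.1)

/-- A functor from `Γ_q^d V` to vector spaces is a quantum polynomial functor if it is `K`-linear
and takes values in finite dimensional spaces. -/
def isQuantumPolynomial (q : Kˣ) (d : ℕ) : ObjectProperty (Source q d ⥤ ModuleCat.{u} K) :=
  fun F => F.Additive ∧ F.Linear K ∧ ∀ A, Module.Finite K (F.obj A)

/-- The category of homogeneous quantum polynomial functors of degree `d`. For `q = 1` these are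
the homogeneous strict polynomial functors of degree `d`. -/
abbrev QFun (q : Kˣ) (d : ℕ) := (isQuantumPolynomial q d).FullSubcategory

namespace QFun

variable {q : Kˣ}

/-- The vector space `F(n)`. -/
abbrev at' (F : QFun q d) (A : Source q d) : ModuleCat.{u} K := F.obj.obj A

/-- The linear map `F(f)`. -/
def lmap (F : QFun q d) {A B : Source q d} (f : A ⟶ B) : F.at' A →ₗ[K] F.at' B :=
  (F.obj.map f).hom

/-- The component of a natural transformation. -/
def app {F G : QFun q d} (φ : F ⟶ G) (A : Source q d) : F.at' A →ₗ[K] G.at' A :=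
  (φ.hom.app A).hom

lemma app_lmap {F G : QFun q d} (φ : F ⟶ G) {A B : Source q d} (f : A ⟶ B) (x : F.at' A) :
    app φ B (F.lmap f x) = G.lmap f (app φ A x) :=
  congrArg (fun g => g.hom x) (φ.hom.naturality f)

instance (F : QFun q d) (A : Source q d) : Module.Finite K (F.at' A) := F.property.2.2 A

lemma lmap_add (F : QFun q d) {A B : Source q d} (f g : A ⟶ B) (x : F.at' A) :
    F.lmap (f + g) x = F.lmap f x + F.lmap g x := by
  have := F.property.1
  simp [lmap, F.obj.map_add]

lemma lmap_smul (F : QFun q d) {A B : Source q d} (r : K) (f : A ⟶ B) (x : F.at' A) :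
    F.lmap (r • f) x = r • F.lmap f x := by
  have := F.property.1
  have := F.property.2.1
  simp [lmap, F.obj.map_smul]

lemma lmap_id (F : QFun q d) (A : Source q d) (x : F.at' A) : F.lmap (𝟙 A) x = x := by
  simp [lmap]

lemma lmap_comp (F : QFun q d) {A B C : Source q d} (f : A ⟶ B) (g : B ⟶ C) (x : F.at' A) :
    F.lmap (f ≫ g) x = F.lmap g (F.lmap f x) := by
  simp [lmap]

/-- A quantum polynomial functor from its values. -/
def ofData (M : Source q d → Type u) [∀ A, AddCommGroup (M A)] [∀ A, Module K (M A)]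
    [∀ A, Module.Finite K (M A)] (map : ∀ {A B : Source q d}, (A ⟶ B) → (M A →ₗ[K] M B))
    (map_id : ∀ A x, map (𝟙 A) x = x)
    (map_comp : ∀ {A B C} (f : A ⟶ B) (g : B ⟶ C) x, map (f ≫ g) x = map g (map f x))
    (map_add : ∀ {A B} (f g : A ⟶ B) x, map (f + g) x = map f x + map g x)
    (map_smul : ∀ {A B} (r : K) (f : A ⟶ B) x, map (r • f) x = r • map f x) : QFun q d where
  obj :=
    { obj := fun A => ModuleCat.of K (M A)
      map := fun f => ModuleCat.ofHom (map f)
      map_id := fun A => by ext x; exact map_id A x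
      map_comp := fun f g => by ext x; exact map_comp f g x }
  property := ⟨⟨fun {_ _ f g} => by ext x; exact map_add f g x⟩,
    ⟨fun f r => by ext x; exact map_smul r f x⟩, fun A => (inferInstance : Module.Finite K (M A))⟩

/-- A natural transformation from its components. -/
def homMk {F G : QFun q d} (φ : ∀ A, F.at' A →ₗ[K] G.at' A)
    (h : ∀ {A B : Source q d} (f : A ⟶ B) (x : F.at' A), φ B (F.lmap f x) = G.lmap f (φ A x)) :
    F ⟶ G :=
  ObjectProperty.homMk
    { app := fun A => ModuleCat.ofHom (φ A)
      naturality := fun _ _ f => by ext x; exact h f x }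

end QFun

open QFun

variable {q : Kˣ}

/-- A subfunctor of a quantum polynomial functor. -/
structure Subfun (F : QFun q d) where
  carrier : ∀ A, Submodule K (F.at' A)
  map_mem : ∀ {A B : Source q d} (f : A ⟶ B) (x : F.at' A), x ∈ carrier A → F.lmap f x ∈ carrier B

namespace Subfun

variable {F G : QFun q d}

/-- A subfunctor as a functor. -/
def toFun (U : Subfun F) : QFun q d :=
  ofData (fun A => U.carrier A) (fun f => (F.lmap f).restrict (U.map_mem f))
    (fun _ _ => Subtype.ext (F.lmap_id _ _)) (fun _ _ _ => Subtype.ext (F.lmap_comp _ _ _))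
    (fun _ _ _ => Subtype.ext (F.lmap_add _ _ _)) (fun _ _ _ => Subtype.ext (F.lmap_smul _ _ _))

/-- The inclusion of a subfunctor. -/
def incl (U : Subfun F) : U.toFun ⟶ F := homMk (fun A => (U.carrier A).subtype) (fun _ _ => rfl)

/-- The quotient by a subfunctor. -/
def quot (U : Subfun F) : QFun q d :=
  ofData (fun A => F.at' A ⧸ U.carrier A)
    (fun {A B} f => (U.carrier A).mapQ (U.carrier B) (F.lmap f) (U.map_mem f))
    (fun A x => by
      obtain ⟨x, rfl⟩ := Submodule.Quotient.mk_surjective _ x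
      exact congrArg _ (F.lmap_id _ x))
    (fun f g x => by
      obtain ⟨x, rfl⟩ := Submodule.Quotient.mk_surjective _ x
      exact congrArg _ (F.lmap_comp f g x))
    (fun f g x => by
      obtain ⟨x, rfl⟩ := Submodule.Quotient.mk_surjective _ x
      exact congrArg _ (F.lmap_add f g x))
    (fun r f x => by
      obtain ⟨x, rfl⟩ := Submodule.Quotient.mk_surjective _ x
      exact congrArg _ (F.lmap_smul r f x))

/-- The natural transformation between subfunctors induced by a natural transformation. -/
def restrict (φ : F ⟶ G) (U : Subfun F) (W : Subfun G)
    (h : ∀ A x, x ∈ U.carrier A → app φ A x ∈ W.carrier A) : U.toFun ⟶ W.toFun :=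
  homMk (fun A => (app φ A).restrict (h A)) (fun f x => Subtype.ext (app_lmap φ f x.1))

/-- The natural transformation between quotients induced by a natural transformation. -/
def mapQuot (φ : F ⟶ G) (U : Subfun F) (W : Subfun G)
    (h : ∀ A x, x ∈ U.carrier A → app φ A x ∈ W.carrier A) : U.quot ⟶ W.quot :=
  homMk (fun A => (U.carrier A).mapQ (W.carrier A) (app φ A) (h A)) (fun f x => by
    obtain ⟨x, rfl⟩ := Submodule.Quotient.mk_surjective _ x
    exact congrArg _ (app_lmap φ f x))

/-- The kernel of a natural transformation. -/
def ker (φ : F ⟶ G) : Subfun F where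
  carrier A := LinearMap.ker (app φ A)
  map_mem f x hx := by
    rw [LinearMap.mem_ker] at hx ⊢
    rw [app_lmap, hx, map_zero]

/-- The image of a natural transformation. -/
def range (φ : F ⟶ G) : Subfun G where
  carrier A := LinearMap.range (app φ A)
  map_mem f x := by
    rintro ⟨y, rfl⟩
    exact ⟨F.lmap f y, app_lmap φ f y⟩

/-- The subfunctor zero. -/
def zero (F : QFun q d) : Subfun F where
  carrier _ := ⊥
  map_mem f x hx := by rw [Submodule.mem_bot] at hx ⊢; rw [hx, map_zero]

/-- The whole functor as a subfunctor. -/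
def whole (F : QFun q d) : Subfun F where
  carrier _ := ⊤
  map_mem _ _ _ := trivial

/-- The intersection `W ∩ U`, as a subfunctor of `U`. -/
def inside (W U : Subfun F) : Subfun U.toFun where
  carrier A := (W.carrier A).comap (U.carrier A).subtype
  map_mem f x hx := W.map_mem f x.1 hx

end Subfun

/-- Cochain complexes of quantum polynomial functors, in the degrees `0, 1, 2, …`. -/
structure Cochain (q : Kˣ) (d : ℕ) where
  X : ℕ → QFun q d
  δ : ∀ i, X i ⟶ X (i + 1)
  δ_δ : ∀ i A x, app (δ (i + 1)) A (app (δ i) A x) = 0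

namespace Cochain

/-- The cocycles. -/
def cocycles (C : Cochain q d) (i : ℕ) : Subfun (C.X i) := Subfun.ker (C.δ i)

/-- The coboundaries. -/
def coboundaries (C : Cochain q d) : ∀ i, Subfun (C.X i)
  | 0 => Subfun.zero _
  | i + 1 => Subfun.range (C.δ i)

/-- The cohomology functor `H^i(C)`: cocycles modulo coboundaries. -/
def cohomology (C : Cochain q d) (i : ℕ) : QFun q d :=
  ((C.coboundaries i).inside (C.cocycles i)).quot

/-- The cohomology class of a cocycle. -/
def cls (C : Cochain q d) {i : ℕ} {A : Source q d} (x : (C.X i).at' A)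
    (hx : app (C.δ i) A x = 0) : (C.cohomology i).at' A :=
  Submodule.Quotient.mk (p := ((C.coboundaries i).inside (C.cocycles i)).carrier A) ⟨x, hx⟩

/-- Morphisms of complexes. -/
structure Hom (C D : Cochain q d) where
  f : ∀ i, C.X i ⟶ D.X i
  comm : ∀ i A x, app (f (i + 1)) A (app (C.δ i) A x) = app (D.δ i) A (app (f i) A x)

/-- The map induced in cohomology by a morphism of complexes. -/
def Hom.cohomologyMap {C D : Cochain q d} (φ : Hom C D) (i : ℕ) :
    C.cohomology i ⟶ D.cohomology i :=
  Subfun.mapQuot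
    (Subfun.restrict (φ.f i) (C.cocycles i) (D.cocycles i) (fun A x hx => by
      have hx : app (C.δ i) A x = 0 := hx
      change app (D.δ i) A (app (φ.f i) A x) = 0
      rw [← φ.comm, hx, map_zero]))
    _ _ (fun A x hx => by
      cases i with
      | zero =>
        have hx : x.1 = 0 := hx
        change app (φ.f 0) A x.1 = 0
        rw [hx, map_zero]
      | succ i =>
        obtain ⟨y, hy⟩ : ∃ y, app (C.δ i) A y = x.1 := hx
        exact ⟨app (φ.f i) A y, by rw [← φ.comm, hy]; rfl⟩)

end Cochain

/-- The functor `⊗^d`. -/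
def tensorPow (q : Kˣ) (d : ℕ) : QFun q d :=
  ofData (fun A => Tens K A.dim d) (fun f => f.1) (fun _ _ => rfl) (fun _ _ _ => rfl)
    (fun f g x => LinearMap.add_apply f.1 g.1 x) (fun r f x => LinearMap.smul_apply r f.1 x)

lemma hom_rel {A B : Source q d} (f : A ⟶ B) (i : ℕ) :
    rel q A.dim d i ≤ (rel q B.dim d i).comap f.1 := by
  rcases Nat.lt_or_ge d i with h | h
  · rw [rel_eq_top q h, rel_eq_top q h, Submodule.comap_top]
  refine rel_le q h (fun k hk y => ?_) (fun k hk hk' y hy => ?_)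
  · rw [Submodule.mem_comap, map_sub, map_smul, f.2 k y]
    exact sym_mem_rel q hk _
  · refine ext_mem_rel q hk hk' ?_
    rw [← f.2 k y, hy, map_smul]

/-- The relations of `S^{d-i} ⊗ Λ^i` as a subfunctor of `⊗^d`. -/
def relSub (q : Kˣ) (d i : ℕ) : Subfun (tensorPow q d) where
  carrier A := rel q A.dim d i
  map_mem f _ hx := hom_rel f i hx

/-- The functor `Ω^i_d = S_q^{d-i} ⊗ Λ_q^i`, which is zero for `i > d`. -/
def Omega (q : Kˣ) (d i : ℕ) : QFun q d := (relSub q d i).quot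

/-- The class in `Ω^i_d(n)` of a tensor. -/
def Omega.mk (q : Kˣ) (d i : ℕ) (A : Source q d) : Tens K A.dim d →ₗ[K] (Omega q d i).at' A :=
  (rel q A.dim d i).mkQ

lemma Omega.mk_surjective (q : Kˣ) (d i : ℕ) (A : Source q d) :
    Function.Surjective (Omega.mk q d i A) := Submodule.mkQ_surjective _

lemma Omega.mk_eq_zero (q : Kˣ) (d i : ℕ) (A : Source q d) (x : Tens K A.dim d) :
    Omega.mk q d i A x = 0 ↔ x ∈ rel q A.dim d i := Submodule.Quotient.mk_eq_zero _

lemma symShuffle_hom {A B : Source q d} (f : A ⟶ B) (m : ℕ) (x : Tens K A.dim d) :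
    symShuffle q m (f.1 x) = f.1 (symShuffle q m x) := by
  induction m with
  | zero => simp [symShuffle_zero]
  | succ m ih => simp [symShuffle_succ, ih, ← f.2 (m - 1)]

lemma extShuffle_hom {A B : Source q d} (f : A ⟶ B) (p i : ℕ) (x : Tens K A.dim d) :
    extShuffle q p i (f.1 x) = f.1 (extShuffle q p i x) := by
  induction i generalizing p with
  | zero => simp [extShuffle_zero]
  | succ i ih => simp [extShuffle_succ, ih, ← f.2 p]

/-- The de Rham differential `δ : Ω^i_d → Ω^{i+1}_d`. -/
def deRhamD (q : Kˣ) (d i : ℕ) : Omega q d i ⟶ Omega q d (i + 1) :=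
  Subfun.mapQuot
    (homMk (F := tensorPow q d) (G := tensorPow q d) (fun _ => symShuffle q (d - i))
      (fun f x => symShuffle_hom f _ x))
    _ _ (fun A _ hx => symShuffle_rel q A.dim d i hx)

/-- The operator on `V_n^{⊗ d}` that induces the Koszul differential. -/
def koszulOp (q : Kˣ) (n d i : ℕ) : Module.End K (Tens K n d) :=
  if i + 1 ≤ d then extShuffle q (d - (i + 1)) (i + 1) else 0

lemma koszulOp_hom {A B : Source q d} (f : A ⟶ B) (i : ℕ) (x : Tens K A.dim d) :
    koszulOp q B.dim d i (f.1 x) = f.1 (koszulOp q A.dim d i x) := by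
  unfold koszulOp
  split_ifs
  · exact extShuffle_hom f _ _ x
  · exact (map_zero f.1).symm

lemma koszulOp_rel (q : Kˣ) (n d i : ℕ) :
    rel (K := K) q n d (i + 1) ≤ (rel q n d i).comap (koszulOp q n d i) := by
  unfold koszulOp
  split_ifs with h
  · exact extShuffle_rel q n d i h
  · exact fun _ _ => zero_mem (rel q n d i)

/-- The Koszul differential `κ : Ω^{i+1}_d → Ω^i_d`. -/
def koszulD (q : Kˣ) (d i : ℕ) : Omega q d (i + 1) ⟶ Omega q d i :=
  Subfun.mapQuot
    (homMk (F := tensorPow q d) (G := tensorPow q d) (fun A => koszulOp q A.dim d i)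
      (fun f x => koszulOp_hom f i x))
    _ _ (fun A _ hx => koszulOp_rel q A.dim d i hx)

/-- The quantum de Rham complex in polynomial degree `d`. -/
def deRham (q : Kˣ) (d : ℕ) : Cochain q d where
  X := Omega q d
  δ := deRhamD q d
  δ_δ i A x := by
    obtain ⟨x, rfl⟩ := Submodule.Quotient.mk_surjective _ x
    exact (Submodule.Quotient.mk_eq_zero _).2 (symShuffle_symShuffle_mem q i x)

/-- The Koszul kernels `N^i_d = ker (κ : Ω^i_d → Ω^{i-1}_d)`. -/
def koszulKer (q : Kˣ) (d : ℕ) : ∀ i, Subfun (Omega q d i)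
  | 0 => Subfun.whole _
  | i + 1 => Subfun.ker (koszulD q d i)

lemma app_deRhamD (q : Kˣ) (d i : ℕ) (A : Source q d) (x : Tens K A.dim d) :
    app (deRhamD q d i) A (Omega.mk q d i A x) =
      Omega.mk q d (i + 1) A (symShuffle q (d - i) x) := rfl

lemma app_koszulD (q : Kˣ) (d i : ℕ) (A : Source q d) (x : Tens K A.dim d) :
    app (koszulD q d i) A (Omega.mk q d (i + 1) A x) =
      Omega.mk q d i A (koszulOp q A.dim d i x) := rfl

lemma koszulD_deRhamD_zero (q : Kˣ) (d : ℕ) (A : Source q d) (x : (Omega q d 0).at' A)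
    (hd : ∑ r ∈ Finset.range d, (q : K) ^ (2 * r) = 0) :
    app (koszulD q d 0) A (app (deRhamD q d 0) A x) = 0 := by
  obtain ⟨x, rfl⟩ := Omega.mk_surjective _ _ _ _ x
  rw [app_deRhamD, app_koszulD, Omega.mk_eq_zero]
  unfold koszulOp
  split_ifs with h
  · have := symShuffle_sub_mem q 0 x
    rw [Nat.sub_zero, hd, zero_smul, sub_zero] at this
    simpa [extShuffle_succ, extShuffle_zero] using this
  · exact zero_mem _

lemma koszulD_deRhamD_succ (q : Kˣ) (d i : ℕ) (A : Source q d) (x : (Omega q d (i + 1)).at' A)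
    (hd : ∑ r ∈ Finset.range d, (q : K) ^ (2 * r) = 0) (hx : app (koszulD q d i) A x = 0) :
    app (koszulD q d (i + 1)) A (app (deRhamD q d (i + 1)) A x) = 0 := by
  obtain ⟨x, rfl⟩ := Omega.mk_surjective _ _ _ _ x
  rw [app_koszulD, Omega.mk_eq_zero] at hx
  rw [app_deRhamD, app_koszulD, Omega.mk_eq_zero]
  unfold koszulOp at hx ⊢
  split_ifs with h
  swap
  · exact zero_mem _
  rw [if_pos (by omega)] at hx
  have h1 := koszul_deRham q (i := i) (by omega) x
  have h2 := symShuffle_rel q A.dim d i hx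
  rw [Submodule.mem_comap] at h2
  rw [hd, mul_zero, zero_smul, sub_zero] at h1
  have h3 := Submodule.sub_mem _ h1 (Submodule.smul_mem _ ((q : K)⁻¹ ^ 2) h2)
  rwa [add_sub_cancel_left] at h3

/-- The subfunctors `N^i_d` form a subcomplex of the de Rham complex if the quantum integer
`(d)_{q²}` is zero. -/
def koszulKerComplex (q : Kˣ) (d : ℕ) (hd : ∑ r ∈ Finset.range d, (q : K) ^ (2 * r) = 0) :
    Cochain q d where
  X i := (koszulKer q d i).toFun
  δ i := Subfun.restrict (deRhamD q d i) _ _ (fun A x hx => by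
    cases i with
    | zero => exact koszulD_deRhamD_zero q d A x hd
    | succ i => exact koszulD_deRhamD_succ q d i A x hd hx)
  δ_δ i A x := Subtype.ext ((deRham q d).δ_δ i A x.1)

/-- The inclusion of the Koszul kernel complex in the de Rham complex. -/
def koszulKerIncl (q : Kˣ) (d : ℕ) (hd : ∑ r ∈ Finset.range d, (q : K) ^ (2 * r) = 0) :
    Cochain.Hom (koszulKerComplex q d hd) (deRham q d) where
  f i := (koszulKer q d i).incl
  comm _ _ _ := rfl

/-- `q` is a primitive `ℓ`-th root of unity, where `ℓ > 1` is odd. -/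
structure IsOddRoot (q : Kˣ) (ℓ : ℕ) : Prop where
  primitive : IsPrimitiveRoot q ℓ
  one_lt : 1 < ℓ
  odd : Odd ℓ

namespace IsOddRoot

variable {ℓ : ℕ}

lemma primitive_sq (h : IsOddRoot q ℓ) : IsPrimitiveRoot ((q : K) ^ 2) ℓ := by
  have h1 : IsPrimitiveRoot (q : K) ℓ := IsPrimitiveRoot.coe_units_iff.2 h.primitive
  exact h1.pow_of_coprime 2 (Nat.coprime_two_left.2 h.odd)

lemma sum_eq_zero (h : IsOddRoot q ℓ) (d : ℕ) :
    ∑ r ∈ Finset.range (d * ℓ), (q : K) ^ (2 * r) = 0 := by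
  have h1 := h.primitive_sq
  have h2 : (q : K) ^ 2 - 1 ≠ 0 := sub_ne_zero.2 (h1.ne_one h.one_lt)
  have h3 := mul_geom_sum ((q : K) ^ 2) (d * ℓ)
  rw [mul_comm d ℓ, pow_mul ((q : K) ^ 2) ℓ d, h1.pow_eq_one, one_pow, sub_self] at h3
  simp only [pow_mul, mul_comm d ℓ]
  exact (mul_eq_zero.1 h3).resolve_left h2

end IsOddRoot

/-- The `q`-binomial coefficients. -/
def gauss (z : K) : ℕ → ℕ → K
  | _, 0 => 1
  | 0, _ + 1 => 0
  | m + 1, r + 1 => z ^ (r + 1) * gauss z m (r + 1) + gauss z m r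

lemma gauss_zero_right (z : K) (m : ℕ) : gauss z m 0 = 1 := by cases m <;> rfl

lemma gauss_of_lt (z : K) (m r : ℕ) (h : m < r) : gauss z m r = 0 := by
  induction m generalizing r with
  | zero => obtain ⟨r, rfl⟩ : ∃ s, r = s + 1 := ⟨r - 1, by omega⟩; rfl
  | succ m ih =>
    obtain ⟨r, rfl⟩ : ∃ s, r = s + 1 := ⟨r - 1, by omega⟩
    rw [gauss, ih _ (by omega), ih _ (by omega), mul_zero, zero_add]

lemma gauss_self (z : K) (m : ℕ) : gauss z m m = 1 := by
  induction m with
  | zero => rfl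
  | succ m ih => rw [gauss, gauss_of_lt z m (m + 1) (by omega), ih, mul_zero, zero_add]

lemma gauss_rec (z : K) (m r : ℕ) (h : r ≤ m) :
    gauss z m (r + 1) * (1 - z ^ (r + 1)) = gauss z m r * (1 - z ^ (m - r)) := by
  induction m generalizing r with
  | zero =>
    obtain rfl : r = 0 := by omega
    simp [gauss]
  | succ m ih =>
    have lhs : gauss z (m + 1) (r + 1) * (1 - z ^ (r + 1)) = gauss z m r * (1 - z ^ (m + 1)) := by
      rcases Nat.lt_or_ge m r with h1 | h1
      · rw [gauss, gauss_of_lt z m (r + 1) (by omega), gauss_of_lt z m r h1]; ring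
      · have e : z ^ (m + 1) = z ^ (r + 1) * z ^ (m - r) := by
          rw [← pow_add]; congr 1; omega
        rw [gauss, add_mul, mul_assoc, ih r h1, e]; ring
    have rhs : gauss z (m + 1) r * (1 - z ^ (m + 1 - r)) = gauss z m r * (1 - z ^ (m + 1)) := by
      cases r with
      | zero => rw [gauss_zero_right, gauss_zero_right, Nat.sub_zero]
      | succ r =>
        have e : z ^ (m + 1) = z ^ (r + 1) * z ^ (m - r) := by
          rw [← pow_add]; congr 1; omega
        rw [gauss, Nat.add_sub_add_right, add_mul, ← ih r (by omega), e]; ring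
    rw [lhs, rhs]

lemma gauss_eq_zero {z : K} {ℓ : ℕ} (hz : IsPrimitiveRoot z ℓ) (r : ℕ) (h : r + 1 < ℓ) :
    gauss z ℓ (r + 1) = 0 := by
  have h1 : 1 - z ^ (r + 1) ≠ 0 :=
    sub_ne_zero.2 (hz.pow_ne_one_of_pos_of_lt (by omega) h).symm
  have h2 := gauss_rec z ℓ r (by omega)
  have h3 : gauss z ℓ r * (1 - z ^ (ℓ - r)) = 0 := by
    cases r with
    | zero => rw [Nat.sub_zero, hz.pow_eq_one, sub_self, mul_zero]
    | succ r => rw [gauss_eq_zero hz r (by omega), zero_mul]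
  rw [h3] at h2
  exact (mul_eq_zero.1 h2).resolve_right h1

section Ring

variable {A : Type*} [Ring A] [Algebra K A]

lemma pow_mul_of_comm {z : K} {a b : A} (h : b * a = z • (a * b)) (r : ℕ) :
    b ^ r * a = z ^ r • (a * b ^ r) := by
  induction r with
  | zero => simp
  | succ r ih =>
    rw [pow_succ, mul_assoc, h, mul_smul_comm, ← mul_assoc, ih, smul_mul_assoc, smul_smul,
      mul_assoc, ← pow_succ']

lemma mul_pow_of_comm {z : K} {a b : A} (h : b * a = z • (a * b)) (r : ℕ) :
    b * a ^ r = z ^ r • (a ^ r * b) := by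
  induction r with
  | zero => simp
  | succ r ih =>
    rw [pow_succ, ← mul_assoc, ih, smul_mul_assoc, mul_assoc, h, mul_smul_comm, smul_smul,
      ← mul_assoc, ← pow_succ]

lemma add_pow_gauss {z : K} {a b : A} (h : b * a = z • (a * b)) (m : ℕ) :
    (a + b) ^ m = ∑ r ∈ Finset.range (m + 1), gauss z m r • (a ^ (m - r) * b ^ r) := by
  induction m with
  | zero => simp [gauss]
  | succ m ih =>
    rw [pow_succ, ih, mul_add, Finset.sum_mul, Finset.sum_mul]
    have e1 : (∑ r ∈ Finset.range (m + 1), gauss z m r • (a ^ (m - r) * b ^ r) * a : A) =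
        a ^ (m + 1) + ∑ r ∈ Finset.range (m + 1),
          (z ^ (r + 1) * gauss z m (r + 1)) • (a ^ (m - r) * b ^ (r + 1)) := by
      rw [Finset.sum_range_succ', Finset.sum_range_succ _ m, gauss_of_lt z m (m + 1) (by omega),
        mul_zero, zero_smul, add_zero, add_comm]
      congr 1
      · simp [gauss_zero_right, pow_succ]
      · refine Finset.sum_congr rfl fun r hr => ?_
        have hr := Finset.mem_range.1 hr
        rw [smul_mul_assoc, mul_assoc, pow_mul_of_comm h, mul_smul_comm, smul_smul, ← mul_assoc,
          ← pow_succ, mul_comm, show m - (r + 1) + 1 = m - r by omega]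
    have e2 : ∑ r ∈ Finset.range (m + 1), gauss z m r • (a ^ (m - r) * b ^ r) * b =
        ∑ r ∈ Finset.range (m + 1), gauss z m r • (a ^ (m - r) * b ^ (r + 1)) :=
      Finset.sum_congr rfl fun r _ => by rw [smul_mul_assoc, mul_assoc, ← pow_succ]
    rw [e1, e2, add_assoc, ← Finset.sum_add_distrib, Finset.sum_range_succ' _ (m + 1), add_comm]
    congr 1
    · refine Finset.sum_congr rfl fun r _ => ?_
      rw [← add_smul, Nat.add_sub_add_right]
      rfl
    · simp [gauss]

lemma add_pow_root {z : K} {ℓ : ℕ} (hz : IsPrimitiveRoot z ℓ) (hℓ : 0 < ℓ) {a b : A}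
    (h : b * a = z • (a * b)) : (a + b) ^ ℓ = a ^ ℓ + b ^ ℓ := by
  obtain ⟨s, rfl⟩ : ∃ s, ℓ = s + 1 := ⟨ℓ - 1, by omega⟩
  rw [add_pow_gauss h, Finset.sum_range_succ, Finset.sum_range_succ', Finset.sum_eq_zero]
  · simp [gauss_self, gauss_zero_right]
  · intro r hr
    rw [gauss_eq_zero hz r (by have := Finset.mem_range.1 hr; omega), zero_smul]

lemma sum_pow_root {z : K} {ℓ : ℕ} (hz : IsPrimitiveRoot z ℓ) (hℓ : 0 < ℓ) {r : ℕ}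
    (a : Fin r → A) (h : ∀ k l, k < l → a l * a k = z • (a k * a l)) :
    (∑ k, a k) ^ ℓ = ∑ k, a k ^ ℓ := by
  induction r with
  | zero => simp [hℓ.ne']
  | succ r ih =>
    rw [Fin.sum_univ_succ, Fin.sum_univ_succ, add_pow_root hz hℓ,
      ih _ fun k l hkl => h _ _ (Fin.succ_lt_succ_iff.2 hkl)]
    rw [Finset.sum_mul, Finset.mul_sum, Finset.smul_sum]
    exact Finset.sum_congr rfl fun k _ => h 0 k.succ (Fin.succ_pos k)

lemma commute_pow_of_qcomm {ℓ : ℕ} (h : IsOddRoot q ℓ) {a b : A}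
    (hab : b * a = (q : K) • (a * b)) : Commute (a ^ ℓ) (b ^ ℓ) := by
  have h0 : (q : K) ^ ℓ = 1 := by
    rw [← Units.val_pow_eq_pow_val, h.primitive.pow_eq_one, Units.val_one]
  have h1 := pow_mul_of_comm hab ℓ
  rw [h0, one_smul] at h1
  exact (show Commute (b ^ ℓ) a from h1).symm.pow_left ℓ

lemma pow_succ_mul_of_comm {z : K} {a b y : A} (h : a * b = b * a + y) (hy : y * a = z • (a * y))
    (r : ℕ) : a ^ (r + 1) * b = b * a ^ (r + 1) +
      (∑ s ∈ Finset.range (r + 1), z ^ s) • (a ^ r * y) := by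
  induction r with
  | zero => simpa using h
  | succ r ih =>
    have e : a ^ (r + 1 + 1) * b = a * (a ^ (r + 1) * b) := by rw [pow_succ' a (r + 1), mul_assoc]
    have e1 : a * (b * a ^ (r + 1)) = b * a ^ (r + 1 + 1) + z ^ (r + 1) • (a ^ (r + 1) * y) := by
      rw [← mul_assoc, h, add_mul, mul_assoc, ← pow_succ', mul_pow_of_comm hy]
    rw [e, ih, mul_add, e1, mul_smul_comm, ← mul_assoc, ← pow_succ', add_assoc, ← add_smul,
      Finset.sum_range_succ _ (r + 1), add_comm (z ^ (r + 1))]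

lemma commute_pow_diag {ℓ : ℕ} (h : IsOddRoot q ℓ) {a b y : A} (hab : a * b = b * a + y)
    (hy : y * a = ((q : K) ^ 2) • (a * y)) : Commute (a ^ ℓ) (b ^ ℓ) := by
  obtain ⟨s, rfl⟩ : ∃ s, ℓ = s + 1 := ⟨ℓ - 1, by have := h.one_lt; omega⟩
  have h1 := pow_succ_mul_of_comm hab hy s
  rw [h.primitive_sq.geom_sum_eq_zero h.one_lt, zero_smul, add_zero] at h1
  exact (show Commute (a ^ (s + 1)) b from h1).pow_right _

/-- In an algebra generated by the entries of a quantum matrix the `ℓ`-th powers of the entries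
commute. -/
lemma commute_pow {ℓ : ℕ} (h : IsOddRoot q ℓ) (X : Fin m → Fin n → A)
    (hX : ∀ i k j l, X i l * X k j - X k j * X i l =
      (coef q i k - coef q j l) • (X i j * X k l)) (i k : Fin m) (j l : Fin n) :
    Commute (X i l ^ ℓ) (X k j ^ ℓ) := by
  have row : ∀ i j l, j < l → X i l * X i j = (q : K) • (X i j * X i l) := by
    intro i j l hjl
    have := hX i i j l
    rw [coef_self, coef_lt q hjl, sub_zero, sub_smul, one_smul] at this
    exact sub_left_injective this
  have col : ∀ i k j, i < k → X k j * X i j = (q : K) • (X i j * X k j) := by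
    intro i k j hik
    have := hX i k j j
    rw [coef_self, coef_lt q hik, zero_sub, neg_smul, sub_smul, one_smul, neg_sub] at this
    exact (sub_right_injective this)
  have diag : ∀ i k j l, i < k → l < j → Commute (X i l ^ ℓ) (X k j ^ ℓ) := by
    intro i k j l hik hlj
    refine commute_pow_diag h (sub_eq_iff_eq_add'.1 (hX i k j l)) ?_
    rw [smul_mul_assoc, mul_assoc, col i k l hik, mul_smul_comm, ← mul_assoc, row i l j hlj,
      smul_mul_assoc, mul_smul_comm, mul_assoc, pow_two]
    module
  have comm : ∀ i k j l, coef q i k = coef q j l → Commute (X i l ^ ℓ) (X k j ^ ℓ) := by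
    intro i k j l e
    have := hX i k j l
    rw [e, sub_self, zero_smul, sub_eq_zero] at this
    exact (show Commute (X i l) (X k j) from this).pow_pow ℓ ℓ
  rcases lt_trichotomy i k with h1 | rfl | h1 <;> rcases lt_trichotomy j l with h2 | rfl | h2
  · exact comm _ _ _ _ (by rw [coef_lt q h1, coef_lt q h2])
  · exact commute_pow_of_qcomm h (col _ _ _ h1)
  · exact diag _ _ _ _ h1 h2
  · exact (commute_pow_of_qcomm h (row _ _ _ h2)).symm
  · exact Commute.refl _
  · exact commute_pow_of_qcomm h (row _ _ _ h2)
  · exact (diag _ _ _ _ h1 h2).symm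
  · exact (commute_pow_of_qcomm h (col _ _ _ h1)).symm
  · exact comm _ _ _ _ (by rw [coef_gt q h1, coef_gt q h2])

end Ring

section Operators

variable {α : Type*}

/-- The functions on lists that satisfy, at every place, the linear relations `R`. -/
def relFun (K : Type u) [Field K] (R : Set (List (K × List α))) :
    Submodule K (List α → K) where
  carrier := {h | ∀ r ∈ R, ∀ x y, (r.map fun p => p.1 * h (x ++ p.2 ++ y)).sum = 0}
  add_mem' hf hg r hr x y := by
    simp only [Pi.add_apply, mul_add, List.sum_map_add, hf r hr x y, hg r hr x y, add_zero]
  zero_mem' r hr x y := by simp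
  smul_mem' c f hf r hr x y := by
    have e := hf r hr x y
    simp only [Pi.smul_apply, smul_eq_mul, mul_left_comm _ c, List.sum_map_mul_left, e, mul_zero]

/-- The operator that appends a letter to the argument. -/
def appendOp (R : Set (List (K × List α))) (a : α) : Module.End K (relFun K R) where
  toFun h := ⟨fun l => h.1 (l ++ [a]), fun r hr x y => by
    simpa only [List.append_assoc] using h.2 r hr x (y ++ [a])⟩
  map_add' _ _ := rfl
  map_smul' _ _ := rfl

lemma appendOp_prod (R : Set (List (K × List α))) (l : List α) (h : relFun K R) (x : List α) :
    ((l.map (appendOp R)).prod h).1 x = h.1 (x ++ l) := by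
  induction l generalizing x with
  | nil => simp
  | cons a l ih =>
    rw [List.map_cons, List.prod_cons, Module.End.mul_apply]
    refine (ih (x ++ [a])).trans ?_
    rw [List.append_assoc, List.singleton_append]

lemma appendOp_prod_nil (R : Set (List (K × List α))) {D : ℕ} (w : Fin D → α) (h : relFun K R) :
    ((List.ofFn fun t => appendOp R (w t)).prod h).1 [] = h.1 (List.ofFn w) := by
  have := appendOp_prod R (List.ofFn w) h []
  rw [List.map_ofFn, List.nil_append] at this
  exact this

end Operators

lemma prod_ofFn_divNat {A : Type*} [Monoid A] {d ℓ : ℕ} (X : Fin d → A) :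
    (List.ofFn fun t : Fin (d * ℓ) => X t.divNat).prod = (List.ofFn fun s => X s ^ ℓ).prod := by
  rw [List.ofFn_mul, List.prod_flatten, List.map_ofFn]
  congr 2
  funext s
  have e : ∀ j : Fin ℓ, Fin.divNat (⟨s * ℓ + j, by
      have h1 := s.2; have h2 := j.2; nlinarith⟩ : Fin (d * ℓ)) = s := by
    intro j
    ext
    simp only [Fin.coe_divNat]
    rw [mul_comm, Nat.mul_add_div (by have := j.2; omega), Nat.div_eq_of_lt j.2, add_zero]
  simp only [Function.comp, e]
  rw [List.ofFn_const, List.prod_replicate]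

lemma T_apply (q : Kˣ) (k : ℕ) (h : k + 1 < d) (v : Tens K n d) (w : Word n d) :
    T q k v w = coef q (w ⟨k, by omega⟩) (w ⟨k + 1, h⟩) * v w + v (w.swap k h) := by
  classical
  induction v using Finsupp.induction_linear with
  | zero => simp
  | add f g hf hg => simp only [map_add, Finsupp.add_apply, hf, hg]; ring
  | single u c =>
    rw [← mul_one c, ← smul_eq_mul, ← Finsupp.smul_single, map_smul, T_single q k h]
    simp only [Finsupp.smul_apply, Finsupp.add_apply, Finsupp.single_apply, smul_eq_mul]
    have e : u.swap k h = w ↔ u = w.swap k h :=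
      ⟨fun e => by rw [← e, Word.swap_swap], fun e => by rw [e, Word.swap_swap]⟩
    simp only [e]
    by_cases h1 : u = w
    · subst h1
      simp only [if_true, mul_ite, mul_one, mul_zero]
      split_ifs <;> ring
    · simp [h1]

/-- The matrix coefficients of a linear map between tensor powers. -/
def entry {r s : ℕ} (f : Tens K n r →ₗ[K] Tens K m s) (I : Word m s) (J : Word n r) : K :=
  f (Finsupp.single J 1) I

lemma mem_schur_iff (f : Tens K n d →ₗ[K] Tens K m d) : f ∈ schur q n m d ↔
    ∀ k, ∀ h : k + 1 < d, ∀ (I : Word m d) (J : Word n d),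
      entry f I (J.swap k h) - entry f (I.swap k h) J =
        (coef q (I ⟨k, by omega⟩) (I ⟨k + 1, h⟩) - coef q (J ⟨k, by omega⟩) (J ⟨k + 1, h⟩)) *
          entry f I J := by
  have key : ∀ k, ∀ h : k + 1 < d, ∀ (I : Word m d) (J : Word n d),
      f (T q k (Finsupp.single J 1)) I - T q k (f (Finsupp.single J 1)) I =
      entry f I (J.swap k h) - entry f (I.swap k h) J -
        (coef q (I ⟨k, by omega⟩) (I ⟨k + 1, h⟩) - coef q (J ⟨k, by omega⟩) (J ⟨k + 1, h⟩)) *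
          entry f I J := by
    intro k h I J
    rw [T_apply q k h, T_single q k h, map_add, map_smul]
    simp only [Finsupp.add_apply, Finsupp.smul_apply, smul_eq_mul, entry]
    ring
  constructor
  · intro hf k h I J
    rw [← sub_eq_zero, ← key k h, hf k, sub_self]
  · intro hf k v
    by_cases h : k + 1 < d
    · have : f ∘ₗ T q k = T q k ∘ₗ f := by
        refine Finsupp.lhom_ext' fun J => LinearMap.ext_ring (Finsupp.ext fun I => ?_)
        rw [← sub_eq_zero]
        refine (key k h I J).trans ?_
        rw [hf k h I J, sub_self]
      exact LinearMap.congr_fun this v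
    · rw [T_of_not q k h, T_of_not q k h]; simp

/-- A list of length `D` as a word. -/
def listWord {α : Type*} (D : ℕ) (l : List α) (hl : l.length = D) : Fin D → α :=
  fun t => l[t.1]'(hl ▸ t.2)

lemma listWord_ofFn {α : Type*} {D : ℕ} (w : Fin D → α) (h : (List.ofFn w).length = D) :
    listWord D (List.ofFn w) h = w := by
  funext t
  simp [listWord]

lemma listWord_congr {α : Type*} {D : ℕ} {l l' : List α} (e : l = l') (h : l.length = D) :
    listWord D l h = listWord D l' (e ▸ h) := by
  subst e
  rfl

lemma listWord_map {α β : Type*} {D : ℕ} (g : α → β) (l : List α) (h : (l.map g).length = D)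
    (h' : l.length = D) : listWord D (l.map g) h = g ∘ listWord D l h' := by
  funext t
  simp [listWord]

lemma listWord_left {x y : List (Fin n)} {a b : Fin n} {k : ℕ} (hx : x.length = k)
    (h : (x ++ [a, b] ++ y).length = d) (hk : k < d) :
    listWord d (x ++ [a, b] ++ y) h ⟨k, hk⟩ = a := by
  subst hx
  simp [listWord]

lemma listWord_right {x y : List (Fin n)} {a b : Fin n} {k : ℕ} (hx : x.length = k)
    (h : (x ++ [a, b] ++ y).length = d) (hk : k + 1 < d) :
    listWord d (x ++ [a, b] ++ y) h ⟨k + 1, hk⟩ = b := by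
  subst hx
  simp [listWord]

lemma listWord_swap {x y : List (Fin n)} {a b : Fin n} {k : ℕ} (hx : x.length = k)
    (h : (x ++ [a, b] ++ y).length = d) (h' : (x ++ [b, a] ++ y).length = d) (hk : k + 1 < d) :
    listWord d (x ++ [b, a] ++ y) h' =
      Word.swap (listWord d (x ++ [a, b] ++ y) h : Word n d) k hk := by
  funext t
  obtain ⟨t, ht⟩ := t
  rcases eq_or_ne t k with rfl | h1
  · rw [Word.swap_left, listWord_left hx, listWord_right hx]
  rcases eq_or_ne t (k + 1) with rfl | h2
  · rw [Word.swap_right, listWord_left hx, listWord_right hx]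
  rw [Word.swap_of_ne _ _ _ _ ht h1 h2]
  simp only [listWord]
  grind

lemma listWord_proj {α : Type*} (p : α → Fin n) (x y : List α) (a b : α)
    (h : (x ++ [a, b] ++ y).length = d) :
    p ∘ listWord d (x ++ [a, b] ++ y) h =
      listWord d (x.map p ++ [p a, p b] ++ y.map p) (by simpa using h) := by
  have e : (x ++ [a, b] ++ y).map p = x.map p ++ [p a, p b] ++ y.map p := by simp
  rw [← listWord_map _ _ (by simpa using h), listWord_congr e]

/-- A function on words of length `D` as a function on lists. -/
def listExt {α : Type*} (D : ℕ) (φ : (Fin D → α) → K) (l : List α) : K :=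
  if hl : l.length = D then φ (listWord D l hl) else 0

lemma listExt_ofFn {α : Type*} {D : ℕ} (φ : (Fin D → α) → K) (w : Fin D → α) :
    listExt D φ (List.ofFn w) = φ w := by
  rw [listExt, dif_pos (List.length_ofFn), listWord_ofFn]

/-- The relations between the entries of a quantum matrix. -/
def matRel (q : Kˣ) (m n : ℕ) : Set (List (K × List (Fin m × Fin n))) :=
  {r | ∃ i k j l, r = [(1, [(i, l), (k, j)]), (-1, [(k, j), (i, l)]),
    (-(coef q i k - coef q j l), [(i, j), (k, l)])]}

lemma listExt_entry_mem (f : schur q n m d) :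
    listExt d (fun w => entry f.1 (Prod.fst ∘ w) (Prod.snd ∘ w)) ∈ relFun K (matRel q m n) := by
  rintro _ ⟨i, k, j, l, rfl⟩ x y
  have len : ∀ a b : Fin m × Fin n, (x ++ [a, b] ++ y).length = x.length + 2 + y.length := by
    intro a b; simp; omega
  by_cases hd : x.length + 2 + y.length = d
  swap
  · simp only [listExt, len, hd, dif_neg, List.map_cons, List.map_nil, List.sum_cons,
      List.sum_nil, mul_zero, add_zero, not_false_eq_true]
  have hk : x.length + 1 < d := by omega
  have e : ∀ a b : Fin m × Fin n,
      listExt d (fun w => entry f.1 (Prod.fst ∘ w) (Prod.snd ∘ w)) (x ++ [a, b] ++ y) =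
      entry f.1
        (listWord d (x.map Prod.fst ++ [a.1, b.1] ++ y.map Prod.fst) (by simp; omega))
        (listWord d (x.map Prod.snd ++ [a.2, b.2] ++ y.map Prod.snd) (by simp; omega)) := by
    intro a b
    rw [listExt, dif_pos ((len a b).trans hd), listWord_proj, listWord_proj]
  have key := (mem_schur_iff f.1).1 f.2 x.length hk
    (listWord d (x.map Prod.fst ++ [i, k] ++ y.map Prod.fst) (by simp; omega))
    (listWord d (x.map Prod.snd ++ [j, l] ++ y.map Prod.snd) (by simp; omega))
  rw [listWord_left (List.length_map _), listWord_left (List.length_map _),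
    listWord_right (List.length_map _), listWord_right (List.length_map _),
    ← listWord_swap (List.length_map _) _ (by simp; omega),
    ← listWord_swap (List.length_map _) _ (by simp; omega)] at key
  simp only [List.map_cons, List.map_nil, List.sum_cons, List.sum_nil, e]
  linear_combination key

lemma schur_swap_right (g : schur q n m d) (I : Word m d) (J : Word n d) (k : ℕ) (h : k + 1 < d)
    (hI : I ⟨k, by omega⟩ = I ⟨k + 1, h⟩) (hJ : J ⟨k, by omega⟩ < J ⟨k + 1, h⟩) :
    entry g.1 I (J.swap k h) = q * entry g.1 I J := by
  have key := (mem_schur_iff g.1).1 g.2 k h I J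
  rw [Word.swap_eq_self I k h hI, hI, coef_self, coef_lt q hJ] at key
  linear_combination key

lemma schur_swap_left (g : schur q n m d) (I : Word m d) (J : Word n d) (k : ℕ) (h : k + 1 < d)
    (hJ : J ⟨k, by omega⟩ = J ⟨k + 1, h⟩) (hI : I ⟨k, by omega⟩ < I ⟨k + 1, h⟩) :
    entry g.1 (I.swap k h) J = q * entry g.1 I J := by
  have key := (mem_schur_iff g.1).1 g.2 k h I J
  rw [Word.swap_eq_self J k h hJ, hJ, coef_self, coef_lt q hI] at key
  linear_combination -key

/-- The relations between the products of entries of two quantum matrices that occur in an entry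
of the product matrix. -/
def prodRel (q : Kˣ) (m r n : ℕ) : Set (List (K × List (Fin m × Fin r × Fin n))) :=
  {s | ∃ i k l j, k < l ∧
    s = [(1, [(i, l, j), (i, k, j)]), (-(q : K) ^ 2, [(i, k, j), (i, l, j)])]}

lemma listExt_prod_mem {r : ℕ} (f : schur q n r d) (g : schur q r m d) :
    listExt d (fun w : Fin d → Fin m × Fin r × Fin n =>
      entry g.1 ((fun a => a.1) ∘ w) ((fun a => a.2.1) ∘ w) *
        entry f.1 ((fun a => a.2.1) ∘ w) ((fun a => a.2.2) ∘ w)) ∈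
      relFun K (prodRel q m r n) := by
  rintro _ ⟨i, k, l, j, hkl, rfl⟩ x y
  have len : ∀ a b : Fin m × Fin r × Fin n,
      (x ++ [a, b] ++ y).length = x.length + 2 + y.length := by
    intro a b; simp; omega
  by_cases hd : x.length + 2 + y.length = d
  swap
  · simp only [listExt, len, hd, dif_neg, List.map_cons, List.map_nil, List.sum_cons,
      List.sum_nil, mul_zero, add_zero, not_false_eq_true]
  have hk : x.length + 1 < d := by omega
  have e : ∀ a b : Fin m × Fin r × Fin n,
      listExt d (fun w : Fin d → Fin m × Fin r × Fin n =>
        entry g.1 ((fun a => a.1) ∘ w) ((fun a => a.2.1) ∘ w) *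
          entry f.1 ((fun a => a.2.1) ∘ w) ((fun a => a.2.2) ∘ w)) (x ++ [a, b] ++ y) =
      entry g.1
        (listWord d (x.map (fun a => a.1) ++ [a.1, b.1] ++ y.map (fun a => a.1))
          (by simp; omega))
        (listWord d (x.map (fun a => a.2.1) ++ [a.2.1, b.2.1] ++ y.map (fun a => a.2.1))
          (by simp; omega)) *
      entry f.1
        (listWord d (x.map (fun a => a.2.1) ++ [a.2.1, b.2.1] ++ y.map (fun a => a.2.1))
          (by simp; omega))
        (listWord d (x.map (fun a => a.2.2) ++ [a.2.2, b.2.2] ++ y.map (fun a => a.2.2))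
          (by simp; omega)) := by
    intro a b
    rw [listExt, dif_pos ((len a b).trans hd), listWord_proj, listWord_proj, listWord_proj]
  simp only [List.map_cons, List.map_nil, List.sum_cons, List.sum_nil, e]
  rw [listWord_swap (List.length_map _) (a := k) (b := l) (by simp; omega) (by simp; omega) hk,
    schur_swap_right, schur_swap_left]
  · ring
  all_goals
    rw [listWord_left (List.length_map _), listWord_right (List.length_map _)]
    try exact hkl

/-- The word of length `d * ℓ` in which every letter of `w` is repeated `ℓ` times. -/
def Word.rep (ℓ : ℕ) (w : Word n d) : Word n (d * ℓ) := w ∘ Fin.divNat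

lemma Word.rep_injective {ℓ : ℕ} (h : 0 < ℓ) :
    Function.Injective (Word.rep ℓ : Word n d → Word n (d * ℓ)) := by
  intro v w e
  funext s
  have hs := s.2
  have h1 : s.1 * ℓ < d * ℓ := Nat.mul_lt_mul_of_pos_right hs h
  have h2 : Fin.divNat (⟨s.1 * ℓ, h1⟩ : Fin (d * ℓ)) = s := by
    ext
    rw [Fin.coe_divNat]
    exact Nat.mul_div_cancel _ h
  have h3 := congrFun e ⟨s.1 * ℓ, h1⟩
  simpa only [Word.rep, Function.comp, h2] using h3

/-- The linear map `V_n^{⊗ d} → V_m^{⊗ d}` whose matrix coefficients are those of `f` between the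
words in which every letter is repeated `ℓ` times. This is the dual of the Frobenius map
`x_{ij} ↦ x_{ij}^ℓ` between the coordinate rings of matrices and of quantum matrices. -/
def frobLin {ℓ : ℕ} (h : 0 < ℓ) :
    (Tens K n (d * ℓ) →ₗ[K] Tens K m (d * ℓ)) →ₗ[K] (Tens K n d →ₗ[K] Tens K m d) where
  toFun f := Finsupp.lcomapDomain (Word.rep ℓ) (Word.rep_injective h) ∘ₗ f ∘ₗ
    Finsupp.lmapDomain K K (Word.rep ℓ)
  map_add' _ _ := by ext; simp
  map_smul' _ _ := by ext; simp

lemma entry_frobLin {ℓ : ℕ} (h : 0 < ℓ) (f : Tens K n (d * ℓ) →ₗ[K] Tens K m (d * ℓ))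
    (I : Word m d) (J : Word n d) :
    entry (frobLin h f) I J = entry f (I.rep ℓ) (J.rep ℓ) := by
  simp [entry, frobLin, Finsupp.lcomapDomain]

lemma entry_ext {f g : Tens K n d →ₗ[K] Tens K m d} (h : ∀ I J, entry f I J = entry g I J) :
    f = g :=
  Finsupp.lhom_ext' fun J => LinearMap.ext_ring (Finsupp.ext fun I => h I J)

lemma entry_rep {ℓ : ℕ} (f : schur q n m (d * ℓ)) (I : Word m d) (J : Word n d) :
    entry f.1 (I.rep ℓ) (J.rep ℓ) =
      ((List.ofFn fun s => appendOp (matRel q m n) (I s, J s) ^ ℓ).prod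
        ⟨_, listExt_entry_mem f⟩).1 [] := by
  rw [← prod_ofFn_divNat (fun s => appendOp (matRel q m n) (I s, J s)),
    appendOp_prod_nil _ (fun t : Fin (d * ℓ) => (I t.divNat, J t.divNat))]
  dsimp only
  rw [listExt_ofFn]
  rfl

lemma entry_comp {r : ℕ} (f : Tens K n d →ₗ[K] Tens K r d) (g : Tens K r d →ₗ[K] Tens K m d)
    (I : Word m d) (J : Word n d) :
    entry (g ∘ₗ f) I J = ∑ L : Word r d, entry g I L * entry f L J := by
  have e : f (Finsupp.single J 1) = ∑ L : Word r d, entry f L J • Finsupp.single L (1 : K) := by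
    ext L
    simp [entry]
  rw [entry, LinearMap.comp_apply, e, map_sum, Finsupp.finsetSum_apply]
  refine Finset.sum_congr rfl fun L _ => ?_
  rw [map_smul, Finsupp.smul_apply, smul_eq_mul, mul_comm]
  rfl

lemma appendOp_matRel (i k : Fin m) (j l : Fin n) :
    appendOp (matRel q m n) (i, l) * appendOp (matRel q m n) (k, j) -
      appendOp (matRel q m n) (k, j) * appendOp (matRel q m n) (i, l) =
    (coef q i k - coef q j l) •
      (appendOp (matRel q m n) (i, j) * appendOp (matRel q m n) (k, l)) := by
  refine LinearMap.ext fun h => Subtype.ext (funext fun x => ?_)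
  have := h.2 _ ⟨i, k, j, l, rfl⟩ x []
  simp only [List.map_cons, List.map_nil, List.sum_cons, List.sum_nil, List.append_nil] at this
  change h.1 (x ++ [(i, l)] ++ [(k, j)]) - h.1 (x ++ [(k, j)] ++ [(i, l)]) =
    (coef q i k - coef q j l) * h.1 (x ++ [(i, j)] ++ [(k, l)])
  simp only [List.append_assoc, List.singleton_append]
  linear_combination this

lemma appendOp_prodRel {r : ℕ} (i : Fin m) (j : Fin n) {k l : Fin r} (h : k < l) :
    appendOp (prodRel q m r n) (i, l, j) * appendOp (prodRel q m r n) (i, k, j) =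
      (q : K) ^ 2 •
        (appendOp (prodRel q m r n) (i, k, j) * appendOp (prodRel q m r n) (i, l, j)) := by
  refine LinearMap.ext fun f => Subtype.ext (funext fun x => ?_)
  have := f.2 _ ⟨i, k, l, j, h, rfl⟩ x []
  simp only [List.map_cons, List.map_nil, List.sum_cons, List.sum_nil, List.append_nil] at this
  change f.1 (x ++ [(i, l, j)] ++ [(i, k, j)]) =
    (q : K) ^ 2 * f.1 (x ++ [(i, k, j)] ++ [(i, l, j)])
  simp only [List.append_assoc, List.singleton_append]
  linear_combination this

variable {ℓ : ℕ}

lemma frobLin_mem (h : IsOddRoot q ℓ) (f : schur q n m (d * ℓ)) :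
    frobLin (zero_lt_one.trans h.one_lt) f.1 ∈ schur (1 : Kˣ) n m d := by
  have c1 : ∀ {r : ℕ} (i j : Fin r), coef (1 : Kˣ) i j = (0 : K) := by
    intro r i j; simp [coef]
  refine (mem_schur_iff _).2 fun k hk I J => ?_
  rw [c1, c1, sub_zero, zero_mul, sub_eq_zero, entry_frobLin, entry_frobLin, entry_rep, entry_rep]
  set X : Fin d → Module.End K (relFun K (matRel q m n)) :=
    fun s => appendOp (matRel q m n) (I s, J.swap k hk s) ^ ℓ with hX
  set σ : Equiv.Perm (Fin d) := Equiv.swap ⟨k, by omega⟩ ⟨k + 1, hk⟩ with hσ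
  have e : (fun s => appendOp (matRel q m n) (I.swap k hk s, J s) ^ ℓ) = X ∘ σ := by
    funext s
    simp [hX, hσ, Word.swap]
  have e' : (List.ofFn X).prod = (List.ofFn (X ∘ σ)).prod :=
    (σ.ofFn_comp_perm X).symm.prod_eq' (List.pairwise_ofFn.2 fun _ _ _ =>
      commute_pow h (fun i j => appendOp (matRel q m n) (i, j)) appendOp_matRel _ _ _ _)
  rw [e, e']

lemma frobLin_id (h : 0 < ℓ) :
    frobLin h (LinearMap.id : Tens K n (d * ℓ) →ₗ[K] Tens K n (d * ℓ)) = LinearMap.id := by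
  classical
  refine entry_ext fun I J => ?_
  rw [entry_frobLin]
  simp [entry, Finsupp.single_apply, (Word.rep_injective (n := n) (d := d) h).eq_iff]

lemma sum_prod_rep {A : Type*} [Ring A] [Algebra K A] {r : ℕ} (Y : Fin d → Fin r → A)
    (hY : ∀ s, (∑ k, Y s k) ^ ℓ = ∑ k, Y s k ^ ℓ) :
    ∑ L : Word r (d * ℓ), (List.ofFn fun t => Y t.divNat (L t)).prod =
      ∑ L : Word r d, (List.ofFn fun s => Y s (L s) ^ ℓ).prod := by
  have e : ∀ {D : ℕ} (X : Fin D → Fin r → A), ∑ L : Word r D, (List.ofFn fun t => X t (L t)).prod =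
      (List.ofFn fun t => ∑ k, X t k).prod := fun X =>
    ((MultilinearMap.mkPiAlgebraFin K _ A).map_sum (fun t k => X t k)).symm
  rw [e (fun t k => Y t.divNat k), e (fun s k => Y s k ^ ℓ),
    prod_ofFn_divNat (fun s => ∑ k, Y s k)]
  simp only [hY]

lemma frobLin_comp (h : IsOddRoot q ℓ) {r : ℕ} (f : schur q n r (d * ℓ))
    (g : schur q r m (d * ℓ)) :
    frobLin (zero_lt_one.trans h.one_lt) (g.1 ∘ₗ f.1) =
      frobLin (zero_lt_one.trans h.one_lt) g.1 ∘ₗ frobLin (zero_lt_one.trans h.one_lt) f.1 := by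
  have hℓ := zero_lt_one.trans h.one_lt
  refine entry_ext fun I J => ?_
  rw [entry_frobLin, entry_comp, entry_comp]
  simp only [entry_frobLin]
  have e1 : ∀ L : Word r (d * ℓ), entry g.1 (I.rep ℓ) L * entry f.1 L (J.rep ℓ) =
      ((List.ofFn fun t : Fin (d * ℓ) => appendOp (prodRel q m r n)
        (I t.divNat, L t, J t.divNat)).prod ⟨_, listExt_prod_mem f g⟩).1 [] := by
    intro L
    rw [appendOp_prod_nil _ (fun t : Fin (d * ℓ) => (I t.divNat, L t, J t.divNat))]
    dsimp only
    rw [listExt_ofFn]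
    rfl
  have e2 : ∀ L : Word r d, entry g.1 (I.rep ℓ) (L.rep ℓ) * entry f.1 (L.rep ℓ) (J.rep ℓ) =
      ((List.ofFn fun s : Fin d => appendOp (prodRel q m r n)
        (I s, L s, J s) ^ ℓ).prod ⟨_, listExt_prod_mem f g⟩).1 [] := by
    intro L
    rw [e1, ← prod_ofFn_divNat (fun s => appendOp (prodRel q m r n) (I s, L s, J s))]
    rfl
  have e3 := sum_prod_rep (K := K) (ℓ := ℓ)
    (fun s k => appendOp (prodRel q m r n) (I s, k, J s)) fun s =>
    sum_pow_root h.primitive_sq hℓ _ fun k l hkl => appendOp_prodRel (I s) (J s) hkl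
  have e4 := congrArg (fun X => (X ⟨_, listExt_prod_mem f g⟩).1 []) e3
  simp only [LinearMap.sum_apply, AddSubmonoidClass.coe_finsetSum, Finset.sum_apply] at e4
  rw [Finset.sum_congr rfl fun L _ => e1 L, Finset.sum_congr rfl fun L _ => e2 L]
  exact e4

/-- The Hecke operator that moves the block of the `b` tensor factors in the positions `≥ p + a`
in front of the block of the `a` tensor factors in the positions `≥ p`. It is the braiding
`V^{⊗ a} ⊗ V^{⊗ b} → V^{⊗ b} ⊗ V^{⊗ a}` that is built from `R`. -/
def blockBraid (q : Kˣ) (p a : ℕ) : ℕ → Module.End K (Tens K n d)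
  | 0 => 1
  | b + 1 => down q (p + b) a * blockBraid q p a b

lemma down_comm_lt (q : Kˣ) (s a k : ℕ) (h : k + 1 < s) :
    down (n := n) (d := d) q s a * T q k = T q k * down q s a := by
  induction a with
  | zero => simp [down]
  | succ a ih => rw [down, mul_assoc, ← T_comm q k (s + a) (by omega), ← mul_assoc, ih, mul_assoc]

lemma down_comm_gt (q : Kˣ) (s a k : ℕ) (h : s + a < k) :
    down (n := n) (d := d) q s a * T q k = T q k * down q s a := by
  induction a with
  | zero => simp [down]
  | succ a ih =>
    rw [down, mul_assoc, T_comm q (s + a) k (by omega), ← mul_assoc, ih (by omega), mul_assoc]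

lemma down_slide (q : Kˣ) (s a k : ℕ) (h1 : s ≤ k) (h2 : k + 1 < s + a) (h3 : s + a < d) :
    down (n := n) (d := d) q s a * T q k = T q (k + 1) * down q s a := by
  induction a with
  | zero => omega
  | succ a ih =>
    rcases Nat.lt_or_ge (k + 1) (s + a) with h | h
    · rw [down, mul_assoc, ← T_comm q k (s + a) h, ← mul_assoc, ih h (by omega), mul_assoc]
    · obtain ⟨a, rfl⟩ : ∃ c, a = c + 1 := ⟨a - 1, by omega⟩
      obtain rfl : k = s + a := by omega
      rw [down, down, ← add_assoc, mul_assoc, mul_assoc, ← mul_assoc (T q (s + a)),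
        T_braid q (s + a) (by omega), mul_assoc, ← mul_assoc, down_comm_gt q s a _ (by omega)]
      simp only [mul_assoc]

lemma down_down (q : Kˣ) (s a : ℕ) (h : s + 1 + a < d) :
    down (n := n) (d := d) q (s + 1) a * down q s a * T q (s + a) =
      T q s * (down q (s + 1) a * down q s a) := by
  induction a with
  | zero => simp [down]
  | succ a ih =>
    have ih := ih (by omega)
    have c := down_comm_gt (n := n) (d := d) q s a (s + a + 1) (by omega)
    have b := T_braid (n := n) (d := d) q (s + a) (by omega)
    rw [down, down, ← add_assoc, show s + 1 + a = s + a + 1 by omega]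
    calc down q (s + 1) a * T q (s + a + 1) * (down q s a * T q (s + a)) * T q (s + a + 1)
        = down q (s + 1) a * (T q (s + a + 1) * down q s a) * T q (s + a) * T q (s + a + 1) := by
          simp only [mul_assoc]
      _ = down q (s + 1) a * down q s a * (T q (s + a + 1) * T q (s + a) * T q (s + a + 1)) := by
          rw [← c]; simp only [mul_assoc]
      _ = (down q (s + 1) a * down q s a * T q (s + a)) * T q (s + a + 1) * T q (s + a) := by
          rw [← b]; simp only [mul_assoc]
      _ = T q s * (down q (s + 1) a * (down q s a * T q (s + a + 1)) * T q (s + a)) := by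
          rw [ih]; simp only [mul_assoc]
      _ = _ := by rw [c]; simp only [mul_assoc]

lemma blockBraid_comm_lt (q : Kˣ) (p a b k : ℕ) (h : k + 1 < p) :
    blockBraid (n := n) (d := d) q p a b * T q k = T q k * blockBraid q p a b := by
  induction b with
  | zero => simp [blockBraid]
  | succ b ih =>
    rw [blockBraid, mul_assoc, ih, ← mul_assoc, down_comm_lt q _ _ _ (by omega), mul_assoc]

lemma blockBraid_comm_ge (q : Kˣ) (p a b k : ℕ) (h : p + a + b ≤ k) :
    blockBraid (n := n) (d := d) q p a b * T q k = T q k * blockBraid q p a b := by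
  induction b with
  | zero => simp [blockBraid]
  | succ b ih =>
    rw [blockBraid, mul_assoc, ih (by omega), ← mul_assoc, down_comm_gt q _ _ _ (by omega),
      mul_assoc]

lemma blockBraid_slide_left (q : Kˣ) (p a b k : ℕ) (h1 : p ≤ k) (h2 : k + 1 < p + a)
    (h3 : p + a + b ≤ d) :
    blockBraid (n := n) (d := d) q p a b * T q k = T q (k + b) * blockBraid q p a b := by
  induction b with
  | zero => simp [blockBraid]
  | succ b ih =>
    rw [blockBraid, mul_assoc, ih (by omega), ← mul_assoc,
      down_slide q _ _ _ (by omega) (by omega) (by omega), mul_assoc, add_assoc]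

lemma blockBraid_slide_right (q : Kˣ) (p a b k : ℕ) (h1 : k + 1 < b) (h3 : p + a + b ≤ d) :
    blockBraid (n := n) (d := d) q p a b * T q (p + a + k) = T q (p + k) * blockBraid q p a b := by
  induction b with
  | zero => omega
  | succ b ih =>
    rcases Nat.lt_or_ge (k + 1) b with h | h
    · rw [blockBraid, mul_assoc, ih h (by omega), ← mul_assoc, down_comm_lt q _ _ _ (by omega),
        mul_assoc]
    · obtain rfl : b = k + 1 := by omega
      rw [blockBraid, blockBraid, mul_assoc, mul_assoc,
        blockBraid_comm_ge q p a k _ (by omega), ← mul_assoc, ← mul_assoc,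
        show p + a + k = p + k + a by omega, ← add_assoc, down_down q _ _ (by omega)]
      simp only [mul_assoc]

section Product

variable {e D : ℕ}

/-- The concatenation of two words. -/
def Word.concat (h : d + e = D) (u : Word n d) (v : Word n e) : Word n D :=
  fun t => Fin.append u v (t.cast h.symm)

/-- The concatenation `V_n^{⊗ d} ⊗ V_n^{⊗ e} → V_n^{⊗ (d + e)}` of tensors. -/
def concat (h : d + e = D) : Tens K n d →ₗ[K] Tens K n e →ₗ[K] Tens K n D :=
  Finsupp.linearCombination K fun u => Finsupp.lmapDomain K K (Word.concat h u)

lemma concat_single (h : d + e = D) (u : Word n d) (v : Word n e) :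
    concat h (Finsupp.single u (1 : K)) (Finsupp.single v 1) =
      Finsupp.single (Word.concat h u v) 1 := by
  simp [concat]

lemma Word.concat_left (h : d + e = D) (u : Word n d) (v : Word n e) (k : ℕ) (hk : k < d) :
    Word.concat h u v ⟨k, by omega⟩ = u ⟨k, hk⟩ :=
  Fin.append_left u v ⟨k, hk⟩

lemma Word.concat_right (h : d + e = D) (u : Word n d) (v : Word n e) (k : ℕ) (hk : k < e) :
    Word.concat h u v ⟨d + k, by omega⟩ = v ⟨k, hk⟩ :=
  Fin.append_right u v ⟨k, hk⟩

lemma Word.concat_swap_left (h : d + e = D) (u : Word n d) (v : Word n e) (k : ℕ)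
    (hk : k + 1 < d) :
    Word.concat h (u.swap k hk) v = (Word.concat h u v).swap k (by omega) := by
  funext ⟨t, ht⟩
  rcases eq_or_ne t k with rfl | h1
  · rw [Word.swap_left, concat_left h _ _ _ (by omega), Word.swap_left, concat_left]
  rcases eq_or_ne t (k + 1) with rfl | h2
  · rw [Word.swap_right, concat_left h _ _ _ (by omega), Word.swap_right, concat_left]
  rw [Word.swap_of_ne _ _ _ _ _ h1 h2]
  rcases Nat.lt_or_ge t d with h3 | h3
  · rw [concat_left h _ _ _ h3, concat_left h _ _ _ h3, Word.swap_of_ne _ _ _ _ _ h1 h2]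
  · obtain ⟨t, rfl⟩ := Nat.exists_eq_add_of_le h3
    rw [concat_right h _ _ t (by omega), concat_right h _ _ t (by omega)]

lemma Word.concat_swap_right (h : d + e = D) (u : Word n d) (v : Word n e) (k : ℕ)
    (hk : k + 1 < e) :
    Word.concat h u (v.swap k hk) = (Word.concat h u v).swap (d + k) (by omega) := by
  funext ⟨t, ht⟩
  rcases eq_or_ne t (d + k) with rfl | h1
  · rw [Word.swap_left, concat_right h _ _ _ (by omega), Word.swap_left]
    exact (concat_right h u v (k + 1) hk).symm
  rcases eq_or_ne t (d + k + 1) with rfl | h2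
  · rw [Word.swap_right, concat_right h _ _ k (by omega)]
    exact (concat_right h u (v.swap k hk) (k + 1) hk).trans (Word.swap_right _ _ _)
  rw [Word.swap_of_ne _ _ _ _ _ h1 h2]
  rcases Nat.lt_or_ge t d with h3 | h3
  · rw [concat_left h _ _ _ h3, concat_left h _ _ _ h3]
  · obtain ⟨t, rfl⟩ := Nat.exists_eq_add_of_le h3
    rw [concat_right h _ _ t (by omega), concat_right h _ _ t (by omega),
      Word.swap_of_ne _ _ _ _ _ (by omega) (by omega)]

lemma concat_T_left (q : Kˣ) (h : d + e = D) (k : ℕ) (hk : k + 1 < d) (x : Tens K n d)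
    (y : Tens K n e) : concat h (T q k x) y = T q k (concat h x y) := by
  suffices H : (concat h).comp (T q k) = (concat (K := K) (n := n) h).compr₂ (T q k) from
    LinearMap.congr_fun (LinearMap.congr_fun H x) y
  refine Finsupp.lhom_ext' fun u => LinearMap.ext_ring (Finsupp.lhom_ext' fun v =>
    LinearMap.ext_ring ?_)
  simp only [LinearMap.comp_apply, LinearMap.compr₂_apply, Finsupp.lsingle_apply]
  rw [T_single q k hk, concat_single, T_single q k (by omega), map_add, map_smul,
    LinearMap.add_apply, LinearMap.smul_apply, concat_single, concat_single,
    Word.concat_swap_left, Word.concat_left, Word.concat_left]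

lemma concat_T_right (q : Kˣ) (h : d + e = D) (k : ℕ) (hk : k + 1 < e) (x : Tens K n d)
    (y : Tens K n e) : concat h x (T q k y) = T q (d + k) (concat h x y) := by
  suffices H : (concat h).compl₂ (T q k) = (concat (K := K) (n := n) h).compr₂ (T q (d + k)) from
    LinearMap.congr_fun (LinearMap.congr_fun H x) y
  refine Finsupp.lhom_ext' fun u => LinearMap.ext_ring (Finsupp.lhom_ext' fun v =>
    LinearMap.ext_ring ?_)
  simp only [LinearMap.comp_apply, LinearMap.compr₂_apply, LinearMap.compl₂_apply,
    Finsupp.lsingle_apply]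
  have e : Word.concat h u v ⟨d + k + 1, by omega⟩ = v ⟨k + 1, hk⟩ :=
    Word.concat_right h u v (k + 1) hk
  rw [T_single q k hk, concat_single, T_single q (d + k) (by omega), map_add, map_smul,
    concat_single, concat_single, Word.concat_swap_right, Word.concat_right h u v k (by omega), e]

/-- The operator on tensors that induces the product `Ω^i_d ⊗ Ω^j_e → Ω^{i+j}_{d+e}`: the factors
`Λ^i` and `S^{e-j}` are interchanged by the braiding and then the products of `S` and of `Λ` are
formed. -/
def mulTens (q : Kˣ) (n : ℕ) (h : d + e = D) (i j : ℕ) :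
    Tens K n d →ₗ[K] Tens K n e →ₗ[K] Tens K n D :=
  if i ≤ d ∧ j ≤ e then (concat h).compr₂ (blockBraid q (d - i) i (e - j)) else 0

lemma mulTens_left (q : Kˣ) (h : d + e = D) (i j : ℕ) (y : Tens K n e) :
    rel q n d i ≤ (rel q n D (i + j)).comap ((mulTens q n h i j).flip y) := by
  unfold mulTens
  split_ifs with hij
  swap
  · exact fun _ _ => zero_mem (rel q n D (i + j))
  obtain ⟨hi, hj⟩ := hij
  refine rel_le q hi (fun k hk x => ?_) (fun k hk hk' x hx => ?_)
  · have c := LinearMap.congr_fun (blockBraid_comm_lt (n := n) (d := D) q (d - i) i (e - j) k hk)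
      (concat h x y)
    simp only [Module.End.mul_apply] at c
    rw [Submodule.mem_comap, map_sub, map_smul]
    simp only [LinearMap.flip_apply, LinearMap.compr₂_apply]
    rw [concat_T_left q h k (by omega), c]
    exact sym_mem_rel q (by omega) _
  · have c := LinearMap.congr_fun (blockBraid_slide_left (n := n) (d := D) q (d - i) i (e - j) k hk
      (by omega) (by omega)) (concat h x y)
    simp only [Module.End.mul_apply] at c
    rw [Submodule.mem_comap]
    refine ext_mem_rel q (k := k + (e - j)) (by omega) (by omega) ?_
    simp only [LinearMap.flip_apply, LinearMap.compr₂_apply]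
    rw [← c, ← concat_T_left q h k (by omega), hx, map_smul, LinearMap.smul_apply, map_smul]

lemma mulTens_right (q : Kˣ) (h : d + e = D) (i j : ℕ) (x : Tens K n d) :
    rel q n e j ≤ (rel q n D (i + j)).comap (mulTens q n h i j x) := by
  unfold mulTens
  split_ifs with hij
  swap
  · exact fun _ _ => zero_mem (rel q n D (i + j))
  obtain ⟨hi, hj⟩ := hij
  refine rel_le q hj (fun k hk y => ?_) (fun k hk hk' y hy => ?_)
  · have c := LinearMap.congr_fun (blockBraid_slide_right (n := n) (d := D) q (d - i) i (e - j) k hk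
      (by omega)) (concat h x y)
    simp only [Module.End.mul_apply] at c
    rw [Nat.sub_add_cancel hi] at c
    rw [Submodule.mem_comap, map_sub, map_smul]
    simp only [LinearMap.compr₂_apply]
    rw [concat_T_right q h k (by omega), c]
    exact sym_mem_rel q (by omega) _
  · have c := LinearMap.congr_fun (blockBraid_comm_ge (n := n) (d := D) q (d - i) i (e - j) (d + k)
      (by omega)) (concat h x y)
    simp only [Module.End.mul_apply] at c
    rw [Submodule.mem_comap]
    refine ext_mem_rel q (k := d + k) (by omega) (by omega) ?_
    simp only [LinearMap.compr₂_apply]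
    rw [← c, ← concat_T_right q h k (by omega), hy, map_smul, map_smul]

/-- The product `Ω^i_d(n) × Ω^j_e(n) → Ω^{i+j}_D(n)`, where `D = d + e`. -/
def Omega.mul (q : Kˣ) {n : ℕ} (hn : 0 < n) (h : d + e = D) (i j : ℕ) :
    (Omega q d i).at' ⟨n, hn⟩ →ₗ[K] (Omega q e j).at' ⟨n, hn⟩ →ₗ[K]
      (Omega q D (i + j)).at' ⟨n, hn⟩ :=
  ((rel q n e j).liftQ ((rel q n d i).liftQ
      ((mulTens q n h i j).compr₂ (Omega.mk q D (i + j) ⟨n, hn⟩)) (fun x hx => by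
        refine LinearMap.ext fun y => (Omega.mk_eq_zero _ _ _ _ _).2 ?_
        exact mulTens_left q h i j y hx)).flip (fun y hy => by
    refine LinearMap.ext fun x => ?_
    obtain ⟨x, rfl⟩ := Omega.mk_surjective q d i ⟨n, hn⟩ x
    exact (Omega.mk_eq_zero _ _ _ _ _).2 (mulTens_right q h i j x hy))).flip

lemma Omega.mul_mk (hn : 0 < n) (h : d + e = D) (i j : ℕ) (x : Tens K n d) (y : Tens K n e) :
    Omega.mul q hn h i j (Omega.mk q d i ⟨n, hn⟩ x) (Omega.mk q e j ⟨n, hn⟩ y) =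
      Omega.mk q D (i + j) ⟨n, hn⟩ (mulTens q n h i j x y) := rfl

end Product

section Frobenius

variable {ℓ : ℕ}

/-- The quantum Frobenius functor `Γ_q^{dℓ} V ⥤ Γ^d V`. It is the identity on dimensions. -/
def frob (h : IsOddRoot q ℓ) (d : ℕ) : Source q (d * ℓ) ⥤ Source (1 : Kˣ) d where
  obj A := ⟨A.dim, A.pos⟩
  map f := ⟨frobLin (zero_lt_one.trans h.one_lt) f.1, frobLin_mem h f⟩
  map_id _ := Subtype.ext (frobLin_id _)
  map_comp f g := Subtype.ext (frobLin_comp h f g)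

/-- The Frobenius twist of a natural transformation or of a functor: strict polynomial functors of
degree `d` are composed with the quantum Frobenius functor. -/
def twist (h : IsOddRoot q ℓ) (d : ℕ) : QFun (1 : Kˣ) d ⥤ QFun q (d * ℓ) where
  obj F := ofData (fun A => F.at' ((frob h d).obj A)) (fun f => F.lmap ((frob h d).map f))
    (fun A x => by rw [(frob h d).map_id]; exact F.lmap_id _ _)
    (fun f g x => by rw [(frob h d).map_comp]; exact F.lmap_comp _ _ _)
    (fun f g x => by
      rw [← F.lmap_add]
      exact congrArg (fun f => F.lmap f x) (Subtype.ext (map_add (frobLin _) f.1 g.1)))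
    (fun r f x => by
      rw [← F.lmap_smul]
      exact congrArg (fun f => F.lmap f x) (Subtype.ext (map_smul (frobLin _) r f.1)))
  map φ := homMk (fun A => app φ ((frob h d).obj A)) (fun f x => app_lmap φ _ x)

/-- The conditions that determine the Cartier isomorphisms
`Ω_d^{i (1)} ≅ H^i(Ω_{dℓ})`: the sum over `d` and `i` of their components at `n` is multiplicative
and unital, and it maps the generators `e_k ⊗ 1` and `1 ⊗ e_k` of the algebra `S(V_n) ⊗ Λ(V_n)` to
the classes of `e_k ^ ℓ ⊗ 1` and of `e_k ^ (ℓ - 1) ⊗ e_k`. -/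
structure IsCartier (h : IsOddRoot q ℓ)
    (c : ∀ d i, (twist h d).obj (Omega 1 d i) ≅ (deRham q (d * ℓ)).cohomology i) : Prop where
  /-- `1 ↦ [1]` -/
  one : ∀ (n : ℕ) (hn : 0 < n) (w : Word n 0) (w' : Word n (0 * ℓ)),
    ∃ hz : app ((deRham q (0 * ℓ)).δ 0) ⟨n, hn⟩
        (Omega.mk q (0 * ℓ) 0 ⟨n, hn⟩ (Finsupp.single w' 1)) = 0,
      app (c 0 0).hom ⟨n, hn⟩ (Omega.mk 1 0 0 ⟨n, hn⟩ (Finsupp.single w 1)) =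
        (deRham q (0 * ℓ)).cls _ hz
  /-- `e_k ⊗ 1 ↦ [e_k ^ ℓ ⊗ 1]` -/
  sym_gen : ∀ (n : ℕ) (hn : 0 < n) (k : Fin n),
    ∃ hz : app ((deRham q (1 * ℓ)).δ 0) ⟨n, hn⟩
        (Omega.mk q (1 * ℓ) 0 ⟨n, hn⟩ (Finsupp.single (fun _ => k) 1)) = 0,
      app (c 1 0).hom ⟨n, hn⟩ (Omega.mk 1 1 0 ⟨n, hn⟩ (Finsupp.single (fun _ => k) 1)) =
        (deRham q (1 * ℓ)).cls _ hz
  /-- `1 ⊗ e_k ↦ [e_k ^ (ℓ - 1) ⊗ e_k]` -/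
  ext_gen : ∀ (n : ℕ) (hn : 0 < n) (k : Fin n),
    ∃ hz : app ((deRham q (1 * ℓ)).δ 1) ⟨n, hn⟩
        (Omega.mk q (1 * ℓ) 1 ⟨n, hn⟩ (Finsupp.single (fun _ => k) 1)) = 0,
      app (c 1 1).hom ⟨n, hn⟩ (Omega.mk 1 1 1 ⟨n, hn⟩ (Finsupp.single (fun _ => k) 1)) =
        (deRham q (1 * ℓ)).cls _ hz
  /-- If `x ↦ [z]` and `y ↦ [w]` then `x y ↦ [z w]`. -/
  mul : ∀ (n : ℕ) (hn : 0 < n) (d e i j : ℕ)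
    (x : (Omega (1 : Kˣ) d i).at' ⟨n, hn⟩) (y : (Omega (1 : Kˣ) e j).at' ⟨n, hn⟩)
    (z : (Omega q (d * ℓ) i).at' ⟨n, hn⟩) (w : (Omega q (e * ℓ) j).at' ⟨n, hn⟩)
    (hz : app ((deRham q (d * ℓ)).δ i) ⟨n, hn⟩ z = 0)
    (hw : app ((deRham q (e * ℓ)).δ j) ⟨n, hn⟩ w = 0),
    app (c d i).hom ⟨n, hn⟩ x = (deRham q (d * ℓ)).cls z hz →
    app (c e j).hom ⟨n, hn⟩ y = (deRham q (e * ℓ)).cls w hw →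
    ∃ hzw : app ((deRham q ((d + e) * ℓ)).δ (i + j)) ⟨n, hn⟩
        (Omega.mul q hn (add_mul d e ℓ).symm i j z w) = 0,
      app (c (d + e) (i + j)).hom ⟨n, hn⟩ (Omega.mul (1 : Kˣ) hn rfl i j x y) =
        (deRham q ((d + e) * ℓ)).cls _ hzw

end Frobenius

end

end QPF

open QPF

/-! The forms of all bidegrees in `n` variables make up one algebra `Form q n`, generated by `X j =
e_j ⊗ 1` and `Y j = 1 ⊗ e_j`. Each `Ω^i_d(n)` embeds in it by evaluating a word with `d - i` letters
`X` followed by `i` letters `Y`. Faithfulness comes from a Fock representation: left multiplications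
by letters on the product of all `Ω^i_d(n)` satisfy the relations of `Form` (`fock_braided`), and
acting on the vacuum recovers the tensor (`part_ev`). In this algebra both differentials are twisted
derivations (`dR_ev`, `kz_ev`), obtained from a map of `Form` to triangular `2 × 2` matrices.
Ordered monomials form a basis (`genF_injective`, `genF_surjective`), and on it the differentials
are sums of operators `D_j` and `κ_j` that change the state of a single letter `j`.

The cohomology is computed on monomials. The multiplicity of each letter, counted in the symmetric
and the exterior part together, is preserved by both differentials. For one letter `j`, the twisted
anticommutator `q⁻² d κ_j + κ_j d` is diagonal. Its eigenvalue is a power of `q` times the quantum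
integer of the multiplicity of `j` with respect to `q²`, so it is invertible exactly where `ℓ` does
not divide that multiplicity. Inverting it at the first such letter gives a homotopy `hM` between
the identity and the projection `pM` to the monomials with all multiplicities divisible by `ℓ`
(`homotopy`). On the image of `pM` the differential vanishes (`dM_pM`). These monomials are the
ordered products of the elements `X j ^ ℓ` and `X j ^ (ℓ - 1) * Y j`, which satisfy the relations of
classical forms (`Braided.frobenius`). Evaluating classical forms at them is the Cartier map `carF`.
It is multiplicative by construction and bijective onto cohomology (`eq_zero_of_carF_eq_dR`,
`exists_carF`).

Naturality holds only up to coboundaries. An `H_d`-linear map `g` is a contraction of the coaction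
`X j ↦ ∑ a, X a ⊗ t a j` of a quantum matrix `t` (`formMap_ev`). Since `q²` is a primitive `ℓ`-th
root of unity, the `ℓ`-th power of this sum is the sum of the `ℓ`-th powers. The element `X j ^ (ℓ -
1) * Y j` is sent to the corresponding sum plus an explicit coboundary, a divided form of the mixed
terms of the `ℓ`-th power (`TwistedDer.add_pow_mul_mem`). The powers `t a j ^ ℓ` are the matrix of
the Frobenius map, so the Cartier map is natural in cohomology (`formMap_carF_sub_mem`).

For the Koszul kernels, `hM` anticommutes with the Koszul differential up to `q²` (`kM_hM`), so the
homotopy stays inside `N`. The Cartier map intertwines the classical and the quantum Koszul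
differentials up to nonzero scalars (`kz_carF`), so it restricts to the kernels on both sides. In
classical degree `1` the kernel is the identity functor for `i = 0` and zero for `i > 0`, which
gives the second assertion. -/

namespace QPF

noncomputable section

/-! ### Evaluation of tensors in algebras with symmetric and exterior letters. -/

section Evaluation

variable {K : Type u} [Field K] {n d e D : ℕ} {A : Type*} [Ring A] [Algebra K A]

/-- Relations of the quantum symmetric algebra for `X` and of the quantum exterior algebra for
`Y`. -/
structure SymExt (r : Kˣ) (X Y : Fin n → A) : Prop where
  -- This is the vanishing of `T - r` on `e_i ⊗ e_j`. It is a tautology for `i = j`, and the cases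
  -- `i < j` and `j < i` are equivalent.
  sym : ∀ i j, coef r i j • (X i * X j) + X j * X i = (r : K) • (X i * X j)
  ext_self : ∀ i, Y i * Y i = 0
  ext : ∀ i j, i < j → Y i * Y j + (r : K) • (Y j * Y i) = 0

/-- Relations of the algebra of quantum differential forms. -/
structure Braided (r : Kˣ) (X Y : Fin n → A) : Prop extends SymExt r X Y where
  braid : ∀ i j, Y i * X j = coef r i j • (X i * Y j) + X j * Y i

/-- The value of a tensor, the letters in position `t` being evaluated by `L t`. -/
def evT (L : ℕ → Fin n → A) (d : ℕ) : Tens K n d →ₗ[K] A :=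
  Finsupp.linearCombination K fun w => (List.ofFn fun t : Fin d => L t (w t)).prod

lemma evT_single (L : ℕ → Fin n → A) (w : Word n d) :
    evT L d (Finsupp.single w (1 : K)) = (List.ofFn fun t : Fin d => L t (w t)).prod := by
  simp [evT]

/-- The outer factors depend only on the values away from `k` and `k + 1`. One pair `a, b` therefore
serves every `G`, and a relation between two neighbouring letters can be substituted in a long
product. -/
lemma prod_ofFn_pair {M : Type*} [Monoid M] (F : Fin d → M) (k : ℕ) (h : k + 1 < d) :
    ∃ a b, ∀ G : Fin d → M, (∀ t : Fin d, t.1 ≠ k → t.1 ≠ k + 1 → G t = F t) →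
      (List.ofFn G).prod = a * (G ⟨k, by omega⟩ * G ⟨k + 1, h⟩) * b := by
  induction k generalizing d with
  | zero =>
    obtain ⟨d, rfl⟩ : ∃ c, d = c + 2 := ⟨d - 2, by omega⟩
    refine ⟨1, (List.ofFn fun t : Fin d => F t.succ.succ).prod, fun G hG => ?_⟩
    rw [List.ofFn_succ, List.ofFn_succ, List.prod_cons, List.prod_cons, one_mul, mul_assoc]
    have : (fun t : Fin d => G t.succ.succ) = fun t => F t.succ.succ :=
      funext fun t => hG _ (by simp) (by simp)
    rw [this]
    rfl
  | succ k ih =>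
    obtain ⟨d, rfl⟩ : ∃ c, d = c + 1 := ⟨d - 1, by omega⟩
    obtain ⟨a, b, hab⟩ := ih (fun t => F t.succ) (by omega)
    refine ⟨F 0 * a, b, fun G hG => ?_⟩
    rw [List.ofFn_succ, List.prod_cons, hab (fun t => G t.succ) fun t h1 h2 =>
      hG _ (by simpa using h1) (by simpa using h2), hG 0 (by simp) (by simp)]
    simp only [mul_assoc]
    rfl

/-- Factorization of the values of words at two neighbouring positions. -/
lemma evT_pair (L : ℕ → Fin n → A) (k : ℕ) (h : k + 1 < d) (w : Word n d) :
    ∃ a b : A, ∀ (L' : ℕ → Fin n → A), (∀ t, t ≠ k → t ≠ k + 1 → L' t = L t) →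
      evT L' d (Finsupp.single w (1 : K)) =
        a * (L' k (w ⟨k, by omega⟩) * L' (k + 1) (w ⟨k + 1, h⟩)) * b ∧
      evT L' d (Finsupp.single (w.swap k h) (1 : K)) =
        a * (L' k (w ⟨k + 1, h⟩) * L' (k + 1) (w ⟨k, by omega⟩)) * b := by
  obtain ⟨a, b, hab⟩ := prod_ofFn_pair (fun t : Fin d => L t (w t)) k h
  refine ⟨a, b, fun L' hL => ⟨?_, ?_⟩⟩
  · rw [evT_single, hab _ fun t h1 h2 => by rw [hL _ h1 h2]]
  · rw [evT_single, hab _ fun t h1 h2 => by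
      rw [hL _ h1 h2, Word.swap_of_ne w k h t.1 t.2 h1 h2]]
    rw [Word.swap_left, Word.swap_right]

/-- `T` rewrites only the letters in positions `k` and `k + 1`, so a relation between products of
two letters suffices. With `L' = L` and `c = r` it gives the symmetric relations. With patterns that
differ by exchanging `X` and `Y`, and `c = 1`, it gives the braiding. -/
lemma evT_T (r : Kˣ) (L L' : ℕ → Fin n → A) (k : ℕ) (h : k + 1 < d)
    (hL : ∀ t, t ≠ k → t ≠ k + 1 → L' t = L t) (c : K)
    (hk : ∀ i j, coef r i j • (L' k i * L' (k + 1) j) + L' k j * L' (k + 1) i =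
      c • (L k i * L (k + 1) j)) (y : Tens K n d) :
    evT L' d (T r k y) = c • evT L d y := by
  suffices H : evT L' d ∘ₗ T r k = c • evT (K := K) L d from LinearMap.congr_fun H y
  refine Finsupp.lhom_ext' fun w => LinearMap.ext_ring ?_
  simp only [LinearMap.comp_apply, Finsupp.lsingle_apply, LinearMap.smul_apply]
  obtain ⟨a, b, hab⟩ := evT_pair (K := K) L k h w
  obtain ⟨h1, h2⟩ := hab L' hL
  rw [T_single r k h, map_add, map_smul, h1, h2, (hab L fun _ _ _ => rfl).1, ← smul_mul_assoc,
    ← mul_smul_comm, ← add_mul, ← mul_add, hk, mul_smul_comm, smul_mul_assoc]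

/-- The coefficients of an eigenvector satisfy `y (w.swap) = r * y w` whenever `w` increases at `k`,
so the values of `w` and of its swap cancel in pairs. -/
lemma evT_ker (r : Kˣ) (L : ℕ → Fin n → A) (k : ℕ) (h : k + 1 < d)
    (h0 : ∀ i, L k i * L (k + 1) i = 0)
    (h1 : ∀ i j, i < j → L k i * L (k + 1) j + (r : K) • (L k j * L (k + 1) i) = 0)
    {y : Tens K n d} (hy : T r k y = (r : K) • y) : evT L d y = 0 := by
  have hr : (r : K) ≠ 0 := r.ne_zero
  have e : ∀ w : Word n d, w ⟨k, by omega⟩ < w ⟨k + 1, h⟩ → y (w.swap k h) = r * y w := by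
    intro w hw
    have := DFunLike.congr_fun hy w
    rw [T_apply r k h, coef_lt r hw] at this
    simpa using this
  have key : ∀ w : Word n d, w ⟨k, by omega⟩ < w ⟨k + 1, h⟩ →
      y w • evT L d (Finsupp.single w (1 : K)) +
        y (w.swap k h) • evT L d (Finsupp.single (w.swap k h) (1 : K)) = 0 := by
    intro w hw
    obtain ⟨a, b, hab⟩ := evT_pair (K := K) L k h w
    obtain ⟨e1, e2⟩ := hab L fun _ _ _ => rfl
    have h1 := h1 _ _ hw
    rw [e1, e2, e w hw, mul_comm (r : K), mul_smul, ← smul_add, ← smul_mul_assoc, ← mul_smul_comm,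
      ← add_mul, ← mul_add, h1, mul_zero, zero_mul, smul_zero]
  have hsum : evT L d y = ∑ w : Word n d, y w • evT L d (Finsupp.single w (1 : K)) := by
    simp only [evT_single]
    rw [evT, Finsupp.linearCombination_apply]
    exact Finsupp.sum_fintype _ _ fun _ => zero_smul _ _
  rw [hsum]
  -- The words fixed by the swap have equal letters at `k` and `k + 1`; they contribute zero by
  -- `h0`.
  refine Finset.sum_involution (fun w _ => w.swap k h) ?_ ?_ (fun _ _ => Finset.mem_univ _)
    (fun w _ => Word.swap_swap w k h)
  · intro w _
    rcases lt_trichotomy (w ⟨k, by omega⟩) (w ⟨k + 1, h⟩) with hw | hw | hw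
    · exact key w hw
    · obtain ⟨a, b, hab⟩ := evT_pair (K := K) L k h w
      rw [Word.swap_eq_self w k h hw, (hab L fun _ _ _ => rfl).1, hw, h0]
      simp
    · have := key (w.swap k h) (by rwa [Word.swap_left, Word.swap_right])
      rwa [Word.swap_swap, add_comm] at this
  · intro w _ hw e
    apply hw
    obtain ⟨a, b, hab⟩ := evT_pair (K := K) L k h w
    have e' := congrFun e ⟨k, by omega⟩
    rw [Word.swap_left] at e'
    rw [(hab L fun _ _ _ => rfl).1, ← e', h0]
    simp

/-- The pattern of letters with `m` letters `X` followed by letters `Y`. -/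
def letters (X Y : Fin n → A) (m : ℕ) : ℕ → Fin n → A := fun t => if t < m then X else Y

/-- Evaluation of a tensor representing an element of `S^{d - i} ⊗ Λ^i`. -/
def ev (X Y : Fin n → A) (d i : ℕ) : Tens K n d →ₗ[K] A :=
  if i ≤ d then evT (letters X Y (d - i)) d else 0

lemma ev_of_le (X Y : Fin n → A) {d i : ℕ} (h : i ≤ d) :
    ev (K := K) X Y d i = evT (letters X Y (d - i)) d := if_pos h

variable {r : Kˣ} {X Y : Fin n → A}

lemma SymExt.rel_le_ker (h : SymExt r X Y) (d i : ℕ) :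
    rel r n d i ≤ LinearMap.ker (ev (K := K) X Y d i) := by
  rcases Nat.lt_or_ge d i with hi | hi
  · rw [ev, if_neg (by omega), LinearMap.ker_zero]; exact le_top
  rw [ev_of_le _ _ hi]
  refine rel_le r hi (fun k hk y => ?_) (fun k hk hk' y hy => ?_)
  · rw [LinearMap.mem_ker, map_sub, map_smul, sub_eq_zero]
    refine evT_T r _ _ k (by omega) (fun _ _ _ => rfl) _ (fun a b => ?_) y
    simp only [letters, if_pos hk, if_pos (show k < d - i by omega), h.sym]
  · refine evT_ker r _ k hk' (fun a => ?_) (fun a b hab => ?_) hy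
    · simp only [letters, if_neg hk.not_gt, if_neg (show ¬ k + 1 < d - i by omega), h.ext_self]
    · simp only [letters, if_neg hk.not_gt, if_neg (show ¬ k + 1 < d - i by omega), h.ext a b hab]

lemma evT_congr {L L' : ℕ → Fin n → A} (h : ∀ t, t < d → L t = L' t) :
    evT (K := K) L d = evT L' d := by
  refine Finsupp.lhom_ext' fun w => LinearMap.ext_ring ?_
  simp only [LinearMap.comp_apply, Finsupp.lsingle_apply, evT_single]
  simp only [h _ (Fin.is_lt _)]

lemma evT_concat (L : ℕ → Fin n → A) (h : d + e = D) (x : Tens K n d) (y : Tens K n e) :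
    evT L D (concat h x y) = evT L d x * evT (fun t => L (d + t)) e y := by
  suffices H : (concat h).compr₂ (evT L D) =
      (LinearMap.mul K A).compl₁₂ (evT (K := K) L d) (evT (fun t => L (d + t)) e) from
    LinearMap.congr_fun (LinearMap.congr_fun H x) y
  refine Finsupp.lhom_ext' fun u => LinearMap.ext_ring (Finsupp.lhom_ext' fun v =>
    LinearMap.ext_ring ?_)
  subst h
  simp only [LinearMap.comp_apply, LinearMap.compr₂_apply, Finsupp.lsingle_apply, concat_single,
    LinearMap.compl₁₂_apply, LinearMap.mul_apply', evT_single]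
  rw [List.ofFn_add, List.prod_append]
  congr 3
  · funext t
    exact congrArg _ (Word.concat_left rfl u v t t.2)
  · funext t
    exact congrArg _ (Word.concat_right rfl u v t t.2)

lemma single_eq_concat (h : d + e = D) (w : Word n D) : ∃ (u : Word n d) (v : Word n e),
    Finsupp.single w (1 : K) = concat h (Finsupp.single u 1) (Finsupp.single v 1) := by
  subst h
  refine ⟨fun t => w (t.castAdd e), fun t => w (t.natAdd d), ?_⟩
  rw [concat_single]
  congr 1
  exact (Fin.append_castAdd_natAdd (f := w)).symm

/-- Each factor `T` of `down` exchanges a pair `Y X` for `X Y` by the braiding relation. Altogether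
the letter `X` in position `s + a` passes to the left over `a` letters `Y`, and `M` describes the
untouched positions. -/
lemma evT_down (h : Braided r X Y) (M : ℕ → Fin n → A) (s a : ℕ) (hd : s + a < d)
    (y : Tens K n d) :
    evT (fun t => if t < s then M t else if t = s then X else if t ≤ s + a then Y else M t) d
      (down r s a y) =
    evT (fun t => if t < s then M t else if t < s + a then Y else if t = s + a then X else M t)
      d y := by
  induction a generalizing y M with
  | zero =>
    rw [down, Module.End.one_apply]
    congr 2
    funext t
    split_ifs <;> first | rfl | omega
  | succ a ih =>
    -- The last `Y` is counted among the untouched letters, so that the induction hypothesis for `a`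
    -- applies and only the exchange at `s + a` remains.
    have e1 : (fun t => if t < s then M t else if t = s then X else
          if t ≤ s + (a + 1) then Y else M t) =
        fun t => if t < s then Function.update M (s + a + 1) Y t else if t = s then X else
          if t ≤ s + a then Y else Function.update M (s + a + 1) Y t := by
      funext t
      simp only [Function.update_apply]
      split_ifs <;> first | rfl | omega
    rw [down, Module.End.mul_apply, e1, ih _ (by omega), ← one_smul K (evT _ d y)]
    refine evT_T r _ _ (s + a) (by omega) (fun t h1 h2 => ?_) 1 (fun i j => ?_) y
    · simp only [Function.update_apply]
      split_ifs <;> first | rfl | omega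
    · have a1 : ¬ s + a < s := by omega
      have a2 : ¬ s + a + 1 < s := by omega
      have a3 : ¬ s + a + 1 < s + a := by omega
      have a7 : s + a + 1 = s + (a + 1) := by omega
      simp only [Function.update_self, a1, a2, a3, lt_irrefl, if_false, if_true,
        ← a7, one_smul, show ¬ s + a + 1 = s + a by omega, show s + a < s + a + 1 by omega]
      exact (h.braid i j).symm

/-- The `b` letters `X` are taken one at a time over the block of `a` letters `Y`. -/
lemma evT_blockBraid (h : Braided r X Y) (M : ℕ → Fin n → A) (p a b : ℕ) (hd : p + a + b ≤ d)
    (y : Tens K n d) :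
    evT (fun t => if t < p + b then X else if t < p + a + b then Y else M t) d
      (blockBraid r p a b y) =
    evT (fun t => if t < p then X else if t < p + a then Y else if t < p + a + b then X else M t)
      d y := by
  induction b generalizing y M with
  | zero =>
    rw [blockBraid, Module.End.one_apply]
    congr 2
    funext t
    split_ifs <;> first | rfl | omega
  | succ b ih =>
    have e1 : (fun t => if t < p + (b + 1) then X else if t < p + a + (b + 1) then Y else M t) =
        fun t => if t < p + b then (fun t => if t < p + b then X else M t) t
          else if t = p + b then X else if t ≤ p + b + a then Y else
            (fun t => if t < p + b then X else M t) t := by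
      funext t
      dsimp only
      split_ifs <;> first | rfl | omega
    rw [blockBraid, Module.End.mul_apply, e1, evT_down h _ _ _ (by omega)]
    have e2 : (fun t => if t < p + b then (fun t => if t < p + b then X else M t) t
          else if t < p + b + a then Y else if t = p + b + a then X else
            (fun t => if t < p + b then X else M t) t) =
        fun t => if t < p + b then X else if t < p + a + b then Y else
          Function.update M (p + a + b) X t := by
      funext t
      simp only [Function.update_apply]
      split_ifs <;> first | rfl | omega
    rw [e2, ih _ (by omega)]
    congr 2
    funext t
    simp only [Function.update_apply]
    split_ifs <;> first | rfl | omega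

/-- Evaluation is multiplicative. -/
lemma Braided.ev_mulTens (hb : Braided r X Y) (h : d + e = D) (i j : ℕ) (hi : i ≤ d) (hj : j ≤ e)
    (x : Tens K n d) (y : Tens K n e) :
    ev X Y D (i + j) (mulTens r n h i j x y) = ev X Y d i x * ev X Y e j y := by
  rw [ev_of_le _ _ hi, ev_of_le _ _ hj, ev_of_le _ _ (by omega), mulTens, if_pos ⟨hi, hj⟩]
  -- The positions from `d + (e - j)` on carry the exterior letters of `y`, hence the letter `Y` for
  -- the untouched positions.
  have e1 := evT_blockBraid (K := K) (d := D) hb (fun _ => Y) (d - i) i (e - j) (by omega)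
    (concat h x y)
  have e2 : (fun t => if t < d - i + (e - j) then X else
      if t < d - i + i + (e - j) then Y else Y) = letters X Y (D - (i + j)) := by
    funext t
    simp only [letters]
    split_ifs <;> first | rfl | omega
  rw [e2] at e1
  rw [LinearMap.compr₂_apply, e1, evT_concat]
  congr 1
  · rw [evT_congr]
    intro t ht
    simp only [letters]
    split_ifs <;> first | rfl | omega
  · rw [evT_congr]
    intro t ht
    simp only [letters]
    split_ifs <;> first | rfl | omega

variable {B : Type*} [Ring B] [Algebra K B]

lemma map_evT (f : A →ₐ[K] B) (L : ℕ → Fin n → A) (y : Tens K n d) :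
    f (evT L d y) = evT (fun t i => f (L t i)) d y := by
  suffices H : f.toLinearMap ∘ₗ evT L d = evT (K := K) (fun t i => f (L t i)) d from
    LinearMap.congr_fun H y
  refine Finsupp.lhom_ext' fun w => LinearMap.ext_ring ?_
  simp only [LinearMap.comp_apply, Finsupp.lsingle_apply, evT_single, AlgHom.toLinearMap_apply,
    map_list_prod, List.map_ofFn]
  rfl

lemma map_ev (f : A →ₐ[K] B) (X Y : Fin n → A) (i : ℕ) (y : Tens K n d) :
    f (ev X Y d i y) = ev (fun j => f (X j)) (fun j => f (Y j)) d i y := by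
  unfold ev
  split_ifs
  · rw [map_evT]
    congr 2
    funext t
    simp only [letters]
    split_ifs <;> rfl
  · simp

end Evaluation

end

end QPF

namespace QPF

noncomputable section

/-! ### Triangular matrices that encode twisted derivations. -/

section Derivation

variable {K : Type u} [Field K] {n d : ℕ} {A : Type*} [Ring A] [Algebra K A]

/-- The matrices that encode twisted derivations of the algebra of quantum differential forms. -/
lemma Braided.matrix {q : Kˣ} {X Y : Fin n → A} (h : Braided q X Y) (s t : K) :
    Braided q (A := Matrix (Fin 2) (Fin 2) A) (fun j => !![X j, s • Y j; 0, (q : K) • X j])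
      (fun j => !![-(q : K)⁻¹ • Y j, t • X j; 0, Y j]) := by
  have hq : (q : K) ≠ 0 := q.ne_zero
  have key : ∀ {a b c a' b' c' : A}, a = a' → b = b' → c = c' →
      (!![a, b; 0, c] : Matrix (Fin 2) (Fin 2) A) = !![a', b'; 0, c'] := by
    rintro _ _ _ _ _ _ rfl rfl rfl; rfl
  have z0 : (0 : Matrix (Fin 2) (Fin 2) A) = !![0, 0; 0, 0] := by
    ext i j; fin_cases i <;> fin_cases j <;> rfl
  -- In every relation the diagonal entries are the same relation for rescaled generators. The
  -- corner entry is the Leibniz rule, and there the scalings by `q` and `-q⁻¹` are needed.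
  constructor
  · constructor
    · intro i j
      have b1 := h.braid i j
      have b2 := h.braid j i
      have b3 := h.sym i j
      simp only [Matrix.mul_fin_two, Matrix.smul_of, Matrix.smul_cons, Matrix.smul_empty, Matrix.of_add_of,
        Matrix.add_cons, Matrix.head_cons, Matrix.tail_cons, Matrix.empty_add_empty, mul_zero,
        zero_mul, add_zero, zero_add, smul_zero]
      refine key b3 ?_ ?_
      · simp only [mul_smul_comm, smul_mul_assoc, b1, b2]
        rcases lt_trichotomy i j with hij | rfl | hij
        · simp only [coef_lt q hij, coef_gt q hij]
          match_scalars <;> field_simp <;> ring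
        · simp only [coef_self]
          match_scalars; ring
        · simp only [coef_lt q hij, coef_gt q hij]
          match_scalars <;> field_simp <;> ring
      · simp only [mul_smul_comm, smul_mul_assoc]
        linear_combination (norm := module) ((q : K) * q) • b3
    · intro i
      have b1 := h.braid i i
      rw [coef_self] at b1
      have b2 := h.ext_self i
      simp only [Matrix.mul_fin_two, mul_zero, zero_mul, add_zero, zero_add, z0]
      refine key ?_ ?_ b2
      · simp only [mul_smul_comm, smul_mul_assoc, b2, smul_zero]
      · simp only [mul_smul_comm, smul_mul_assoc, b1]
        match_scalars; field_simp; ring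
    · intro i j hij
      have b1 := h.braid i j
      have b2 := h.braid j i
      have b3 := h.ext i j hij
      rw [coef_lt q hij] at b1
      rw [coef_gt q hij] at b2
      simp only [Matrix.mul_fin_two, Matrix.smul_of, Matrix.smul_cons, Matrix.smul_empty, Matrix.of_add_of,
        Matrix.add_cons, Matrix.head_cons, Matrix.tail_cons, Matrix.empty_add_empty, mul_zero,
        zero_mul, add_zero, zero_add, smul_zero, z0]
      refine key ?_ ?_ b3
      · simp only [mul_smul_comm, smul_mul_assoc]
        linear_combination (norm := module) ((q : K)⁻¹ * (q : K)⁻¹) • b3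
      · simp only [mul_smul_comm, smul_mul_assoc, b1, b2]
        match_scalars <;> field_simp <;> ring
  · intro i j
    have b1 := h.braid i j
    have b2 := h.sym i j
    simp only [Matrix.mul_fin_two, Matrix.smul_of, Matrix.smul_cons, Matrix.smul_empty, Matrix.of_add_of,
      Matrix.add_cons, Matrix.head_cons, Matrix.tail_cons, Matrix.empty_add_empty, mul_zero,
      zero_mul, add_zero, zero_add, smul_zero]
    refine key ?_ ?_ ?_
    · simp only [mul_smul_comm, smul_mul_assoc]
      linear_combination (norm := module) (-(q : K)⁻¹) • b1
    · have e2 : coef q i j • (X i * (t • X j)) + X j * (t • X i) = (t * q) • (X i * X j) := by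
        simp only [mul_smul_comm]
        linear_combination (norm := module) t • b2
      simp only [mul_smul_comm, smul_mul_assoc] at e2 ⊢
      rcases lt_trichotomy i j with hij | rfl | hij
      · have b3 := h.ext i j hij
        rw [coef_lt q hij] at e2 ⊢
        linear_combination (norm := skip) (-(1 : K)) • e2 - ((q : K)⁻¹ * s) • b3
        match_scalars <;> field_simp <;> ring
      · have b3 := h.ext_self i
        simp only [b3, coef_self] at e2 ⊢
        linear_combination (norm := module) (-(1 : K)) • e2
      · have b3 := h.ext j i hij
        rw [coef_gt q hij] at e2 ⊢
        linear_combination (norm := skip) (-(1 : K)) • e2 - s • b3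
        match_scalars <;> field_simp <;> ring
    · simp only [mul_smul_comm, smul_mul_assoc]
      linear_combination (norm := module) (q : K) • b1

end Derivation

/-! ### The algebra of quantum differential forms by generators and relations. -/

section FormAlgebra

variable {K : Type u} [Field K] {n d : ℕ}

/-- The defining relations of the algebra of quantum differential forms; `Sum.inl j` stands for
`e_j ⊗ 1` and `Sum.inr j` for `1 ⊗ e_j`. -/
inductive FormRel (q : Kˣ) (n : ℕ) :
    FreeAlgebra K (Fin n ⊕ Fin n) → FreeAlgebra K (Fin n ⊕ Fin n) → Prop
  | sym (i j : Fin n) : FormRel q n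
      (coef q i j • (FreeAlgebra.ι K (Sum.inl i) * FreeAlgebra.ι K (Sum.inl j)) +
        FreeAlgebra.ι K (Sum.inl j) * FreeAlgebra.ι K (Sum.inl i))
      ((q : K) • (FreeAlgebra.ι K (Sum.inl i) * FreeAlgebra.ι K (Sum.inl j)))
  | ext_self (i : Fin n) : FormRel q n
      (FreeAlgebra.ι K (Sum.inr i) * FreeAlgebra.ι K (Sum.inr i)) 0
  | ext (i j : Fin n) (h : i < j) : FormRel q n
      (FreeAlgebra.ι K (Sum.inr i) * FreeAlgebra.ι K (Sum.inr j) +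
        (q : K) • (FreeAlgebra.ι K (Sum.inr j) * FreeAlgebra.ι K (Sum.inr i))) 0
  | braid (i j : Fin n) : FormRel q n
      (FreeAlgebra.ι K (Sum.inr i) * FreeAlgebra.ι K (Sum.inl j))
      (coef q i j • (FreeAlgebra.ι K (Sum.inl i) * FreeAlgebra.ι K (Sum.inr j)) +
        FreeAlgebra.ι K (Sum.inl j) * FreeAlgebra.ι K (Sum.inr i))

/-- The algebra of quantum differential forms in `n` variables. -/
def Form (q : Kˣ) (n : ℕ) : Type u := RingQuot (FormRel q n)

instance (q : Kˣ) (n : ℕ) : Ring (Form q n) := inferInstanceAs (Ring (RingQuot (FormRel q n)))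

instance (q : Kˣ) (n : ℕ) : Algebra K (Form q n) :=
  inferInstanceAs (Algebra K (RingQuot (FormRel q n)))

namespace Form

variable {q : Kˣ}

/-- The quotient map. -/
def mk (q : Kˣ) (n : ℕ) : FreeAlgebra K (Fin n ⊕ Fin n) →ₐ[K] Form q n :=
  RingQuot.mkAlgHom K (FormRel q n)

/-- The variable `e_j ⊗ 1`. -/
def X (q : Kˣ) (j : Fin n) : Form q n := mk q n (FreeAlgebra.ι K (Sum.inl j))

/-- The differential `1 ⊗ e_j`. -/
def Y (q : Kˣ) (j : Fin n) : Form q n := mk q n (FreeAlgebra.ι K (Sum.inr j))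

lemma braided (q : Kˣ) (n : ℕ) : Braided q (X q) (Y (n := n) q) := by
  have e : ∀ {a b}, FormRel q n a b →
mk q n a = mk q n b :=
    fun h => RingQuot.mkAlgHom_rel K h
  refine ⟨⟨fun i j => ?_, fun i => ?_, fun i j h => ?_⟩, fun i j => ?_⟩
  · simpa only [map_add, map_smul, map_mul, X, Y] using e (.sym i j)
  · simpa only [map_mul, map_zero, X, Y] using e (.ext_self i)
  · simpa only [map_add, map_smul, map_mul, map_zero, X, Y] using e (.ext i j h)
  · simpa only [map_add, map_smul, map_mul, X, Y] using e (.braid i j)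

variable {B : Type*} [Ring B] [Algebra K B]

/-- The universal property of the algebra of quantum differential forms. -/
def lift {x y : Fin n → B} (h : Braided q x y) : Form q n →ₐ[K] B :=
  RingQuot.liftAlgHom K ⟨FreeAlgebra.lift K (Sum.elim x y), by
    rintro _ _ (⟨i, j⟩ | ⟨i⟩ | ⟨i, j, hij⟩ | ⟨i, j⟩)
    · simpa only [map_add, map_smul, map_mul, FreeAlgebra.lift_ι_apply, Sum.elim_inl, Sum.elim_inr] using h.sym i j
    · simpa only [map_mul, map_zero, FreeAlgebra.lift_ι_apply, Sum.elim_inl, Sum.elim_inr] using h.ext_self i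
    · simpa only [map_add, map_smul, map_mul, map_zero, FreeAlgebra.lift_ι_apply, Sum.elim_inl, Sum.elim_inr] using
        h.ext i j hij
    · simpa only [map_add, map_smul, map_mul, FreeAlgebra.lift_ι_apply, Sum.elim_inl, Sum.elim_inr] using h.braid i j⟩

@[simp]
lemma lift_X {x y : Fin n → B} (h : Braided q x y) (j : Fin n) : lift h (X q j) = x j := by
  refine (RingQuot.liftAlgHom_mkAlgHom_apply K _ _ _).trans ?_
  simp

@[simp]
lemma lift_Y {x y : Fin n → B} (h : Braided q x y) (j : Fin n) : lift h (Y q j) = y j := by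
  refine (RingQuot.liftAlgHom_mkAlgHom_apply K _ _ _).trans ?_
  simp

/-- A subspace that contains `1` and is stable under left multiplication by the generators is
everything. -/
lemma mem_of_mul_mem (P : Submodule K (Form q n)) (h1 : 1 ∈ P) (hX : ∀ j, ∀ a ∈ P, X q j * a ∈ P)
    (hY : ∀ j, ∀ a ∈ P, Y q j * a ∈ P) (a : Form q n) : a ∈ P := by
  -- The stronger statement is stable under products of elements `a`, as the induction over the free
  -- algebra requires.
  suffices H : ∀ b ∈ P, a * b ∈ P by simpa using H 1 h1
  obtain ⟨a, rfl⟩ : ∃ b, mk q n b = a := RingQuot.mkAlgHom_surjective K (FormRel q n) a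
  induction a using FreeAlgebra.induction with
  | grade0 r =>
    intro b hb
    rw [AlgHom.commutes, ← Algebra.smul_def]
    exact P.smul_mem r hb
  | grade1 j =>
    rcases j with j | j
    · exact hX j
    · exact hY j
  | mul a b ha hb => exact fun c hc => by rw [map_mul, mul_assoc]; exact ha _ (hb c hc)
  | add a b ha hb => exact fun c hc => by rw [map_add, add_mul]; exact P.add_mem (ha c hc) (hb c hc)

end Form

/-- A `(σ, τ)`-derivation `δ` of an algebra. -/
structure TwistedDer (K : Type u) [Field K] (A : Type*) [Ring A] [Algebra K A] where
  σ : A →ₐ[K] A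
  τ : A →ₐ[K] A
  δ : A →ₗ[K] A
  leibniz : ∀ a b, δ (a * b) = σ a * δ b + δ a * τ b

lemma TwistedDer.map_one {A : Type*} [Ring A] [Algebra K A] (D : TwistedDer K A) : D.δ 1 = 0 := by
  have := D.leibniz 1 1
  simpa using this

namespace Form

variable {q : Kˣ}

/-- The algebra map to triangular matrices that encodes a twisted derivation. -/
def toMatrix (q : Kˣ) (n : ℕ) (s t : K) : Form q n →ₐ[K] Matrix (Fin 2) (Fin 2) (Form q n) :=
  lift ((braided q n).matrix s t)

/-- The generators go to upper triangular matrices. Triangularity of all values makes the diagonal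
entries multiplicative, so that the corner entry is a twisted derivation. -/
lemma toMatrix_one_zero (s t : K) (a : Form q n) : toMatrix q n s t a 1 0 = 0 := by
  refine mem_of_mul_mem (P := LinearMap.ker ({
    toFun := fun a => toMatrix q n s t a 1 0
    map_add' := fun a b => by simp
    map_smul' := fun r a => by simp } : Form q n →ₗ[K] Form q n)) ?_ ?_ ?_ a
  · simp
  · intro j a ha
    have ha : toMatrix q n s t a 1 0 = 0 := ha
    change toMatrix q n s t (X q j * a) 1 0 = 0
    simp [toMatrix, Matrix.mul_apply, Fin.sum_univ_two] at ha ⊢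
    simp [ha]
  · intro j a ha
    have ha : toMatrix q n s t a 1 0 = 0 := ha
    change toMatrix q n s t (Y q j * a) 1 0 = 0
    simp [toMatrix, Matrix.mul_apply, Fin.sum_univ_two] at ha ⊢
    simp [ha]

/-- The twisted derivation with `e_j ⊗ 1 ↦ s (1 ⊗ e_j)` and `1 ⊗ e_j ↦ t (e_j ⊗ 1)`. -/
def der (q : Kˣ) (n : ℕ) (s t : K) : TwistedDer K (Form q n) where
  σ :=
    { toFun := fun a => toMatrix q n s t a 0 0
      map_one' := by simp
      map_mul' := fun a b => by simp [Matrix.mul_apply, toMatrix_one_zero]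
      map_zero' := by simp
      map_add' := fun a b => by simp
      commutes' := fun r => by simp [Matrix.algebraMap_matrix_apply] }
  τ :=
    { toFun := fun a => toMatrix q n s t a 1 1
      map_one' := by simp
      map_mul' := fun a b => by simp [Matrix.mul_apply, toMatrix_one_zero]
      map_zero' := by simp
      map_add' := fun a b => by simp
      commutes' := fun r => by simp [Matrix.algebraMap_matrix_apply] }
  δ :=
    { toFun := fun a => toMatrix q n s t a 0 1
      map_add' := fun a b => by simp
      map_smul' := fun r a => by simp }
  leibniz a b := by
    change toMatrix q n s t (a * b) 0 1 = toMatrix q n s t a 0 0 * toMatrix q n s t b 0 1 +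
      toMatrix q n s t a 0 1 * toMatrix q n s t b 1 1
    simp [Matrix.mul_apply]

variable (s t : K) (j : Fin n)

@[simp]
lemma der_σ_X : (der q n s t).σ (X q j) = X q j := by
  change toMatrix q n s t (X q j) 0 0 = _
  simp [toMatrix]

@[simp]
lemma der_σ_Y : (der q n s t).σ (Y q j) = -(q : K)⁻¹ • Y q j := by
  change toMatrix q n s t (Y q j) 0 0 = _
  simp [toMatrix]

@[simp]
lemma der_τ_X : (der q n s t).τ (X q j) = (q : K) • X q j := by
  change toMatrix q n s t (X q j) 1 1 = _
  simp [toMatrix]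

@[simp]
lemma der_τ_Y : (der q n s t).τ (Y q j) = Y q j := by
  change toMatrix q n s t (Y q j) 1 1 = _
  simp [toMatrix]

@[simp]
lemma der_δ_X : (der q n s t).δ (X q j) = s • Y q j := by
  change toMatrix q n s t (X q j) 0 1 = _
  simp [toMatrix]

@[simp]
lemma der_δ_Y : (der q n s t).δ (Y q j) = t • X q j := by
  change toMatrix q n s t (Y q j) 0 1 = _
  simp [toMatrix]

end Form

/-! ### The two differentials as twisted derivations. -/

section ListProd

variable {A : Type*} [Ring A] [Algebra K A]

lemma ofFn_smul_prod (c : K) (F : Fin d → A) :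
    (List.ofFn fun t => c • F t).prod = c ^ d • (List.ofFn F).prod := by
  induction d with
  | zero => simp
  | succ d ih =>
    rw [List.ofFn_succ, List.prod_cons, ih, List.ofFn_succ, List.prod_cons, smul_mul_smul_comm,
      pow_succ']

end ListProd

/-- The de Rham differential of forms. -/
abbrev dR (q : Kˣ) (n : ℕ) : Form q n →ₗ[K] Form q n := (Form.der q n 1 0).δ

/-- The Koszul differential of forms. -/
abbrev kz (q : Kˣ) (n : ℕ) : Form q n →ₗ[K] Form q n := (Form.der q n 0 1).δ

/-- The value of a tensor in the algebra of forms. -/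
abbrev evF (q : Kˣ) (n d i : ℕ) : Tens K n d →ₗ[K] Form q n := ev (Form.X q) (Form.Y q) d i

variable {q : Kˣ}

lemma der_evT_Y (s : K) (v : Tens K n d) : (Form.der q n s 0).δ (evT (fun _ => Form.Y q) d v) = 0 := by
  suffices H : (Form.der q n s 0).δ ∘ₗ evT (fun _ => Form.Y q) d = 0 from LinearMap.congr_fun H v
  refine Finsupp.lhom_ext' fun w => LinearMap.ext_ring ?_
  simp only [LinearMap.comp_apply, Finsupp.lsingle_apply, evT_single, LinearMap.zero_apply]
  induction d with
  | zero => simpa using (Form.der q n s 0).map_one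
  | succ d ih =>
    rw [List.ofFn_succ, List.prod_cons, TwistedDer.leibniz]
    have := ih (0 : Tens K n d) (fun t => w t.succ)
    simp [this]

lemma der_evT_X (t : K) (v : Tens K n d) : (Form.der q n 0 t).δ (evT (fun _ => Form.X q) d v) = 0 := by
  suffices H : (Form.der q n 0 t).δ ∘ₗ evT (fun _ => Form.X q) d = 0 from LinearMap.congr_fun H v
  refine Finsupp.lhom_ext' fun w => LinearMap.ext_ring ?_
  simp only [LinearMap.comp_apply, Finsupp.lsingle_apply, evT_single, LinearMap.zero_apply]
  induction d with
  | zero => simpa using (Form.der q n 0 t).map_one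
  | succ d ih =>
    rw [List.ofFn_succ, List.prod_cons, TwistedDer.leibniz]
    have := ih (0 : Tens K n d) (fun t => w t.succ)
    simp [this]

lemma der_σ_evT_X (s t : K) (v : Tens K n d) :
    (Form.der q n s t).σ (evT (fun _ => Form.X q) d v) = evT (fun _ => Form.X q) d v := by
  rw [map_evT]
  simp

lemma der_τ_evT_Y (s t : K) (v : Tens K n d) :
    (Form.der q n s t).τ (evT (fun _ => Form.Y q) d v) = evT (fun _ => Form.Y q) d v := by
  rw [map_evT]
  simp

lemma evT_smul (c : K) {A : Type*} [Ring A] [Algebra K A] (L : Fin n → A) (v : Tens K n d) :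
    evT (fun _ j => c • L j) d v = c ^ d • evT (fun _ => L) d v := by
  suffices H : evT (fun _ j => c • L j) d = c ^ d • evT (K := K) (fun _ => L) d from
    LinearMap.congr_fun H v
  refine Finsupp.lhom_ext' fun w => LinearMap.ext_ring ?_
  simp only [LinearMap.comp_apply, Finsupp.lsingle_apply, evT_single, LinearMap.smul_apply]
  exact ofFn_smul_prod c _

lemma ev_concat {A : Type*} [Ring A] [Algebra K A] (X Y : Fin n → A) {m i D : ℕ} (h : m + i = D)
    (u : Tens K n m) (v : Tens K n i) :
    ev X Y D i (concat h u v) = evT (fun _ => X) m u * evT (fun _ => Y) i v := by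
  rw [ev_of_le _ _ (by omega), evT_concat]
  congr 1
  · rw [evT_congr]
    intro t ht
    rw [letters, if_pos (by omega)]
  · rw [evT_congr]
    intro t ht
    rw [letters, if_neg (by omega)]

lemma concat_induction {d e D : ℕ} (h : d + e = D) {M : Type*} [AddCommGroup M] [Module K M]
    {f g : Tens K n D →ₗ[K] M}
    (H : ∀ (u : Tens K n d) (v : Tens K n e), f (concat h u v) = g (concat h u v)) : f = g := by
  refine Finsupp.lhom_ext' fun w => LinearMap.ext_ring ?_
  obtain ⟨u, v, e⟩ := single_eq_concat (K := K) h w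
  simp only [LinearMap.comp_apply, Finsupp.lsingle_apply, e, H]

/-- `σ` fixes the letters `X` and scales each of the `i` letters `Y` by `-q⁻¹`. That the eigenvalue
is nonzero is what later makes a cocycle times a coboundary a coboundary. -/
lemma der_σ_ev (s t : K) (d i : ℕ) (y : Tens K n d) :
    (Form.der q n s t).σ (evF q n d i y) = (-(q : K)⁻¹) ^ i • evF q n d i y := by
  rcases Nat.lt_or_ge d i with hi | hi
  · simp [ev, hi.not_ge]
  obtain ⟨m, rfl⟩ := Nat.exists_eq_add_of_le' hi
  refine LinearMap.congr_fun (concat_induction (f := (Form.der q n s t).σ.toLinearMap ∘ₗ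
    evF q n (m + i) i) (g := (-(q : K)⁻¹) ^ i • evF q n (m + i) i) rfl fun u v => ?_) y
  simp only [LinearMap.comp_apply, LinearMap.smul_apply, AlgHom.toLinearMap_apply]
  rw [ev_concat, map_mul, der_σ_evT_X, map_evT]
  simp only [Form.der_σ_Y]
  rw [evT_smul, mul_smul_comm]

/-- `τ` fixes the letters `Y` and scales each of the `d - i` letters `X` by `q`. -/
lemma der_τ_ev (s t : K) (d i : ℕ) (y : Tens K n d) :
    (Form.der q n s t).τ (evF q n d i y) = (q : K) ^ (d - i) • evF q n d i y := by
  rcases Nat.lt_or_ge d i with hi | hi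
  · simp [ev, hi.not_ge]
  obtain ⟨m, rfl⟩ := Nat.exists_eq_add_of_le' hi
  refine LinearMap.congr_fun (concat_induction (f := (Form.der q n s t).τ.toLinearMap ∘ₗ
    evF q n (m + i) i) (g := (q : K) ^ (m + i - i) • evF q n (m + i) i) rfl fun u v => ?_) y
  simp only [LinearMap.comp_apply, LinearMap.smul_apply, AlgHom.toLinearMap_apply]
  rw [ev_concat, map_mul, der_τ_evT_Y, map_evT]
  simp only [Form.der_τ_X]
  rw [evT_smul, smul_mul_assoc, Nat.add_sub_cancel]

lemma symShuffle_concat {d e D : ℕ} (h : d + e = D) (m : ℕ) (hm : m ≤ d) (u : Tens K n d)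
    (v : Tens K n e) : symShuffle q m (concat h u v) = concat h (symShuffle q m u) v := by
  induction m with
  | zero => simp [symShuffle_zero]
  | succ m ih =>
    simp only [symShuffle_succ, LinearMap.add_apply, Module.End.one_apply, LinearMap.smul_apply,
      Module.End.mul_apply, map_add, map_smul, ih (by omega)]
    -- For `m = 0` the index `m - 1` need not lie inside the first factor, but it multiplies
    -- `symShuffle q 0 = 0`.
    rcases Nat.eq_zero_or_pos m with rfl | hm'
    · simp [symShuffle_zero]
    · rw [concat_T_left q h _ (by omega)]

lemma extShuffle_concat {d e D : ℕ} (h : d + e = D) (p i : ℕ) (hi : p + i ≤ e) (u : Tens K n d)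
    (v : Tens K n e) : extShuffle q (d + p) i (concat h u v) = concat h u (extShuffle q p i v) := by
  induction i generalizing p with
  | zero => simp [extShuffle_zero]
  | succ i ih =>
    simp only [extShuffle_succ, LinearMap.add_apply, Module.End.one_apply, LinearMap.smul_apply,
      Module.End.mul_apply, map_add, map_smul, add_assoc]
    rw [ih (p + 1) (by omega)]
    rcases Nat.eq_zero_or_pos i with rfl | hi'
    · simp [extShuffle_zero]
    · rw [concat_T_right q h _ (by omega)]

lemma evT_one_hom {A B : Type*} [Ring A] [Algebra K A] [Ring B] [Algebra K B] (f : A →ₗ[K] B)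
    (X : Fin n → A) (Y : Fin n → B) (h : ∀ j, f (X j) = Y j) (v : Tens K n 1) :
    f (evT (fun _ => X) 1 v) = evT (fun _ => Y) 1 v := by
  suffices H : f ∘ₗ evT (fun _ => X) 1 = evT (K := K) (fun _ => Y) 1 from LinearMap.congr_fun H v
  refine Finsupp.lhom_ext' fun w => LinearMap.ext_ring ?_
  simp [evT_single, h]

/-- The recursion for the shuffle sum is the Leibniz rule for splitting off the last letter.
Differentiating that letter gives the summand `1`. Otherwise `τ` contributes `q`, and the letter `Y`
produced further left is carried over the last `X` by `T`. -/
lemma dR_evT (m : ℕ) (u : Tens K n m) : dR q n (evT (fun _ => Form.X q) m u) =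
    evT (letters (Form.X q) (Form.Y q) (m - 1)) m (symShuffle q m u) := by
  induction m with
  | zero =>
    rw [symShuffle_zero, LinearMap.zero_apply, map_zero]
    suffices H : dR q n ∘ₗ evT (fun _ => Form.X q) 0 = 0 from LinearMap.congr_fun H u
    refine Finsupp.lhom_ext' fun w => LinearMap.ext_ring ?_
    simpa [evT_single] using (Form.der q n 1 0).map_one
  | succ m ih =>
    refine LinearMap.congr_fun (concat_induction (f := dR q n ∘ₗ evT (fun _ => Form.X q) (m + 1))
      (g := evT (letters (Form.X q) (Form.Y q) m) (m + 1) ∘ₗ symShuffle q (m + 1)) rfl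
      fun u v => ?_) u
    simp only [LinearMap.comp_apply, symShuffle_succ, LinearMap.add_apply, Module.End.one_apply,
      LinearMap.smul_apply, Module.End.mul_apply, map_add, map_smul]
    rw [evT_concat, TwistedDer.leibniz, der_σ_evT_X, ih, symShuffle_concat _ _ le_rfl]
    have e1 : evT (letters (Form.X q) (Form.Y q) m) (m + 1) (concat rfl u v) =
        evT (fun _ => Form.X q) m u * (Form.der q n 1 0).δ (evT (fun _ => Form.X q) 1 v) := by
      have := ev_concat (Form.X q) (Form.Y q) (rfl : m + 1 = m + 1) u v
      rw [ev_of_le _ _ (by omega), Nat.add_sub_cancel] at this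
      rw [this, evT_one_hom _ _ (Form.Y q) (by simp)]
    have e2 : (Form.der q n 1 0).τ (evT (fun _ => Form.X q) 1 v) =
        (q : K) • evT (fun _ => Form.X q) 1 v := by
      rw [map_evT]
      simp only [Form.der_τ_X]
      rw [evT_smul, pow_one]
    rw [e1, e2, mul_smul_comm]
    congr 2
    rcases Nat.eq_zero_or_pos m with rfl | hm
    · simp [symShuffle_zero]
    -- The pattern `X ⋯ X Y X` becomes `X ⋯ X X Y` by one braiding.
    have e3 := evT_T q (fun t => if t < m then letters (Form.X q) (Form.Y (n := n) q) (m - 1) t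
      else if t = m then Form.X q else Form.Y q) (letters (Form.X q) (Form.Y q) m) (m - 1) (d := m + 1) (by omega)
      (fun t h1 h2 => by
        simp only [letters]
        split_ifs <;> first | rfl | omega) 1
      (fun i j => by
        simp only [letters, show m - 1 + 1 = m by omega, show m - 1 < m by omega, lt_irrefl,
          if_true, if_false, one_smul]
        exact ((Form.braided q n).braid i j).symm) (concat rfl (symShuffle q m u) v)
    rw [e3, one_smul, evT_concat]
    congr 1
    · rw [evT_congr]
      intro t ht
      rw [if_pos ht]
    · rw [evT_congr]
      intro t ht
      rw [if_neg (by omega), if_pos (by omega)]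

/-- Mirror image of the de Rham case: the first letter is split off, `σ` contributes `-q⁻¹`, and the
new letter `X` is carried to the front by `T`. -/
lemma kz_evT (i : ℕ) (v : Tens K n i) : kz q n (evT (fun _ => Form.Y q) i v) =
    evT (letters (Form.X q) (Form.Y q) 1) i (extShuffle q 0 i v) := by
  induction i with
  | zero =>
    rw [extShuffle_zero, LinearMap.zero_apply, map_zero]
    suffices H : kz q n ∘ₗ evT (fun _ => Form.Y q) 0 = 0 from LinearMap.congr_fun H v
    refine Finsupp.lhom_ext' fun w => LinearMap.ext_ring ?_
    simpa [evT_single] using (Form.der q n 0 1).map_one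
  | succ i ih =>
    refine LinearMap.congr_fun (concat_induction (f := kz q n ∘ₗ evT (fun _ => Form.Y q) (i + 1))
      (g := evT (letters (Form.X q) (Form.Y q) 1) (i + 1) ∘ₗ extShuffle q 0 (i + 1))
      (add_comm 1 i) fun u v => ?_) v
    simp only [LinearMap.comp_apply, extShuffle_succ, LinearMap.add_apply, Module.End.one_apply,
      LinearMap.smul_apply, Module.End.mul_apply, map_add, map_smul]
    have h0 := extShuffle_concat (q := q) (add_comm 1 i) 0 i (by omega) u v
    rw [add_zero] at h0
    rw [evT_concat, TwistedDer.leibniz, der_τ_evT_Y, ih, zero_add, h0, add_comm]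
    have e1 : evT (letters (Form.X q) (Form.Y q) 1) (i + 1) (concat (add_comm 1 i) u v) =
        (Form.der q n 0 1).δ (evT (fun _ => Form.Y q) 1 u) * evT (fun _ => Form.Y q) i v := by
      have := ev_concat (Form.X q) (Form.Y q) (add_comm 1 i) u v
      rw [ev_of_le _ _ (by omega), Nat.add_sub_cancel_left] at this
      rw [this, evT_one_hom _ _ (Form.X q) (by simp)]
    have e2 : (Form.der q n 0 1).σ (evT (fun _ => Form.Y q) 1 u) =
        (-(q : K)⁻¹) • evT (fun _ => Form.Y q) 1 u := by
      rw [map_evT]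
      simp only [Form.der_σ_Y]
      rw [evT_smul, pow_one]
    rw [e1, e2, smul_mul_assoc]
    congr 2
    rcases Nat.eq_zero_or_pos i with rfl | hi
    · simp [extShuffle_zero]
    have e3 := evT_T q (fun t => if t = 1 then Form.X q else Form.Y (n := n) q)
      (letters (Form.X q) (Form.Y q) 1) 0 (d := i + 1) (by omega)
      (fun t h1 h2 => by
        simp only [letters]
        split_ifs <;> first | rfl | omega) 1
      (fun i j => by
        simp only [letters, zero_add, show (0 : ℕ) < 1 by omega, lt_irrefl, zero_ne_one,
          if_true, if_false, one_smul]
        exact ((Form.braided q n).braid i j).symm)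
      (concat (add_comm 1 i) u (extShuffle q 0 i v))
    rw [e3, one_smul, evT_concat]
    refine congrArg₂ (· * ·) ?_ ?_
    · rw [evT_congr]
      intro t ht
      rw [if_neg (by omega)]
    · rw [evT_congr]
      intro t ht
      simp only [letters]
      split_ifs <;> first | rfl | omega

/-- The de Rham differential is induced by a twisted derivation of the algebra of forms. -/
lemma dR_ev (d i : ℕ) (y : Tens K n d) :
    dR q n (evF q n d i y) = evF q n d (i + 1) (symShuffle q (d - i) y) := by
  rcases Nat.lt_or_ge d i with hi | hi
  · simp [ev, hi.not_ge, show ¬ i + 1 ≤ d by omega]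
  obtain ⟨m, rfl⟩ := Nat.exists_eq_add_of_le' hi
  refine LinearMap.congr_fun (concat_induction (f := dR q n ∘ₗ evF q n (m + i) i)
    (g := evF q n (m + i) (i + 1) ∘ₗ symShuffle q (m + i - i)) rfl fun u v => ?_) y
  simp only [LinearMap.comp_apply]
  rw [ev_concat, TwistedDer.leibniz, der_evT_Y, mul_zero, zero_add, dR_evT, der_τ_evT_Y,
    Nat.add_sub_cancel, symShuffle_concat _ _ le_rfl]
  rcases Nat.eq_zero_or_pos m with rfl | hm
  · simp [symShuffle_zero]
  rw [evF, ev_of_le _ _ (by omega), evT_concat]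
  congr 1
  · rw [show m + i - (i + 1) = m - 1 by omega]
  · rw [evT_congr]
    intro t ht
    rw [letters, if_neg (by omega)]

/-- The Koszul differential is induced by a twisted derivation of the algebra of forms. -/
lemma kz_ev (d i : ℕ) (y : Tens K n d) :
    kz q n (evF q n d (i + 1) y) = evF q n d i (koszulOp q n d i y) := by
  unfold koszulOp
  split_ifs with hi
  swap
  · simp [ev, hi]
  obtain ⟨m, rfl⟩ := Nat.exists_eq_add_of_le' hi
  refine LinearMap.congr_fun (concat_induction (f := kz q n ∘ₗ evF q n (m + (i + 1)) (i + 1))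
    (g := evF q n (m + (i + 1)) i ∘ₗ extShuffle q (m + (i + 1) - (i + 1)) (i + 1)) rfl
    fun u v => ?_) y
  simp only [LinearMap.comp_apply]
  have h0 := extShuffle_concat (q := q) (rfl : m + (i + 1) = _) 0 (i + 1) (by omega) u v
  rw [add_zero] at h0
  rw [ev_concat, TwistedDer.leibniz, der_evT_X, zero_mul, add_zero, kz_evT, der_σ_evT_X,
    Nat.add_sub_cancel, h0, evF, ev_of_le _ _ (by omega), evT_concat]
  congr 1
  · rw [evT_congr]
    intro t ht
    rw [letters, if_pos (by omega)]
  · rw [evT_congr]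
    intro t ht
    simp only [letters]
    split_ifs <;> first | rfl | omega

lemma kz_ev_zero (d : ℕ) (y : Tens K n d) : kz q n (evF q n d 0 y) = 0 := by
  have : evF q n d 0 y = evT (fun _ => Form.X q) d y := by
    rw [evF, ev_of_le _ _ (by omega), evT_congr]
    intro t ht
    rw [letters, if_pos (by omega)]
  rw [this, der_evT_X]

end FormAlgebra

end

end QPF

namespace QPF

noncomputable section

/-! ### The Fock representation and the faithfulness of evaluation. -/

section Fock

open QFun

variable {K : Type u} [Field K] {n d : ℕ} {q : Kˣ}

/-- Left multiplication of tensors by a letter. -/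
def consT (K : Type u) [Field K] {n d : ℕ} (j : Fin n) : Tens K n d →ₗ[K] Tens K n (d + 1) :=
  concat (add_comm 1 d) (Finsupp.single (fun _ => j) 1)

lemma consT_T (j : Fin n) (k : ℕ) (y : Tens K n d) :
    consT K j (T q k y) = T q (k + 1) (consT K j y) := by
  by_cases hk : k + 1 < d
  · have := concat_T_right q (add_comm 1 d) k hk (Finsupp.single (fun _ => j) (1 : K)) y
    rwa [show 1 + k = k + 1 from add_comm 1 k] at this
  · rw [T_of_not q k hk, T_of_not q (k + 1) (by omega)]
    simp

lemma consT_single (j : Fin n) (w : Word n d) :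
    consT K j (Finsupp.single w 1) = Finsupp.single (Fin.cons j w : Word n (d + 1)) 1 := by
  rw [consT, concat_single]
  congr 1
  funext ⟨t, ht⟩
  cases t with
  | zero => exact Word.concat_left _ _ w 0 (by omega)
  | succ t =>
    refine Eq.trans ?_ (Word.concat_right (add_comm 1 d) (fun _ => j) w t (by omega))
    congr 2
    omega

lemma T_zero_consT (i j : Fin n) (y : Tens K n d) :
    T q 0 (consT K i (consT K j y)) =
      coef q i j • consT K i (consT K j y) + consT K j (consT K i y) := by
  suffices H : T q 0 ∘ₗ consT K i ∘ₗ consT K j =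
      coef q i j • (consT K i ∘ₗ consT K j) + consT K j ∘ₗ consT (d := d) K i from
    LinearMap.congr_fun H y
  refine Finsupp.lhom_ext' fun w => LinearMap.ext_ring ?_
  simp only [LinearMap.comp_apply, Finsupp.lsingle_apply, LinearMap.add_apply,
    LinearMap.smul_apply, consT_single]
  rw [T_single q 0 (by omega)]
  congr 2
  funext ⟨t, ht⟩
  rcases t with _ | _ | t
  · exact Word.swap_left _ _ _
  · exact Word.swap_right _ _ _
  · exact Word.swap_of_ne _ _ _ _ _ (by omega) (by omega)

/-- The Hecke operator moving the first letter to the position `m`. -/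
abbrev moveFirst (q : Kˣ) (m : ℕ) : Module.End K (Tens K n d) := blockBraid q 0 1 m

lemma blockBraid_one_succ (p m : ℕ) :
    blockBraid (n := n) (d := d) q p 1 (m + 1) = T q (p + m) * blockBraid q p 1 m := by
  simp [blockBraid, down]

lemma consT_moveFirst (j : Fin n) (m : ℕ) (y : Tens K n d) :
    consT K j (moveFirst q m y) = blockBraid q 1 1 m (consT K j y) := by
  induction m with
  | zero => simp [moveFirst, blockBraid]
  | succ m ih =>
    rw [moveFirst, blockBraid_one_succ, blockBraid_one_succ, Module.End.mul_apply,
      Module.End.mul_apply, consT_T, ih, zero_add, add_comm 1 m]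

lemma moveFirst_succ (m : ℕ) :
    moveFirst (n := n) (d := d) q (m + 1) = blockBraid q 1 1 m * T q 0 := by
  induction m with
  | zero => simp [moveFirst, blockBraid, down]
  | succ m ih =>
    rw [moveFirst, blockBraid_one_succ, ← moveFirst, ih, blockBraid_one_succ, mul_assoc, zero_add,
      add_comm 1 m]

/-- Naturality of the braiding: when the first two letters are moved over `m` letters, an operator
acting on these two becomes the operator at their new position. The induction uses one braid
relation per step. -/
lemma moveFirst_moveFirst (m : ℕ) (h : m + 1 < d) :
    moveFirst (n := n) (d := d) q m * blockBraid q 1 1 m * T q 0 =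
      T q m * (moveFirst q m * blockBraid q 1 1 m) := by
  induction m with
  | zero => simp [moveFirst, blockBraid]
  | succ m ih =>
    have c := blockBraid_comm_ge (n := n) (d := d) q 0 1 m (m + 1) (by omega)
    have b := T_braid (n := n) (d := d) q m (by omega)
    have ih := ih (by omega)
    simp only [moveFirst, blockBraid_one_succ, zero_add, add_comm 1 m] at ih ⊢
    calc T q m * blockBraid q 0 1 m * (T q (m + 1) * blockBraid q 1 1 m) * T q 0
        = T q m * (blockBraid q 0 1 m * T q (m + 1)) * blockBraid q 1 1 m * T q 0 := by
          simp only [mul_assoc]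
      _ = T q m * T q (m + 1) * (blockBraid q 0 1 m * blockBraid q 1 1 m * T q 0) := by
          rw [c]; simp only [mul_assoc]
      _ = T q m * T q (m + 1) * T q m * (blockBraid q 0 1 m * blockBraid q 1 1 m) := by
          rw [ih]; simp only [mul_assoc]
      _ = T q (m + 1) * (T q m * (T q (m + 1) * blockBraid q 0 1 m)) * blockBraid q 1 1 m := by
          rw [b]; simp only [mul_assoc]
      _ = _ := by rw [← c]; simp only [mul_assoc]

/-- A new first letter enlarges the symmetric block and shifts all positions by one. The bound on
`i` is needed: for `i = d + 1` the relations in degree `d` are everything, those in degree `d + 1`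
in general not. -/
lemma consT_rel (j : Fin n) {i : ℕ} (h : i ≤ d) :
    rel q n d i ≤ (rel q n (d + 1) i).comap (consT K j) := by
  refine rel_le q h (fun k hk y => ?_) (fun k hk hk' y hy => ?_)
  · rw [Submodule.mem_comap, map_sub, map_smul, consT_T]
    exact sym_mem_rel q (by omega) _
  · exact ext_mem_rel q (k := k + 1) (by omega) (by omega) (by rw [← consT_T, hy, map_smul])

/-- The new exterior letter is taken over the `d - i` symmetric letters. This returns the symmetric
relations to their old positions and leaves the exterior ones shifted by one. -/
lemma consT_ext_rel (j : Fin n) (i : ℕ) :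
    rel q n d i ≤ (rel q n (d + 1) (i + 1)).comap (moveFirst q (d - i) ∘ₗ consT K j) := by
  rcases Nat.lt_or_ge d i with h | h
  · rw [rel_eq_top q (show d + 1 < i + 1 by omega), Submodule.comap_top]; exact le_top
  refine rel_le q h (fun k hk y => ?_) (fun k hk hk' y hy => ?_)
  · have c := LinearMap.congr_fun (blockBraid_slide_right (n := n) (d := d + 1) q 0 1 (d - i) k hk
      (by omega)) (consT K j y)
    rw [zero_add, zero_add, show 1 + k = k + 1 from add_comm 1 k] at c
    simp only [Module.End.mul_apply] at c
    rw [Submodule.mem_comap, map_sub, map_smul, LinearMap.comp_apply, consT_T, moveFirst, c]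
    exact sym_mem_rel q (by omega) _
  · have c := LinearMap.congr_fun (blockBraid_comm_ge (n := n) (d := d + 1) q 0 1 (d - i) (k + 1)
      (by omega)) (consT K j y)
    simp only [Module.End.mul_apply] at c
    refine ext_mem_rel q (k := k + 1) (by omega) (by omega) ?_
    rw [LinearMap.comp_apply, ← c, ← consT_T, hy, map_smul, map_smul]

/-- The product of all `Ω^i_d(n)`, as vector spaces. -/
def Fock (q : Kˣ) (n : ℕ) : Type u := ∀ d i : ℕ, Tens K n d ⧸ rel q n d i

instance (q : Kˣ) (n : ℕ) : AddCommGroup (Fock q n) :=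
  inferInstanceAs (AddCommGroup (∀ d i : ℕ, Tens K n d ⧸ rel q n d i))

instance (q : Kˣ) (n : ℕ) : Module K (Fock q n) :=
  inferInstanceAs (Module K (∀ d i : ℕ, Tens K n d ⧸ rel q n d i))

lemma Fock.add_apply (f g : Fock q n) (d i : ℕ) : (f + g) d i = f d i + g d i := rfl

lemma Fock.smul_apply (r : K) (f : Fock q n) (d i : ℕ) : (r • f) d i = r • f d i := rfl

lemma Fock.zero_apply (d i : ℕ) : (0 : Fock q n) d i = 0 := rfl

/-- Left multiplication by `e_j ⊗ 1`. -/
def mulX (q : Kˣ) (j : Fin n) (d i : ℕ) :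
    (Tens K n d ⧸ rel q n d i) →ₗ[K] (Tens K n (d + 1) ⧸ rel q n (d + 1) i) :=
  if h : i ≤ d then (rel q n d i).mapQ _ (consT K j) (consT_rel j h) else 0

/-- Left multiplication by `1 ⊗ e_j`. -/
def mulY (q : Kˣ) (j : Fin n) (d i : ℕ) :
    (Tens K n d ⧸ rel q n d i) →ₗ[K] (Tens K n (d + 1) ⧸ rel q n (d + 1) (i + 1)) :=
  (rel q n d i).mapQ _ (moveFirst q (d - i) ∘ₗ consT K j) (consT_ext_rel j i)

lemma mulX_mk (j : Fin n) {d i : ℕ} (h : i ≤ d) (y : Tens K n d) :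
    mulX q j d i ((rel q n d i).mkQ y) = (rel q n (d + 1) i).mkQ (consT K j y) := by
  rw [mulX, dif_pos h]
  rfl

lemma mulY_mk (j : Fin n) (d i : ℕ) (y : Tens K n d) :
    mulY q j d i ((rel q n d i).mkQ y) =
      (rel q n (d + 1) (i + 1)).mkQ (moveFirst q (d - i) (consT K j y)) := rfl

lemma quot_rel_eq_zero {d i : ℕ} (h : d < i) (x : Tens K n d ⧸ rel q n d i) : x = 0 := by
  obtain ⟨x, rfl⟩ := Submodule.mkQ_surjective _ x
  exact (Submodule.Quotient.mk_eq_zero _).2 (by rw [rel_eq_top q h]; trivial)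

/-- Left multiplication by `e_j ⊗ 1` in all degrees. -/
def fockX (q : Kˣ) (j : Fin n) : Module.End K (Fock q n) where
  toFun f := fun
    | 0, _ => 0
    | d + 1, i => mulX q j d i (f d i)
  map_add' f g := by
    funext d i
    cases d with
    | zero => exact (add_zero _).symm
    | succ d => exact map_add _ _ _
  map_smul' r f := by
    funext d i
    cases d with
    | zero => exact (smul_zero r).symm
    | succ d => exact (mulX q j d i).map_smul r (f d i)

/-- Left multiplication by `1 ⊗ e_j` in all degrees. -/
def fockY (q : Kˣ) (j : Fin n) : Module.End K (Fock q n) where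
  toFun f := fun
    | 0, _ => 0
    | _ + 1, 0 => 0
    | d + 1, i + 1 => mulY q j d i (f d i)
  map_add' f g := by
    funext d i
    cases d with
    | zero => exact (add_zero _).symm
    | succ d =>
      cases i with
      | zero => exact (add_zero _).symm
      | succ i => exact map_add _ _ _
  map_smul' r f := by
    funext d i
    cases d with
    | zero => exact (smul_zero r).symm
    | succ d =>
      cases i with
      | zero => exact (smul_zero r).symm
      | succ i => exact (mulY q j d i).map_smul r (f d i)

lemma fockX_zero (j : Fin n) (f : Fock q n) (i : ℕ) : fockX q j f 0 i = 0 := rfl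

lemma fockX_succ (j : Fin n) (f : Fock q n) (d i : ℕ) :
    fockX q j f (d + 1) i = mulX q j d i (f d i) := rfl

lemma fockY_zero_left (j : Fin n) (f : Fock q n) (i : ℕ) : fockY q j f 0 i = 0 := rfl

lemma fockY_zero_right (j : Fin n) (f : Fock q n) (d : ℕ) : fockY q j f d 0 = 0 := by
  cases d <;> rfl

lemma fockY_succ (j : Fin n) (f : Fock q n) (d i : ℕ) :
    fockY q j f (d + 1) (i + 1) = mulY q j d i (f d i) := rfl

lemma mulY_mulY_mk (i j : Fin n) (d a : ℕ) (y : Tens K n d) :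
    mulY q i (d + 1) (a + 1) (mulY q j d a ((rel q n d a).mkQ y)) =
      (rel q n (d + 2) (a + 2)).mkQ
        (moveFirst q (d - a) (blockBraid q 1 1 (d - a) (consT K i (consT K j y)))) := by
  rw [mulY_mk, mulY_mk, Nat.add_sub_add_right, consT_moveFirst]

/-- Once both letters have passed the symmetric block, an eigenvector of `T` at `0` is an
eigenvector at `d - a`, and there it is an exterior relation. -/
lemma moveFirst_mem_rel (d a : ℕ) {z : Tens K n (d + 2)} (hz : T q 0 z = (q : K) • z) :
    (rel q n (d + 2) (a + 2)).mkQ (moveFirst q (d - a) (blockBraid q 1 1 (d - a) z)) = 0 := by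
  refine (Submodule.Quotient.mk_eq_zero _).2
    (ext_mem_rel q (k := d - a) (by omega) (by omega) ?_)
  have := LinearMap.congr_fun (moveFirst_moveFirst (q := q) (n := n) (d := d + 2) (d - a)
    (by omega)) z
  simp only [Module.End.mul_apply, hz, map_smul] at this
  exact this.symm

/-- Every relation compares two ways of putting two letters in front of a tensor, so it reduces to
the formula for `T q 0` on the first two letters. Consequently `Form` acts on `Fock`. -/
lemma fock_braided (q : Kˣ) (n : ℕ) : Braided q (fockX q) (fockY (n := n) q) := by
  have hq : (q : K) ≠ 0 := q.ne_zero
  refine ⟨⟨fun i j => ?_, fun i => ?_, fun i j hij => ?_⟩, fun i j => ?_⟩ <;>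
    refine LinearMap.ext fun f => funext fun d => funext fun a => ?_
  · simp only [LinearMap.add_apply, LinearMap.smul_apply, Module.End.mul_apply, Fock.add_apply,
      Fock.smul_apply]
    rcases d with _ | _ | d
    · simp [fockX_zero]
    · simp [fockX_zero, fockX_succ]
    simp only [fockX_succ]
    rcases Nat.lt_or_ge d a with h | h
    · simp [quot_rel_eq_zero h (f d a)]
    obtain ⟨y, hy⟩ := Submodule.mkQ_surjective _ (f d a)
    rw [← hy, mulX_mk _ h, mulX_mk _ h, mulX_mk _ (by omega), mulX_mk _ (by omega),
      ← map_smul (rel q n (d + 1 + 1) a).mkQ, ← map_smul (rel q n (d + 1 + 1) a).mkQ, ← map_add,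
      ← T_zero_consT, ← sub_eq_zero, ← map_sub]
    exact (Submodule.Quotient.mk_eq_zero _).2 (sym_mem_rel q (by omega) _)
  · simp only [Module.End.mul_apply]
    rcases d with _ | _ | d <;> rcases a with _ | _ | a <;>
      try simp only [fockY_zero_right, fockY_zero_left, fockY_succ, map_zero,
        Fock.zero_apply, LinearMap.zero_apply]
    obtain ⟨y, hy⟩ := Submodule.mkQ_surjective _ (f d a)
    rw [← hy, mulY_mulY_mk, moveFirst_mem_rel]
    rw [T_zero_consT, coef_self]
    module
  · simp only [LinearMap.add_apply, LinearMap.smul_apply, Module.End.mul_apply, Fock.add_apply,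
      Fock.smul_apply]
    rcases d with _ | _ | d <;> rcases a with _ | _ | a <;>
      try simp only [fockY_zero_right, fockY_zero_left, fockY_succ, map_zero, smul_zero, add_zero,
        Fock.zero_apply, LinearMap.zero_apply]
    obtain ⟨y, hy⟩ := Submodule.mkQ_surjective _ (f d a)
    rw [← hy, mulY_mulY_mk, mulY_mulY_mk, ← map_smul, ← map_smul, ← map_smul, ← map_add, ← map_add,
      ← map_add, moveFirst_mem_rel]
    -- For `i < j` the vector `e_i ⊗ e_j + q e_j ⊗ e_i` is an eigenvector of `T` with eigenvalue
    -- `q`.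
    rw [map_add, map_smul, T_zero_consT, T_zero_consT, coef_lt q hij, coef_gt q hij]
    match_scalars <;> field_simp <;> ring
  · simp only [LinearMap.add_apply, LinearMap.smul_apply, Module.End.mul_apply, Fock.add_apply,
      Fock.smul_apply]
    rcases d with _ | _ | d <;> rcases a with _ | a <;>
      try simp only [fockY_zero_right, fockY_zero_left, fockY_succ, fockX_succ, fockX_zero, map_zero,
        smul_zero, add_zero]
    rcases Nat.lt_or_ge d a with h | h
    · simp [quot_rel_eq_zero h (f d a)]
    obtain ⟨y, hy⟩ := Submodule.mkQ_surjective _ (f d a)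
    rw [← hy, mulX_mk _ h, mulY_mk, mulY_mk, mulY_mk, mulX_mk _ (by omega), mulX_mk _ (by omega),
      consT_moveFirst, consT_moveFirst, ← map_smul (rel q n (d + 1 + 1) (a + 1)).mkQ, ← map_add,
      ← map_smul, ← map_add, ← T_zero_consT, Nat.sub_add_comm h, moveFirst_succ]
    rfl

/-- The vacuum vector. -/
def vac (q : Kˣ) (n : ℕ) : Fock q n
  | 0, 0 => (rel q n 0 0).mkQ (Finsupp.single Fin.elim0 1)
  | _, _ => 0

/-- The component in `Ω^i_d(n)` of a form. -/
def part (q : Kˣ) (n d i : ℕ) : Form q n →ₗ[K] (Tens K n d ⧸ rel q n d i) where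
  toFun a := Form.lift (fock_braided q n) a (vac q n) d i
  map_add' a b := by rw [map_add]; rfl
  map_smul' r a := by rw [map_smul]; rfl

lemma X_mul_ev {A : Type*} [Ring A] [Algebra K A] (X Y : Fin n → A) (j : Fin n) {d i : ℕ}
    (h : i ≤ d) (y : Tens K n d) : X j * ev X Y d i y = ev X Y (d + 1) i (consT K j y) := by
  rw [ev_of_le _ _ h, ev_of_le _ _ (by omega), consT, evT_concat, evT_single]
  congr 1
  · simp [letters, show 0 < d + 1 - i by omega]
  · refine LinearMap.congr_fun (evT_congr fun t ht => ?_) _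
    simp only [letters]
    split_ifs <;> first | rfl | omega

/-- This is the multiplicativity of evaluation for a tensor of length one: bringing `Y` behind the
symmetric letters is the braiding `moveFirst`. -/
lemma Y_mul_ev {A : Type*} [Ring A] [Algebra K A] {X Y : Fin n → A} (hb : Braided q X Y)
    (j : Fin n) (d i : ℕ) (y : Tens K n d) :
    Y j * ev X Y d i y = ev X Y (d + 1) (i + 1) (moveFirst q (d - i) (consT K j y)) := by
  rcases Nat.lt_or_ge d i with h | h
  · simp [ev, h.not_ge]
  have := hb.ev_mulTens (add_comm 1 d) 1 i le_rfl h (Finsupp.single (fun _ => j) 1) y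
  rw [mulTens, if_pos ⟨le_rfl, h⟩, add_comm 1 i] at this
  refine Eq.trans ?_ this.symm
  congr 1
  simp [ev, evT_single, letters]

lemma consT_induction {M : Type*} [AddCommGroup M] [Module K M] {f g : Tens K n (d + 1) →ₗ[K] M}
    (H : ∀ (j : Fin n) (y : Tens K n d), f (consT K j y) = g (consT K j y)) : f = g := by
  refine Finsupp.lhom_ext' fun w => LinearMap.ext_ring ?_
  have := H (w 0) (Finsupp.single (fun t => w t.succ) 1)
  rw [consT_single] at this
  have e : (Fin.cons (w 0) fun t => w t.succ : Word n (d + 1)) = w := Fin.cons_self_tail w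
  rw [e] at this
  exact this

lemma lift_X_mul (j : Fin n) (a : Form q n) (f : Fock q n) :
    Form.lift (fock_braided q n) (Form.X q j * a) f =
      fockX q j (Form.lift (fock_braided q n) a f) := by
  rw [map_mul, Form.lift_X, Module.End.mul_apply]

lemma lift_Y_mul (j : Fin n) (a : Form q n) (f : Fock q n) :
    Form.lift (fock_braided q n) (Form.Y q j * a) f =
      fockY q j (Form.lift (fock_braided q n) a f) := by
  rw [map_mul, Form.lift_Y, Module.End.mul_apply]

/-- Acting on the vacuum rebuilds a tensor letter by letter, modulo relations. Hence evaluation in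
`Form` has no kernel beyond `rel`. -/
lemma part_ev (d i : ℕ) (y : Tens K n d) :
    part q n d i (evF q n d i y) = (rel q n d i).mkQ y := by
  rcases Nat.lt_or_ge d i with h | h
  · rw [quot_rel_eq_zero h (part _ _ _ _ _), quot_rel_eq_zero h ((rel q n d i).mkQ y)]
  induction d generalizing i with
  | zero =>
    obtain rfl : i = 0 := by omega
    suffices H : part q n 0 0 ∘ₗ evF q n 0 0 = (rel q n 0 0).mkQ from LinearMap.congr_fun H y
    refine Finsupp.lhom_ext' fun w => LinearMap.ext_ring ?_
    have e : w = Fin.elim0 := Subsingleton.elim _ _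
    subst e
    have e1 : evF q n 0 0 (Finsupp.single (Fin.elim0 : Word n 0) (1 : K)) = 1 := by
      rw [evF, ev_of_le _ _ le_rfl, evT_single]
      rfl
    simp only [LinearMap.comp_apply, Finsupp.lsingle_apply, e1]
    change Form.lift (fock_braided q n) 1 (vac q n) 0 0 = _
    rw [map_one]
    rfl
  | succ d ih =>
    refine LinearMap.congr_fun (consT_induction (f := part q n (d + 1) i ∘ₗ evF q n (d + 1) i)
      (g := (rel q n (d + 1) i).mkQ) fun j y => ?_) y
    simp only [LinearMap.comp_apply]
    -- Either all letters are exterior, and the new one crosses no symmetric letter, or the first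
    -- letter is symmetric.
    rcases Nat.lt_or_ge d i with h' | h'
    · obtain rfl : i = d + 1 := by omega
      have e := Y_mul_ev (Form.braided q n) j d d y
      rw [Nat.sub_self, moveFirst, blockBraid, Module.End.one_apply] at e
      rw [evF, ← e]
      change Form.lift (fock_braided q n) _ (vac q n) (d + 1) (d + 1) = _
      rw [lift_Y_mul, fockY_succ]
      have := ih d y le_rfl
      change Form.lift (fock_braided q n) _ (vac q n) d d = _ at this
      rw [this, mulY_mk, Nat.sub_self, moveFirst, blockBraid, Module.End.one_apply]
    · rw [evF, ← X_mul_ev _ _ j h' y]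
      change Form.lift (fock_braided q n) _ (vac q n) (d + 1) i = _
      rw [lift_X_mul, fockX_succ]
      have := ih i y h'
      change Form.lift (fock_braided q n) _ (vac q n) d i = _ at this
      rw [this, mulX_mk j h']

/-- Left multiplication by a letter raises the bidegree of all components by that of the letter, and
the vacuum is concentrated in bidegree `(0, 0)`. -/
lemma part_ev_of_ne {d i d' i' : ℕ} (hne : ¬ (d = d' ∧ i = i')) (y : Tens K n d) :
    part q n d' i' (evF q n d i y) = 0 := by
  rcases Nat.lt_or_ge d i with h | h
  · simp [ev, h.not_ge]
  induction d generalizing i d' i' with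
  | zero =>
    obtain rfl : i = 0 := by omega
    suffices H : part q n d' i' ∘ₗ evF q n 0 0 = 0 from LinearMap.congr_fun H y
    refine Finsupp.lhom_ext' fun w => LinearMap.ext_ring ?_
    have e1 : evF q n 0 0 (Finsupp.single w (1 : K)) = 1 := by
      rw [evF, ev_of_le _ _ le_rfl, evT_single]
      rfl
    simp only [LinearMap.comp_apply, Finsupp.lsingle_apply, e1]
    change Form.lift (fock_braided q n) 1 (vac q n) d' i' = _
    rw [map_one, Module.End.one_apply]
    rcases d' with _ | d' <;> rcases i' with _ | i' <;> first | rfl | simp at hne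
  | succ d ih =>
    refine LinearMap.congr_fun (consT_induction (f := part q n d' i' ∘ₗ evF q n (d + 1) i)
      (g := 0) fun j y => ?_) y
    simp only [LinearMap.comp_apply, LinearMap.zero_apply]
    rcases Nat.lt_or_ge d i with h' | h'
    · obtain rfl : i = d + 1 := by omega
      have e := Y_mul_ev (Form.braided q n) j d d y
      rw [Nat.sub_self, moveFirst, blockBraid, Module.End.one_apply] at e
      rw [evF, ← e]
      change Form.lift (fock_braided q n) _ (vac q n) d' i' = _
      rw [lift_Y_mul]
      rcases d' with _ | d'
      · rfl
      rcases i' with _ | i'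
      · rfl
      have := ih (i := d) (d' := d') (i' := i') (by omega) y le_rfl
      change Form.lift (fock_braided q n) _ (vac q n) d' i' = _ at this
      rw [fockY_succ, this, map_zero]
    · rw [evF, ← X_mul_ev _ _ j h' y]
      change Form.lift (fock_braided q n) _ (vac q n) d' i' = _
      rw [lift_X_mul]
      rcases d' with _ | d'
      · rfl
      have := ih (i := i) (d' := d') (i' := i') (by omega) y h'
      change Form.lift (fock_braided q n) _ (vac q n) d' i' = _ at this
      rw [fockX_succ, this, map_zero]

/-- Two linear maps on forms agree if they agree on the homogeneous forms. -/
lemma Form.ext_homogeneous {M : Type*} [AddCommGroup M] [Module K M] {f g : Form q n →ₗ[K] M}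
    (H : ∀ d i (y : Tens K n d), f (evF q n d i y) = g (evF q n d i y)) : f = g := by
  have key := Form.mem_of_mul_mem (q := q) (n := n)
    (⨆ p : ℕ × ℕ, LinearMap.range (evF q n p.1 p.2)) ?_ ?_ ?_
  · refine LinearMap.ext fun a => ?_
    have : (⨆ p : ℕ × ℕ, LinearMap.range (evF q n p.1 p.2)) ≤ LinearMap.eqLocus f g :=
      iSup_le fun p => by
        rintro _ ⟨y, rfl⟩
        exact H _ _ y
    exact this (key a)
  · refine Submodule.mem_iSup_of_mem (0, 0) ⟨Finsupp.single Fin.elim0 1, ?_⟩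
    rw [evF, ev_of_le _ _ le_rfl, evT_single]
    rfl
  · intro j a ha
    suffices h : (⨆ p : ℕ × ℕ, LinearMap.range (evF q n p.1 p.2)) ≤
        (⨆ p : ℕ × ℕ, LinearMap.range (evF q n p.1 p.2)).comap
          (LinearMap.mulLeft K (Form.X q j)) from h ha
    refine iSup_le fun p => ?_
    rintro _ ⟨y, rfl⟩
    rw [Submodule.mem_comap, LinearMap.mulLeft_apply]
    rcases Nat.lt_or_ge p.1 p.2 with h | h
    · simp [ev, h.not_ge]
    · rw [evF, X_mul_ev _ _ j h]
      exact Submodule.mem_iSup_of_mem (p.1 + 1, p.2) ⟨_, rfl⟩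
  · intro j a ha
    suffices h : (⨆ p : ℕ × ℕ, LinearMap.range (evF q n p.1 p.2)) ≤
        (⨆ p : ℕ × ℕ, LinearMap.range (evF q n p.1 p.2)).comap
          (LinearMap.mulLeft K (Form.Y q j)) from h ha
    refine iSup_le fun p => ?_
    rintro _ ⟨y, rfl⟩
    rw [Submodule.mem_comap, LinearMap.mulLeft_apply, evF, Y_mul_ev (Form.braided q n)]
    exact Submodule.mem_iSup_of_mem (p.1 + 1, p.2 + 1) ⟨_, rfl⟩

end Fock

/-! ### `Ω` inside the algebra of forms. -/

section OmegaEvaluation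

open QFun

variable {K : Type u} [Field K] {d : ℕ} {q : Kˣ}

/-- The embedding of `Ω^i_d(n)` in an algebra of forms. -/
def evO (q : Kˣ) (d i : ℕ) (N : Source q d) : (Omega q d i).at' N →ₗ[K] Form q N.dim :=
  (rel q N.dim d i).liftQ (evF q N.dim d i) ((Form.braided q N.dim).rel_le_ker d i)

lemma evO_mk (i : ℕ) (N : Source q d) (y : Tens K N.dim d) :
    evO q d i N (Omega.mk q d i N y) = evF q N.dim d i y := rfl

lemma part_evO (i : ℕ) (N : Source q d) (z : (Omega q d i).at' N) :
    part q N.dim d i (evO q d i N z) = z := by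
  obtain ⟨y, rfl⟩ := Omega.mk_surjective q d i N z
  exact part_ev d i y

lemma evO_injective (i : ℕ) (N : Source q d) : Function.Injective (evO q d i N) :=
  Function.LeftInverse.injective (part_evO i N)

lemma dR_evO (i : ℕ) (N : Source q d) (z : (Omega q d i).at' N) :
    evO q d (i + 1) N (app (deRhamD q d i) N z) = dR q N.dim (evO q d i N z) := by
  obtain ⟨y, rfl⟩ := Omega.mk_surjective q d i N z
  exact (dR_ev d i y).symm

lemma kz_evO (i : ℕ) (N : Source q d) (z : (Omega q d (i + 1)).at' N) :
    evO q d i N (app (koszulD q d i) N z) = kz q N.dim (evO q d (i + 1) N z) := by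
  obtain ⟨y, rfl⟩ := Omega.mk_surjective q d (i + 1) N z
  exact (kz_ev d i y).symm

/-- `dR` is homogeneous. A primitive of a homogeneous form can therefore be replaced by its
component of the right bidegree, and exactness may be tested in the whole algebra. -/
lemma part_dR_succ (n d i : ℕ) (a : Form q n) :
    part q n d (i + 1) (dR q n a) = (rel q n d i).mapQ (rel q n d (i + 1)) (symShuffle q (d - i))
      (symShuffle_rel q n d i) (part q n d i a) := by
  refine LinearMap.congr_fun (Form.ext_homogeneous (f := part q n d (i + 1) ∘ₗ dR q n)
    (g := (rel q n d i).mapQ (rel q n d (i + 1)) (symShuffle q (d - i))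
      (symShuffle_rel q n d i) ∘ₗ part q n d i) fun d' i' y => ?_) a
  simp only [LinearMap.comp_apply]
  rw [dR_ev]
  by_cases h : d' = d ∧ i' = i
  · obtain ⟨rfl, rfl⟩ := h
    rw [part_ev, part_ev]
    rfl
  · rw [part_ev_of_ne h, part_ev_of_ne (by omega), map_zero]

lemma part_dR_zero (d n : ℕ) (a : Form q n) : part q n d 0 (dR q n a) = 0 := by
  refine LinearMap.congr_fun (Form.ext_homogeneous (f := part q n d 0 ∘ₗ dR q n)
    (g := 0) fun d' i' y => ?_) a
  simp only [LinearMap.comp_apply]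
  rw [dR_ev, part_ev_of_ne (by omega)]
  rfl

/-- An element of `Ω^i_d(n)` is a coboundary if it is one in the algebra of forms. -/
lemma mem_coboundaries (i : ℕ) (N : Source q d) (z : (Omega q d i).at' N) (a : Form q N.dim)
    (h : evO q d i N z = dR q N.dim a) : z ∈ ((deRham q d).coboundaries i).carrier N := by
  have e := congrArg (part q N.dim d i) h
  rw [part_evO] at e
  cases i with
  | zero =>
    rw [part_dR_zero] at e
    exact e
  | succ i => exact ⟨part q N.dim d i a, by rw [e, part_dR_succ]; rfl⟩

lemma evO_coboundary (i : ℕ) (N : Source q d) {z : (Omega q d i).at' N}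
    (h : z ∈ ((deRham q d).coboundaries i).carrier N) :
    ∃ a, evO q d i N z = dR q N.dim a := by
  cases i with
  | zero =>
    have h : z = 0 := h
    exact ⟨0, by rw [h, map_zero, map_zero]⟩
  | succ i =>
    obtain ⟨y, rfl⟩ := h
    exact ⟨_, dR_evO i N y⟩

end OmegaEvaluation

end

end QPF

namespace QPF

noncomputable section

/-! ### Products over the letters in increasing order. -/

section OrderedProducts

variable {K : Type u} [Field K] {n : ℕ} {A : Type*} [Ring A] [Algebra K A]

lemma ofFn_smul (c : Fin n → K) (F : Fin n → A) :
    (List.ofFn fun k => c k • F k).prod = (∏ k, c k) • (List.ofFn F).prod := by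
  induction n with
  | zero => simp
  | succ n ih =>
    rw [List.ofFn_succ, List.prod_cons, ih, List.ofFn_succ, List.prod_cons, smul_mul_smul_comm,
      Fin.prod_univ_succ]

/-- The factor `x` travels over the factors before `j`, collecting their scalars, and is absorbed in
the factor at `j`. -/
lemma mul_ofFn_prod (x : A) (G : Fin n → A) (j : Fin n) (c : Fin n → K)
    (h : ∀ k, k < j → x * G k = c k • (G k * x)) :
    x * (List.ofFn G).prod = (∏ k, if k < j then c k else 1) •
      (List.ofFn (Function.update G j (x * G j))).prod := by
  induction n with
  | zero => exact j.elim0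
  | succ n ih =>
    rw [List.ofFn_succ, List.prod_cons, List.ofFn_succ, List.prod_cons, Fin.prod_univ_succ]
    induction j using Fin.cases with
    | zero =>
      have e : (fun k : Fin n => Function.update G 0 (x * G 0) k.succ) = fun k => G k.succ := by
        funext k
        rw [Function.update_of_ne (Fin.succ_ne_zero k)]
      rw [e, Function.update_self, mul_assoc]
      simp
    | succ j =>
      have e : (fun k : Fin n => Function.update G j.succ (x * G j.succ) k.succ) =
          Function.update (fun k => G k.succ) j (x * G j.succ) := by
        funext k
        simp only [Function.update_apply, Fin.succ_inj]
      have := ih (fun k => G k.succ) j (fun k => c k.succ) fun k hk =>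
        h _ (Fin.succ_lt_succ_iff.2 hk)
      rw [e, ← mul_assoc, h 0 (Fin.succ_pos j), smul_mul_assoc, mul_assoc, this,
        Function.update_of_ne (Fin.succ_ne_zero j).symm, mul_smul_comm, smul_smul]
      simp only [Fin.succ_pos, if_true, Fin.succ_lt_succ_iff]

lemma ofFn_prod_mul_comm (x : A) (F : Fin n → A) (c : Fin n → K)
    (h : ∀ k, F k * x = c k • (x * F k)) :
    (List.ofFn F).prod * x = (∏ k, c k) • (x * (List.ofFn F).prod) := by
  induction n with
  | zero => simp
  | succ n ih =>
    rw [List.ofFn_succ, List.prod_cons, mul_assoc, ih _ _ fun k => h k.succ, mul_smul_comm,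
      ← mul_assoc, h, Fin.prod_univ_succ, mul_smul, smul_mul_assoc, mul_assoc, smul_comm]

lemma ofFn_prod_mul (x : A) (G : Fin n → A) (j : Fin n) (c : Fin n → K)
    (h : ∀ k, j < k → G k * x = c k • (x * G k)) :
    (List.ofFn G).prod * x = (∏ k, if j < k then c k else 1) •
      (List.ofFn (Function.update G j (G j * x))).prod := by
  induction n with
  | zero => exact j.elim0
  | succ n ih =>
    rw [List.ofFn_succ, List.prod_cons, List.ofFn_succ, List.prod_cons, Fin.prod_univ_succ]
    induction j using Fin.cases with
    | zero =>
      have e : (fun k : Fin n => Function.update G 0 (G 0 * x) k.succ) = fun k => G k.succ := by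
        funext k
        rw [Function.update_of_ne (Fin.succ_ne_zero k)]
      rw [e, Function.update_self, mul_assoc,
        ofFn_prod_mul_comm x _ (fun k => c k.succ) fun k => h _ (Fin.succ_pos k)]
      simp [mul_assoc]
    | succ j =>
      have e : (fun k : Fin n => Function.update G j.succ (G j.succ * x) k.succ) =
          Function.update (fun k => G k.succ) j (G j.succ * x) := by
        funext k
        simp only [Function.update_apply, Fin.succ_inj]
      have := ih (fun k => G k.succ) j (fun k => c k.succ) fun k hk =>
        h _ (Fin.succ_lt_succ_iff.2 hk)
      rw [e, mul_assoc, this, Function.update_of_ne (Fin.succ_ne_zero j).symm, mul_smul_comm]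
      simp [Fin.succ_lt_succ_iff]

lemma ofFn_mul_ofFn (F G : Fin n → A) (h : ∀ k j, k < j → Commute (F j) (G k)) :
    (List.ofFn F).prod * (List.ofFn G).prod = (List.ofFn fun k => F k * G k).prod := by
  induction n with
  | zero => simp
  | succ n ih =>
    have e : Commute (List.ofFn fun k : Fin n => F k.succ).prod (G 0) :=
      Commute.list_prod_left _ _ fun x hx => by
        obtain ⟨k, rfl⟩ := List.mem_ofFn.1 hx
        exact h 0 k.succ (Fin.succ_pos k)
    rw [List.ofFn_succ, List.prod_cons, List.ofFn_succ, List.prod_cons, List.ofFn_succ,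
      List.prod_cons, ← ih _ _ fun k j hkj => h _ _ (Fin.succ_lt_succ_iff.2 hkj), mul_assoc,
      ← mul_assoc _ (G 0), e.eq]
    simp only [mul_assoc]

/-- Iterated Leibniz rule: `σ` acts on the factors before the differentiated one and `τ` on those
after it. -/
lemma TwistedDer.ofFn_prod (D : TwistedDer K A) (F : Fin n → A) :
    D.δ (List.ofFn F).prod = ∑ j, (List.ofFn fun k =>
      if k < j then D.σ (F k) else if j < k then D.τ (F k) else D.δ (F k)).prod := by
  induction n with
  | zero => simpa using D.map_one
  | succ n ih =>
    rw [List.ofFn_succ, List.prod_cons, D.leibniz, ih, Fin.sum_univ_succ, add_comm, Finset.mul_sum]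
    congr 1
    · rw [List.ofFn_succ, List.prod_cons, map_list_prod, List.map_ofFn]
      simp
      rfl
    · refine Finset.sum_congr rfl fun j _ => ?_
      rw [List.ofFn_succ, List.prod_cons]
      simp [Fin.succ_lt_succ_iff]

/-- Each letter `a` to the right of the differentiated one contributes `q` through `τ` and another
`q` when `b` is moved over it. This is why the quantum integer is taken at `q²`. -/
lemma TwistedDer.pow (D : TwistedDer K A) {q : K} {a b : A} (h : b * a = q • (a * b))
    (hσ : D.σ a = a) (hτ : D.τ a = q • a) (hδ : D.δ a = b) (m : ℕ) :
    D.δ (a ^ m) = (∑ s ∈ Finset.range m, (q ^ 2) ^ s) • (a ^ (m - 1) * b) := by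
  induction m with
  | zero => simpa using D.map_one
  | succ m ih =>
    rw [_root_.pow_succ, D.leibniz, map_pow, hσ, hδ, hτ, ih, Nat.add_sub_cancel, Finset.sum_range_succ',
      smul_mul_smul_comm, mul_assoc, h, mul_smul_comm, smul_smul, ← mul_assoc]
    rcases Nat.eq_zero_or_pos m with rfl | hm
    · simp
    · rw [← _root_.pow_succ, Nat.sub_add_cancel hm, add_comm, add_smul, Finset.sum_mul, Finset.sum_mul]
      congr 2
      · exact Finset.sum_congr rfl fun s _ => by ring
      · simp

end OrderedProducts

/-! ### Operators on monomials that change one letter. -/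

section Sites

variable (K : Type u) [Field K] {n : ℕ}

/-- The states of a letter: its multiplicity in the symmetric part and whether it occurs in the
exterior part. -/
abbrev State : Type := ℕ × Bool

/-- The space with basis the pairs of a monomial in the symmetric algebra and one in the exterior
algebra. -/
abbrev Mono (n : ℕ) : Type u := (Fin n → State) →₀ K

/-- An operator that changes the state of one letter, with coefficients to the left and to the
right of it. -/
structure Site where
  l : State → K
  r : State → K
  v : State → K
  φ : State → State

variable {K}

namespace Site

/-- The coefficient for the state of the letter `k` of the operator at `j`. -/
def coe (a : Site K) (j k : Fin n) : State → K :=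
  if k < j then a.l else if j < k then a.r else a.v

lemma coe_lt (a : Site K) {j k : Fin n} (h : k < j) : a.coe j k = a.l := if_pos h

lemma coe_gt (a : Site K) {j k : Fin n} (h : j < k) : a.coe j k = a.r := by
  rw [coe, if_neg h.not_gt, if_pos h]

lemma coe_self (a : Site K) (j : Fin n) : a.coe j j = a.v := by simp [coe]

/-- The operator at the letter `j`. -/
def op (a : Site K) (j : Fin n) : Module.End K (Mono K n) :=
  Finsupp.linearCombination K fun f =>
    (∏ k, a.coe j k (f k)) • Finsupp.single (Function.update f j (a.φ (f j))) 1

lemma op_single (a : Site K) (j : Fin n) (f : Fin n → State) :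
    a.op j (Finsupp.single f 1) =
      (∏ k, a.coe j k (f k)) • Finsupp.single (Function.update f j (a.φ (f j))) 1 := by
  simp [op]

lemma op_op_single (a b : Site K) (j k : Fin n) (f : Fin n → State) :
    b.op k (a.op j (Finsupp.single f 1)) =
      (∏ x, a.coe j x (f x) * b.coe k x (Function.update f j (a.φ (f j)) x)) •
      Finsupp.single (Function.update (Function.update f j (a.φ (f j))) k
        (b.φ (Function.update f j (a.φ (f j)) k))) 1 := by
  rw [op_single, map_smul, op_single, smul_smul, Finset.prod_mul_distrib]

lemma end_ext {f g : Module.End K (Mono K n)}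
    (h : ∀ s, f (Finsupp.single s 1) = g (Finsupp.single s 1)) : f = g :=
  Finsupp.lhom_ext' fun s => LinearMap.ext_ring (h s)

/-- Commutation of operators at different letters. -/
lemma op_mul_op (a b : Site K) {j k : Fin n} (hjk : j < k) (α β : K)
    (h1 : ∀ s, a.v s * b.l (a.φ s) = α * (b.l s * a.v s))
    (h2 : ∀ s, b.v s * a.r (b.φ s) = β * (a.r s * b.v s)) :
    β • (b.op k * a.op j) = α • (a.op j * b.op k) := by
  refine end_ext fun f => ?_
  simp only [LinearMap.smul_apply, Module.End.mul_apply]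
  rw [op_op_single, op_op_single, smul_smul, smul_smul]
  congr 1
  · have e : ∀ x, (if x = k then β else 1) *
        (a.coe j x (f x) * b.coe k x (Function.update f j (a.φ (f j)) x)) =
        (if x = j then α else 1) *
          (b.coe k x (f x) * a.coe j x (Function.update f k (b.φ (f k)) x)) := by
      intro x
      rcases eq_or_ne x j with rfl | hx
      · rw [Function.update_self, Function.update_of_ne hjk.ne, if_neg hjk.ne, if_pos rfl,
          coe_self, coe_lt b hjk, h1, one_mul]
      rcases eq_or_ne x k with rfl | hx'
      · rw [Function.update_self, Function.update_of_ne hjk.ne', if_neg hjk.ne', if_pos rfl,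
          coe_self, coe_gt a hjk, h2, one_mul]
      · rw [Function.update_of_ne hx, Function.update_of_ne hx', if_neg hx, if_neg hx', mul_comm (b.coe k x _)]
    have := Finset.prod_congr (rfl : (Finset.univ : Finset (Fin n)) = _) fun x _ => e x
    rw [Finset.prod_mul_distrib (f := fun x => if x = k then β else 1),
      Finset.prod_mul_distrib (f := fun x => if x = j then α else 1), Finset.prod_ite_eq',
      Finset.prod_ite_eq', if_pos (Finset.mem_univ _), if_pos (Finset.mem_univ _)] at this
    exact this
  · rw [Function.update_of_ne hjk.ne', Function.update_of_ne hjk.ne,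
      Function.update_comm hjk.ne]

variable (q : Kˣ)

/-- The coefficient of the exterior sign. -/
def sgn (s : State) : K := if s.2 then -(q : K)⁻¹ else 1

/-- Multiplication by a letter of the symmetric algebra. -/
def X : Site K := ⟨fun s => (q : K) ^ s.1, fun _ => 1, fun _ => 1, fun s => (s.1 + 1, s.2)⟩

/-- Multiplication by a letter of the exterior algebra. -/
def Y : Site K := ⟨sgn q, fun _ => 1, fun s => if s.2 then 0 else 1, fun s => (s.1, true)⟩

/-- The components of the de Rham differential. -/
def D : Site K := ⟨sgn q, fun s => (q : K) ^ s.1,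
  fun s => if s.2 then 0 else ∑ t ∈ Finset.range s.1, ((q : K) ^ 2) ^ t, fun s => (s.1 - 1, true)⟩

/-- The components of the Koszul differential. -/
def κ : Site K := ⟨sgn q, fun s => (q : K) ^ s.1, fun s => if s.2 then 1 else 0,
  fun s => (s.1 + 1, false)⟩

lemma X_comm {j k : Fin n} (h : j < k) : (X q).op k * (X q).op j = (q : K) • ((X q).op j * (X q).op k) := by
  have := op_mul_op (X q) (X q) h q 1 (fun s => by simp [X, pow_succ, mul_comm]) (fun s => by simp [X])
  rwa [one_smul] at this

lemma Y_comm {j k : Fin n} (h : j < k) :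
    (Y q).op k * (Y q).op j = -(q : K)⁻¹ • ((Y q).op j * (Y q).op k) := by
  have := op_mul_op (Y q) (Y q) h (-(q : K)⁻¹) 1 (fun s => by rcases s with ⟨a, _ | _⟩ <;> simp [Y, sgn])
    (fun s => by simp [Y])
  rwa [one_smul] at this

/-- The operator at one letter vanishes twice if its second application has coefficient zero. -/
lemma op_mul_self (a : Site K) (h : ∀ s, a.v s * a.v (a.φ s) = 0) (j : Fin n) :
    a.op j * a.op j = 0 := by
  refine end_ext fun f => ?_
  rw [Module.End.mul_apply, op_op_single, Finset.prod_eq_zero (Finset.mem_univ j), zero_smul]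
  · rfl
  · rw [coe_self, Function.update_self, h]

/-- No braiding relation is claimed: in a word of `S ⊗ Λ` the letters `X` already precede the
letters `Y`, so these relations suffice for a normal form. -/
lemma symExt (n : ℕ) : SymExt q ((X q).op (n := n)) (Y q).op := by
  have hq : (q : K) ≠ 0 := q.ne_zero
  refine ⟨fun i j => ?_, fun i => ?_, fun i j hij => ?_⟩
  · rcases lt_trichotomy i j with h | rfl | h
    · rw [coef_lt q h, X_comm q h]; module
    · rw [coef_self]; module
    · rw [coef_gt q h, X_comm q h]
      match_scalars
      field_simp
      ring
  · exact op_mul_self _ (fun s => by simp [Y]) i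
  · rw [Y_comm q hij]
    match_scalars
    field_simp
    ring

end Site

end Sites

end

end QPF

namespace QPF

noncomputable section

/-! ### Normal forms of tensors. -/

section NormalForm

variable {K : Type u} [Field K] {n : ℕ} {A : Type*} [Ring A] [Algebra K A]

/-- The ordered monomials in two families of elements of an algebra. -/
def gen (X Y : Fin n → A) : Mono K n →ₗ[K] A :=
  Finsupp.linearCombination K fun f =>
    (List.ofFn fun k => X k ^ (f k).1).prod * (List.ofFn fun k => Y k ^ (f k).2.toNat).prod

lemma gen_single (X Y : Fin n → A) (f : Fin n → State) :
    gen X Y (Finsupp.single f (1 : K)) =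
      (List.ofFn fun k => X k ^ (f k).1).prod * (List.ofFn fun k => Y k ^ (f k).2.toNat).prod := by
  simp [gen]

/-- The ordered monomials in one family, indexed by the exterior parts of the states. -/
def genY (Y : Fin n → A) : Mono K n →ₗ[K] A :=
  Finsupp.linearCombination K fun f => (List.ofFn fun k => Y k ^ (f k).2.toNat).prod

lemma genY_single (Y : Fin n → A) (f : Fin n → State) :
    genY Y (Finsupp.single f (1 : K)) = (List.ofFn fun k => Y k ^ (f k).2.toNat).prod := by
  simp [genY]

variable {r : Kˣ} {X Y : Fin n → A}

lemma SymExt.X_qcomm (h : SymExt r X Y) {k j : Fin n} (hkj : k < j) :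
    X j * X k = (r : K) • (X k * X j) := by
  have := h.sym k j
  rwa [coef_lt r hkj, zero_smul, zero_add] at this

lemma SymExt.Y_qcomm (h : SymExt r X Y) {k j : Fin n} (hkj : k < j) :
    Y j * Y k = -(r : K)⁻¹ • (Y k * Y j) := by
  have hr : (r : K) ≠ 0 := r.ne_zero
  have h1 := congrArg (fun a => (r : K)⁻¹ • a) (h.ext k j hkj)
  simp only [smul_add, smul_smul, inv_mul_cancel₀ hr, one_smul, smul_zero] at h1
  rw [neg_smul, eq_neg_iff_add_eq_zero, ← h1, add_comm]

lemma Y_pow_qcomm (hl : ∀ k j : Fin n, k < j → Y j * Y k = -(r : K)⁻¹ • (Y k * Y j))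
    {k j : Fin n} (hkj : k < j) (s : State) :
    Y j * Y k ^ s.2.toNat = Site.sgn r s • (Y k ^ s.2.toNat * Y j) := by
  rcases s with ⟨a, _ | _⟩
  · simp [Site.sgn]
  · simpa [Site.sgn] using hl k j hkj

/-- Sorting the new letter into its place costs one factor `r` for each symmetric letter smaller
than `j`, which is the left coefficient of `Site.X`. -/
lemma SymExt.X_mul_gen (h : SymExt r X Y) (j : Fin n) (p : Mono K n) :
    X j * gen X Y p = gen X Y ((Site.X r).op j p) := by
  suffices H : (LinearMap.mulLeft K (X j)).comp (gen X Y) = (gen X Y).comp ((Site.X r).op j) from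
    LinearMap.congr_fun H p
  refine Finsupp.lhom_ext' fun f => LinearMap.ext_ring ?_
  simp only [LinearMap.comp_apply, Finsupp.lsingle_apply, LinearMap.mulLeft_apply]
  rw [Site.op_single, map_smul, gen_single, gen_single, ← mul_assoc,
    mul_ofFn_prod (X j) _ j (fun k => (r : K) ^ (f k).1) fun k hk =>
      mul_pow_of_comm (h.X_qcomm hk) _, smul_mul_assoc]
  have e1 : (∏ k, if k < j then (r : K) ^ (f k).1 else 1) =
      ∏ k, (Site.X r).coe j k (f k) := by
    refine Finset.prod_congr rfl fun k _ => ?_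
    simp only [Site.coe, Site.X]
    split_ifs <;> rfl
  have e2 : Function.update (fun k => X k ^ (f k).1) j (X j * X j ^ (f j).1) =
      fun k => X k ^ (Function.update f j ((Site.X r).φ (f j)) k).1 := by
    funext k
    rcases eq_or_ne k j with rfl | hk
    · simp [Site.X, pow_succ']
    · simp [hk]
  have e3 : (fun k => Y k ^ (f k).2.toNat) =
      fun k => Y k ^ (Function.update f j ((Site.X r).φ (f j)) k).2.toNat := by
    funext k
    rcases eq_or_ne k j with rfl | hk
    · simp [Site.X]
    · simp [hk]
  rw [e1, e2, e3]

lemma SymExt.Y_mul_ofFn (h : SymExt r X Y) (j : Fin n) (p : Mono K n) :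
    Y j * genY Y p = genY Y ((Site.Y r).op j p) := by
  suffices H : (LinearMap.mulLeft K (Y j)).comp (genY Y) = (genY Y).comp ((Site.Y r).op j) from
    LinearMap.congr_fun H p
  refine Finsupp.lhom_ext' fun f => LinearMap.ext_ring ?_
  simp only [LinearMap.comp_apply, Finsupp.lsingle_apply, LinearMap.mulLeft_apply]
  rw [Site.op_single, map_smul, genY_single, genY_single,
    mul_ofFn_prod (Y j) _ j (fun k => Site.sgn r (f k)) fun k hk =>
      Y_pow_qcomm (fun _ _ => h.Y_qcomm) hk _]
  rcases hf : (f j).2 with _ | _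
  · congr 1
    · refine Finset.prod_congr rfl fun k _ => ?_
      simp only [Site.coe, Site.Y]
      split_ifs with h1 h2
      · rfl
      · rfl
      · obtain rfl : k = j := le_antisymm (not_lt.1 h2) (not_lt.1 h1)
        simp_all
    · congr 2
      funext k
      rcases eq_or_ne k j with rfl | hk
      · simp [Site.Y]
      · simp [hk]
  -- The letter `j` already occurs, and both sides vanish.
  · rw [Finset.prod_eq_zero (f := fun k => (Site.Y r).coe j k (f k)) (Finset.mem_univ j)
      (by simp [Site.coe, Site.Y, hf]), zero_smul, List.prod_eq_zero, smul_zero]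
    exact List.mem_ofFn.2 ⟨j, by simp [h.ext_self j]⟩

/-- The vacuum. -/
def vacM (K : Type u) [Field K] (n : ℕ) : Mono K n := Finsupp.single (fun _ => (0, false)) 1

/-- The normal form of a tensor with respect to the relations of `S^{d-i} ⊗ Λ^i`. -/
def nf (r : Kˣ) (n d i : ℕ) : Tens K n d →ₗ[K] Mono K n :=
  (LinearMap.applyₗ (vacM K n)).comp (ev (Site.X r).op (Site.Y r).op d i)

lemma nf_apply (d i : ℕ) (y : Tens K n d) :
    nf r n d i y = ev (Site.X r).op (Site.Y r).op d i y (vacM K n) := rfl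

lemma Y_mul_ev_self {A : Type*} [Ring A] [Algebra K A] (X Y : Fin n → A) (j : Fin n) {d : ℕ}
    (y : Tens K n d) : ev X Y (d + 1) (d + 1) (consT K j y) = Y j * ev X Y d d y := by
  suffices H : (ev X Y (d + 1) (d + 1)).comp (consT K j) =
      (LinearMap.mulLeft K (Y j)).comp (ev X Y d d) from LinearMap.congr_fun H y
  refine Finsupp.lhom_ext' fun w => LinearMap.ext_ring ?_
  simp only [LinearMap.comp_apply, Finsupp.lsingle_apply, LinearMap.mulLeft_apply]
  rw [consT_single, ev_of_le _ _ le_rfl, ev_of_le _ _ le_rfl, evT_single, evT_single,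
    List.ofFn_succ, List.prod_cons]
  simp [letters]

lemma nf_consT_X (j : Fin n) {d i : ℕ} (hi : i ≤ d) (y : Tens K n d) :
    nf r n (d + 1) i (consT K j y) = (Site.X r).op j (nf r n d i y) := by
  rw [nf_apply, ← X_mul_ev _ _ j hi, Module.End.mul_apply, nf_apply]

lemma nf_consT_Y (j : Fin n) {d : ℕ} (y : Tens K n d) :
    nf r n (d + 1) (d + 1) (consT K j y) = (Site.Y r).op j (nf r n d d y) := by
  rw [nf_apply, Y_mul_ev_self, Module.End.mul_apply, nf_apply]

/-- The projection that forgets the symmetric parts of the states. -/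
def forget (K : Type u) [Field K] (n : ℕ) : Mono K n →ₗ[K] Mono K n :=
  Finsupp.lmapDomain K K fun f k => (0, (f k).2)

lemma forget_Y (j : Fin n) (p : Mono K n) :
    forget K n ((Site.Y r).op j p) = (Site.Y r).op j (forget K n p) := by
  suffices H : (forget K n).comp ((Site.Y r).op j) = ((Site.Y r).op j).comp (forget K n) from
    LinearMap.congr_fun H p
  refine Finsupp.lhom_ext' fun f => LinearMap.ext_ring ?_
  simp only [LinearMap.comp_apply, Finsupp.lsingle_apply]
  rw [Site.op_single, map_smul]
  simp only [forget, Finsupp.lmapDomain_apply, Finsupp.mapDomain_single]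
  rw [Site.op_single]
  have e1 : ∏ k, (Site.Y r).coe j k (f k) = ∏ k, (Site.Y r).coe j k (0, (f k).2) := by
    refine Finset.prod_congr rfl fun k _ => ?_
    simp only [Site.coe, Site.Y]
    split_ifs <;> simp [Site.sgn]
  have e2 : (fun k => ((0 : ℕ), (Function.update f j ((Site.Y r).φ (f j)) k).2)) =
      Function.update (fun k => (0, (f k).2)) j ((Site.Y r).φ (0, (f j).2)) := by
    funext k
    rcases eq_or_ne k j with rfl | hk
    · simp [Site.Y]
    · simp [hk]
  rw [e1, e2]

lemma gen_forget (X Y : Fin n → A) (p : Mono K n) : gen X Y (forget K n p) = genY Y p := by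
  suffices H : (gen X Y).comp (forget K n) = genY Y from LinearMap.congr_fun H p
  refine Finsupp.lhom_ext' fun f => LinearMap.ext_ring ?_
  simp only [LinearMap.comp_apply, Finsupp.lsingle_apply]
  simp only [forget, Finsupp.lmapDomain_apply, Finsupp.mapDomain_single, gen_single, genY_single]
  simp

lemma tens_zero_ext {M : Type*} [AddCommGroup M] [Module K M] {f g : Tens K n 0 →ₗ[K] M}
    (h : f (Finsupp.single Fin.elim0 1) = g (Finsupp.single Fin.elim0 1)) : f = g := by
  refine Finsupp.lhom_ext' fun w => LinearMap.ext_ring ?_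
  rw [Subsingleton.elim w Fin.elim0]
  exact h

lemma nf_zero : nf r n 0 0 (Finsupp.single Fin.elim0 1) = vacM K n := by
  rw [nf_apply, ev_of_le _ _ le_rfl, evT_single]
  simp

/-- A word of exterior letters only never changes a symmetric multiplicity, so its value can be
computed with `genY` instead of `gen`. -/
lemma forget_nf (d : ℕ) (y : Tens K n d) : forget K n (nf r n d d y) = nf r n d d y := by
  induction d with
  | zero =>
    refine LinearMap.congr_fun (f := (forget K n).comp (nf r n 0 0)) (tens_zero_ext ?_) y
    rw [LinearMap.comp_apply, nf_zero, vacM]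
    simp [forget]
  | succ d ih =>
    refine LinearMap.congr_fun (f := (forget K n).comp (nf r n _ _)) (consT_induction fun j y => ?_) y
    rw [LinearMap.comp_apply, nf_consT_Y, forget_Y, ih]

/-- Evaluation of tensors factors through their normal form. -/
lemma SymExt.gen_nf (h : SymExt r X Y) (d i : ℕ) (hi : i ≤ d) (y : Tens K n d) :
    gen X Y (nf r n d i y) = ev X Y d i y := by
  -- At `d = i` all letters are exterior; every further letter is put in front and is symmetric.
  induction d, hi using Nat.le_induction with
  | base =>
    rw [← forget_nf, gen_forget]
    induction i with
    | zero =>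
      refine LinearMap.congr_fun (f := (genY Y).comp (nf r n 0 0)) (tens_zero_ext ?_) y
      rw [LinearMap.comp_apply, nf_zero, vacM, genY_single, ev_of_le _ _ le_rfl, evT_single]
      simp
    | succ d ih =>
      refine LinearMap.congr_fun (f := (genY Y).comp (nf r n _ _)) (consT_induction fun j y => ?_) y
      rw [LinearMap.comp_apply, nf_consT_Y, ← h.Y_mul_ofFn, ih, Y_mul_ev_self]
  | succ d hi ih =>
    refine LinearMap.congr_fun (f := (gen X Y).comp (nf r n _ _)) (consT_induction fun j y => ?_) y
    rw [LinearMap.comp_apply, nf_consT_X _ hi, ← h.X_mul_gen, ih, X_mul_ev _ _ _ hi]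

/-- The degree of a monomial. -/
def deg (f : Fin n → State) : ℕ := ∑ k, ((f k).1 + (f k).2.toNat)

/-- The exterior degree of a monomial. -/
def extDeg (f : Fin n → State) : ℕ := ∑ k, (f k).2.toNat

lemma extDeg_le (f : Fin n → State) : extDeg f ≤ deg f :=
  Finset.sum_le_sum fun _ _ => Nat.le_add_left _ _

lemma deg_update (f : Fin n → State) (j : Fin n) (s : State) :
    deg (Function.update f j s) + ((f j).1 + (f j).2.toNat) = deg f + (s.1 + s.2.toNat) := by
  have e : (fun k => (Function.update f j s k).1 + (Function.update f j s k).2.toNat) =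
      Function.update (fun k => (f k).1 + (f k).2.toNat) j (s.1 + s.2.toNat) := by
    funext k
    rcases eq_or_ne k j with rfl | hk
    · simp
    · simp [hk]
  rw [deg, e, Finset.sum_update_of_mem (Finset.mem_univ j), deg,
    ← Finset.sum_sdiff (Finset.subset_univ {j}) (f := fun k => (f k).1 + (f k).2.toNat),
    Finset.sum_singleton]
  omega

lemma extDeg_update (f : Fin n → State) (j : Fin n) (s : State) :
    extDeg (Function.update f j s) + (f j).2.toNat = extDeg f + s.2.toNat := by
  have e : (fun k => (Function.update f j s k).2.toNat) =
      Function.update (fun k => (f k).2.toNat) j s.2.toNat := by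
    funext k
    rcases eq_or_ne k j with rfl | hk
    · simp
    · simp [hk]
  rw [extDeg, e, Finset.sum_update_of_mem (Finset.mem_univ j), extDeg,
    ← Finset.sum_sdiff (Finset.subset_univ {j}) (f := fun k => (f k).2.toNat),
    Finset.sum_singleton]
  omega

lemma Site.sgn_ne_zero (r : Kˣ) (s : State) : Site.sgn r s ≠ 0 := by
  rw [Site.sgn]
  split_ifs
  · exact neg_ne_zero.2 (inv_ne_zero r.ne_zero)
  · exact one_ne_zero

lemma Site.exists_op (a : Site K) (j : Fin n) {f f' : Fin n → State}
    (h1 : Function.update f' j (a.φ (f' j)) = f) (h2 : ∀ k, a.coe j k (f' k) ≠ 0) :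
    ∃ c : K, a.op j (c • Finsupp.single f' 1) = Finsupp.single f 1 := by
  refine ⟨(∏ k, a.coe j k (f' k))⁻¹, ?_⟩
  rw [map_smul, Site.op_single, smul_smul,
    inv_mul_cancel₀ (Finset.prod_ne_zero_iff.2 fun k _ => h2 k), h1, one_smul]

/-- A letter is stripped off, a symmetric one as long as there is one and an exterior one after
that. The site operator that puts it back has a nonzero coefficient. -/
lemma exists_nf (r : Kˣ) (f : Fin n → State) :
    ∃ y, nf r n (deg f) (extDeg f) y = Finsupp.single f 1 := by
  obtain ⟨d, hd⟩ : ∃ d, d = deg f := ⟨_, rfl⟩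
  obtain ⟨i, hi⟩ : ∃ i, i = extDeg f := ⟨_, rfl⟩
  rw [← hd, ← hi]
  induction d generalizing f i with
  | zero =>
    have h0 : ∀ k, (f k).1 + (f k).2.toNat = 0 := fun k =>
      (Finset.sum_eq_zero_iff.1 hd.symm) k (Finset.mem_univ k)
    have : f = fun _ => (0, false) := by
      funext k
      have h1 := h0 k
      rcases hf : f k with ⟨a, _ | _⟩ <;> rw [hf] at h1 <;> simp at h1 ⊢
      exact h1
    subst this
    obtain rfl : i = 0 := by simpa [extDeg] using hi
    exact ⟨_, nf_zero⟩
  | succ d ih =>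
    by_cases hX : ∃ j, 0 < (f j).1
    · obtain ⟨j, hj⟩ := hX
      let f' := Function.update f j ((f j).1 - 1, (f j).2)
      have e1 : deg f' + _ = _ := deg_update f j ((f j).1 - 1, (f j).2)
      have e2 : extDeg f' + _ = _ := extDeg_update f j ((f j).1 - 1, (f j).2)
      dsimp only at e1 e2
      have hl := extDeg_le f'
      have d1 : d = deg f' := by omega
      have d2 : i = extDeg f' := by omega
      obtain ⟨c, hc⟩ := Site.exists_op (Site.X r) j (f' := f') (f := f) (by
          funext k
          rcases eq_or_ne k j with rfl | hk
          · simp [f', Site.X, Nat.sub_add_cancel hj]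
          · simp [f', hk]) (fun k => by
          simp only [Site.coe, Site.X]
          split_ifs <;> simp)
      obtain ⟨y, hy⟩ := ih f' d1 i d2
      exact ⟨consT K j (c • y), by rw [nf_consT_X _ (by omega), map_smul, hy, hc]⟩
    · push Not at hX
      have hX : ∀ k, (f k).1 = 0 := fun k => Nat.le_zero.1 (hX k)
      -- Without symmetric letters the degree is the exterior degree.
      have hdi : i = d + 1 := by rw [hi, hd]; simp [deg, extDeg, hX]
      obtain ⟨j, hj⟩ : ∃ j, (f j).2 = true := by
        by_contra! hc
        have : deg f = 0 := Finset.sum_eq_zero fun k _ => by simp [hX, hc]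
        omega
      let f' := Function.update f j (0, false)
      have e1 : deg f' + _ = _ := deg_update f j (0, false)
      have e2 : extDeg f' + _ = _ := extDeg_update f j (0, false)
      simp only [hj, hX, Bool.toNat_true, Bool.toNat_false] at e1 e2
      have d1 : d = deg f' := by omega
      have d2 : d = extDeg f' := by omega
      obtain ⟨c, hc⟩ := Site.exists_op (Site.Y r) j (f' := f') (f := f) (by
          funext k
          rcases eq_or_ne k j with rfl | hk
          · simp [f', Site.Y, Prod.ext_iff, hX, hj]
          · simp [f', hk]) (fun k => by
          simp only [Site.coe, Site.Y]
          split_ifs with h1 h2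
          · exact Site.sgn_ne_zero _ _
          · simp
          · obtain rfl : k = j := le_antisymm (not_lt.1 h2) (not_lt.1 h1)
            simp [f'])
      obtain ⟨y, hy⟩ := ih f' d1 d d2
      subst hdi
      exact ⟨consT K j (c • y), by rw [nf_consT_Y, map_smul, hy, hc]⟩

end NormalForm

end

end QPF

namespace QPF

noncomputable section

/-! ### The monomial basis of the algebra of forms and the differentials in it. -/

section Basis

variable {K : Type u} [Field K] {n : ℕ} {q : Kˣ}

/-- The normal form of an element of `S^{d-i} ⊗ Λ^i`. -/
def nfQ (q : Kˣ) (n d i : ℕ) : (Tens K n d ⧸ rel q n d i) →ₗ[K] Mono K n :=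
  (rel q n d i).liftQ (nf q n d i) fun y hy => by
    rw [LinearMap.mem_ker, nf_apply, (LinearMap.mem_ker.1 ((Site.symExt q n).rel_le_ker d i hy))]
    rfl

lemma nfQ_mk (d i : ℕ) (y : Tens K n d) : nfQ q n d i ((rel q n d i).mkQ y) = nf q n d i y := rfl

/-- The basis of the algebra of forms. -/
abbrev genF (q : Kˣ) (n : ℕ) : Mono K n →ₗ[K] Form q n := gen (Form.X q) (Form.Y q)

lemma gen_nfQ {A : Type*} [Ring A] [Algebra K A] {X Y : Fin n → A} (h : SymExt q X Y) (d i : ℕ)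
    (y : Tens K n d) : gen X Y (nfQ q n d i ((rel q n d i).mkQ y)) = ev X Y d i y := by
  rcases Nat.lt_or_ge d i with hi | hi
  · rw [quot_rel_eq_zero hi ((rel q n d i).mkQ y), ev, if_neg hi.not_ge]
    simp
  · rw [nfQ_mk, h.gen_nf d i hi]

/-- Each monomial is the normal form of a tensor of its own bidegree, so the round trip through
`Form` is the projection to one bidegree. -/
lemma nfQ_part_genF (d i : ℕ) (p : Mono K n) :
    nfQ q n d i (part q n d i (genF q n p)) = p.filter fun f => deg f = d ∧ extDeg f = i := by
  induction p using Finsupp.induction_linear with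
  | zero => simp only [map_zero]; exact (Finsupp.filter_zero _).symm
  | add f g hf hg => rw [map_add, map_add, map_add, hf, hg, Finsupp.filter_add]
  | single f c =>
    obtain ⟨y, hy⟩ := exists_nf q f
    have e : Finsupp.single f c = c • Finsupp.single f (1 : K) := by simp
    have e' := (Form.braided q n).toSymExt.gen_nf (deg f) (extDeg f) (extDeg_le f) y
    rw [hy] at e'
    rw [e, map_smul, e', map_smul, map_smul, Finsupp.filter_smul]
    congr 1
    by_cases h : deg f = d ∧ extDeg f = i
    · rw [Finsupp.filter_single_of_pos (fun f => deg f = d ∧ extDeg f = i) h]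
      obtain ⟨rfl, rfl⟩ := h
      rw [← hy, ← nfQ_mk, ← part_ev]
    · rw [Finsupp.filter_single_of_neg (fun f => deg f = d ∧ extDeg f = i) h]
      have := part_ev_of_ne (q := q) h y
      rw [evF] at this
      rw [this, map_zero]

/-- The coefficient at `f` is recovered from the component in the bidegree of `f`, so ordered
monomials are linearly independent. -/
lemma genF_injective : Function.Injective (genF q n) := by
  rw [injective_iff_map_eq_zero]
  intro p hp
  ext f
  have := nfQ_part_genF (q := q) (deg f) (extDeg f) p
  rw [hp, map_zero, map_zero] at this
  have h := congrArg (fun p => p f) this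
  rw [← Finsupp.filter_apply_pos (fun f' => deg f' = deg f ∧ extDeg f' = extDeg f) p ⟨rfl, rfl⟩]
  exact h.symm

/-- Forms are sums of evaluated tensors, and evaluation factors through the normal form. -/
lemma genF_surjective : Function.Surjective (genF q n) := by
  rw [← LinearMap.range_eq_top, ← Submodule.ker_mkQ (LinearMap.range (genF q n)),
    LinearMap.ker_eq_top]
  refine Form.ext_homogeneous fun d i y => ?_
  rw [LinearMap.zero_apply, Submodule.mkQ_apply, Submodule.Quotient.mk_eq_zero]
  exact ⟨_, gen_nfQ (Form.braided q n).toSymExt d i y⟩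

/-- The de Rham differential on monomials. -/
def dM (q : Kˣ) (n : ℕ) : Module.End K (Mono K n) := ∑ j, (Site.D q).op j

/-- The Koszul differential on monomials. -/
def kM (q : Kˣ) (n : ℕ) : Module.End K (Mono K n) := ∑ j, (Site.κ q).op j

lemma List.prod_ofFn_zero {A : Type*} [MonoidWithZero A] (F : Fin n → A) (j : Fin n) (h : F j = 0) :
    (List.ofFn F).prod = 0 :=
  List.prod_eq_zero (List.mem_ofFn.2 ⟨j, h⟩)

variable {A : Type*} [Ring A] [Algebra K A]

lemma ofFn_if_smul (j : Fin n) (c d : Fin n → K) (F : Fin n → A) (x : A) (e : K) :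
    (List.ofFn fun k => if k < j then c k • F k else if j < k then d k • F k else e • x).prod =
      (∏ k, if k < j then c k else if j < k then d k else e) •
        (List.ofFn (Function.update F j x)).prod := by
  rw [← ofFn_smul]
  congr 2
  funext k
  rcases lt_trichotomy k j with h | rfl | h
  · rw [if_pos h, if_pos h, Function.update_of_ne h.ne]
  · simp
  · rw [if_neg h.not_gt, if_pos h, if_neg h.not_gt, if_pos h, Function.update_of_ne h.ne']

lemma Form.Y_X_comm {k j : Fin n} (h : k < j) :
    Form.Y q k * Form.X q j = Form.X q j * Form.Y q k := by
  rw [(Form.braided q n).braid, coef_lt q h, zero_smul, zero_add]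

lemma prod_if_lt (j : Fin n) (c d : Fin n → K) (e : K) :
    ∏ k, (if k < j then c k else if j < k then d k else e) =
      (∏ k, if k < j then c k else 1) * (∏ k, if j < k then d k else 1) * e := by
  have : e = ∏ k, if k = j then e else 1 := by
    rw [Finset.prod_ite_eq', if_pos (Finset.mem_univ j)]
  conv_rhs => rw [this]
  rw [← Finset.prod_mul_distrib, ← Finset.prod_mul_distrib]
  refine Finset.prod_congr rfl fun k _ => ?_
  rcases lt_trichotomy k j with h | rfl | h
  · simp [h, h.ne, h.not_gt]
  · simp
  · simp [h, h.ne', h.not_gt]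

lemma prod_site_eq (j : Fin n) (a : Site K) (f : Fin n → State) :
    ∏ k, a.coe j k (f k) = (∏ k, if k < j then a.l (f k) else 1) *
      (∏ k, if j < k then a.r (f k) else 1) * a.v (f j) := by
  rw [← prod_if_lt]
  refine Finset.prod_congr rfl fun k _ => ?_
  rcases lt_trichotomy k j with h | rfl | h
  · simp [Site.coe, h]
  · simp [Site.coe]
  · simp [Site.coe, h, h.not_gt]

lemma Form.der_δ_X_pow (s : K) (j : Fin n) (m : ℕ) :
    (Form.der q n s 0).δ (Form.X q j ^ m) =
      (s * ∑ t ∈ Finset.range m, ((q : K) ^ 2) ^ t) • (Form.X q j ^ (m - 1) * Form.Y q j) := by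
  have hb : Form.Y q j * Form.X q j = (q : K) • (Form.X q j * Form.Y q j) := by
    rw [(Form.braided q n).braid, coef_self]
    module
  have := (Form.der q n s 0).pow (q := q) (a := Form.X q j) (b := s • Form.Y q j) (by
    rw [smul_mul_assoc, hb, mul_smul_comm, smul_comm]) (Form.der_σ_X _ _ _) (Form.der_τ_X _ _ _)
    (Form.der_δ_X _ _ _) m
  rw [this, mul_smul_comm, smul_smul, mul_comm]

lemma Form.der_δ_ofFn_Y (s : K) (f : Fin n → State) :
    (Form.der q n s 0).δ (List.ofFn fun k => Form.Y q k ^ (f k).2.toNat).prod = 0 := by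
  rw [TwistedDer.ofFn_prod]
  refine Finset.sum_eq_zero fun j _ => List.prod_ofFn_zero _ j ?_
  simp only [lt_irrefl, if_false]
  rcases (f j).2
  · simpa using (Form.der q n s 0).map_one
  · simp [Form.der_δ_Y]

lemma Form.der_δ_ofFn_X (t : K) (f : Fin n → State) :
    (Form.der q n 0 t).δ (List.ofFn fun k => Form.X q k ^ (f k).1).prod = 0 := by
  have h : ∀ j m, (Form.der q n 0 t).δ (Form.X q j ^ m) = 0 := fun j m => by
    induction m with
    | zero => simpa using (Form.der q n 0 t).map_one
    | succ m ih => rw [pow_succ, (Form.der q n 0 t).leibniz, ih, Form.der_δ_X]; simp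
  rw [TwistedDer.ofFn_prod]
  refine Finset.sum_eq_zero fun j _ => List.prod_ofFn_zero _ j ?_
  simp only [lt_irrefl, if_false, h]

lemma Form.Y_mul_ofFn (j : Fin n) (f : Fin n → State) :
    Form.Y q j * (List.ofFn fun k => Form.Y q k ^ (f k).2.toNat).prod =
      (∏ k, if k < j then Site.sgn q (f k) else 1) • (List.ofFn
        (Function.update (fun k => Form.Y q k ^ (f k).2.toNat) j
          (Form.Y q j * Form.Y q j ^ (f j).2.toNat))).prod :=
  mul_ofFn_prod _ _ j (fun k => Site.sgn q (f k)) fun _ hk =>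
      Y_pow_qcomm (fun _ _ => (Form.braided q n).toSymExt.Y_qcomm) hk _

/-- Differentiating `X j ^ a` gives a quantum integer times `X j ^ (a - 1) * Y j`, and `τ`
contributes a power of `q` for the later letters. The new `Y j` commutes with the later `X k` and is
then sorted into the exterior part. These are the coefficients of `Site.D`. -/
lemma dR_genF (p : Mono K n) : dR q n (genF q n p) = genF q n (dM q n p) := by
  suffices H : (dR q n).comp (genF q n) = (genF q n).comp (dM q n) from LinearMap.congr_fun H p
  refine Finsupp.lhom_ext' fun f => LinearMap.ext_ring ?_
  simp only [LinearMap.comp_apply, Finsupp.lsingle_apply]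
  rw [gen_single, (Form.der q n 1 0).leibniz, Form.der_δ_ofFn_Y, mul_zero, zero_add,
    TwistedDer.ofFn_prod, dM, LinearMap.sum_apply, map_sum, Finset.sum_mul]
  refine Finset.sum_congr rfl fun j _ => ?_
  have hτ : (Form.der q n 1 0).τ (List.ofFn fun k => Form.Y q k ^ (f k).2.toNat).prod =
      (List.ofFn fun k => Form.Y q k ^ (f k).2.toNat).prod := by
    rw [map_list_prod, List.map_ofFn]
    congr 2
    funext k
    simp [Form.der_τ_Y]
  have e : (fun k => if k < j then (Form.der q n 1 0).σ (Form.X q k ^ (f k).1)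
      else if j < k then (Form.der q n 1 0).τ (Form.X q k ^ (f k).1)
      else (Form.der q n 1 0).δ (Form.X q k ^ (f k).1)) = fun k =>
      if k < j then (1 : K) • Form.X q k ^ (f k).1 else if j < k then
        ((q : K) ^ (f k).1) • Form.X q k ^ (f k).1 else
        (∑ t ∈ Finset.range (f j).1, ((q : K) ^ 2) ^ t) •
          (Form.X q j ^ ((f j).1 - 1) * Form.Y q j) := by
    funext k
    split_ifs with h1 h2
    · simp [Form.der_σ_X]
    · simp [Form.der_τ_X, smul_pow]
    · obtain rfl : k = j := le_antisymm (not_lt.1 h2) (not_lt.1 h1)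
      rw [Form.der_δ_X_pow, one_mul]
  rw [e, ofFn_if_smul j (fun _ => (1 : K)) (fun k => (q : K) ^ (f k).1), hτ]
  -- For `j < k` the elements `Y j` and `X k` commute, so `Y j` leaves the symmetric part without a
  -- scalar.
  have hm := ofFn_prod_mul (Form.Y q j) (Function.update (fun k => Form.X q k ^ (f k).1) j
    (Form.X q j ^ ((f j).1 - 1))) j (fun _ => (1 : K)) fun k hk => by
      rw [Function.update_of_ne hk.ne', one_smul]
      exact ((Commute.pow_right (Form.Y_X_comm hk) _).eq).symm
  simp only [ite_self, Finset.prod_const_one, one_smul, Function.update_idem,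
    Function.update_self] at hm
  rw [← hm, smul_mul_assoc, mul_assoc, Form.Y_mul_ofFn, mul_smul_comm, smul_smul, Site.op_single,
    map_smul, gen_single, prod_site_eq]
  have hY : Form.Y q j * Form.Y q j = 0 := (Form.braided q n).ext_self j
  rcases hf : (f j).2
  · have e1 : Function.update (fun k => Form.X q k ^ (f k).1) j (Form.X q j ^ ((f j).1 - 1)) =
        fun k => Form.X q k ^ (Function.update f j ((Site.D q).φ (f j)) k).1 := by
      funext k
      rcases eq_or_ne k j with rfl | hk
      · simp [Site.D]
      · simp [hk]
    have e2 : Function.update (fun k => Form.Y q k ^ (f k).2.toNat) j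
        (Form.Y q j * Form.Y q j ^ false.toNat) =
        fun k => Form.Y q k ^ (Function.update f j ((Site.D q).φ (f j)) k).2.toNat := by
      funext k
      rcases eq_or_ne k j with rfl | hk
      · simp [Site.D]
      · simp [hk]
    rw [e1, e2, prod_if_lt]
    simp only [Site.D, hf, ite_self, Finset.prod_const_one]
    congr 1
    simp
    ring
  -- If `j` already occurs in the exterior part, the term contains `Y j * Y j = 0`.
  · rw [List.prod_ofFn_zero (Function.update (fun k => Form.Y q k ^ (f k).2.toNat) j
      (Form.Y q j * Form.Y q j ^ true.toNat)) j (by simp [hY])]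
    simp [Site.D, hf]

/-- Turning `Y j` into `X j` collects, through `σ`, a factor `-q⁻¹` for each earlier exterior
letter. The new `X j` commutes with the earlier `Y k` and then passes the later `X k` at the cost of
powers of `q`. -/
lemma kz_genF (p : Mono K n) : kz q n (genF q n p) = genF q n (kM q n p) := by
  suffices H : (kz q n).comp (genF q n) = (genF q n).comp (kM q n) from LinearMap.congr_fun H p
  refine Finsupp.lhom_ext' fun f => LinearMap.ext_ring ?_
  simp only [LinearMap.comp_apply, Finsupp.lsingle_apply]
  rw [gen_single, (Form.der q n 0 1).leibniz, Form.der_δ_ofFn_X, zero_mul, add_zero,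
    TwistedDer.ofFn_prod, kM, LinearMap.sum_apply, map_sum, Finset.mul_sum]
  refine Finset.sum_congr rfl fun j _ => ?_
  have hσ : (Form.der q n 0 1).σ (List.ofFn fun k => Form.X q k ^ (f k).1).prod =
      (List.ofFn fun k => Form.X q k ^ (f k).1).prod := by
    rw [map_list_prod, List.map_ofFn]
    congr 2
    funext k
    simp [Form.der_σ_X]
  have hδ : (Form.der q n 0 1).δ (Form.Y q j ^ (f j).2.toNat) =
      (Site.κ q).v (f j) • Form.X q j := by
    rcases h : (f j).2
    · simpa [Site.κ, h] using (Form.der q n 0 1).map_one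
    · simp [Site.κ, h, Form.der_δ_Y]
  have e : (fun k => if k < j then (Form.der q n 0 1).σ (Form.Y q k ^ (f k).2.toNat)
      else if j < k then (Form.der q n 0 1).τ (Form.Y q k ^ (f k).2.toNat)
      else (Form.der q n 0 1).δ (Form.Y q k ^ (f k).2.toNat)) = fun k =>
      if k < j then Site.sgn q (f k) • Form.Y q k ^ (f k).2.toNat else if j < k then
        (1 : K) • Form.Y q k ^ (f k).2.toNat else (Site.κ q).v (f j) • Form.X q j := by
    funext k
    split_ifs with h1 h2
    · rcases h : (f k).2 <;> simp [Form.der_σ_Y, Site.sgn, h]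
    · simp [Form.der_τ_Y]
    · obtain rfl : k = j := le_antisymm (not_lt.1 h2) (not_lt.1 h1)
      exact hδ
  rw [e, ofFn_if_smul j (fun k => Site.sgn q (f k)) (fun _ => (1 : K)), hσ]
  have hm := mul_ofFn_prod (Form.X q j) (Function.update (fun k => Form.Y q k ^ (f k).2.toNat) j 1)
    j (fun _ => (1 : K)) fun k hk => by
      rw [Function.update_of_ne hk.ne, one_smul]
      exact ((Commute.pow_left (Form.Y_X_comm hk) _).eq).symm
  simp only [ite_self, Finset.prod_const_one, one_smul, Function.update_idem,
    Function.update_self, mul_one] at hm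
  have hm' := ofFn_prod_mul (Form.X q j) (fun k => Form.X q k ^ (f k).1) j
    (fun k => (q : K) ^ (f k).1) fun k hk =>
      pow_mul_of_comm ((Form.braided q n).toSymExt.X_qcomm hk) _
  rw [← hm, mul_smul_comm, ← mul_assoc, hm', smul_mul_assoc, smul_smul, Site.op_single,
    map_smul, gen_single, prod_site_eq]
  rcases hf : (f j).2
  · simp only [Site.κ, hf]
    rw [prod_if_lt]
    simp
  · have e1 : Function.update (fun k => Form.X q k ^ (f k).1) j (Form.X q j ^ (f j).1 * Form.X q j) =
        fun k => Form.X q k ^ (Function.update f j ((Site.κ q).φ (f j)) k).1 := by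
      funext k
      rcases eq_or_ne k j with rfl | hk
      · simp [Site.κ, pow_succ]
      · simp [hk]
    have e2 : Function.update (fun k => Form.Y q k ^ (f k).2.toNat) j 1 =
        fun k => Form.Y q k ^ (Function.update f j ((Site.κ q).φ (f j)) k).2.toNat := by
      funext k
      rcases eq_or_ne k j with rfl | hk
      · simp [Site.κ]
      · simp [hk]
    rw [e1, e2, prod_if_lt]
    simp only [Site.κ, hf, ite_self, Finset.prod_const_one]
    congr 1
    simp

end Basis

end

end QPF

namespace QPF

noncomputable section

/-! ### The contracting homotopy. -/

section Homotopy

variable {K : Type u} [Field K] {n : ℕ} {q : Kˣ}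

lemma prod_eq_mul_prod {F G : Fin n → K} (j : Fin n) {c : K} (h : ∀ x, x ≠ j → F x = G x)
    (hj : F j = c * G j) : ∏ x, F x = c * ∏ x, G x := by
  have : c = ∏ x, if x = j then c else 1 := by
    rw [Finset.prod_ite_eq', if_pos (Finset.mem_univ j)]
  rw [this, ← Finset.prod_mul_distrib]
  refine Finset.prod_congr rfl fun x _ => ?_
  rcases eq_or_ne x j with rfl | hx
  · rw [if_pos rfl, hj]
  · rw [if_neg hx, h x hx, one_mul]

/-- The diagonal operators. -/
def diag (w : (Fin n → State) → K) : Module.End K (Mono K n) :=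
  Finsupp.linearCombination K fun f => w f • Finsupp.single f 1

lemma diag_single (w : (Fin n → State) → K) (f : Fin n → State) :
    diag w (Finsupp.single f 1) = w f • Finsupp.single f 1 := by simp [diag]

lemma diag_mul_op (a : Site K) (w : (Fin n → State) → K) (j : Fin n) (c : K)
    (h : ∀ f, a.v (f j) ≠ 0 → w (Function.update f j (a.φ (f j))) = c * w f) :
    diag w * a.op j = c • (a.op j * diag w) := by
  refine Site.end_ext fun f => ?_
  rw [Module.End.mul_apply, LinearMap.smul_apply, Module.End.mul_apply, diag_single, map_smul,
    Site.op_single, map_smul, diag_single, smul_smul, smul_smul, smul_smul]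
  by_cases hv : a.v (f j) = 0
  · rw [Finset.prod_eq_zero (Finset.mem_univ j) (by rw [Site.coe_self, hv])]
    simp
  · rw [h f hv]
    congr 1
    ring

namespace Site

variable (q)

/-- The anticommutator of the components of the two differentials at the same letter. -/
def U : Site K := ⟨fun s => sgn q s ^ 2, fun s => (q : K) ^ (2 * s.1),
  fun s => sgn q s ^ 2 * ∑ t ∈ Finset.range (s.1 + s.2.toNat), ((q : K) ^ 2) ^ t, id⟩

lemma U_single (j : Fin n) (f : Fin n → State) :
    (U q).op j (Finsupp.single f 1) = (∏ k, (U q).coe j k (f k)) • Finsupp.single f 1 := by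
  rw [op_single]
  simp [U]

lemma κ_κ_lt {j k : Fin n} (h : j < k) : (κ q).op k * (κ q).op j + (κ q).op j * (κ q).op k = 0 := by
  have hq : (q : K) ≠ 0 := q.ne_zero
  have := op_mul_op (κ q) (κ q) h (-q) q (fun s => by rcases s with ⟨a, _ | _⟩ <;> simp [κ, sgn, hq])
    (fun s => by rcases s with ⟨a, _ | _⟩ <;> simp [κ, pow_succ']) 
  have h2 := congrArg (fun x => (q : K)⁻¹ • x) this
  simp only [smul_smul, inv_mul_cancel₀ hq, one_smul, mul_neg] at h2
  rw [h2]
  module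

/-- At different letters the components commute up to a scalar, which is exactly the one that makes
the cross terms of the twisted anticommutator cancel. -/
lemma D_κ_lt {j k : Fin n} (h : j < k) :
    ((q : K) ^ 2)⁻¹ • ((D q).op j * (κ q).op k) + (κ q).op k * (D q).op j = 0 := by
  have hq : (q : K) ≠ 0 := q.ne_zero
  have := op_mul_op (D q) (κ q) h (-(q : K)⁻¹) q
    (fun s => by rcases s with ⟨a, _ | _⟩ <;> simp [D, κ, sgn, mul_comm])
    (fun s => by rcases s with ⟨a, _ | _⟩ <;> simp [D, κ, pow_succ'])
  have h2 := congrArg (fun x => (q : K)⁻¹ • x) this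
  simp only [smul_smul, inv_mul_cancel₀ hq, one_smul] at h2
  rw [h2, ← add_smul]
  convert zero_smul K _
  field_simp
  ring

lemma κ_D_lt {j k : Fin n} (h : j < k) :
    ((q : K) ^ 2)⁻¹ • ((D q).op k * (κ q).op j) + (κ q).op j * (D q).op k = 0 := by
  have hq : (q : K) ≠ 0 := q.ne_zero
  have := op_mul_op (κ q) (D q) h (-(q : K)) (q : K)⁻¹
    (fun s => by rcases s with ⟨a, _ | _⟩ <;> simp [D, κ, sgn, hq])
    (fun s => by
      rcases s with ⟨_ | a, _ | _⟩ <;> simp [D, κ, pow_succ']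
      field_simp)
  have h2 := congrArg (fun x => (q : K)⁻¹ • x) this
  simp only [smul_smul] at h2
  rw [← inv_pow, pow_two, h2]
  conv_lhs => enter [2]; rw [← one_smul K ((κ q).op j * (D q).op k)]
  rw [← add_smul]
  convert zero_smul K _
  field_simp
  ring

/-- One of the two terms always vanishes, according to whether the letter occurs in the exterior
part. The other restores the state, with the quantum integer of its multiplicity as coefficient. -/
lemma D_κ_self (j : Fin n) :
    ((q : K) ^ 2)⁻¹ • ((D q).op j * (κ q).op j) + (κ q).op j * (D q).op j = (U q).op j := by
  have hq : (q : K) ≠ 0 := q.ne_zero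
  refine end_ext fun f => ?_
  rw [LinearMap.add_apply, LinearMap.smul_apply, Module.End.mul_apply, Module.End.mul_apply,
    op_op_single, op_op_single, U_single]
  rcases hf : f j with ⟨a, _ | _⟩
  · rw [Finset.prod_eq_zero (Finset.mem_univ j) (by simp [coe_self, hf, κ]), zero_smul, smul_zero,
      zero_add]
    rcases a with _ | a
    · rw [Finset.prod_eq_zero (Finset.mem_univ j) (by simp [coe_self, hf, D]),
        Finset.prod_eq_zero (Finset.mem_univ j) (by simp [coe_self, hf, U]), zero_smul, zero_smul]
    · rw [prod_eq_mul_prod (G := fun k => (U q).coe j k (f k)) j (c := 1), one_mul]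
      · congr 2
        funext k
        rcases eq_or_ne k j with rfl | hk
        · simp [D, κ, hf]
        · simp [hk]
      · intro x hx
        rw [Function.update_of_ne hx]
        rcases lt_or_gt_of_ne hx with h | h
        · rw [coe_lt _ h, coe_lt _ h, coe_lt _ h]; simp [D, κ, U, pow_two]
        · rw [coe_gt _ h, coe_gt _ h, coe_gt _ h]; simp [D, κ, U, two_mul, pow_add]
      · simp [coe_self, D, κ, U, hf, sgn]
  · rw [Finset.prod_eq_zero (f := fun x => (D q).coe j x (f x) * _) (Finset.mem_univ j)
      (by simp [coe_self, hf, D]), zero_smul, add_zero,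
      prod_eq_mul_prod (G := fun k => (U q).coe j k (f k)) j (c := (q : K) ^ 2), smul_smul,
      ← mul_assoc, inv_mul_cancel₀ (pow_ne_zero _ hq), one_mul]
    · congr 2
      funext k
      rcases eq_or_ne k j with rfl | hk
      · simp [D, κ, hf]
      · simp [hk]
    · intro x hx
      rw [Function.update_of_ne hx]
      rcases lt_or_gt_of_ne hx with h | h
      · rw [coe_lt _ h, coe_lt _ h, coe_lt _ h]; simp [D, κ, U, pow_two]
      · rw [coe_gt _ h, coe_gt _ h, coe_gt _ h]; simp [D, κ, U, two_mul, pow_add]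
    · simp [coe_self, D, κ, U, hf, sgn, hq]

end Site

/-- The single component `κ_j` already gives a diagonal anticommutator with the full differential,
because all cross terms cancel. This allows the homotopy to be built from one letter at a time. -/
lemma dM_κ (j : Fin n) : ((q : K) ^ 2)⁻¹ • (dM q n * (Site.κ q).op j) + (Site.κ q).op j * dM q n =
    (Site.U q).op j := by
  rw [dM, Finset.sum_mul, Finset.mul_sum, Finset.smul_sum, ← Finset.sum_add_distrib,
    Finset.sum_eq_single j]
  · exact Site.D_κ_self q j
  · intro k _ hk
    rcases lt_or_gt_of_ne hk with h | h
    · exact Site.D_κ_lt q h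
    · exact Site.κ_D_lt q h
  · simp

lemma kM_κ (j : Fin n) : kM q n * (Site.κ q).op j + (Site.κ q).op j * kM q n = 0 := by
  rw [kM, Finset.sum_mul, Finset.mul_sum, ← Finset.sum_add_distrib]
  refine Finset.sum_eq_zero fun k _ => ?_
  rcases lt_trichotomy k j with h | rfl | h
  · rw [add_comm, Site.κ_κ_lt q h]
  · rw [Site.op_mul_self, add_zero]
    rintro ⟨a, _ | _⟩ <;> simp [Site.κ]
  · exact Site.κ_κ_lt q h

/-- The total multiplicity of a letter. -/
def wt (s : State) : ℕ := s.1 + s.2.toNat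

/-- A letter is only exchanged between the two parts. The nonvanishing coefficient excludes the
state where the subtraction in `Site.D` is truncated. -/
lemma wt_D {s : State} (h : (Site.D q).v s ≠ 0) : wt ((Site.D q).φ s) = wt s := by
  rcases s with ⟨_ | a, _ | _⟩ <;> simp [Site.D, wt] at h ⊢

lemma wt_κ {s : State} (h : (Site.κ q).v s ≠ 0) : wt ((Site.κ q).φ s) = wt s := by
  rcases s with ⟨a, _ | _⟩ <;> simp [Site.κ, wt] at h ⊢

lemma wt_update {f : Fin n → State} {j : Fin n} {s : State} (h : wt s = wt (f j)) (k : Fin n) :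
    wt (Function.update f j s k) = wt (f k) := by
  rcases eq_or_ne k j with rfl | hk
  · simpa
  · simp [hk]

/-- The eigenvalues of the anticommutators of the differentials. -/
def dg (q : Kˣ) (j : Fin n) (f : Fin n → State) : K := ∏ k, (Site.U q).coe j k (f k)

/-- Wherever `k` lies relative to `j`, one more exterior and one less symmetric occurrence of `k`
costs `q⁻²`. This cancels the twist in `dM_κ`, so the resulting homotopy is an untwisted one. -/
lemma dg_D (j k : Fin n) (f : Fin n → State) (h : (Site.D q).v (f k) ≠ 0) :
    dg q j (Function.update f k ((Site.D q).φ (f k))) = ((q : K) ^ 2)⁻¹ * dg q j f := by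
  have hq : (q : K) ≠ 0 := q.ne_zero
  refine prod_eq_mul_prod k (fun x hx => by rw [Function.update_of_ne hx]) ?_
  rw [Function.update_self]
  rcases hf : f k with ⟨_ | a, _ | _⟩ <;> simp [Site.D, hf] at h
  rcases lt_trichotomy k j with h | rfl | h
  · rw [Site.coe_lt _ h]; simp [Site.U, Site.D, Site.sgn]
  · rw [Site.coe_self]; simp [Site.U, Site.D, Site.sgn]
  · rw [Site.coe_gt _ h]; simp [Site.U, Site.D, mul_add, pow_add]; field_simp

lemma dg_κ (j k : Fin n) (f : Fin n → State) (h : (Site.κ q).v (f k) ≠ 0) :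
    dg q j (Function.update f k ((Site.κ q).φ (f k))) = (q : K) ^ 2 * dg q j f := by
  have hq : (q : K) ≠ 0 := q.ne_zero
  refine prod_eq_mul_prod k (fun x hx => by rw [Function.update_of_ne hx]) ?_
  rw [Function.update_self]
  rcases hf : f k with ⟨a, _ | _⟩ <;> simp [Site.κ, hf] at h
  rcases lt_trichotomy k j with h | rfl | h
  · rw [Site.coe_lt _ h]; simp [Site.U, Site.κ, Site.sgn, hq]
  · rw [Site.coe_self]; simp [Site.U, Site.κ, Site.sgn, hq]
  · rw [Site.coe_gt _ h]; simp only [Site.U, Site.κ]; ring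

variable {ℓ : ℕ}

/-- Up to powers of `q` and signs the eigenvalue is a geometric sum in `q²` of length `wt (f j)`. It
vanishes only if `(q²) ^ wt (f j) = 1`, that is, if `ℓ` divides the multiplicity. -/
lemma dg_ne_zero (h : IsOddRoot q ℓ) (j : Fin n) (f : Fin n → State) (hj : ¬ ℓ ∣ wt (f j)) :
    dg q j f ≠ 0 := by
  have hq : (q : K) ≠ 0 := q.ne_zero
  refine Finset.prod_ne_zero_iff.2 fun k _ => ?_
  rcases lt_trichotomy k j with hk | rfl | hk
  · rw [Site.coe_lt _ hk]; exact pow_ne_zero _ (Site.sgn_ne_zero _ _)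
  · rw [Site.coe_self]
    refine mul_ne_zero (pow_ne_zero _ (Site.sgn_ne_zero _ _)) fun h0 => hj ?_
    have h1 := mul_geom_sum ((q : K) ^ 2) (wt (f k))
    rw [wt, h0, mul_zero] at h1
    exact (h.primitive_sq.pow_eq_one_iff_dvd _).1 (sub_eq_zero.1 h1.symm)
  · rw [Site.coe_gt _ hk]; exact pow_ne_zero _ hq

/-- The condition that `j` is the first letter whose multiplicity is not divisible by `ℓ`. -/
def IsFirst (ℓ : ℕ) (j : Fin n) (f : Fin n → State) : Prop :=
  ¬ ℓ ∣ wt (f j) ∧ ∀ k, k < j → ℓ ∣ wt (f k)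

open Classical in
/-- The coefficients of the homotopy. -/
def hw (q : Kˣ) (ℓ : ℕ) (j : Fin n) (f : Fin n → State) : K :=
  if IsFirst ℓ j f then ((q : K) ^ 2)⁻¹ * (dg q j f)⁻¹ else 0

/-- A contracting homotopy of the complement of the span of the monomials in which all letters have
multiplicities divisible by `ℓ`. -/
def hM (q : Kˣ) (n ℓ : ℕ) : Module.End K (Mono K n) := ∑ j, (Site.κ q).op j * diag (hw q ℓ j)

open Classical in
/-- The projection to the span of the monomials in which all letters have multiplicities divisible
by `ℓ`. -/
def pM (K : Type u) [Field K] (n ℓ : ℕ) : Module.End K (Mono K n) :=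
  diag fun f => if ∀ k, ℓ ∣ wt (f k) then 1 else 0

lemma isFirst_update {f : Fin n → State} {k : Fin n} {s : State} (h : wt s = wt (f k))
    (j : Fin n) : IsFirst ℓ j (Function.update f k s) ↔ IsFirst ℓ j f := by
  simp only [IsFirst, wt_update h]

/-- `dM` preserves all multiplicities, hence the condition `IsFirst`, and multiplies the eigenvalue
in the denominator by `q⁻²`. -/
lemma diag_hw_dM (j : Fin n) :
    diag (hw q ℓ j) * dM q n = (q : K) ^ 2 • (dM q n * diag (hw q ℓ j)) := by
  rw [dM, Finset.mul_sum, Finset.sum_mul, Finset.smul_sum]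
  refine Finset.sum_congr rfl fun k _ => diag_mul_op _ _ _ _ fun f hf => ?_
  by_cases hF : IsFirst ℓ j f
  · rw [hw, hw, if_pos hF, if_pos ((isFirst_update (wt_D hf) j).2 hF), dg_D j k f hf, mul_inv, inv_inv]
    ring
  · rw [hw, hw, if_neg hF, if_neg (mt (isFirst_update (wt_D hf) j).1 hF), mul_zero]

lemma diag_hw_kM (j : Fin n) :
    diag (hw q ℓ j) * kM q n = ((q : K) ^ 2)⁻¹ • (kM q n * diag (hw q ℓ j)) := by
  rw [kM, Finset.mul_sum, Finset.sum_mul, Finset.smul_sum]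
  refine Finset.sum_congr rfl fun k _ => diag_mul_op _ _ _ _ fun f hf => ?_
  by_cases hF : IsFirst ℓ j f
  · rw [hw, hw, if_pos hF, if_pos ((isFirst_update (wt_κ hf) j).2 hF), dg_κ j k f hf, mul_inv]
  · rw [hw, hw, if_neg hF, if_neg (mt (isFirst_update (wt_κ hf) j).1 hF), mul_zero]

/-- `kM` anticommutes with each `κ_j` and commutes with the diagonal factors up to a power of `q`.
Thus the homotopy preserves the kernel of the Koszul differential, which settles the case of `N`. -/
lemma kM_hM : kM q n * hM q n ℓ + (q : K) ^ 2 • (hM q n ℓ * kM q n) = 0 := by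
  have hq : (q : K) ≠ 0 := q.ne_zero
  rw [hM, Finset.mul_sum, Finset.sum_mul, Finset.smul_sum, ← Finset.sum_add_distrib]
  refine Finset.sum_eq_zero fun j _ => ?_
  rw [mul_assoc _ (diag _), diag_hw_kM, mul_smul_comm, smul_smul,
    mul_inv_cancel₀ (pow_ne_zero _ hq), one_smul, ← mul_assoc, ← mul_assoc, ← add_mul, kM_κ,
    zero_mul]

lemma homotopy (h : IsOddRoot q ℓ) : dM q n * hM q n ℓ + hM q n ℓ * dM q n = 1 - pM K n ℓ := by
  have hq : (q : K) ≠ 0 := q.ne_zero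
  have e : dM q n * hM q n ℓ + hM q n ℓ * dM q n =
      ∑ j, (q : K) ^ 2 • ((Site.U q).op j * diag (hw q ℓ j)) := by
    rw [hM, Finset.mul_sum, Finset.sum_mul, ← Finset.sum_add_distrib]
    refine Finset.sum_congr rfl fun j _ => ?_
    rw [mul_assoc, diag_hw_dM, ← dM_κ, add_mul, smul_add, smul_mul_assoc, smul_smul,
      mul_inv_cancel₀ (pow_ne_zero _ hq), one_smul, mul_smul_comm, mul_assoc, mul_assoc]
  rw [e]
  refine Site.end_ext fun f => ?_
  simp only [LinearMap.sum_apply, LinearMap.sub_apply, LinearMap.smul_apply, Module.End.mul_apply,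
    Module.End.one_apply, pM, diag_single, map_smul, Site.U_single, smul_smul]
  rw [← Finset.sum_smul]
  conv_rhs => rw [← one_smul K (Finsupp.single f (1 : K)), smul_smul, mul_one, ← sub_smul]
  congr 1
  -- The weights `hw` were chosen as `q⁻²` times the inverse eigenvalue, so what remains is the
  -- indicator of `IsFirst`.
  have key : ∀ j, (q : K) ^ 2 * (hw q ℓ j f * ∏ k, (Site.U q).coe j k (f k)) =
      @ite _ (IsFirst ℓ j f) (Classical.propDecidable _) 1 0 := fun j => by
    change (q : K) ^ 2 * (hw q ℓ j f * dg q j f) = _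
    rw [hw]
    split_ifs with hj
    · have := dg_ne_zero h j f hj.1
      field_simp
    · simp
  simp only [key]
  by_cases hall : ∀ k, ℓ ∣ wt (f k)
  · rw [if_pos hall, sub_self]
    exact Finset.sum_eq_zero fun j _ => if_neg fun hj => hj.1 (hall j)
  · rw [if_neg hall, sub_zero]
    push Not at hall
    -- If some multiplicity is not divisible by `ℓ`, there is exactly one first such letter, and the
    -- sum of indicators is `1`.
    obtain ⟨j, hj, hmin⟩ := WellFounded.has_min (wellFounded_lt (α := Fin n))
      {k | ¬ ℓ ∣ wt (f k)} hall
    have hf : IsFirst ℓ j f := ⟨hj, fun k hk => by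
      by_contra hc
      exact hmin k hc hk⟩
    rw [Finset.sum_eq_single j]
    · exact if_pos hf
    · intro k _ hk
      refine if_neg fun hk' => ?_
      rcases lt_or_gt_of_ne hk with hlt | hlt
      · exact hk'.1 (hf.2 k hlt)
      · exact hj (hk'.2 j hlt)
    · simp

lemma pM_dM : pM K n ℓ * dM q n = dM q n * pM K n ℓ := by
  rw [dM, Finset.mul_sum, Finset.sum_mul]
  refine Finset.sum_congr rfl fun k _ => ?_
  rw [pM, diag_mul_op _ _ _ 1, one_smul]
  intro f hf
  simp only [wt_update (wt_D hf), one_mul]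

/-- If the letter `j` is not in the exterior part, its exponent is its whole multiplicity, divisible
by `ℓ`, and the quantum integer is zero. If it is in the exterior part, `D_j` vanishes anyway. -/
lemma dM_pM (h : IsOddRoot q ℓ) : dM q n * pM K n ℓ = 0 := by
  rw [dM, Finset.sum_mul]
  refine Finset.sum_eq_zero fun j _ => Site.end_ext fun f => ?_
  rw [Module.End.mul_apply, pM, diag_single, map_smul, Site.op_single, LinearMap.zero_apply]
  split_ifs with hf
  · rw [Finset.prod_eq_zero (Finset.mem_univ j), zero_smul, smul_zero]
    rw [Site.coe_self]
    rcases hs : f j with ⟨a, _ | _⟩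
    · obtain ⟨b, hb⟩ := hf j
      simp only [hs, wt, Bool.toNat_false, add_zero] at hb
      have := h.sum_eq_zero b
      simp only [pow_mul, mul_comm b] at this
      simp [Site.D, hb, this]
    · simp [Site.D]
  · rw [zero_smul]

end Homotopy

end

end QPF

namespace QPF

noncomputable section

/-! ### Frobenius twists of the generators. -/

section FrobeniusForms

variable {K : Type u} [Field K] {n : ℕ} {q : Kˣ} {ℓ : ℕ} {A : Type*} [Ring A] [Algebra K A]
  {X Y : Fin n → A}

lemma coef_one {n : ℕ} (i j : Fin n) : coef (1 : Kˣ) i j = 0 := by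
  unfold coef
  split_ifs <;> simp

lemma Braided.Y_X_comm (h : Braided q X Y) {k j : Fin n} (hkj : k < j) :
    Commute (Y k) (X j) := by
  have := h.braid k j
  rwa [coef_lt q hkj, zero_smul, zero_add] at this

lemma Braided.Y_X_self (h : Braided q X Y) (j : Fin n) :
    Y j * X j = (q : K) • (X j * Y j) := by
  have := h.braid j j
  rw [coef_self] at this
  rw [this]
  module

/-- The correction to commutativity carries the quantum integer of `m + 1` with respect to `q²`,
which is zero for `m + 1 = ℓ`. -/
lemma Braided.Y_mul_X_pow_succ (h : Braided q X Y) {k j : Fin n} (hkj : k < j) (m : ℕ) :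
    Y j * X k ^ (m + 1) = X k ^ (m + 1) * Y j +
      (∑ s ∈ Finset.range (m + 1), ((q : K) ^ 2) ^ s) •
        (X k ^ m * (((q : K) - (q : K)⁻¹) • (X j * Y k))) := by
  have h0 := h.braid j k
  rw [coef_gt q hkj] at h0
  have h1 : X k * Y j = Y j * X k + -(((q : K) - (q : K)⁻¹) • (X j * Y k)) := by
    rw [h0]
    abel
  have := pow_succ_mul_of_comm h1 (z := (q : K) ^ 2) (by
    rw [neg_mul, mul_neg, smul_mul_assoc, mul_assoc, h.Y_X_self, mul_smul_comm, ← mul_assoc,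
      h.X_qcomm hkj, mul_smul_comm, ← mul_assoc, smul_mul_assoc, pow_two]
    module) m
  rw [this, mul_neg, smul_neg]
  abel

lemma q_pow (h : IsOddRoot q ℓ) : (q : K) ^ ℓ = 1 := by
  rw [← Units.val_pow_eq_pow_val, h.primitive.pow_eq_one, Units.val_one]

lemma IsOddRoot.pos (h : IsOddRoot q ℓ) : 0 < ℓ := zero_lt_one.trans h.one_lt

/-- Three reasons, by the order of the letters: plain commutation, `q ^ ℓ = 1`, and the vanishing of
the quantum integer of `ℓ`. -/
lemma Braided.commute_Y_X_pow (hb : Braided q X Y) (h : IsOddRoot q ℓ) (i j : Fin n) :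
    Commute (Y i) (X j ^ ℓ) := by
  rcases lt_trichotomy i j with hij | rfl | hij
  · exact (hb.Y_X_comm hij).pow_right ℓ
  · have := mul_pow_of_comm (hb.Y_X_self i) ℓ
    rwa [q_pow h, one_smul] at this
  · obtain ⟨m, rfl⟩ : ∃ m, ℓ = m + 1 := ⟨ℓ - 1, by have := h.one_lt; omega⟩
    have := hb.Y_mul_X_pow_succ hij m
    rwa [h.primitive_sq.geom_sum_eq_zero h.one_lt, zero_smul, add_zero] at this

lemma SymExt.commute_X_X_pow (hb : SymExt q X Y) (h : IsOddRoot q ℓ) (i j : Fin n) :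
    Commute (X i) (X j ^ ℓ) := by
  rcases lt_trichotomy i j with hij | rfl | hij
  · have := pow_mul_of_comm (hb.X_qcomm hij) ℓ
    rw [q_pow h, one_smul] at this
    exact this.symm
  · exact Commute.self_pow _ _
  · have := mul_pow_of_comm (hb.X_qcomm hij) ℓ
    rwa [q_pow h, one_smul] at this

/-- The correction term of the commutation contains `Y i` twice. -/
lemma Braided.Y_mul_η (hb : Braided q X Y) (i j : Fin n) (m : ℕ) (hij : i < j) :
    Y j * (X i ^ m * Y i) = X i ^ m * (Y j * Y i) := by
  cases m with
  | zero => simp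
  | succ m =>
    rw [← mul_assoc, hb.Y_mul_X_pow_succ hij m, add_mul, mul_assoc, smul_mul_assoc,
      mul_assoc (X i ^ m), smul_mul_assoc, mul_assoc (X j), hb.ext_self i]
    simp

/-- The Frobenius twists of the generators of an algebra of forms satisfy the relations of the
generators of classical forms. -/
lemma Braided.frobenius (hb : Braided q X Y) (h : IsOddRoot q ℓ) :
    Braided (1 : Kˣ) (fun j => X j ^ ℓ) (fun j => X j ^ (ℓ - 1) * Y j) := by
  have hq : (q : K) ≠ 0 := q.ne_zero
  refine ⟨⟨fun i j => ?_, fun i => ?_, fun i j hij => ?_⟩, fun i j => ?_⟩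
  · rw [coef_one, zero_smul, zero_add, Units.val_one, one_smul]
    exact ((hb.commute_X_X_pow h j i).pow_left ℓ).eq
  · rw [mul_assoc, ← mul_assoc (Y i), mul_pow_of_comm (hb.Y_X_self i), smul_mul_assoc, mul_assoc,
      hb.ext_self]
    simp
  · have e1 : X i ^ (ℓ - 1) * Y i * (X j ^ (ℓ - 1) * Y j) =
        X i ^ (ℓ - 1) * X j ^ (ℓ - 1) * (Y i * Y j) := by
      rw [mul_assoc, ← mul_assoc (Y i), ((hb.Y_X_comm hij).pow_right _).eq]
      simp only [mul_assoc]
    have e2 : X j ^ (ℓ - 1) * Y j * (X i ^ (ℓ - 1) * Y i) =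
        -(X i ^ (ℓ - 1) * X j ^ (ℓ - 1) * (Y i * Y j)) := by
      obtain ⟨m, rfl⟩ : ∃ m, ℓ = m + 1 := ⟨ℓ - 1, by have := h.one_lt; omega⟩
      -- With `m = ℓ - 1` one has `q ^ m = q⁻¹`. The scalar from exchanging the powers of `X` is
      -- therefore `q`, and it cancels the `q⁻¹` in `Y j * Y i = -q⁻¹ • (Y i * Y j)`.
      have hqm : ((q : K) ^ m) ^ m = q := by
        have h1 : (q : K) ^ m = (q : K)⁻¹ := by
          exact eq_inv_of_mul_eq_one_left (by rw [← pow_succ, q_pow h])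
        rw [h1, inv_pow, h1, inv_inv]
      have h2 := pow_mul_of_comm (mul_pow_of_comm (hb.X_qcomm hij) m) m
      rw [hqm] at h2
      rw [Nat.add_sub_cancel, mul_assoc, hb.Y_mul_η i j m hij, ← mul_assoc, h2,
        hb.Y_qcomm hij, mul_smul_comm, smul_mul_assoc, smul_smul]
      rw [neg_mul, inv_mul_cancel₀ hq, neg_one_smul]
    rw [e1, e2, Units.val_one, one_smul, add_neg_cancel]
  · rw [coef_one, zero_smul, zero_add]
    exact (((hb.commute_X_X_pow h i j).pow_left _).mul_left (hb.commute_Y_X_pow h i j)).eq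

/-- The map of states that belongs to the Frobenius twist. -/
def thS (ℓ : ℕ) (s : State) : State := (ℓ * s.1 + (ℓ - 1) * s.2.toNat, s.2)

/-- The map of monomials that belongs to the Frobenius twist. -/
def thM (K : Type u) [Field K] (n ℓ : ℕ) : Mono K n →ₗ[K] Mono K n :=
  Finsupp.lmapDomain K K fun f k => thS ℓ (f k)

lemma thM_single (f : Fin n → State) :
    thM K n ℓ (Finsupp.single f 1) = Finsupp.single (fun k => thS ℓ (f k)) 1 := by
  simp [thM]

lemma thS_injective (h : 0 < ℓ) : Function.Injective (thS ℓ) := by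
  rintro ⟨a, b⟩ ⟨a', b'⟩ e
  simp only [thS, Prod.mk.injEq] at e
  obtain ⟨e, rfl⟩ := e
  simpa [h.ne'] using e

lemma thM_injective (h : 0 < ℓ) : Function.Injective (thM K n ℓ) :=
  Finsupp.mapDomain_injective fun _ _ e => funext fun k => thS_injective h (congrFun e k)

lemma wt_thS (h : 0 < ℓ) (s : State) : wt (thS ℓ s) = ℓ * wt s := by
  rcases s with ⟨a, _ | _⟩
  · simp [wt, thS]
  · simp [wt, thS, mul_add]
    omega

lemma deg_thS (h : 0 < ℓ) (f : Fin n → State) : deg (fun k => thS ℓ (f k)) = deg f * ℓ := by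
  rw [mul_comm, deg, deg, Finset.mul_sum]
  exact Finset.sum_congr rfl fun k _ => wt_thS h (f k)

lemma extDeg_thS (f : Fin n → State) : extDeg (fun k => thS ℓ (f k)) = extDeg f := rfl

lemma pM_thM (h : 0 < ℓ) (p : Mono K n) : pM K n ℓ (thM K n ℓ p) = thM K n ℓ p := by
  suffices H : (pM K n ℓ).comp (thM K n ℓ) = thM K n ℓ from LinearMap.congr_fun H p
  refine Finsupp.lhom_ext' fun f => LinearMap.ext_ring ?_
  simp only [LinearMap.comp_apply, Finsupp.lsingle_apply]
  rw [thM_single, pM, diag_single, if_pos fun k => ?_, one_smul]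
  rw [wt_thS h]
  exact dvd_mul_right _ _

/-- If all multiplicities are divisible by `ℓ`, an exponent is divisible by `ℓ` when its letter is
not exterior and is congruent to `-1` when it is. These are the exponents that occur in products of
the twisted generators. -/
lemma exists_thM (h : 0 < ℓ) (p : Mono K n) : ∃ p', thM K n ℓ p' = pM K n ℓ p := by
  suffices H : LinearMap.range (pM K n ℓ) ≤ LinearMap.range (thM K n ℓ) from H ⟨p, rfl⟩
  rintro _ ⟨p, rfl⟩
  induction p using Finsupp.induction_linear with
  | zero => simp
  | add f g hf hg => rw [map_add]; exact add_mem hf hg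
  | single f c =>
    rw [← mul_one c, ← smul_eq_mul, ← Finsupp.smul_single, map_smul]
    refine Submodule.smul_mem _ _ ?_
    rw [pM, diag_single]
    split_ifs with hf
    · rw [one_smul]
      -- Rounding down removes the exponent `ℓ - 1` that belongs to an exterior letter.
      refine ⟨Finsupp.single (fun k => ((f k).1 / ℓ, (f k).2)) 1, ?_⟩
      rw [thM_single]
      congr 1
      funext k
      obtain ⟨b, hb⟩ := hf k
      rcases hs : f k with ⟨a, _ | _⟩
      · simp only [hs, wt, Bool.toNat_false, add_zero] at hb
        simp [thS, hb, h]
      · simp only [hs, wt, Bool.toNat_true] at hb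
        obtain ⟨c, rfl⟩ : ∃ c, b = c + 1 := ⟨b - 1, by
          rcases b with _ | b
          · omega
          · rfl⟩
        have ha : a = (ℓ - 1) + ℓ * c := by rw [mul_add] at hb; omega
        have hd : a / ℓ = c := by
          rw [ha, Nat.add_mul_div_left _ _ h, Nat.div_eq_of_lt (by omega), zero_add]
        simp only [thS, hd, Bool.toNat_true, mul_one, Prod.mk.injEq, and_true]
        omega
    · rw [zero_smul]
      exact zero_mem _

lemma filter_thM (h : 0 < ℓ) (d i : ℕ) (p : Mono K n) :
    (thM K n ℓ p).filter (fun f => deg f = d * ℓ ∧ extDeg f = i) =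
      thM K n ℓ (p.filter fun f => deg f = d ∧ extDeg f = i) := by
  induction p using Finsupp.induction_linear with
  | zero => simp only [map_zero, Finsupp.filter_zero]
  | add f g hf hg => rw [map_add, Finsupp.filter_add, hf, hg, Finsupp.filter_add, map_add]
  | single f c =>
    have ec : Finsupp.single f c = c • Finsupp.single f (1 : K) := by simp
    rw [ec, map_smul, Finsupp.filter_smul,
      Finsupp.filter_smul, map_smul, thM_single]
    congr 1
    have e : (deg (fun k => thS ℓ (f k)) = d * ℓ ∧ extDeg (fun k => thS ℓ (f k)) = i) ↔
        (deg f = d ∧ extDeg f = i) := by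
      rw [deg_thS h, extDeg_thS, Nat.mul_left_inj h.ne']
    by_cases hf : deg f = d ∧ extDeg f = i
    · rw [Finsupp.filter_single_of_pos (fun f => deg f = d * ℓ ∧ extDeg f = i) (e.2 hf),
        Finsupp.filter_single_of_pos (fun f => deg f = d ∧ extDeg f = i) hf, thM_single]
    · rw [Finsupp.filter_single_of_neg (fun f => deg f = d * ℓ ∧ extDeg f = i) (mt e.1 hf),
        Finsupp.filter_single_of_neg (fun f => deg f = d ∧ extDeg f = i) hf, map_zero]

/-- No scalars appear: the `ℓ`-th powers of the `X k` commute with all `X j`, and `Y k` commutes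
with `X j` for `k < j`, which are the only exchanges needed. -/
lemma Braided.gen_frobenius (hb : Braided q X Y) (h : IsOddRoot q ℓ) (p : Mono K n) :
    gen (fun j => X j ^ ℓ) (fun j => X j ^ (ℓ - 1) * Y j) p = gen X Y (thM K n ℓ p) := by
  suffices H : gen (K := K) (fun j => X j ^ ℓ) (fun j => X j ^ (ℓ - 1) * Y j) =
      (gen X Y).comp (thM K n ℓ) from LinearMap.congr_fun H p
  refine Finsupp.lhom_ext' fun f => LinearMap.ext_ring ?_
  simp only [LinearMap.comp_apply, Finsupp.lsingle_apply]
  rw [thM_single, gen_single, gen_single]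
  have e1 : (fun k => (X k ^ (ℓ - 1) * Y k) ^ (f k).2.toNat) =
      fun k => X k ^ ((ℓ - 1) * (f k).2.toNat) * Y k ^ (f k).2.toNat := by
    funext k
    rcases (f k).2 <;> simp
  rw [e1, ← ofFn_mul_ofFn, ← mul_assoc, ofFn_mul_ofFn]
  · simp only [← pow_mul, ← pow_add, thS]
  · intro k j _
    exact ((hb.commute_X_X_pow h k j).symm.pow_left _).pow_right _
  · intro k j hkj
    exact ((hb.Y_X_comm hkj).symm.pow_left _).pow_right _

/-- The Koszul differentials of the monomials and of their Frobenius twists. -/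
lemma kM_thM (h : IsOddRoot q ℓ) (p : Mono K n) :
    kM q n (thM K n ℓ p) = (q : K) • thM K n ℓ
      (kM 1 n (diag (fun f => (q : K)⁻¹ ^ extDeg f) p)) := by
  have hq : (q : K) ≠ 0 := q.ne_zero
  suffices H : (kM q n).comp (thM K n ℓ) = (q : K) • (thM K n ℓ).comp
      ((kM 1 n).comp (diag (fun f => (q : K)⁻¹ ^ extDeg f))) from LinearMap.congr_fun H p
  refine Finsupp.lhom_ext' fun f => LinearMap.ext_ring ?_
  simp only [LinearMap.comp_apply, Finsupp.lsingle_apply, LinearMap.smul_apply]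
  rw [thM_single, diag_single, map_smul, map_smul, smul_smul, kM, kM, LinearMap.sum_apply,
    LinearMap.sum_apply, map_sum, Finset.smul_sum]
  refine Finset.sum_congr rfl fun j _ => ?_
  rw [Site.op_single, Site.op_single, map_smul, thM_single, smul_smul]
  rcases hf : f j with ⟨a, _ | _⟩
  · rw [Finset.prod_eq_zero (Finset.mem_univ j) (by simp [Site.coe_self, Site.κ, hf, thS]),
      Finset.prod_eq_zero (Finset.mem_univ j) (by simp [Site.coe_self, Site.κ, hf]), mul_zero,
      zero_smul, zero_smul]
  · congr 1
    · rw [extDeg, ← Finset.prod_pow_eq_pow_sum, mul_assoc, ← Finset.prod_mul_distrib]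
      refine prod_eq_mul_prod j (fun x hx => ?_) ?_
      -- Since `q ^ (ℓ - 1) = q⁻¹`, every exterior letter other than `j` contributes `q⁻¹` compared
      -- with the classical coefficient, on either side of `j`. The factor `q` in the statement
      -- makes up for `j` itself.
      · have hqa : ∀ s : State, (q : K) ^ (thS ℓ s).1 = (q : K)⁻¹ ^ s.2.toNat := by
          rintro ⟨b, _ | _⟩
          · simp [thS, pow_mul, q_pow h]
          · simp only [thS, Bool.toNat_true, mul_one, pow_one]
            rw [pow_add, pow_mul, q_pow h, one_pow, one_mul]
            exact eq_inv_of_mul_eq_one_left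
              (by rw [← pow_succ, Nat.sub_add_cancel h.pos, q_pow h])
        rcases lt_or_gt_of_ne hx with hxj | hxj
        · rw [Site.coe_lt _ hxj, Site.coe_lt _ hxj]
          rcases hs : f x with ⟨b, _ | _⟩ <;> simp [Site.κ, Site.sgn, thS]
        · rw [Site.coe_gt _ hxj, Site.coe_gt _ hxj]
          simp [Site.κ, hqa]
      · rw [Site.coe_self, Site.coe_self]
        simp [Site.κ, thS, hf, hq]
    · congr 1
      funext k
      rcases eq_or_ne k j with rfl | hk
      · have := h.pos
        simp only [Site.κ, Function.update_self, thS, Bool.toNat_true, Bool.toNat_false, mul_one,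
          mul_zero, add_zero, Prod.mk.injEq, and_true]
        rw [mul_add]
        omega
      · simp [hk]

end FrobeniusForms

end

end QPF

namespace QPF

noncomputable section

/-! ### The Cartier map on forms. -/

section CartierMap

open QFun

variable {K : Type u} [Field K] {n : ℕ} {q : Kˣ} {ℓ : ℕ}

/-- The generators `e_k^ℓ`. -/
abbrev frX (q : Kˣ) (n ℓ : ℕ) : Fin n → Form q n := fun j => Form.X q j ^ ℓ

/-- The generators `e_k^(ℓ-1) ⊗ e_k`. -/
abbrev frY (q : Kˣ) (n ℓ : ℕ) : Fin n → Form q n := fun j => Form.X q j ^ (ℓ - 1) * Form.Y q j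

lemma fr_braided (h : IsOddRoot q ℓ) (n : ℕ) : Braided (1 : Kˣ) (frX q n ℓ) (frY q n ℓ) :=
  (Form.braided q n).frobenius h

/-- Evaluation of elements of `S^{d-i} ⊗ Λ^i`. -/
def SymExt.evQ {A : Type*} [Ring A] [Algebra K A] {r : Kˣ} {X Y : Fin n → A} (h : SymExt r X Y)
    (d i : ℕ) : (Tens K n d ⧸ rel r n d i) →ₗ[K] A :=
  (rel r n d i).liftQ (ev X Y d i) (h.rel_le_ker d i)

lemma SymExt.evQ_mk {A : Type*} [Ring A] [Algebra K A] {r : Kˣ} {X Y : Fin n → A}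
    (h : SymExt r X Y) (d i : ℕ) (y : Tens K n d) :
    h.evQ d i ((rel r n d i).mkQ y) = ev X Y d i y := rfl

/-- The Cartier map on classical forms with values in the algebra of quantum forms. -/
def carF (h : IsOddRoot q ℓ) (n d i : ℕ) : (Tens K n d ⧸ rel (1 : Kˣ) n d i) →ₗ[K] Form q n :=
  (fr_braided h n).toSymExt.evQ d i

lemma carF_mk (h : IsOddRoot q ℓ) (d i : ℕ) (y : Tens K n d) :
    carF h n d i ((rel (1 : Kˣ) n d i).mkQ y) = ev (frX q n ℓ) (frY q n ℓ) d i y :=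
  (fr_braided h n).toSymExt.evQ_mk d i y

/-- In the monomial bases the Cartier map is the injective map of states `thM`; all computations
below take place there. -/
lemma carF_eq (h : IsOddRoot q ℓ) (d i : ℕ) (x : Tens K n d ⧸ rel (1 : Kˣ) n d i) :
    carF h n d i x = genF q n (thM K n ℓ (nfQ 1 n d i x)) := by
  obtain ⟨y, rfl⟩ := Submodule.mkQ_surjective _ x
  rw [carF_mk, ← gen_nfQ (fr_braided h n).toSymExt, (Form.braided q n).gen_frobenius h]

lemma part_genF_nfQ (d i : ℕ) (x : Tens K n d ⧸ rel q n d i) :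
    part q n d i (genF q n (nfQ q n d i x)) = x := by
  obtain ⟨y, rfl⟩ := Submodule.mkQ_surjective _ x
  rw [gen_nfQ (Form.braided q n).toSymExt, ← part_ev]

lemma nfQ_filter (d i : ℕ) (x : Tens K n d ⧸ rel q n d i) :
    (nfQ q n d i x).filter (fun f => deg f = d ∧ extDeg f = i) = nfQ q n d i x := by
  rw [← nfQ_part_genF (q := q), part_genF_nfQ]

lemma nfQ_injective (d i : ℕ) : Function.Injective (nfQ q n d i) :=
  Function.LeftInverse.injective (g := fun p => part q n d i (genF q n p)) (part_genF_nfQ d i)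

lemma evO_eq {d : ℕ} (i : ℕ) (N : Source q d) (z : (Omega q d i).at' N) :
    evO q d i N z = genF q N.dim (nfQ q N.dim d i z) := by
  obtain ⟨y, rfl⟩ := Omega.mk_surjective q d i N z
  exact (gen_nfQ (Form.braided q N.dim).toSymExt d i y).symm

/-- The Cartier map on classical forms with values in quantum forms. -/
def carQ (h : IsOddRoot q ℓ) (n d i : ℕ) :
    (Tens K n d ⧸ rel (1 : Kˣ) n d i) →ₗ[K] (Tens K n (d * ℓ) ⧸ rel q n (d * ℓ) i) :=
  (part q n (d * ℓ) i).comp (carF h n d i)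

lemma nfQ_carQ (h : IsOddRoot q ℓ) (d i : ℕ) (x : Tens K n d ⧸ rel (1 : Kˣ) n d i) :
    nfQ q n (d * ℓ) i (carQ h n d i x) = thM K n ℓ (nfQ 1 n d i x) := by
  rw [carQ, LinearMap.comp_apply, carF_eq, nfQ_part_genF, filter_thM h.pos, nfQ_filter]

lemma evO_carQ (h : IsOddRoot q ℓ) {d : ℕ} (i : ℕ) (N : Source q (d * ℓ))
    (x : Tens K N.dim d ⧸ rel (1 : Kˣ) N.dim d i) :
    evO q (d * ℓ) i N (carQ h N.dim d i x) = carF h N.dim d i x := by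
  refine (evO_eq i N _).trans ?_
  rw [nfQ_carQ, carF_eq]

/-- Values of `thM` are fixed by `pM`, and `dM` kills the image of `pM`. -/
lemma dR_carF (h : IsOddRoot q ℓ) (d i : ℕ) (x : Tens K n d ⧸ rel (1 : Kˣ) n d i) :
    dR q n (carF h n d i x) = 0 := by
  rw [carF_eq, dR_genF, ← pM_thM h.pos, ← Module.End.mul_apply, dM_pM h, LinearMap.zero_apply,
    map_zero]

/-- Applying `pM` fixes the left side and kills the coboundary, since `pM` commutes with `dM` and
`dM` vanishes on its image. -/
lemma eq_zero_of_carF_eq_dR (h : IsOddRoot q ℓ) (d i : ℕ) (x : Tens K n d ⧸ rel (1 : Kˣ) n d i)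
    (a : Form q n) (hx : carF h n d i x = dR q n a) : x = 0 := by
  obtain ⟨p, rfl⟩ := genF_surjective a
  rw [carF_eq, dR_genF] at hx
  have e := genF_injective hx
  have e2 := congrArg (pM K n ℓ) e
  rw [pM_thM h.pos, ← Module.End.mul_apply, pM_dM, dM_pM h, LinearMap.zero_apply] at e2
  exact nfQ_injective d i (thM_injective h.pos (by rw [e2, map_zero, map_zero]))

lemma diag_filter (w : (Fin n → State) → K) (c : K) (P : (Fin n → State) → Prop)
    [DecidablePred P] (hw : ∀ f, P f → w f = c) (p : Mono K n) :
    diag w (p.filter P) = c • p.filter P := by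
  induction p using Finsupp.induction_linear with
  | zero => simp only [Finsupp.filter_zero, map_zero, smul_zero]
  | add f g hf hg => rw [Finsupp.filter_add, map_add, hf, hg, smul_add]
  | single f c' =>
    have ec : Finsupp.single f c' = c' • Finsupp.single f (1 : K) := by simp
    rw [ec, Finsupp.filter_smul, map_smul]
    by_cases h : P f
    · rw [Finsupp.filter_single_of_pos P h, diag_single, hw f h, smul_comm]
    · rw [Finsupp.filter_single_of_neg P h]
      simp

lemma diag_filter_comm (w : (Fin n → State) → K) (P : (Fin n → State) → Prop)
    [DecidablePred P] (p : Mono K n) : diag w (p.filter P) = (diag w p).filter P := by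
  induction p using Finsupp.induction_linear with
  | zero => simp only [Finsupp.filter_zero, map_zero]
  | add f g hf hg => rw [Finsupp.filter_add, map_add, hf, hg, map_add, Finsupp.filter_add]
  | single f c' =>
    have ec : Finsupp.single f c' = c' • Finsupp.single f (1 : K) := by simp
    rw [ec, Finsupp.filter_smul, map_smul, map_smul, diag_single, Finsupp.filter_smul,
      Finsupp.filter_smul]
    by_cases h : P f
    · rw [Finsupp.filter_single_of_pos P h, diag_single]
    · rw [Finsupp.filter_single_of_neg P h]
      simp

/-- Cocycles are cohomologous to values of the Cartier map. -/
lemma exists_carF (h : IsOddRoot q ℓ) (d i : ℕ) (p : Mono K n)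
    (hp : p.filter (fun f => deg f = d * ℓ ∧ extDeg f = i) = p) (hd : dM q n p = 0) :
    ∃ x, genF q n p = carF h n d i x + dR q n (genF q n (hM q n ℓ p)) := by
  obtain ⟨p', hp'⟩ := exists_thM (K := K) (n := n) h.pos p
  -- The preimage `p'` need not be homogeneous; its component of bidegree `(d, i)` has the same
  -- image, because `p` is homogeneous.
  refine ⟨part 1 n d i (genF 1 n p'), ?_⟩
  rw [carF_eq, nfQ_part_genF, ← filter_thM h.pos, hp', pM, ← diag_filter_comm, hp, dR_genF,
    ← map_add]
  congr 1
  have e := LinearMap.congr_fun (homotopy (n := n) h) p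
  simp only [LinearMap.add_apply, Module.End.mul_apply, hd, map_zero, add_zero,
    LinearMap.sub_apply, Module.End.one_apply] at e
  rw [e]
  exact (add_sub_cancel _ _).symm

/-- The Koszul differential. -/
abbrev kosQ (q : Kˣ) (n d i : ℕ) :
    (Tens K n d ⧸ rel q n d (i + 1)) →ₗ[K] (Tens K n d ⧸ rel q n d i) :=
  (rel q n d (i + 1)).mapQ (rel q n d i) (koszulOp q n d i) (koszulOp_rel q n d i)

lemma kM_nfQ (d i : ℕ) (x : Tens K n d ⧸ rel q n d (i + 1)) :
    kM q n (nfQ q n d (i + 1) x) = nfQ q n d i (kosQ q n d i x) := by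
  apply genF_injective (q := q)
  obtain ⟨y, rfl⟩ := Submodule.mkQ_surjective _ x
  rw [← kz_genF, gen_nfQ (Form.braided q n).toSymExt]
  exact (kz_ev d i y).trans (gen_nfQ (Form.braided q n).toSymExt d i _).symm

/-- The Cartier map and the Koszul differentials. -/
lemma kz_carF (h : IsOddRoot q ℓ) (d i : ℕ) (x : Tens K n d ⧸ rel (1 : Kˣ) n d (i + 1)) :
    kz q n (carF h n d (i + 1) x) =
      (q : K)⁻¹ ^ i • carF h n d i (kosQ 1 n d i x) := by
  have hq : (q : K) ≠ 0 := q.ne_zero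
  have e2 : diag (fun f => (q : K)⁻¹ ^ extDeg f) (nfQ 1 n d (i + 1) x) =
      (q : K)⁻¹ ^ (i + 1) • nfQ 1 n d (i + 1) x := by
    rw [← nfQ_filter (q := 1) d (i + 1) x]
    exact diag_filter _ _ _ (fun f hf => by rw [hf.2]) _
  rw [carF_eq, kz_genF, kM_thM h, e2, map_smul, map_smul, map_smul, map_smul, smul_smul, kM_nfQ,
    ← carF_eq h, pow_succ', ← mul_assoc, mul_inv_cancel₀ hq, one_mul]

lemma kz_carF_zero (h : IsOddRoot q ℓ) (d : ℕ) (x : Tens K n d ⧸ rel (1 : Kˣ) n d 0) :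
    kz q n (carF h n d 0 x) = 0 := by
  have e2 : kM 1 n (nfQ 1 n d 0 x) = 0 := by
    apply genF_injective (q := 1)
    obtain ⟨y, rfl⟩ := Submodule.mkQ_surjective _ x
    rw [← kz_genF, gen_nfQ (Form.braided 1 n).toSymExt]
    exact (kz_ev_zero d y).trans (map_zero _).symm
  have e : diag (fun f => (q : K)⁻¹ ^ extDeg f) (nfQ 1 n d 0 x) = (1 : K) • nfQ 1 n d 0 x := by
    rw [← nfQ_filter (q := 1) d 0 x]
    exact diag_filter _ _ _ (fun f hf => by rw [hf.2, pow_zero]) _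
  rw [carF_eq, kz_genF, kM_thM h, e, one_smul, e2]
  simp

lemma part_kz (n d i : ℕ) (a : Form q n) :
    part q n d i (kz q n a) = kosQ q n d i (part q n d (i + 1) a) := by
  refine LinearMap.congr_fun (Form.ext_homogeneous (f := part q n d i ∘ₗ kz q n)
    (g := kosQ q n d i ∘ₗ part q n d (i + 1)) fun d' i' y => ?_) a
  simp only [LinearMap.comp_apply]
  cases i' with
  | zero =>
    rw [kz_ev_zero, part_ev_of_ne (by omega), map_zero, map_zero]
  | succ i' =>
    rw [kz_ev]
    by_cases h : d' = d ∧ i' = i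
    · obtain ⟨rfl, rfl⟩ := h
      rw [part_ev, part_ev]
      rfl
    · rw [part_ev_of_ne h, part_ev_of_ne (by omega), map_zero]

/-- The primitive that the homotopy produces for a cocycle in `N` again lies in the kernel of the
Koszul differential. -/
lemma kz_hM (p : Mono K n) (hp : kM q n p = 0) : kz q n (genF q n (hM q n ℓ p)) = 0 := by
  have e := LinearMap.congr_fun (kM_hM (q := q) (n := n) (ℓ := ℓ)) p
  simp only [LinearMap.add_apply, Module.End.mul_apply, LinearMap.smul_apply, hp, map_zero,
    smul_zero, add_zero, LinearMap.zero_apply] at e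
  rw [kz_genF, e, map_zero]

end CartierMap

end

end QPF

namespace QPF

noncomputable section

/-! ### The coaction of a quantum matrix on forms. -/

section Coaction

open TensorProduct

variable {K : Type u} [Field K] {m n d : ℕ} {q : Kˣ} {A E : Type*} [Ring A] [Algebra K A]
  [Ring E] [Algebra K E]

/-- The image of a family of elements under the coaction of a matrix. -/
def coact (t : Fin m → Fin n → E) (U : Fin m → A) (j : Fin n) : A ⊗[K] E := ∑ a, U a ⊗ₜ t a j

lemma coact_mul_coact (t : Fin m → Fin n → E) (U V : Fin m → A) (i j : Fin n) :
    coact (K := K) t U i * coact t V j = ∑ a, ∑ b, (U a * V b) ⊗ₜ (t a i * t b j) := by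
  simp only [coact, Finset.sum_mul_sum, Algebra.TensorProduct.tmul_mul_tmul]

/-- The relations of a quantum matrix are compatible with the braiding. -/
lemma coact_braid {t : Fin m → Fin n → E}
    (ht : ∀ i k j l, t i l * t k j - t k j * t i l =
      (coef q i k - coef q j l) • (t i j * t k l)) (U V : Fin m → A) (i j : Fin n) :
    ∑ a, ∑ b, (coef q a b • (U a * V b) + U b * V a) ⊗ₜ[K] (t a i * t b j) =
      coef q i j • (coact t U i * coact t V j) + coact t U j * coact t V i := by
  rw [coact_mul_coact, coact_mul_coact]
  simp only [TensorProduct.add_tmul, Finset.sum_add_distrib]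
  -- After renaming the indices only the order of two entries of `t` differs, and `ht` supplies
  -- exactly the correction.
  have e : ∑ a, ∑ b, (U b * V a) ⊗ₜ[K] (t a i * t b j) =
      ∑ a, ∑ b, (U a * V b) ⊗ₜ[K] (t b i * t a j) := Finset.sum_comm
  rw [e, ← Finset.sum_add_distrib, Finset.smul_sum, ← Finset.sum_add_distrib]
  refine Finset.sum_congr rfl fun a _ => ?_
  rw [← Finset.sum_add_distrib, Finset.smul_sum, ← Finset.sum_add_distrib]
  refine Finset.sum_congr rfl fun b _ => ?_
  have h1 : t a j * t b i = t b i * t a j + (coef q a b - coef q i j) • (t a i * t b j) := by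
    rw [← ht]
    abel
  rw [h1, TensorProduct.tmul_add, TensorProduct.smul_tmul', ← TensorProduct.smul_tmul, sub_smul,
    TensorProduct.sub_tmul]
  abel

/-- On exterior letters the Hecke generator acts by its other eigenvalue `-q⁻¹`. This is the single
equation to which `coact_braid` applies. -/
lemma SymExt.ext_braid {X Y : Fin m → A} (h : SymExt q X Y) (a b : Fin m) :
    coef q a b • (Y a * Y b) + Y b * Y a = -(q : K)⁻¹ • (Y a * Y b) := by
  have hq : (q : K) ≠ 0 := q.ne_zero
  rcases lt_trichotomy a b with hab | rfl | hab
  · rw [coef_lt q hab, zero_smul, zero_add, h.Y_qcomm hab]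
  · rw [h.ext_self]
    simp
  · rw [coef_gt q hab, h.Y_qcomm hab]
    match_scalars
    field_simp
    ring

/-- The coaction of a quantum matrix preserves the relations between the generators of an algebra of
forms. -/
lemma Braided.coact {X Y : Fin m → A} (h : Braided q X Y) (hq2 : (q : K) ^ 2 + 1 ≠ 0)
    {t : Fin m → Fin n → E} (ht : ∀ i k j l, t i l * t k j - t k j * t i l =
      (coef q i k - coef q j l) • (t i j * t k l)) :
    Braided (K := K) q (QPF.coact (K := K) t X) (QPF.coact t Y) := by
  have hq : (q : K) ≠ 0 := q.ne_zero
  have hY : ∀ i j, coef q i j • (QPF.coact (K := K) t Y i * QPF.coact t Y j) +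
      QPF.coact t Y j * QPF.coact t Y i =
      -(q : K)⁻¹ • (QPF.coact t Y i * QPF.coact t Y j) := fun i j => by
    rw [← coact_braid ht]
    simp only [h.ext_braid, ← TensorProduct.smul_tmul', ← Finset.smul_sum, coact_mul_coact]
  refine ⟨⟨fun i j => ?_, fun i => ?_, fun i j hij => ?_⟩, fun i j => ?_⟩
  · rw [← coact_braid ht]
    simp only [h.sym, ← TensorProduct.smul_tmul', ← Finset.smul_sum, coact_mul_coact]
  · have := hY i i
    rw [coef_self] at this
    -- For equal indices the eigenvalue equation determines the square only up to the factor `q +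
    -- q⁻¹`; hence the assumption on `q² + 1`.
    have e : ((q : K) + (q : K)⁻¹) • (QPF.coact (K := K) t Y i * QPF.coact t Y i) = 0 := by
      rw [add_smul, ← sub_eq_zero.2 this]
      module
    refine (smul_eq_zero.1 e).resolve_left fun h0 => hq2 ?_
    field_simp at h0
    rwa [mul_zero] at h0
  · have := hY i j
    rw [coef_lt q hij, zero_smul, zero_add] at this
    rw [this, smul_smul, mul_neg, mul_inv_cancel₀ hq, neg_one_smul, add_neg_cancel]
  · rw [← coact_braid ht, coact_mul_coact]
    simp only [h.braid]

/-- A twisted derivation of the first factor of a tensor product. -/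
def TwistedDer.tensor (D : TwistedDer K A) (E : Type*) [Ring E] [Algebra K E] :
    TwistedDer K (A ⊗[K] E) where
  σ := Algebra.TensorProduct.map D.σ (AlgHom.id K E)
  τ := Algebra.TensorProduct.map D.τ (AlgHom.id K E)
  δ := D.δ.rTensor E
  leibniz a b := by
    induction a with
    | zero => simp
    | add x y hx hy => simp only [add_mul, map_add, hx, hy]; abel
    | tmul x e =>
      induction b with
      | zero => simp
      | add x y hx hy => simp only [mul_add, map_add, hx, hy]; abel
      | tmul y e' => simp [D.leibniz, TensorProduct.add_tmul]

/-- Contraction of the second factor with a linear form. -/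
def slice (θ : E →ₗ[K] K) : A ⊗[K] E →ₗ[K] A :=
  (TensorProduct.rid K A).toLinearMap ∘ₗ θ.lTensor A

lemma slice_tmul (θ : E →ₗ[K] K) (a : A) (e : E) : slice θ (a ⊗ₜ e) = θ e • a := by
  simp [slice]

lemma slice_tensor (D : TwistedDer K A) (θ : E →ₗ[K] K) (x : A ⊗[K] E) :
    slice θ ((D.tensor E).δ x) = D.δ (slice θ x) := by
  induction x with
  | zero => simp
  | add x y hx hy => simp only [map_add, hx, hy]
  | tmul x e =>
    change slice θ (D.δ x ⊗ₜ e) = _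
    rw [slice_tmul, slice_tmul, map_smul]

lemma ofFn_tmul (F : Fin d → A) (G : Fin d → E) :
    (List.ofFn fun t => F t ⊗ₜ[K] G t).prod = (List.ofFn F).prod ⊗ₜ (List.ofFn G).prod := by
  induction d with
  | zero => simp [Algebra.TensorProduct.one_def]
  | succ d ih => simp only [List.ofFn_succ, List.prod_cons, ih, Algebra.TensorProduct.tmul_mul_tmul]

lemma ofFn_sum_prod {ι : Type*} [Fintype ι] [DecidableEq ι] (F : Fin d → ι → A) :
    (List.ofFn fun t => ∑ a, F t a).prod = ∑ I : Fin d → ι, (List.ofFn fun t => F t (I t)).prod :=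
  (MultilinearMap.mkPiAlgebraFin ℤ d A).map_sum (fun t k => F t k)

/-- The coaction sends the word `J` to the sum over `I` of the word `I` tensored with the product of
the entries at `(I t, J t)`. Contraction replaces these products by the matrix coefficients of `g`.
-/
lemma slice_evT (θ : E →ₗ[K] K) (s : Fin m → Fin n → E) (g : Tens K n d →ₗ[K] Tens K m d)
    (hg : ∀ I J, entry g I J = θ (List.ofFn fun t => s (I t) (J t)).prod) (L : ℕ → Fin m → A)
    (y : Tens K n d) :
    slice θ (evT (fun t => coact s (L t)) d y) = evT L d (g y) := by
  suffices H : (slice θ).comp (evT (fun t => coact s (L t)) d) = (evT L d).comp g from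
    LinearMap.congr_fun H y
  refine Finsupp.lhom_ext' fun J => LinearMap.ext_ring ?_
  simp only [LinearMap.comp_apply, Finsupp.lsingle_apply]
  have e : g (Finsupp.single J 1) = ∑ I : Word m d, entry g I J • Finsupp.single I (1 : K) := by
    ext I
    simp [entry]
  rw [evT_single, e, map_sum]
  simp only [coact]
  rw [ofFn_sum_prod, map_sum]
  refine Finset.sum_congr rfl fun I _ => ?_
  rw [ofFn_tmul, slice_tmul, map_smul, evT_single, hg]

end Coaction

/-! ### Coboundaries that measure the failure of additivity. -/

section Divided

variable {K : Type u} [Field K] {q : Kˣ} {ℓ : ℕ} {A : Type*} [Ring A] [Algebra K A]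

/-- The elements that a twisted derivation kills and that are eigenvectors of its twists. -/
structure TwistedDer.Good (D : TwistedDer K A) (c c' : K) (a : A) : Prop where
  δ : D.δ a = 0
  σ : D.σ a = c • a
  τ : D.τ a = c' • a

lemma TwistedDer.Good.mul {D : TwistedDer K A} {c c' e e' : K} {a b : A} (ha : D.Good c c' a)
    (hb : D.Good e e' b) : D.Good (c * e) (c' * e') (a * b) := by
  refine ⟨?_, ?_, ?_⟩
  · rw [D.leibniz, ha.δ, hb.δ, mul_zero, zero_mul, add_zero]
  · rw [map_mul, ha.σ, hb.σ, smul_mul_smul_comm]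
  · rw [map_mul, ha.τ, hb.τ, smul_mul_smul_comm]

lemma TwistedDer.Good.sum {ι : Type*} {s : Finset ι} {D : TwistedDer K A} {c c' : K} {a : ι → A}
    (h : ∀ i ∈ s, D.Good c c' (a i)) : D.Good c c' (∑ i ∈ s, a i) := by
  refine ⟨?_, ?_, ?_⟩
  · rw [map_sum, Finset.sum_eq_zero fun i hi => (h i hi).δ]
  · rw [map_sum, Finset.smul_sum]
    exact Finset.sum_congr rfl fun i hi => (h i hi).σ
  · rw [map_sum, Finset.smul_sum]
    exact Finset.sum_congr rfl fun i hi => (h i hi).τ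

/-- Products of cohomologous good elements are cohomologous. -/
lemma TwistedDer.prod_sub_prod_mem {D : TwistedDer K A} {d : ℕ} (F G : Fin d → A)
    (hF : ∀ t, ∃ c c', c ≠ 0 ∧ c' ≠ 0 ∧ D.Good c c' (F t))
    (hG : ∀ t, ∃ c c', c ≠ 0 ∧ c' ≠ 0 ∧ D.Good c c' (G t))
    (h : ∀ t, F t - G t ∈ LinearMap.range D.δ) :
    (∃ c c', c ≠ 0 ∧ c' ≠ 0 ∧ D.Good c c' (List.ofFn F).prod) ∧
    (List.ofFn F).prod - (List.ofFn G).prod ∈ LinearMap.range D.δ := by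
  induction d with
  | zero =>
    refine ⟨⟨1, 1, one_ne_zero, one_ne_zero, ?_, ?_, ?_⟩, ?_⟩
    · simpa using D.map_one
    · simp
    · simp
    · simp
  | succ d ih =>
    obtain ⟨⟨c, c', hc, hc', h1⟩, w, hw⟩ := ih (fun t => F t.succ) (fun t => G t.succ)
      (fun t => hF _) (fun t => hG _) (fun t => h _)
    obtain ⟨e, e', he, he', h2⟩ := hF 0
    obtain ⟨f, f', hf, hf', h3⟩ := hG 0
    obtain ⟨v, hv⟩ := h 0
    rw [List.ofFn_succ, List.prod_cons, List.ofFn_succ, List.prod_cons]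
    refine ⟨⟨_, _, mul_ne_zero he hc, mul_ne_zero he' hc', h2.mul h1⟩, ?_⟩
    -- The difference is `(F 0 - G 0) * F' + G 0 * (F' - G')`, where `F'` and `G'` are the products
    -- of the later factors. The Leibniz rule gives primitives of both terms after division by the
    -- eigenvalues of `τ` on `F'` and of `σ` on `G 0`.
    refine ⟨c'⁻¹ • (v * (List.ofFn fun t => F t.succ).prod) + f⁻¹ • (G 0 * w), ?_⟩
    rw [map_add, map_smul, map_smul, D.leibniz, D.leibniz, h1.δ, h1.τ, h3.δ, h3.σ, hv, hw,
      mul_zero, zero_add, zero_mul, add_zero, mul_smul_comm, smul_smul, smul_mul_assoc, smul_smul,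
      inv_mul_cancel₀ hc', inv_mul_cancel₀ hf, one_smul, one_smul]
    noncomm_ring

/-- The closed elements `a^(ℓ-1) d a`. -/
lemma TwistedDer.good_pow_mul {D : TwistedDer K A} {a b : A} (h : b * a = (q : K) • (a * b))
    (hb : b * b = 0) (hσ : D.σ a = a) (hτ : D.τ a = (q : K) • a) (hδ : D.δ a = b)
    (hσb : D.σ b = -(q : K)⁻¹ • b) (hτb : D.τ b = b) (hδb : D.δ b = 0) (m : ℕ) :
    D.Good (-(q : K)⁻¹) ((q : K) ^ m) (a ^ m * b) := by
  refine ⟨?_, ?_, ?_⟩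
  · rw [D.leibniz, hδb, hτb, D.pow h hσ hτ hδ, smul_mul_assoc, mul_assoc, hb]
    simp
  · rw [map_mul, map_pow, hσ, hσb, mul_smul_comm]
  · rw [map_mul, map_pow, hτ, hτb, smul_pow, smul_mul_assoc]

lemma TwistedDer.good_pow (h : IsOddRoot q ℓ) {D : TwistedDer K A} {a b : A}
    (hab : b * a = (q : K) • (a * b)) (hσ : D.σ a = a) (hτ : D.τ a = (q : K) • a)
    (hδ : D.δ a = b) : D.Good 1 1 (a ^ ℓ) := by
  refine ⟨?_, ?_, ?_⟩
  · rw [D.pow hab hσ hτ hδ, h.primitive_sq.geom_sum_eq_zero h.one_lt, zero_smul]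
  · rw [map_pow, hσ, one_smul]
  · rw [map_pow, hτ, smul_pow, q_pow h]

/-- The form `(a + A)^(ℓ-1) d(a + A)` is cohomologous to `a^(ℓ-1) da + A^(ℓ-1) dA`. -/
lemma TwistedDer.add_pow_mul_mem (h : IsOddRoot q ℓ) {D : TwistedDer K A} {a b a' b' : A}
    (h1 : a' * a = (q : K) ^ 2 • (a * a')) (h2 : b * a' = (q : K)⁻¹ • (a' * b))
    (h3 : b * a = (q : K) • (a * b)) (h4 : b' * a' = (q : K) • (a' * b'))
    (hσ : D.σ a = a) (hτ : D.τ a = (q : K) • a) (hδ : D.δ a = b)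
    (hσ' : D.σ a' = a') (hτ' : D.τ a' = (q : K) • a') (hδ' : D.δ a' = b') :
    (a + a') ^ (ℓ - 1) * (b + b') - (a ^ (ℓ - 1) * b + a' ^ (ℓ - 1) * b') ∈
      LinearMap.range D.δ := by
  have hq : (q : K) ≠ 0 := q.ne_zero
  obtain ⟨m, rfl⟩ : ∃ m, ℓ = m + 1 := ⟨ℓ - 1, by have := h.one_lt; omega⟩
  rw [Nat.add_sub_cancel]
  set z : K := (q : K) ^ 2 with hz
  let num : ℕ → K := fun r => ∑ s ∈ Finset.range r, z ^ s
  have hnum : ∀ r, num r * (1 - z) = 1 - z ^ r := fun r => by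
    have := geom_sum_mul z r
    linear_combination -this
  have hz1 : (1 - z) ≠ 0 := sub_ne_zero.2 (h.primitive_sq.ne_one h.one_lt).symm
  have hnum0 : ∀ r, 0 < r → r < m + 1 → num r ≠ 0 := fun r hr hr' h0 => by
    have := hnum r
    rw [h0, zero_mul] at this
    exact h.primitive_sq.pow_ne_one_of_pos_of_lt hr.ne' hr' (sub_eq_zero.1 this.symm).symm
  have hmon : ∀ s r, D.δ (a ^ s * a' ^ r) =
      num r • (a ^ s * a' ^ (r - 1) * b') + num s • (a ^ (s - 1) * a' ^ r * b) := fun s r => by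
    rw [D.leibniz, D.pow h3 hσ hτ hδ, D.pow h4 hσ' hτ' hδ', map_pow, map_pow, hσ, hτ', smul_pow,
      mul_smul_comm, smul_mul_assoc, mul_smul_comm, mul_assoc (a ^ (s - 1)), mul_pow_of_comm h2,
      mul_smul_comm, smul_smul ((q : K) ^ r), ← mul_pow, mul_inv_cancel₀ hq, one_pow, one_smul]
    simp only [mul_assoc]
    rfl
  -- The recursion of the Gaussian binomials makes the `b`-part of each summand an adjacent term of
  -- the expansion of `(a + a') ^ m`.
  have hg : ∀ r, r < m → gauss z m r * (num (r + 1))⁻¹ * num (m - r) = gauss z m (r + 1) := by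
    intro r hr
    have h5 := gauss_rec z m r hr.le
    rw [← hnum, ← hnum, ← mul_assoc, ← mul_assoc] at h5
    have h6 := mul_right_cancel₀ hz1 h5
    have h7 := hnum0 (r + 1) (by omega) (by omega)
    field_simp
    linear_combination -h6
  -- Formally this is `((a + a') ^ ℓ - a ^ ℓ - a' ^ ℓ)` divided by the quantum integer of `ℓ`. That
  -- integer is zero, but it cancels from the Gaussian binomials before specialization, leaving a
  -- binomial for `ℓ - 1` over the invertible quantum integer of `r + 1`.
  refine ⟨∑ r ∈ Finset.range m, (gauss z m r * (num (r + 1))⁻¹) • (a ^ (m - r) * a' ^ (r + 1)), ?_⟩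
  rw [map_sum]
  have e : ∀ r ∈ Finset.range m,
      D.δ ((gauss z m r * (num (r + 1))⁻¹) • (a ^ (m - r) * a' ^ (r + 1))) =
      gauss z m r • (a ^ (m - r) * a' ^ r) * b' +
        gauss z m (r + 1) • (a ^ (m - (r + 1)) * a' ^ (r + 1)) * b := fun r hr => by
    have hr := Finset.mem_range.1 hr
    rw [map_smul, hmon, smul_add, smul_smul, smul_smul, hg r hr, mul_assoc (gauss z m r),
      inv_mul_cancel₀ (hnum0 (r + 1) (by omega) (by omega)), mul_one, smul_mul_assoc,
      smul_mul_assoc, Nat.add_sub_cancel, Nat.sub_sub]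
  rw [Finset.sum_congr rfl e, Finset.sum_add_distrib, ← Finset.sum_mul, ← Finset.sum_mul]
  -- The expansion of `(a + a') ^ m` is used twice: without its last term, `a' ^ m`, in front of
  -- `b'`, and without its first term, `a ^ m`, in front of `b`.
  have f1 := add_pow_gauss h1 m
  have f2 := f1
  rw [Finset.sum_range_succ, gauss_self, one_smul, Nat.sub_self, pow_zero, one_mul] at f1
  rw [Finset.sum_range_succ', gauss_zero_right, one_smul, Nat.sub_zero, pow_zero, mul_one] at f2
  rw [eq_sub_iff_add_eq.2 f1.symm, eq_sub_iff_add_eq.2 f2.symm]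
  noncomm_ring

/-- The relations between the summands of the coaction on the generators of an algebra of forms. -/
structure ColRel (q : Kˣ) {r : ℕ} (a b : Fin r → A) : Prop where
  aa : ∀ i k, i < k → a k * a i = (q : K) ^ 2 • (a i * a k)
  lt : ∀ i k, i < k → b i * a k = (q : K)⁻¹ • (a k * b i)
  self : ∀ i, b i * a i = (q : K) • (a i * b i)
  gt : ∀ i k, i < k → b k * a i = ((q : K) - (q : K)⁻¹) • (a k * b i) + (q : K) • (a i * b k)

lemma ColRel.succ {r : ℕ} {a b : Fin (r + 1) → A} (h : ColRel q a b) :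
    ColRel q (fun i => a i.succ) (fun i => b i.succ) :=
  ⟨fun _ _ hik => h.aa _ _ (Fin.succ_lt_succ_iff.2 hik),
    fun _ _ hik => h.lt _ _ (Fin.succ_lt_succ_iff.2 hik), fun _ => h.self _,
    fun _ _ hik => h.gt _ _ (Fin.succ_lt_succ_iff.2 hik)⟩

/-- For `i < k` the products `b i * a k` and `b k * a i` contribute `q⁻¹` and `q - q⁻¹` times `a k *
b i`, which add up to `q`. -/
lemma ColRel.sum {r : ℕ} {a b : Fin r → A} (h : ColRel q a b) :
    (∑ i, b i) * ∑ i, a i = (q : K) • ((∑ i, a i) * ∑ i, b i) := by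
  induction r with
  | zero => simp
  | succ r ih =>
    rw [Fin.sum_univ_succ, Fin.sum_univ_succ, add_mul, mul_add, mul_add, ih h.succ, h.self]
    have e1 : b 0 * ∑ i : Fin r, a i.succ = (q : K)⁻¹ • ((∑ i : Fin r, a i.succ) * b 0) := by
      rw [Finset.mul_sum, Finset.sum_mul, Finset.smul_sum]
      exact Finset.sum_congr rfl fun i _ => h.lt _ _ (Fin.succ_pos i)
    have e2 : (∑ i : Fin r, b i.succ) * a 0 = ((q : K) - (q : K)⁻¹) •
        ((∑ i : Fin r, a i.succ) * b 0) + (q : K) • (a 0 * ∑ i : Fin r, b i.succ) := by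
      rw [Finset.mul_sum, Finset.sum_mul, Finset.sum_mul, Finset.smul_sum, Finset.smul_sum,
        ← Finset.sum_add_distrib]
      exact Finset.sum_congr rfl fun i _ => h.gt _ _ (Fin.succ_pos i)
    rw [e1, e2, add_mul, mul_add, mul_add]
    module

/-- The summands are split off one at a time; the sum of the later ones stands in the same relations
to the first summand as each of them. -/
lemma TwistedDer.sum_pow_mul_mem (h : IsOddRoot q ℓ) {D : TwistedDer K A} {r : ℕ} {a b : Fin r → A}
    (hc : ColRel q a b) (hσ : ∀ i, D.σ (a i) = a i) (hτ : ∀ i, D.τ (a i) = (q : K) • a i)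
    (hδ : ∀ i, D.δ (a i) = b i) :
    (∑ i, a i) ^ (ℓ - 1) * (∑ i, b i) - ∑ i, a i ^ (ℓ - 1) * b i ∈ LinearMap.range D.δ := by
  induction r with
  | zero => simp
  | succ r ih =>
    rw [Fin.sum_univ_succ, Fin.sum_univ_succ, Fin.sum_univ_succ]
    have h1 := TwistedDer.add_pow_mul_mem h (D := D) (a := a 0) (b := b 0)
      (a' := ∑ i : Fin r, a i.succ) (b' := ∑ i : Fin r, b i.succ) (by
        rw [Finset.mul_sum, Finset.sum_mul, Finset.smul_sum]
        exact Finset.sum_congr rfl fun i _ => hc.aa _ _ (Fin.succ_pos i)) (by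
        rw [Finset.mul_sum, Finset.sum_mul, Finset.smul_sum]
        exact Finset.sum_congr rfl fun i _ => hc.lt _ _ (Fin.succ_pos i)) (hc.self 0) hc.succ.sum
        (hσ 0) (hτ 0) (hδ 0) (by simp only [map_sum, hσ])
        (by simp only [map_sum, hτ, Finset.smul_sum]) (by simp only [map_sum, hδ])
    have h2 := ih hc.succ (fun i => hσ _) (fun i => hτ _) (fun i => hδ _)
    convert add_mem h1 h2 using 1
    abel

end Divided

end

end QPF

namespace QPF

noncomputable section

/-! ### Naturality of the Cartier map up to coboundaries. -/

section Naturality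

open TensorProduct QFun

variable {K : Type u} [Field K] {m n d : ℕ} {q : Kˣ} {ℓ : ℕ} {A E : Type*} [Ring A] [Algebra K A]
  [Ring E] [Algebra K E]

lemma TwistedDer.tensor_σ_tmul (D : TwistedDer K A) (a : A) (e : E) :
    (D.tensor E).σ (a ⊗ₜ e) = D.σ a ⊗ₜ e := rfl

lemma TwistedDer.tensor_τ_tmul (D : TwistedDer K A) (a : A) (e : E) :
    (D.tensor E).τ (a ⊗ₜ e) = D.τ a ⊗ₜ e := rfl

lemma TwistedDer.tensor_δ_tmul (D : TwistedDer K A) (a : A) (e : E) :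
    (D.tensor E).δ (a ⊗ₜ e) = D.δ a ⊗ₜ e := rfl

/-- The relations of a quantum matrix. -/
def IsQMatrix (q : Kˣ) (t : Fin m → Fin n → E) : Prop :=
  ∀ i k j l, t i l * t k j - t k j * t i l = (coef q i k - coef q j l) • (t i j * t k l)

lemma IsQMatrix.col {t : Fin m → Fin n → E} (ht : IsQMatrix q t) (j : Fin n) {i k : Fin m}
    (h : i < k) : t k j * t i j = (q : K) • (t i j * t k j) := by
  have := ht i k j j
  rw [coef_self, coef_lt q h, zero_sub, neg_smul, sub_smul, one_smul, neg_sub] at this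
  exact sub_right_injective this

/-- Entries of one column of `t` commute up to `q`, so every relation of `X` and `Y` between
different letters acquires one more factor `q`, or cancels one. -/
lemma Braided.colRel {X Y : Fin m → A} (h : Braided q X Y) {t : Fin m → Fin n → E}
    (ht : IsQMatrix q t) (j : Fin n) :
    ColRel q (fun a => X a ⊗ₜ[K] t a j) (fun a => Y a ⊗ₜ[K] t a j) := by
  have hq : (q : K) ≠ 0 := q.ne_zero
  refine ⟨fun i k hik => ?_, fun i k hik => ?_, fun i => ?_, fun i k hik => ?_⟩
  · rw [Algebra.TensorProduct.tmul_mul_tmul, Algebra.TensorProduct.tmul_mul_tmul, h.X_qcomm hik,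
      ht.col j hik, tmul_smul, smul_tmul', smul_smul, pow_two, smul_tmul']
  · rw [Algebra.TensorProduct.tmul_mul_tmul, Algebra.TensorProduct.tmul_mul_tmul,
      (h.Y_X_comm hik).eq, ht.col j hik, tmul_smul, smul_smul, inv_mul_cancel₀ hq, one_smul]
  · rw [Algebra.TensorProduct.tmul_mul_tmul, Algebra.TensorProduct.tmul_mul_tmul, h.Y_X_self,
      smul_tmul']
  · simp only [Algebra.TensorProduct.tmul_mul_tmul]
    rw [h.braid, coef_gt q hik, add_tmul, ← smul_tmul', ht.col j hik]
    simp only [tmul_smul]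

/-- The summands commute up to `q²`, a primitive `ℓ`-th root of unity, so all mixed terms of the
`ℓ`-th power vanish. -/
lemma coact_pow (h : IsOddRoot q ℓ) {X Y : Fin m → A} (hb : Braided q X Y)
    {t : Fin m → Fin n → E} (ht : IsQMatrix q t) (j : Fin n) :
    coact (K := K) t X j ^ ℓ = coact (fun a j => t a j ^ ℓ) (fun a => X a ^ ℓ) j := by
  rw [coact, sum_pow_root h.primitive_sq h.pos _ fun _ _ hkl => (hb.colRel ht j).aa _ _ hkl, coact]
  simp only [Algebra.TensorProduct.tmul_pow]

lemma coact_pow_mul (h : IsOddRoot q ℓ) {X Y : Fin m → A} {t : Fin m → Fin n → E} (j : Fin n) :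
    coact (K := K) (fun a j => t a j ^ ℓ) (fun a => X a ^ (ℓ - 1) * Y a) j =
      ∑ a, (X a ⊗ₜ[K] t a j) ^ (ℓ - 1) * Y a ⊗ₜ t a j := by
  rw [coact]
  refine Finset.sum_congr rfl fun a _ => ?_
  rw [Algebra.TensorProduct.tmul_pow, Algebra.TensorProduct.tmul_mul_tmul, ← pow_succ,
    Nat.sub_add_cancel h.pos]

/-- If `q² = -1`, its `ℓ`-th power gives `-1 = 1` because `ℓ` is odd, so `q² = 1`. The argument also
covers characteristic two. -/
lemma IsOddRoot.sq_add_one_ne_zero (h : IsOddRoot q ℓ) : (q : K) ^ 2 + 1 ≠ 0 := by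
  intro h0
  have h1 : (q : K) ^ 2 = -1 := eq_neg_of_add_eq_zero_left h0
  have h2 := h.primitive_sq.pow_eq_one
  rw [h1, h.odd.neg_one_pow] at h2
  exact h.primitive_sq.ne_one h.one_lt (h1.trans h2)

/-- The coaction on the twisted generators is, up to coboundaries, induced by the `ℓ`-th powers of
the entries of the matrix. -/
lemma ev_coact_sub_mem (h : IsOddRoot q ℓ) {t : Fin m → Fin n → E} (ht : IsQMatrix q t) (i : ℕ)
    (y : Tens K n d) :
    ev (fun j => coact (K := K) t (Form.X q) j ^ ℓ)
        (fun j => coact t (Form.X q) j ^ (ℓ - 1) * coact t (Form.Y q) j) d i y -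
      ev (coact (fun a j => t a j ^ ℓ) (frX q m ℓ)) (coact (fun a j => t a j ^ ℓ) (frY q m ℓ)) d i y ∈
    LinearMap.range ((Form.der q m 1 0).tensor E).δ := by
  have hq : (q : K) ≠ 0 := q.ne_zero
  rcases Nat.lt_or_ge d i with hi | hi
  · simp [ev, hi.not_ge]
  set D := (Form.der q m 1 0).tensor E
  have hb := Form.braided q m
  have hB := hb.coact h.sq_add_one_ne_zero ht
  have hσ : ∀ a j, D.σ (Form.X q a ⊗ₜ t a j) = Form.X q a ⊗ₜ t a j := fun a j => by
    rw [TwistedDer.tensor_σ_tmul, Form.der_σ_X]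
  have hτ : ∀ a j, D.τ (Form.X q a ⊗ₜ t a j) = (q : K) • Form.X q a ⊗ₜ t a j := fun a j => by
    rw [TwistedDer.tensor_τ_tmul, Form.der_τ_X, smul_tmul']
  have hδ : ∀ a j, D.δ (Form.X q a ⊗ₜ t a j) = Form.Y q a ⊗ₜ t a j := fun a j => by
    rw [TwistedDer.tensor_δ_tmul, Form.der_δ_X, one_smul]
  have hσY : ∀ a j, D.σ (Form.Y q a ⊗ₜ t a j) = -(q : K)⁻¹ • Form.Y q a ⊗ₜ t a j := fun a j => by
    rw [TwistedDer.tensor_σ_tmul, Form.der_σ_Y, smul_tmul']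
  have hτY : ∀ a j, D.τ (Form.Y q a ⊗ₜ t a j) = Form.Y q a ⊗ₜ t a j := fun a j => by
    rw [TwistedDer.tensor_τ_tmul, Form.der_τ_Y]
  have hδY : ∀ a j, D.δ (Form.Y q a ⊗ₜ t a j) = 0 := fun a j => by
    rw [TwistedDer.tensor_δ_tmul, Form.der_δ_Y, zero_smul, zero_tmul]
  have cσ : ∀ j, D.σ (coact t (Form.X q) j) = coact t (Form.X q) j := fun j => by
    simp only [coact, map_sum, hσ]
  have cτ : ∀ j, D.τ (coact t (Form.X q) j) = (q : K) • coact t (Form.X q) j := fun j => by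
    simp only [coact, map_sum, hτ, Finset.smul_sum]
  have cδ : ∀ j, D.δ (coact t (Form.X q) j) = coact t (Form.Y q) j := fun j => by
    simp only [coact, map_sum, hδ]
  have cσY : ∀ j, D.σ (coact t (Form.Y q) j) = -(q : K)⁻¹ • coact t (Form.Y q) j := fun j => by
    simp only [coact, map_sum, hσY, Finset.smul_sum]
  have cτY : ∀ j, D.τ (coact t (Form.Y q) j) = coact t (Form.Y q) j := fun j => by
    simp only [coact, map_sum, hτY]
  have cδY : ∀ j, D.δ (coact t (Form.Y q) j) = 0 := fun j => by
    simp only [coact, map_sum, hδY, Finset.sum_const_zero]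
  have gX : ∀ j, D.Good 1 1 (coact t (Form.X q) j ^ ℓ) := fun j =>
    TwistedDer.good_pow h (hB.Y_X_self j) (cσ j) (cτ j) (cδ j)
  have gY : ∀ j, D.Good (-(q : K)⁻¹) ((q : K) ^ (ℓ - 1))
      (coact t (Form.X q) j ^ (ℓ - 1) * coact t (Form.Y q) j) := fun j =>
    TwistedDer.good_pow_mul (hB.Y_X_self j) (hB.ext_self j) (cσ j) (cτ j) (cδ j) (cσY j) (cτY j)
      (cδY j) _
  have gY' : ∀ j, D.Good (-(q : K)⁻¹) ((q : K) ^ (ℓ - 1))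
      (coact (fun a j => t a j ^ ℓ) (frY q m ℓ) j) := fun j => by
    rw [coact_pow_mul h]
    refine TwistedDer.Good.sum fun a _ => ?_
    exact TwistedDer.good_pow_mul ((hb.colRel ht j).self a) (by
      rw [Algebra.TensorProduct.tmul_mul_tmul, hb.ext_self, zero_tmul]) (hσ a j) (hτ a j) (hδ a j)
      (hσY a j) (hτY a j) (hδY a j) _
  have n1 : -(q : K)⁻¹ ≠ 0 := neg_ne_zero.2 (inv_ne_zero hq)
  have n2 : (q : K) ^ (ℓ - 1) ≠ 0 := pow_ne_zero _ hq
  rw [ev_of_le _ _ hi, ev_of_le _ _ hi]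
  induction y using Finsupp.induction_linear with
  | zero => simp
  | add f g hf hg =>
    rw [map_add, map_add, add_sub_add_comm]
    exact add_mem hf hg
  | single w c =>
    have ec : Finsupp.single w c = c • Finsupp.single w (1 : K) := by simp
    rw [ec, map_smul, map_smul, ← smul_sub]
    refine Submodule.smul_mem _ _ ?_
    rw [evT_single, evT_single]
    -- The comparison is made factor by factor: symmetric letters agree exactly, exterior letters up
    -- to a coboundary.
    refine (TwistedDer.prod_sub_prod_mem _ _ (fun s => ?_) (fun s => ?_) (fun s => ?_)).2
    · simp only [letters]
      split_ifs
      · exact ⟨1, 1, one_ne_zero, one_ne_zero, gX _⟩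
      · exact ⟨_, _, n1, n2, gY _⟩
    · simp only [letters]
      split_ifs
      · refine ⟨1, 1, one_ne_zero, one_ne_zero, ?_⟩
        rw [← coact_pow h hb ht]
        exact gX _
      · exact ⟨_, _, n1, n2, gY' _⟩
    · simp only [letters]
      split_ifs
      · rw [← coact_pow h hb ht, sub_self]
        exact zero_mem _
      · rw [coact_pow_mul h]
        exact TwistedDer.sum_pow_mul_mem h (hb.colRel ht _) (fun a => hσ a _) (fun a => hτ a _)
          (fun a => hδ a _)

/-- The linear form on operators that belongs to a map that is linear over the Hecke algebra. -/
def schurForm (g : schur q n m d) : Module.End K (relFun K (matRel q m n)) →ₗ[K] K where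
  toFun a := (a ⟨_, listExt_entry_mem g⟩).1 []
  map_add' _ _ := rfl
  map_smul' _ _ := rfl

/-- The universal matrix. -/
abbrev univ (q : Kˣ) (m n : ℕ) (i : Fin m) (j : Fin n) : Module.End K (relFun K (matRel q m n)) :=
  appendOp (matRel q m n) (i, j)

lemma univ_isQMatrix (q : Kˣ) (m n : ℕ) : IsQMatrix q (univ q m n) := appendOp_matRel

/-- All matrix coefficients of `g` are values of one linear form on words in the universal quantum
matrix, so `g` is a contraction of the coaction. -/
lemma entry_eq_schurForm (g : schur q n m d) (I : Word m d) (J : Word n d) :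
    entry g.1 I J = schurForm g (List.ofFn fun t => univ q m n (I t) (J t)).prod := by
  change _ = ((List.ofFn fun t => appendOp (matRel q m n) (I t, J t)).prod
    ⟨_, listExt_entry_mem g⟩).1 []
  rw [appendOp_prod_nil _ (fun t : Fin d => (I t, J t))]
  dsimp only
  rw [listExt_ofFn]
  rfl

lemma slice_ev (θ : E →ₗ[K] K) (s : Fin m → Fin n → E) (g : Tens K n d →ₗ[K] Tens K m d)
    (hg : ∀ I J, entry g I J = θ (List.ofFn fun t => s (I t) (J t)).prod) (X Y : Fin m → A) (i : ℕ)
    (y : Tens K n d) :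
    slice θ (ev (coact s X) (coact s Y) d i y) = ev X Y d i (g y) := by
  rcases Nat.lt_or_ge d i with hi | hi
  · simp [ev, hi.not_ge]
  · rw [ev_of_le _ _ hi, ev_of_le _ _ hi, ← slice_evT θ s g hg]
    have e : letters (coact (K := K) s X) (coact s Y) (d - i) =
        fun t => coact s (letters X Y (d - i) t) := by
      funext t
      simp only [letters]
      split_ifs <;> rfl
    rw [e]

/-- The functoriality of forms in terms of the coaction. -/
def formMap (h : IsOddRoot q ℓ) (g : schur q n m d) : Form q n →ₗ[K] Form q m :=
  (slice (schurForm g)).comp (Form.lift ((Form.braided q m).coact h.sq_add_one_ne_zero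
    (univ_isQMatrix q m n))).toLinearMap

/-- The functoriality of `Ω` is the coaction followed by a contraction, a form in which it can be
compared with products and derivations. -/
lemma formMap_ev (h : IsOddRoot q ℓ) (g : schur q n m d) (i : ℕ) (y : Tens K n d) :
    formMap h g (evF q n d i y) = evF q m d i (g.1 y) := by
  rw [formMap, LinearMap.comp_apply, AlgHom.toLinearMap_apply, map_ev,
    ← slice_ev (schurForm g) (univ q m n) g.1 (entry_eq_schurForm g)]
  congr 3 <;> funext j
  · exact Form.lift_X _ j
  · exact Form.lift_Y _ j

/-- The `ℓ`-th powers of the entries of the universal matrix contract to the matrix of `frobLin`.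
The discrepancy with the powers of the coaction is a coboundary, and contraction commutes with the
differential of the first tensor factor. -/
lemma formMap_carF_sub_mem (h : IsOddRoot q ℓ) (g : schur q n m (d * ℓ)) (i : ℕ)
    (y : Tens K n d) :
    formMap h g (ev (frX q n ℓ) (frY q n ℓ) d i y) -
      ev (frX q m ℓ) (frY q m ℓ) d i (frobLin h.pos g.1 y) ∈ LinearMap.range (dR q m) := by
  rw [← slice_ev (schurForm g) (fun a j => univ q m n a j ^ ℓ) (frobLin h.pos g.1)
    (fun I J => (entry_frobLin h.pos g.1 I J).trans (entry_rep g I J)), formMap,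
    LinearMap.comp_apply, AlgHom.toLinearMap_apply, map_ev, ← map_sub]
  obtain ⟨w, hw⟩ := ev_coact_sub_mem h (univ_isQMatrix q m n) i y
  refine ⟨slice (schurForm g) w, ?_⟩
  rw [← slice_tensor, hw]
  congr 4 <;> funext j <;> simp [Form.lift_X, Form.lift_Y]

end Naturality

end

end QPF

namespace QPF

noncomputable section

/-! ### The Cartier isomorphism of functors. -/

section CartierMap

open QFun

variable {K : Type u} [Field K] {n m d : ℕ} {q : Kˣ} {ℓ : ℕ}

/-- A natural transformation with bijective components is an isomorphism. -/
def QFun.isoOfBijective {F G : QFun q d} (φ : F ⟶ G) (hφ : ∀ A, Function.Bijective (app φ A)) :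
    F ≅ G where
  hom := φ
  inv := homMk (fun A => (LinearEquiv.ofBijective (app φ A) (hφ A)).symm.toLinearMap) (by
    intro A B f x
    apply (hφ B).1
    rw [app_lmap]
    exact (LinearEquiv.apply_symm_apply (LinearEquiv.ofBijective (app φ B) (hφ B)) _).trans
      (congrArg (G.lmap f)
        (LinearEquiv.apply_symm_apply (LinearEquiv.ofBijective (app φ A) (hφ A)) x).symm))
  hom_inv_id := by
    apply ObjectProperty.hom_ext
    ext A x
    exact LinearEquiv.symm_apply_apply (LinearEquiv.ofBijective (app φ A) (hφ A)) x
  inv_hom_id := by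
    apply ObjectProperty.hom_ext
    ext A x
    exact LinearEquiv.apply_symm_apply (LinearEquiv.ofBijective (app φ A) (hφ A)) x

lemma Cochain.cls_surjective (C : Cochain q d) {i : ℕ} {A : Source q d}
    (c : (C.cohomology i).at' A) : ∃ x hx, c = C.cls x hx := by
  obtain ⟨⟨x, hx⟩, rfl⟩ := Submodule.Quotient.mk_surjective _ c
  exact ⟨x, hx, rfl⟩

lemma Cochain.cls_eq_iff (C : Cochain q d) {i : ℕ} {A : Source q d} (x y : (C.X i).at' A)
    (hx : app (C.δ i) A x = 0) (hy : app (C.δ i) A y = 0) :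
    C.cls x hx = C.cls y hy ↔ x - y ∈ (C.coboundaries i).carrier A :=
  Submodule.Quotient.eq _

lemma mem_coboundaries_iff (i : ℕ) (N : Source q d) (z : (Omega q d i).at' N) :
    z ∈ ((deRham q d).coboundaries i).carrier N ↔ ∃ a, evO q d i N z = dR q N.dim a :=
  ⟨evO_coboundary i N, fun ⟨a, ha⟩ => mem_coboundaries i N z a ha⟩

lemma deRham_cocycle_iff (i : ℕ) (N : Source q d) (z : (Omega q d i).at' N) :
    app ((deRham q d).δ i) N z = 0 ↔ dR q N.dim (evO q d i N z) = 0 := by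
  rw [← dR_evO]
  exact (map_eq_zero_iff (evO q d (i + 1) N) (evO_injective (i + 1) N)).symm

lemma deRham_cls_eq_iff {i : ℕ} {N : Source q d} (x y : (Omega q d i).at' N)
    (hx : app ((deRham q d).δ i) N x = 0) (hy : app ((deRham q d).δ i) N y = 0) :
    (deRham q d).cls x hx = (deRham q d).cls y hy ↔
      ∃ a, evO q d i N x - evO q d i N y = dR q N.dim a := by
  refine (Cochain.cls_eq_iff (deRham q d) (i := i) (A := N) x y hx hy).trans ((mem_coboundaries_iff i N (x - y)).trans ?_)
  rw [map_sub]

lemma carQ_cocycle (h : IsOddRoot q ℓ) (d i : ℕ) (N : Source q (d * ℓ))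
    (x : Tens K N.dim d ⧸ rel (1 : Kˣ) N.dim d i) :
    app ((deRham q (d * ℓ)).δ i) N (carQ h N.dim d i x) = 0 :=
  (deRham_cocycle_iff i N _).2 (by rw [evO_carQ, dR_carF])

/-- `carQ` itself need not be natural; the two composites differ by a coboundary and agree in
cohomology. -/
lemma carQ_hom (h : IsOddRoot q ℓ) (d i : ℕ) {M N : Source q (d * ℓ)} (f : M ⟶ N)
    (x : (Omega (1 : Kˣ) d i).at' ((frob h d).obj M)) :
    ∃ a, evO q (d * ℓ) i N (carQ h N.dim d i ((Omega 1 d i).lmap ((frob h d).map f) x)) -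
      evO q (d * ℓ) i N ((Omega q (d * ℓ) i).lmap f (carQ h M.dim d i x)) = dR q N.dim a := by
  have key : ∀ z : (Omega q (d * ℓ) i).at' M,
      evO q (d * ℓ) i N ((Omega q (d * ℓ) i).lmap f z) =
        formMap h f (evO q (d * ℓ) i M z) := by
    intro z
    obtain ⟨y, rfl⟩ := Omega.mk_surjective _ _ _ _ z
    exact (formMap_ev h f i y).symm
  obtain ⟨y, rfl⟩ := Omega.mk_surjective _ _ _ _ x
  obtain ⟨a, ha⟩ := formMap_carF_sub_mem h f i y
  have e1 := (key _).trans (congrArg (formMap h f) (evO_carQ h i M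
    ((rel (1 : Kˣ) M.dim d i).mkQ y)))
  have e2 := evO_carQ h i N ((rel (1 : Kˣ) N.dim d i).mkQ (frobLin h.pos f.1 y))
  refine ⟨-a, (congrArg₂ (· - ·) e2 e1).trans ?_⟩
  rw [map_neg, ha, neg_sub, carF_mk]
  rfl

/-- The components of the Cartier map. -/
def cartierApp (h : IsOddRoot q ℓ) (d i : ℕ) (N : Source q (d * ℓ)) :
    ((twist h d).obj (Omega 1 d i)).at' N →ₗ[K] ((deRham q (d * ℓ)).cohomology i).at' N :=
  (Submodule.mkQ ((((deRham q (d * ℓ)).coboundaries i).inside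
      ((deRham q (d * ℓ)).cocycles i)).carrier N)).comp
    (LinearMap.codRestrict (((deRham q (d * ℓ)).cocycles i).carrier N) (carQ h N.dim d i)
      (carQ_cocycle h d i N))

lemma cartierApp_eq (h : IsOddRoot q ℓ) (d i : ℕ) (N : Source q (d * ℓ))
    (x : Tens K N.dim d ⧸ rel (1 : Kˣ) N.dim d i) :
    cartierApp h d i N x = (deRham q (d * ℓ)).cls (carQ h N.dim d i x) (carQ_cocycle h d i N x) :=
  rfl

lemma cartierApp_eq_cls_iff (h : IsOddRoot q ℓ) (d i : ℕ) (N : Source q (d * ℓ))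
    (x : Tens K N.dim d ⧸ rel (1 : Kˣ) N.dim d i) (z : (Omega q (d * ℓ) i).at' N)
    (hz : app ((deRham q (d * ℓ)).δ i) N z = 0) :
    cartierApp h d i N x = (deRham q (d * ℓ)).cls z hz ↔
      ∃ a, carF h N.dim d i x - evO q (d * ℓ) i N z = dR q N.dim a := by
  rw [cartierApp_eq]
  refine (deRham_cls_eq_iff _ z _ hz).trans ?_
  rw [evO_carQ]

/-- The primitive is kept explicit because for the Koszul kernels it has to be shown to lie in the
kernel of `kz`. -/
lemma exists_carQ (h : IsOddRoot q ℓ) (d i : ℕ) (N : Source q (d * ℓ))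
    (z : (Omega q (d * ℓ) i).at' N) (hz : app ((deRham q (d * ℓ)).δ i) N z = 0) :
    ∃ x, evO q (d * ℓ) i N z = carF h N.dim d i x +
      dR q N.dim (genF q N.dim (hM q N.dim ℓ (nfQ q N.dim (d * ℓ) i z))) := by
  rw [evO_eq]
  refine exists_carF h d i _ (nfQ_filter _ _ _) ?_
  apply genF_injective (q := q)
  rw [← dR_genF, ← evO_eq, (deRham_cocycle_iff i N z).1 hz, map_zero]

lemma cartierApp_bijective (h : IsOddRoot q ℓ) (d i : ℕ) (N : Source q (d * ℓ)) :
    Function.Bijective (cartierApp h d i N) := by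
  refine ⟨(injective_iff_map_eq_zero _).2 fun x hx => ?_, fun c => ?_⟩
  · obtain ⟨a, ha⟩ := (cartierApp_eq_cls_iff h d i N x 0 (map_zero _)).1 hx
    rw [map_zero, sub_zero] at ha
    exact eq_zero_of_carF_eq_dR h d i x a ha
  · obtain ⟨z, hz, rfl⟩ := Cochain.cls_surjective _ c
    obtain ⟨x, hx⟩ := exists_carQ h d i N z hz
    refine ⟨x, (cartierApp_eq_cls_iff h d i N x z hz).2 ⟨-(genF q N.dim
      (hM q N.dim ℓ (nfQ q N.dim (d * ℓ) i z))), ?_⟩⟩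
    rw [hx, map_neg]
    abel

lemma cartierApp_lmap (h : IsOddRoot q ℓ) (d i : ℕ) {M N : Source q (d * ℓ)} (f : M ⟶ N)
    (x : ((twist h d).obj (Omega 1 d i)).at' M) :
    cartierApp h d i N (((twist h d).obj (Omega 1 d i)).lmap f x) =
      ((deRham q (d * ℓ)).cohomology i).lmap f (cartierApp h d i M x) :=
  (deRham_cls_eq_iff (N := N) _ ((Omega q (d * ℓ) i).lmap f (carQ h M.dim d i x))
    (carQ_cocycle h d i N _) (by
      refine (app_lmap ((deRham q (d * ℓ)).δ i) f _).trans ?_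
      exact (congrArg _ (carQ_cocycle h d i M x)).trans (map_zero _))).2 (carQ_hom h d i f x)

/-- The Cartier isomorphism. -/
def cartier (h : IsOddRoot q ℓ) (d i : ℕ) :
    (twist h d).obj (Omega 1 d i) ≅ (deRham q (d * ℓ)).cohomology i :=
  QFun.isoOfBijective (homMk (cartierApp h d i) (cartierApp_lmap h d i))
    (cartierApp_bijective h d i)

lemma app_cartier_eq_cls_iff (h : IsOddRoot q ℓ) (d i : ℕ) (N : Source q (d * ℓ))
    (x : Tens K N.dim d ⧸ rel (1 : Kˣ) N.dim d i) (z : (Omega q (d * ℓ) i).at' N)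
    (hz : app ((deRham q (d * ℓ)).δ i) N z = 0) :
    app (cartier h d i).hom N x = (deRham q (d * ℓ)).cls z hz ↔
      ∃ a, carF h N.dim d i x - evO q (d * ℓ) i N z = dR q N.dim a :=
  cartierApp_eq_cls_iff h d i N x z hz

end CartierMap

end

end QPF

namespace QPF

noncomputable section

/-! ### Multiplicativity and the values on generators. -/

section CartierAlgebra

open QFun

variable {K : Type u} [Field K] {n m d e D : ℕ} {q : Kˣ} {ℓ : ℕ}

section Evaluation

variable {A : Type*} [Ring A] [Algebra K A] (X Y : Fin n → A)

lemma ev_single_of_eq_zero (hd : d = 0) (w : Word n d) : ev X Y d 0 (Finsupp.single w (1 : K)) = 1 := by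
  subst hd
  rw [ev_of_le _ _ le_rfl, evT_single, List.ofFn_zero, List.prod_nil]

lemma ev_single_const_zero (k : Fin n) :
    ev X Y d 0 (Finsupp.single (fun _ : Fin d => k) (1 : K)) = X k ^ d := by
  rw [ev_of_le _ _ (Nat.zero_le _), evT_single, ← List.prod_replicate, ← List.ofFn_const]
  congr 2
  funext t
  rw [letters, if_pos (by omega)]

lemma ev_single_const_one (hd : 0 < d) (k : Fin n) :
    ev X Y d 1 (Finsupp.single (fun _ : Fin d => k) (1 : K)) = X k ^ (d - 1) * Y k := by
  obtain ⟨d, rfl⟩ := Nat.exists_eq_add_of_le' hd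
  rw [ev_of_le _ _ (by omega), evT_single, List.ofFn_succ', List.concat_eq_append, List.prod_append,
    List.prod_singleton, Nat.add_sub_cancel]
  congr 1
  · rw [← List.prod_replicate, ← List.ofFn_const]
    congr 2
    funext t
    rw [letters, if_pos (by simp)]
  · rw [letters, if_neg (by simp)]

end Evaluation

lemma evO_mul {d e D : ℕ} (hn : 0 < n) (h : d + e = D) (i j : ℕ) (z : (Omega q d i).at' ⟨n, hn⟩)
    (w : (Omega q e j).at' ⟨n, hn⟩) :
    evO q D (i + j) ⟨n, hn⟩ (Omega.mul q hn h i j z w) =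
      evO q d i ⟨n, hn⟩ z * evO q e j ⟨n, hn⟩ w := by
  rcases Nat.lt_or_ge d i with hi | hi
  · have hz : z = 0 := quot_rel_eq_zero hi z
    subst hz
    simp only [map_zero, LinearMap.zero_apply, zero_mul]
  rcases Nat.lt_or_ge e j with hj | hj
  · have hw : w = 0 := quot_rel_eq_zero hj w
    subst hw
    simp only [map_zero, mul_zero]
  obtain ⟨x, rfl⟩ := Omega.mk_surjective _ _ _ _ z
  obtain ⟨y, rfl⟩ := Omega.mk_surjective _ _ _ _ w
  rw [Omega.mul_mk, evO_mk, evO_mk, evO_mk]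
  exact (Form.braided q n).ev_mulTens h i j hi hj x y

lemma carF_mul (h : IsOddRoot q ℓ) (hn : 0 < n) (d e i j : ℕ)
    (x : (Omega (1 : Kˣ) d i).at' ⟨n, hn⟩) (y : (Omega (1 : Kˣ) e j).at' ⟨n, hn⟩) :
    carF h n (d + e) (i + j) (Omega.mul (1 : Kˣ) hn rfl i j x y) =
      carF h n d i x * carF h n e j y := by
  rcases Nat.lt_or_ge d i with hi | hi
  · have hx : x = 0 := quot_rel_eq_zero hi x
    subst hx
    simp only [map_zero, LinearMap.zero_apply]
    exact (map_zero _).trans ((congrArg (· * _) (map_zero (carF h n d i))).trans (zero_mul _)).symm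
  rcases Nat.lt_or_ge e j with hj | hj
  · have hy : y = 0 := quot_rel_eq_zero hj y
    subst hy
    simp only [map_zero]
    exact (map_zero _).trans ((congrArg (_ * ·) (map_zero (carF h n e j))).trans (mul_zero _)).symm
  obtain ⟨x, rfl⟩ := Omega.mk_surjective _ _ _ _ x
  obtain ⟨y, rfl⟩ := Omega.mk_surjective _ _ _ _ y
  exact (fr_braided h n).ev_mulTens rfl i j hi hj x y

lemma der_σ_evO (s t : K) (i : ℕ) (N : Source q d) (z : (Omega q d i).at' N) :
    (Form.der q N.dim s t).σ (evO q d i N z) = (-(q : K)⁻¹) ^ i • evO q d i N z := by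
  obtain ⟨y, rfl⟩ := Omega.mk_surjective _ _ _ _ z
  exact der_σ_ev s t d i y

lemma der_τ_evO (s t : K) (i : ℕ) (N : Source q d) (z : (Omega q d i).at' N) :
    (Form.der q N.dim s t).τ (evO q d i N z) = (q : K) ^ (d - i) • evO q d i N z := by
  obtain ⟨y, rfl⟩ := Omega.mk_surjective _ _ _ _ z
  exact der_τ_ev s t d i y

/-- By the Leibniz rule the product is the differential of `z * b` divided by the eigenvalue of `σ`
on the cocycle `z`. -/
lemma evO_mul_dR {i : ℕ} {N : Source q d} {z : (Omega q d i).at' N}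
    (hz : dR q N.dim (evO q d i N z) = 0) (b : Form q N.dim) :
    ∃ a, evO q d i N z * dR q N.dim b = dR q N.dim a := by
  have hc : (-(q : K)⁻¹) ^ i ≠ 0 := pow_ne_zero _ (neg_ne_zero.2 (inv_ne_zero q.ne_zero))
  refine ⟨((-(q : K)⁻¹) ^ i)⁻¹ • (evO q d i N z * b), ?_⟩
  rw [map_smul, (Form.der q N.dim 1 0).leibniz, hz, zero_mul, add_zero, der_σ_evO, smul_mul_assoc,
    smul_smul, inv_mul_cancel₀ hc, one_smul]

lemma dR_mul_evO {i : ℕ} {N : Source q d} {z : (Omega q d i).at' N}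
    (hz : dR q N.dim (evO q d i N z) = 0) (b : Form q N.dim) :
    ∃ a, dR q N.dim b * evO q d i N z = dR q N.dim a := by
  have hc : (q : K) ^ (d - i) ≠ 0 := pow_ne_zero _ q.ne_zero
  refine ⟨((q : K) ^ (d - i))⁻¹ • (b * evO q d i N z), ?_⟩
  rw [map_smul, (Form.der q N.dim 1 0).leibniz, hz, mul_zero, zero_add, der_τ_evO, mul_smul_comm,
    smul_smul, inv_mul_cancel₀ hc, one_smul]

/-- On the unit and the generators the representatives agree in the algebra of forms, with no
coboundary; closedness comes for free. -/
lemma app_cartier_of_eq (h : IsOddRoot q ℓ) (d i : ℕ) (N : Source q (d * ℓ))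
    (x : Tens K N.dim d ⧸ rel (1 : Kˣ) N.dim d i) (z : (Omega q (d * ℓ) i).at' N)
    (hxz : carF h N.dim d i x = evO q (d * ℓ) i N z) :
    ∃ hz : app ((deRham q (d * ℓ)).δ i) N z = 0,
      app (cartier h d i).hom N x = (deRham q (d * ℓ)).cls z hz :=
  ⟨(deRham_cocycle_iff i N z).2 (by rw [← hxz, dR_carF]),
    (app_cartier_eq_cls_iff h d i N x z _).2 ⟨0, by rw [hxz, sub_self, map_zero]⟩⟩

lemma isCartier_cartier (h : IsOddRoot q ℓ) : IsCartier h (cartier h) where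
  one n hn w w' := app_cartier_of_eq h 0 0 ⟨n, hn⟩ _ _
    ((ev_single_of_eq_zero (frX q n ℓ) (frY q n ℓ) rfl w).trans
      (ev_single_of_eq_zero (Form.X q) (Form.Y q) (zero_mul ℓ) w').symm)
  sym_gen n hn k := app_cartier_of_eq h 1 0 ⟨n, hn⟩ _ _
    ((ev_single_const_zero (frX q n ℓ) (frY q n ℓ) k).trans (by
      rw [evO_mk, pow_one]
      refine Eq.trans ?_ (ev_single_const_zero (Form.X q) (Form.Y q) k).symm
      rw [one_mul]))
  ext_gen n hn k := app_cartier_of_eq h 1 1 ⟨n, hn⟩ _ _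
    ((ev_single_const_one (frX q n ℓ) (frY q n ℓ) one_pos k).trans (by
      rw [evO_mk, Nat.sub_self, pow_zero, one_mul]
      refine Eq.trans ?_ (ev_single_const_one (Form.X q) (Form.Y q) (by simpa using h.pos) k).symm
      rw [one_mul]))
  mul n hn d e i j x y z w hz hw hxz hyw := by
    obtain ⟨a, ha⟩ := (app_cartier_eq_cls_iff h d i ⟨n, hn⟩ x z hz).1 hxz
    obtain ⟨b, hb⟩ := (app_cartier_eq_cls_iff h e j ⟨n, hn⟩ y w hw).1 hyw
    have hz' := (deRham_cocycle_iff i ⟨n, hn⟩ z).1 hz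
    have hw' := (deRham_cocycle_iff j ⟨n, hn⟩ w).1 hw
    have hzw : app ((deRham q ((d + e) * ℓ)).δ (i + j)) ⟨n, hn⟩
        (Omega.mul q hn (add_mul d e ℓ).symm i j z w) = 0 := by
      refine (deRham_cocycle_iff (i + j) ⟨n, hn⟩ _).2 ?_
      rw [evO_mul]
      refine ((Form.der q n 1 0).leibniz _ _).trans ?_
      rw [hz', hw', mul_zero, zero_mul, add_zero]
    refine ⟨hzw, (app_cartier_eq_cls_iff h (d + e) (i + j) ⟨n, hn⟩ _ _ hzw).2 ?_⟩
    -- With `c` for `carF`, the difference is split as `c x * c y - z * w = (c x - z) * c y + z * (c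
    -- y - w)`: a coboundary times a cocycle and a cocycle times a coboundary.
    have hy : dR q n (evO q (e * ℓ) j ⟨n, hn⟩ (carQ h n e j y)) = 0 :=
      (congrArg _ (evO_carQ h j ⟨n, hn⟩ y)).trans (dR_carF h e j y)
    obtain ⟨a', ha'⟩ := dR_mul_evO (N := ⟨n, hn⟩) hy a
    obtain ⟨b', hb'⟩ := evO_mul_dR (N := ⟨n, hn⟩) hz' b
    refine ⟨a' + b', ?_⟩
    rw [map_add, ← ha', ← hb', ← ha, ← hb, evO_mul]
    refine (congrArg (· - _) (carF_mul h hn d e i j x y)).trans ?_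
    rw [evO_carQ h j ⟨n, hn⟩ y]
    noncomm_ring

end CartierAlgebra

end

end QPF

namespace QPF

noncomputable section

/-! ### The restriction to the Koszul kernels. -/

section KoszulKernels

open QFun

variable {K : Type u} [Field K] {n m d : ℕ} {q : Kˣ} {ℓ : ℕ}

lemma mem_koszulKer_iff (d i : ℕ) (N : Source q d) (z : (Omega q d i).at' N) :
    z ∈ (koszulKer q d i).carrier N ↔ kz q N.dim (evO q d i N z) = 0 := by
  cases i with
  | zero =>
    obtain ⟨y, rfl⟩ := Omega.mk_surjective _ _ _ _ z
    exact ⟨fun _ => kz_ev_zero d y, fun _ => trivial⟩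
  | succ i =>
    rw [← kz_evO]
    exact (map_eq_zero_iff (evO q d i N) (evO_injective i N)).symm

/-- The Cartier map intertwines the Koszul differentials up to a nonzero scalar and is injective. -/
lemma mem_koszulKer_one_iff (h : IsOddRoot q ℓ) (d i : ℕ) (N : Source q (d * ℓ))
    (x : Tens K N.dim d ⧸ rel (1 : Kˣ) N.dim d i) :
    x ∈ (koszulKer (1 : Kˣ) d i).carrier ((frob h d).obj N) ↔
      kz q N.dim (carF h N.dim d i x) = 0 := by
  cases i with
  | zero => exact ⟨fun _ => kz_carF_zero h d x, fun _ => trivial⟩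
  | succ i =>
    rw [kz_carF, smul_eq_zero_iff_right (pow_ne_zero _ (inv_ne_zero q.ne_zero))]
    refine ⟨fun hx => ?_, fun hx => ?_⟩
    · exact (congrArg (carF h N.dim d i) hx).trans (map_zero _)
    -- Injectivity is the case of the zero coboundary.
    · exact eq_zero_of_carF_eq_dR h d i _ 0 (hx.trans (map_zero _).symm)

lemma carQ_mem_koszulKer (h : IsOddRoot q ℓ) (d i : ℕ) (N : Source q (d * ℓ))
    (x : Tens K N.dim d ⧸ rel (1 : Kˣ) N.dim d i) :
    carQ h N.dim d i x ∈ (koszulKer q (d * ℓ) i).carrier N ↔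
      x ∈ (koszulKer (1 : Kˣ) d i).carrier ((frob h d).obj N) := by
  rw [mem_koszulKer_one_iff]
  refine (mem_koszulKer_iff (d * ℓ) i N _).trans ?_
  rw [evO_carQ]

lemma part_mem_koszulKer (d i : ℕ) (N : Source q d) {a : Form q N.dim} (ha : kz q N.dim a = 0) :
    part q N.dim d i a ∈ (koszulKer q d i).carrier N := by
  cases i with
  | zero => trivial
  | succ i =>
    have e := part_kz N.dim d i a
    rw [ha, map_zero] at e
    exact e.symm

/-- The homogeneous component of a primitive killed by `kz` is a primitive in `N`, because taking
components commutes with both differentials. -/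
lemma exists_mem_coboundaries_koszulKer (d i : ℕ)
    (hd : ∑ r ∈ Finset.range d, (q : K) ^ (2 * r) = 0) (N : Source q d)
    (w : (Omega q d i).at' N) {a : Form q N.dim} (ha : kz q N.dim a = 0)
    (hw : evO q d i N w = dR q N.dim a) :
    ∃ hk : w ∈ (koszulKer q d i).carrier N,
      (⟨w, hk⟩ : (koszulKer q d i).carrier N) ∈
        ((koszulKerComplex q d hd).coboundaries i).carrier N := by
  have e := congrArg (part q N.dim d i) hw
  rw [part_evO] at e
  cases i with
  | zero =>
    rw [part_dR_zero] at e
    exact ⟨trivial, Subtype.ext e⟩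
  | succ i =>
    have hy := part_mem_koszulKer d i N ha
    rw [part_dR_succ] at e
    have e' : (app ((koszulKerComplex q d hd).δ i) N ⟨part q N.dim d i a, hy⟩).1 = w := e.symm
    refine ⟨?_, ⟨part q N.dim d i a, hy⟩, Subtype.ext e'⟩
    rw [← e']
    exact (app ((koszulKerComplex q d hd).δ i) N ⟨part q N.dim d i a, hy⟩).2

lemma carQ_koszulKer_cocycle (h : IsOddRoot q ℓ) (d i : ℕ) (N : Source q (d * ℓ))
    (x : (koszulKer (1 : Kˣ) d i).carrier ((frob h d).obj N)) :
    app ((koszulKerComplex q (d * ℓ) (h.sum_eq_zero d)).δ i) N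
      ⟨carQ h N.dim d i x.1, (carQ_mem_koszulKer h d i N x.1).2 x.2⟩ = 0 :=
  Subtype.ext (carQ_cocycle h d i N x.1)

/-- The components of the restriction of the Cartier map to the Koszul kernels. -/
def koszulCartierApp (h : IsOddRoot q ℓ) (d i : ℕ) (N : Source q (d * ℓ)) :
    ((twist h d).obj (koszulKer 1 d i).toFun).at' N →ₗ[K]
      ((koszulKerComplex q (d * ℓ) (h.sum_eq_zero d)).cohomology i).at' N :=
  (Submodule.mkQ ((((koszulKerComplex q (d * ℓ) (h.sum_eq_zero d)).coboundaries i).inside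
      ((koszulKerComplex q (d * ℓ) (h.sum_eq_zero d)).cocycles i)).carrier N)).comp
    (LinearMap.codRestrict
      (((koszulKerComplex q (d * ℓ) (h.sum_eq_zero d)).cocycles i).carrier N)
      ((carQ h N.dim d i).restrict fun x => (carQ_mem_koszulKer h d i N x).2)
      (carQ_koszulKer_cocycle h d i N))

lemma cohomologyMap_koszulCartierApp (h : IsOddRoot q ℓ) (d i : ℕ) (N : Source q (d * ℓ))
    (x : ((twist h d).obj (koszulKer 1 d i).toFun).at' N) :
    app ((koszulKerIncl q (d * ℓ) (h.sum_eq_zero d)).cohomologyMap i) N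
        (koszulCartierApp h d i N x) =
      app (cartier h d i).hom N (app ((twist h d).map (koszulKer 1 d i).incl) N x) := rfl

lemma koszulCartierApp_comp_injective (h : IsOddRoot q ℓ) (d i : ℕ) (N : Source q (d * ℓ)) :
    Function.Injective fun x : ((twist h d).obj (koszulKer 1 d i).toFun).at' N =>
      app (cartier h d i).hom N (app ((twist h d).map (koszulKer 1 d i).incl) N x) :=
  fun _ _ e => Subtype.ext ((cartierApp_bijective h d i N).1 e)

/-- Injectivity is inherited from the full Cartier map. Surjectivity holds because the primitive
supplied by the homotopy stays in `N`, so a cocycle of `N` is cohomologous inside `N` to a value of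
`carQ`. -/
lemma koszulCartierApp_bijective (h : IsOddRoot q ℓ) (d i : ℕ) (N : Source q (d * ℓ)) :
    Function.Bijective (koszulCartierApp h d i N) := by
  refine ⟨fun x y e => ?_, fun c => ?_⟩
  · refine koszulCartierApp_comp_injective h d i N ?_
    dsimp only
    rw [← cohomologyMap_koszulCartierApp, e, cohomologyMap_koszulCartierApp]
  obtain ⟨⟨z, hk⟩, hz, rfl⟩ := Cochain.cls_surjective _ c
  obtain ⟨x, hx⟩ := exists_carQ h d i N z (congrArg Subtype.val hz)
  have hp : kM q N.dim (nfQ q N.dim (d * ℓ) i z) = 0 := by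
    apply genF_injective (q := q)
    rw [← kz_genF, ← evO_eq, (mem_koszulKer_iff _ i N z).1 hk, map_zero]
  have ha : kz q N.dim (-genF q N.dim (hM q N.dim ℓ (nfQ q N.dim (d * ℓ) i z))) = 0 := by
    rw [map_neg, kz_hM _ hp, neg_zero]
  let y : (Omega q (d * ℓ) i).at' N := carQ h N.dim d i x
  obtain ⟨hw, hw'⟩ := exists_mem_coboundaries_koszulKer (d * ℓ) i (h.sum_eq_zero d) N
    (y - z) ha (by
      refine (map_sub _ _ _).trans ?_
      rw [show evO q (d * ℓ) i N y = carF h N.dim d i x from evO_carQ h i N x, hx, map_neg]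
      abel)
  -- `y - z` is a coboundary inside `N` and `z` lies in `N`, so `y` does as well.
  have hxk : y ∈ (koszulKer q (d * ℓ) i).carrier N := by
    have := add_mem hw hk
    rwa [sub_add_cancel] at this
  refine ⟨⟨x, (carQ_mem_koszulKer h d i N x).1 hxk⟩, ?_⟩
  exact (Cochain.cls_eq_iff (koszulKerComplex q (d * ℓ) (h.sum_eq_zero d)) (i := i) (A := N)
    ⟨y, hxk⟩ ⟨z, hk⟩
    (carQ_koszulKer_cocycle h d i N ⟨x, (carQ_mem_koszulKer h d i N x).1 hxk⟩) hz).2 hw'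

lemma koszulCartierApp_lmap (h : IsOddRoot q ℓ) (d i : ℕ) {M N : Source q (d * ℓ)} (f : M ⟶ N)
    (x : ((twist h d).obj (koszulKer 1 d i).toFun).at' M) :
    koszulCartierApp h d i N (((twist h d).obj (koszulKer 1 d i).toFun).lmap f x) =
      ((koszulKerComplex q (d * ℓ) (h.sum_eq_zero d)).cohomology i).lmap f
        (koszulCartierApp h d i M x) := by
  -- The injectivity at hand is that of the composite into the cohomology of `Ω`, not of the map
  -- induced by the inclusion. The right side is therefore first written as a value of
  -- `koszulCartierApp`.
  obtain ⟨y, hy⟩ := (koszulCartierApp_bijective h d i N).2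
    (((koszulKerComplex q (d * ℓ) (h.sum_eq_zero d)).cohomology i).lmap f
        (koszulCartierApp h d i M x))
  rw [← hy]
  congr 1
  refine koszulCartierApp_comp_injective h d i N ?_
  dsimp only
  rw [← cohomologyMap_koszulCartierApp h d i N y, hy, app_lmap, app_lmap, app_lmap,
    cohomologyMap_koszulCartierApp]

/-- The restriction of the Cartier isomorphism to the Koszul kernels. -/
def koszulCartier (h : IsOddRoot q ℓ) (d i : ℕ) :
    (twist h d).obj (koszulKer 1 d i).toFun ≅
      (koszulKerComplex q (d * ℓ) (h.sum_eq_zero d)).cohomology i :=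
  QFun.isoOfBijective (homMk (koszulCartierApp h d i) (koszulCartierApp_lmap h d i))
    (koszulCartierApp_bijective h d i)

lemma koszulCartier_comp (h : IsOddRoot q ℓ) (d i : ℕ) :
    (koszulCartier h d i).hom ≫ (koszulKerIncl q (d * ℓ) (h.sum_eq_zero d)).cohomologyMap i =
      (twist h d).map (koszulKer 1 d i).incl ≫ (cartier h d i).hom := by
  apply ObjectProperty.hom_ext
  ext N x
  exact cohomologyMap_koszulCartierApp h d i N x

/-! ### Koszul kernels in classical degree one. -/

lemma rel_one_zero (q : Kˣ) (n : ℕ) : rel q n 1 0 = ⊥ :=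
  le_bot_iff.1 (rel_le q (Nat.zero_le 1) (fun _ _ => by omega) fun _ _ _ => by omega)

/-- The Koszul kernel in the degrees `(1, 0)` is the identity functor. -/
def koszulKerOneZero (r : Kˣ) : (koszulKer r 1 0).toFun ≅ tensorPow r 1 :=
  (QFun.isoOfBijective (F := tensorPow r 1) (G := (koszulKer r 1 0).toFun)
    (homMk (fun A => LinearMap.codRestrict ((koszulKer r 1 0).carrier A) (Omega.mk r 1 0 A)
      fun _ => trivial) fun _ _ => rfl) fun A => by
    refine ⟨(injective_iff_map_eq_zero _).2 fun x hx => ?_, fun y => ?_⟩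
    · have hx := (Omega.mk_eq_zero r 1 0 A x).1 (congrArg Subtype.val hx)
      rwa [rel_one_zero] at hx
    · obtain ⟨x, hx⟩ := Omega.mk_surjective r 1 0 A y.1
      exact ⟨x, Subtype.ext hx⟩).symm

/-- For `i = 1` the Koszul differential is the identity of `V`, so its kernel is zero; for `i > 1`
there are no forms. -/
lemma koszulKer_one_subsingleton (r : Kˣ) {i : ℕ} (hi : 0 < i) (A : Source r 1) :
    Subsingleton ((koszulKer r 1 i).carrier A) := by
  refine subsingleton_of_forall_eq 0 fun ⟨x, hx⟩ => Subtype.ext ?_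
  rcases Nat.lt_or_ge 1 i with h | h
  · exact quot_rel_eq_zero h x
  obtain rfl : i = 1 := by omega
  obtain ⟨y, rfl⟩ := Omega.mk_surjective r 1 1 A x
  have hx : app (koszulD r 1 0) A (Omega.mk r 1 1 A y) = 0 := hx
  rw [app_koszulD, Omega.mk_eq_zero, rel_one_zero] at hx
  have hy : y = 0 := by
    simpa [koszulOp, extShuffle_succ, extShuffle_zero] using hx
  exact (congrArg (Omega.mk r 1 1 A) hy).trans (map_zero _)

/-- A functor whose values are zero is a zero object. -/
lemma QFun.isZero {F : QFun q d} (hF : ∀ A, Subsingleton (F.at' A)) : Limits.IsZero F where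
  unique_to G := ⟨⟨⟨homMk (fun _ => 0) fun f x => (map_zero _).symm⟩, fun φ => by
    apply ObjectProperty.hom_ext
    ext A x
    have := hF A
    rw [Subsingleton.elim x 0, map_zero, map_zero]⟩⟩
  unique_from G := ⟨⟨⟨homMk (fun _ => 0) fun f x => (map_zero _).symm⟩, fun φ => by
    apply ObjectProperty.hom_ext
    ext A x
    have := hF A
    exact Subsingleton.elim (α := F.at' A) _ _⟩⟩

lemma isZero_koszulKerComplex_cohomology (h : IsOddRoot q ℓ) {i : ℕ} (hi : 0 < i) :
    Limits.IsZero ((koszulKerComplex q (1 * ℓ) (h.sum_eq_zero 1)).cohomology i) :=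
  Limits.IsZero.of_iso (QFun.isZero (F := (twist h 1).obj (koszulKer 1 1 i).toFun)
    fun A => koszulKer_one_subsingleton 1 hi ((frob h 1).obj A)) (koszulCartier h 1 i).symm

end KoszulKernels

end

end QPF

theorem mainTheorem10 {K : Type u} [Field K] (q : Kˣ) (ℓ : ℕ) (h : IsOddRoot q ℓ) :
    (∃ c : ∀ d i, (twist h d).obj (Omega 1 d i) ≅ (deRham q (d * ℓ)).cohomology i,
      IsCartier h c ∧
      ∀ d i, ∃ φ : (twist h d).obj (koszulKer 1 d i).toFun ≅
          (koszulKerComplex q (d * ℓ) (h.sum_eq_zero d)).cohomology i,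
        φ.hom ≫ (koszulKerIncl q (d * ℓ) (h.sum_eq_zero d)).cohomologyMap i =
          (twist h d).map (koszulKer 1 d i).incl ≫ (c d i).hom) ∧
    Nonempty ((koszulKerComplex q (1 * ℓ) (h.sum_eq_zero 1)).cohomology 0 ≅
      (twist h 1).obj (tensorPow 1 1)) ∧
    ∀ i, 0 < i → Limits.IsZero ((koszulKerComplex q (1 * ℓ) (h.sum_eq_zero 1)).cohomology i) := by
  refine ⟨⟨cartier h, isCartier_cartier h, fun d i => ⟨koszulCartier h d i, koszulCartier_comp h d i⟩⟩,
    ⟨(koszulCartier h 1 0).symm ≪≫ (twist h 1).mapIso (koszulKerOneZero 1)⟩, fun i hi => ?_⟩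
  exact isZero_koszulKerComplex_cohomology h hi
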